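/- **Setting.** $\lambda$ is the security parameter; "efficient" means probabilistic polynomial time in $\lambda$, negligible means smaller than every inverse polynomial in $\lambda$, and overwhelming probability means $1$ minus a negligible function. Let $H^s$ be a keyed hash function with outputs of polynomial length, and let $(G,\mathrm{Upd},S,V)$ be a key-evolving signature scheme: the secret key is evolved from period to period, signatures are verified with respect to a period, and honestly generated signatures are always accepted. It is *existentially unforgeable* if every efficient adversary who may ask for signatures in the current period, advance the period, and finally obtain the current secret key (break-in) outputs with only negligible probability a valid signature on some message for some period $t$ before the break-in (any period, if there is none), such that this message was not queried in period $t$. *PoS execution.* An efficient PoS protocol with polynomially many parties runs against an efficient adversary for $T(\lambda)$ rounds, $T$ any polynomial. The adversary may corrupt parties adaptively, as far as the corruption model of the protocol grants it, and then gets their current signing key. An epoch consists of $C\ge1$ consecutive rounds; one epoch is one signature period, and the scheme supports all epochs of the execution. Each epoch $j$ has a sync committee $S^j$ of $m$ public keys ($m$ constant), $S^0$ being recorded in the genesis state $st_0$. Each honest member of $S^j$ signs, at the beginning of epoch $j$, the commitment $\langle\delta^*(st_0,\mathbb L)\rangle$ to the state of its current ledger $\mathbb L$ and, at the end of epoch $j$,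 the handover message $(j+1,S^{j+1})$. It signs nothing else with this key, and then evolves its key. Signed messages of the two kinds are distinct. $\mathbb L^{P}_{\rho}$ denotes the ledger of party $P$ at round $\rho$. *Honest-majority sync committees*: against every efficient adversary, with overwhelming probability, for every epoch $j$ more than $m/2$ positions of $S^j$ belong to parties that are honest until the end of epoch $j$. *Safety of the PoS protocol*: against every efficient adversary, with overwhelming probability, $\mathbb L^{P_2}_{\rho_2}\preccurlyeq\mathbb L^{P_1}_{\rho_1}$ for all rounds $\rho_1\ge\rho_2$, all $P_1$ honest at $\rho_1$ and all $P_2$ honest at $\rho_2$. *Tournament at round $r=r(\lambda)<T(\lambda)$.* Let $N=\lfloor r/C\rfloor+1$. A verifier who knows $st_0$ is connected to a set of provers chosen by the adversary; some may be run by honest parties, and the adversary answers for all the others. Each prover claims a state commitment. An honest prover claims the commitment to the state of its ledger at the beginning of the epoch of round $r$, and holds the Merkle mountain range (MMR, hashed with $H^s$) over the leaves $S^0,\dots,S^{N-1}$. While two remaining provers have different claims, two such provers (chosen by the adversary) play one step: * Each sends its MMR peaks, an alleged latest committee with a Merkle proof that it is leaf $N-1$, and more than $m/2$ signatures (counted by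 position) of this committee on its claim for epoch $N-1$. A prover failing these checks is eliminated. * If both pass, the verifier takes the first peak on which they differ (if there is none, both are eliminated) and runs the *bisection game* in that tree: both provers open the current node, each pair of children must hash to its parent, and the verifier descends to the left child if the two left children differ, else to the right child. * At a leaf $j$, each prover reveals its committee at leaf $j$, matching its leaf hash. If $j=0$, the committee must be $S^0$. If $j>0$, the prover also reveals its committee at leaf $j-1$, a Merkle proof of it with respect to its peaks, and valid signatures on $(j,\text{its committee at }j)$ for epoch $j-1$ at more than $m/2$ positions of its committee at $j-1$. * A prover failing a check is eliminated; if both pass all checks, both are eliminated. When all remaining provers have the same claim, the verifier accepts it. All queries and honest answers are seen by the adversary, and its later behaviour in the PoS execution may depend on them. *State security* (latency $\nu$) of a commitment $\langle st\rangle$ obtained at round $r$: there is a ledger $\mathbb L$ such that $\langle st\rangle=\langle\delta^*(st_0,\mathbb L)\rangle$ and, for all rounds $r'$ of the execution, * **Safety:** if $r'\ge r+\nu$, then $\mathbb L\preccurlyeq\mathbb L^{\cup}_{r'}$; * **Liveness:** if $r'\le r-\nu$, then $\mathbb L^{\cap}_{r'}\preccurlyeq\mathbb L$. Here $\mathbb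 L^{\cup}_{r'}$ ($\mathbb L^{\cap}_{r'}$) is the ledger of an honest party at round $r'$ that extends (is a prefix of) the ledgers of all parties honest at $r'$; its existence is part of the claim. **Theorem.** Suppose that $H^s$ is collision resistant, the key-evolving signature scheme is existentially unforgeable, the sync committees have honest majorities, and the PoS protocol is safe. Then, for every efficient adversary and every choice of rounds $r(\lambda)<T(\lambda)$, the following holds with overwhelming probability in $\lambda$: if at least one prover of the tournament at round $r$ is honest, then the verifier accepts, at the end of the tournament, a state commitment that satisfies state security with latency $\nu=C$. -/

import Mathlib

namespace Superlight

/-! ## Data, programs and polynomial time -/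

/-- Binary trees, the universal data type of all algorithms and messages. -/
inductive Data : Type
  | nil : Data
  | cons : Data → Data → Data
  deriving DecidableEq

namespace Data

def size : Data → ℕ
  | nil => 1
  | cons a b => a.size + b.size + 1

def fst : Data → Data
  | nil => nil
  | cons a _ => a

def snd : Data → Data
  | nil => nil
  | cons _ b => b

/-- A list is the right spine of a tree. -/
def ofList : List Data → Data
  | [] => nil
  | a :: l => cons a (ofList l)

def toList : Data → List Data
  | nil => []
  | cons a b => a :: b.toList

/-- Natural numbers are written in unary. -/
def num (n : ℕ) : Data := ofList (List.replicate n nil)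

def toNat (d : Data) : ℕ := d.toList.length

def ofBool : Bool → Data
  | false => nil
  | true => cons nil nil

/-- The `i`-th entry of a list, `nil` beyond its end. -/
def nth (d : Data) (i : ℕ) : Data := d.toList.getD i nil

end Data

open Data

/-- Programs of a while language over binary trees. A program maps one tree to one tree. -/
inductive Prog : Type
  | id : Prog
  | nil : Prog
  | fst : Prog
  | snd : Prog
  | eq : Prog
  | pair : Prog → Prog → Prog
  | comp : Prog → Prog → Prog
  | cond : Prog → Prog → Prog → Prog
  | loop : Prog → Prog → Prog

/-- `p.Run x y t`: on input `x` the program `p` halts with output `y` after `t` steps. An atomic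
operation is charged the size of its whole input; copying is charged, so the size of every value
that is ever built is bounded by the number of steps. `loop c b` iterates `b` as long as `c` does
not return `nil`. -/
inductive Prog.Run : Prog → Data → Data → ℕ → Prop
  | id (x : Data) : Run .id x x x.size
  | nil (x : Data) : Run .nil x .nil x.size
  | fst (x : Data) : Run .fst x x.fst x.size
  | snd (x : Data) : Run .snd x x.snd x.size
  | eq (x : Data) : Run .eq x (ofBool (decide (x.fst = x.snd))) (x.size + 3)
  | pair {p q : Prog} {x y z : Data} {t u : ℕ} :
      Run p x y t → Run q x z u → Run (.pair p q) x (.cons y z) (t + u + 1)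
  | comp {p q : Prog} {x y z : Data} {t u : ℕ} :
      Run p x y t → Run q y z u → Run (.comp p q) x z (t + u + 1)
  | condTrue {c p q : Prog} {x v y : Data} {t u : ℕ} :
      Run c x v t → v ≠ .nil → Run p x y u → Run (.cond c p q) x y (t + u + 1)
  | condFalse {c p q : Prog} {x y : Data} {t u : ℕ} :
      Run c x .nil t → Run q x y u → Run (.cond c p q) x y (t + u + 1)
  | loopStop {c b : Prog} {x : Data} {t : ℕ} :
      Run c x .nil t → Run (.loop c b) x x (t + 1)
  | loopStep {c b : Prog} {x v y z : Data} {t u w : ℕ} :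
      Run c x v t → v ≠ .nil → Run b x y u → Run (.loop c b) y z w →
        Run (.loop c b) x z (t + u + w + 1)

/-- The function sending `inp i` to `out i` is computed by a program that runs in time polynomial
in the size of its input. -/
def PolyTime {ι : Type} (inp out : ι → Data) : Prop :=
  ∃ (p : Prog) (P : Polynomial ℕ), ∀ i, ∃ t ≤ P.eval (inp i).size, p.Run (inp i) (out i) t

/-! ## Randomness -/

/-- Strings of `k` independent fair coins. -/
abbrev Coins (k : ℕ) : Type := Fin k → Bool

def Coins.toData {k : ℕ} (ω : Coins k) : Data := ofList (List.ofFn fun i => ofBool (ω i))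

/-- Probability of an event under the uniform distribution on a finite type. -/
noncomputable def pr {Ω : Type} (E : Ω → Prop) : ℝ :=
  (Nat.card {ω : Ω // E ω} : ℝ) / (Nat.card Ω : ℝ)

/-- Negligible functions of the security parameter: they decay faster than every inverse
polynomial. An event has overwhelming probability if its complement has negligible probability. -/
def Negligible (f : ℕ → ℝ) : Prop :=
  Asymptotics.SuperpolynomialDecay Filter.atTop (fun n : ℕ => (n : ℝ)) f

/-- A probabilistic polynomial-time interactive adversary, given by its next-message function: from
the security parameter (in unary), its coins and the list of all messages received so far it
computes its next message, whose length is bounded by a polynomial in the security parameter. -/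
structure Adversary where
  coins : Polynomial ℕ
  len : Polynomial ℕ
  next : (n : ℕ) → Coins (coins.eval n) → List Data → Data
  next_size : ∀ n ω h, (next n ω h).size ≤ len.eval n
  next_poly : PolyTime
    (fun x : (n : ℕ) × Coins (coins.eval n) × List Data =>
      ofList [num x.1, x.2.1.toData, ofList x.2.2])
    (fun x => next x.1 x.2.1 x.2.2)

/-! ## Cryptographic primitives -/

/-- A keyed hash function with outputs of polynomially bounded length. -/
structure HashFamily where
  coins : Polynomial ℕ
  len : Polynomial ℕ
  gen : (n : ℕ) → Coins (coins.eval n) → Data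
  hash : ℕ → Data → Data → Data
  hash_size : ∀ n s x, (hash n s x).size ≤ len.eval n
  gen_poly : PolyTime
    (fun x : (n : ℕ) × Coins (coins.eval n) => ofList [num x.1, x.2.toData])
    (fun x => gen x.1 x.2)
  hash_poly : PolyTime
    (fun x : ℕ × Data × Data => ofList [num x.1, x.2.1, x.2.2])
    (fun x => hash x.1 x.2.1 x.2.2)

/-- No efficient adversary finds, given the key, two different inputs with the same hash, except
with negligible probability. -/
def HashFamily.CollisionResistant (H : HashFamily) : Prop :=
  ∀ A : Adversary, Negligible fun n =>
    pr fun ω : Coins (H.coins.eval n) × Coins (A.coins.eval n) =>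
      let s := H.gen n ω.1
      let out := A.next n ω.2 [s]
      out.fst ≠ out.snd ∧ H.hash n s out.fst = H.hash n s out.snd

/-- The algorithms of a key-evolving signature scheme: key generation (public key, secret key of
period `0`), evolution of the secret key to the next period, signing (with the secret key of the
current period), verification of a signature for a given period. `periods n` is the number of
periods that the scheme supports. -/
structure SignatureAlgorithms where
  coins : Polynomial ℕ
  periods : ℕ → ℕ
  gen : (n : ℕ) → Coins (coins.eval n) → Data × Data
  update : (n : ℕ) → Data → Coins (coins.eval n) → Data
  sign : (n : ℕ) → Data → Data → Coins (coins.eval n) → Data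
  verify : ℕ → Data → ℕ → Data → Data → Bool

/-- The secret key of period `t`. -/
def SignatureAlgorithms.keyAt (S : SignatureAlgorithms) (n : ℕ) (ω : Coins (S.coins.eval n))
    (u : ℕ → Coins (S.coins.eval n)) : ℕ → Data
  | 0 => (S.gen n ω).2
  | t + 1 => S.update n (S.keyAt n ω u t) (u t)

/-- A key-evolving signature scheme: efficient algorithms, secret keys of polynomial size, and
honestly generated signatures are always accepted. -/
structure SignatureScheme extends SignatureAlgorithms where
  keyLen : Polynomial ℕ
  key_size : ∀ n ω u t, t < periods n → (toSignatureAlgorithms.keyAt n ω u t).size ≤ keyLen.eval n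
  correct : ∀ n ω u t m ρ, t < periods n →
    verify n (gen n ω).1 t m (sign n (toSignatureAlgorithms.keyAt n ω u t) m ρ) = true
  gen_poly : PolyTime
    (fun x : (n : ℕ) × Coins (coins.eval n) => ofList [num x.1, x.2.toData])
    (fun x => .cons (gen x.1 x.2).1 (gen x.1 x.2).2)
  update_poly : PolyTime
    (fun x : (n : ℕ) × Data × Coins (coins.eval n) => ofList [num x.1, x.2.1, x.2.2.toData])
    (fun x => update x.1 x.2.1 x.2.2)
  sign_poly : PolyTime
    (fun x : (n : ℕ) × Data × Data × Coins (coins.eval n) =>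
      ofList [num x.1, x.2.1, x.2.2.1, x.2.2.2.toData])
    (fun x => sign x.1 x.2.1 x.2.2.1 x.2.2.2)
  verify_poly : PolyTime
    (fun x : ℕ × Data × ℕ × Data × Data =>
      ofList [num x.1, x.2.1, num x.2.2.1, x.2.2.2.1, x.2.2.2.2])
    (fun x => ofBool (verify x.1 x.2.1 x.2.2.1 x.2.2.2.1 x.2.2.2.2))

/-- State of the challenger in the attack game. -/
structure AttackState where
  period : ℕ
  key : Data
  received : List Data
  queries : List (ℕ × Data)
  broken : Option ℕ

/-- One move of the adversary `F`: nothing, a signing query in the current period, a request to pass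
to the next period, or a break-in, which reveals the current secret key and ends the queries. -/
def SignatureScheme.attackStep (S : SignatureScheme) (n : ℕ) (F : List Data → Data)
    (st : AttackState) (ρ : Coins (S.coins.eval n)) : AttackState :=
  match st.broken with
  | some _ => st
  | none =>
    match F st.received with
    | .nil => { st with received := st.received ++ [.nil] }
    | .cons tag msg =>
      match tag.toNat with
      | 0 =>
        { st with
          received := st.received ++ [S.sign n st.key msg ρ]
          queries := st.queries ++ [(st.period, msg)] }
      | 1 =>
        if st.period + 1 < S.periods n then
          { st with
            period := st.period + 1
            key := S.update n st.key ρ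
            received := st.received ++ [.nil] }
        else { st with received := st.received ++ [.nil] }
      | _ =>
        { st with
          received := st.received ++ [st.key]
          broken := some st.period }

/-- The state after the query phase, with one fresh string of coins for each move. -/
def SignatureScheme.attack (S : SignatureScheme) (n : ℕ) (F : List Data → Data)
    (ω : Coins (S.coins.eval n)) {q : ℕ} (ρ : Fin q → Coins (S.coins.eval n)) : AttackState :=
  (List.ofFn ρ).foldl (S.attackStep n F)
    { period := 0, key := (S.gen n ω).2, received := [(S.gen n ω).1], queries := [],
      broken := none }

/-- The final output `(t, m, σ)` is a forgery: it is accepted, `t` lies before the period of the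
break-in (if there was one), and `m` was not queried in period `t`. -/
def SignatureScheme.Forges (S : SignatureScheme) (n : ℕ) (F : List Data → Data)
    (ω : Coins (S.coins.eval n)) {q : ℕ} (ρ : Fin q → Coins (S.coins.eval n)) : Prop :=
  let st := S.attack n F ω ρ
  let out := F st.received
  let t := (out.nth 0).toNat
  S.verify n (S.gen n ω).1 t (out.nth 1) (out.nth 2) = true ∧ t < S.periods n ∧
    (∀ b, st.broken = some b → t < b) ∧ (t, out.nth 1) ∉ st.queries

/-- Existential unforgeability under chosen message attack, for key-evolving schemes: for every
efficient adversary with polynomially many moves a forgery has negligible probability. -/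
def SignatureScheme.ExistentiallyUnforgeable (S : SignatureScheme) : Prop :=
  ∀ (F : Adversary) (q : Polynomial ℕ), Negligible fun n =>
    pr fun ω : Coins (F.coins.eval n) × Coins (S.coins.eval n) ×
        (Fin (q.eval n) → Coins (S.coins.eval n)) =>
      S.Forges n (F.next n ω.1) ω.2.1 ω.2.2

/-! ## The proof-of-stake protocol -/

/-- The replicated state machine: the transition function `δ`, commitments to states (which may use
the hash key), and the sync committee recorded in a state. -/
structure StateMachine where
  δ : Data → Data → Data
  commit : ℕ → Data → Data → Data
  committee : Data → Data
  apply_poly : PolyTime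
    (fun x : Data × List Data => .cons x.1 (ofList x.2)) (fun x => x.2.foldl δ x.1)
  commit_poly : PolyTime
    (fun x : ℕ × Data × Data => ofList [num x.1, x.2.1, x.2.2])
    (fun x => commit x.1 x.2.1 x.2.2)
  committee_poly : PolyTime (fun x : Data => x) committee

/-- A proof-of-stake protocol together with its network and corruption model, that is, everything
the adversary interacts with in an execution, apart from the duties of the sync committees. Its
parties are `0, …, parties - 1`. `genesis` is the genesis state, computed from the public
parameters (hash key, public keys of the parties) and the adversary's first message. `step` is the
outcome of the current round, computed from the genesis and round messages of the adversary so far: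
see `Outcome` below for its components. -/
structure PoSProtocol where
  parties : Polynomial ℕ
  coins : Polynomial ℕ
  genesis : (n : ℕ) → Coins (coins.eval n) → Data → List Data → Data → Data
  step : (n : ℕ) → Coins (coins.eval n) → Data → List Data → List Data → Data
  genesis_poly : PolyTime
    (fun x : (n : ℕ) × Coins (coins.eval n) × Data × List Data × Data =>
      ofList [num x.1, x.2.1.toData, x.2.2.1, ofList x.2.2.2.1, x.2.2.2.2])
    (fun x => genesis x.1 x.2.1 x.2.2.1 x.2.2.2.1 x.2.2.2.2)
  step_poly : PolyTime
    (fun x : (n : ℕ) × Coins (coins.eval n) × Data × List Data × List Data =>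
      ofList [num x.1, x.2.1.toData, x.2.2.1, ofList x.2.2.2.1, ofList x.2.2.2.2])
    (fun x => step x.1 x.2.1 x.2.2.1 x.2.2.2.1 x.2.2.2.2)

/-- The outcome of a round: a message to the adversary, the ledgers of all parties, the parties whose
corruption the model grants to the adversary in this round, and the sync committee of the next
epoch (used in the last round of an epoch only). -/
structure Outcome where
  reply : Data
  ledgers : Data
  granted : Data
  nextCommittee : Data

def Outcome.ofData (d : Data) : Outcome := ⟨d.nth 0, d.nth 1, d.nth 2, d.nth 3⟩

def Outcome.toData (o : Outcome) : Data := ofList [o.reply, o.ledgers, o.granted, o.nextCommittee]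

/-- The ledger of party `i`, a list of transactions. -/
def Outcome.ledger (o : Outcome) (i : ℕ) : List Data := (o.ledgers.nth i).toList

def Outcome.Grants (o : Outcome) (i : ℕ) : Bool := (o.granted.toList.map toNat).contains i

/-- Everything that is fixed once the security parameter and the coins of the honest side are fixed:
committee size `m`, epoch length `C`, number `K` of parties, hash key, keys of the parties, signing
(party, epoch, message) for the two duties, and the algorithms. -/
structure Env where
  m : ℕ
  C : ℕ
  K : ℕ
  hashKey : Data
  pk : ℕ → Data
  sk : ℕ → ℕ → Data
  signState : ℕ → ℕ → Data → Data
  signHandover : ℕ → ℕ → Data → Data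
  verify : Data → ℕ → Data → Data → Bool
  hash : Data → Data
  δ : Data → Data → Data
  commit : Data → Data
  committeeOf : Data → Data
  genesis : Data → Data
  step : List Data → Data

/-- The record of one round: the adversary's message, the outcome, the lists (by party) of
signatures on state commitments and on handover messages, and the leaked secret keys. -/
structure Round where
  move : Data
  out : Outcome
  stateSigs : Data
  handoverSigs : Data
  leaks : Data

/-- What the adversary receives in a round. -/
def Round.msg (q : Round) : Data := ofList [q.out.toData, q.stateSigs, q.handoverSigs, q.leaks]

/-- The message that a committee member signs to vouch for a state commitment. -/
def stateMsg (c : Data) : Data := .cons (num 0) c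

/-- The message by which the committee of epoch `j - 1` hands over to the committee `S` of epoch `j`. -/
def handoverMsg (j : ℕ) (S : Data) : Data := .cons (num 1) (.cons (num j) S)

namespace Env

variable (E : Env)

/-- `δ*` followed by the commitment to the resulting state. -/
def stateCommitment (st₀ : Data) (L : List Data) : Data := E.commit (L.foldl E.δ st₀)

/-- The `k`-th public key of a committee. A committee has the `m` positions `k < m`. -/
def member (S : Data) (k : ℕ) : Data := S.nth k

def IsMember (i : ℕ) (S : Data) : Bool := (List.range E.m).any fun k => decide (member S k = E.pk i)

/-- The public parameters, the first message to the adversary. -/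
def setupMsg : Data := .cons E.hashKey (ofList ((List.range E.K).map E.pk))

def genesisMove (strat : List Data → Data) : Data := strat [E.setupMsg]

def st₀ (strat : List Data → Data) : Data := E.genesis (E.genesisMove strat)

/-- All messages received by the adversary by the end of the rounds `rs`. -/
def view (strat : List Data → Data) (rs : List Round) : List Data :=
  E.setupMsg :: E.st₀ strat :: rs.map Round.msg

/-- Party `i` has been corrupted in one of the rounds `rs`. -/
def corrupted (rs : List Round) (i : ℕ) : Bool := rs.any fun q => q.out.Grants i

/-- The outcome of round `ρ` (empty if the round is not in the list). -/
def outcome (rs : List Round) (ρ : ℕ) : Outcome :=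
  (rs[ρ]?.map Round.out).getD (Outcome.ofData .nil)

/-- The sync committee of epoch `j`: the genesis one for `j = 0`, otherwise the one announced in the
last round of epoch `j - 1`. -/
def committee (strat : List Data → Data) (rs : List Round) : ℕ → Data
  | 0 => E.committeeOf (E.st₀ strat)
  | j + 1 => (outcome rs ((j + 1) * E.C - 1)).nextCommittee

/-- The round following the rounds `rs`. It belongs to epoch `j = rs.length / C`. In the first round
of an epoch the uncorrupted members of its committee sign the commitment to the state of their
ledger, in the last round they sign the next committee. The adversary obtains the current keys of
the parties that it corrupts in this round. -/
def nextRound (strat : List Data → Data) (rs : List Round) : Round :=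
  let j := rs.length / E.C
  let move := strat (E.view strat rs)
  let out := Outcome.ofData (E.step (E.genesisMove strat :: rs.map Round.move ++ [move]))
  let corr := fun i => corrupted rs i || out.Grants i
  let S := E.committee strat rs j
  let active := fun i => !corr i && E.IsMember i S
  { move := move
    out := out
    stateSigs :=
      if rs.length % E.C = 0 then
        ofList ((List.range E.K).map fun i =>
          if active i then
            E.signState i j (stateMsg (E.stateCommitment (E.st₀ strat) (out.ledger i)))
          else .nil)
      else .nil
    handoverSigs :=
      if (rs.length + 1) % E.C = 0 then
        ofList ((List.range E.K).map fun i =>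
          if active i then E.signHandover i j (handoverMsg (j + 1) out.nextCommittee) else .nil)
      else .nil
    leaks :=
      ofList ((List.range E.K).map fun i =>
        if out.Grants i && !corrupted rs i then E.sk i j else .nil) }

/-- The execution of the protocol with the adversary `strat` for a number of rounds. -/
def exec (strat : List Data → Data) : ℕ → List Round
  | 0 => []
  | k + 1 => exec strat k ++ [E.nextRound strat (exec strat k)]

/-- Party `i` is honest in round `ρ`. -/
def Honest (rs : List Round) (ρ i : ℕ) : Prop :=
  i < E.K ∧ corrupted (rs.take (ρ + 1)) i = false

def ledger (rs : List Round) (ρ i : ℕ) : List Data := (outcome rs ρ).ledger i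

/-- Safety of the execution `rs`. -/
def Safe (rs : List Round) : Prop :=
  ∀ i₁ i₂ ρ₁ ρ₂, ρ₂ ≤ ρ₁ → ρ₁ < rs.length → E.Honest rs ρ₁ i₁ → E.Honest rs ρ₂ i₂ →
    ledger rs ρ₂ i₂ <+: ledger rs ρ₁ i₁

/-- In each epoch of the execution `rs`, more than half of the positions of the sync committee are
held by parties that are honest until the end of the epoch. -/
def HonestMajority (strat : List Data → Data) (rs : List Round) : Prop :=
  ∀ j, j * E.C < rs.length →
    E.m < 2 * Nat.card {k : Fin E.m // ∃ i, member (E.committee strat rs j) k = E.pk i ∧ i < E.K ∧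
      ∀ ρ < rs.length, ρ / E.C ≤ j → E.Honest rs ρ i}

/-! ## State security -/

/-- `U` is the union of the honest ledgers in round `ρ`: an honest ledger that extends all others. -/
def IsUnion (rs : List Round) (ρ : ℕ) (U : List Data) : Prop :=
  (∃ i, E.Honest rs ρ i ∧ ledger rs ρ i = U) ∧ ∀ i, E.Honest rs ρ i → ledger rs ρ i <+: U

/-- `I` is the intersection of the honest ledgers in round `ρ`: an honest ledger that is a prefix of
all others. -/
def IsInter (rs : List Round) (ρ : ℕ) (I : List Data) : Prop :=
  (∃ i, E.Honest rs ρ i ∧ ledger rs ρ i = I) ∧ ∀ i, E.Honest rs ρ i → I <+: ledger rs ρ i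

/-- State security, with latency `ν`, of a commitment `c` obtained in round `r` of the execution. -/
def StateSecure (strat : List Data → Data) (rs : List Round) (ν r : ℕ) (c : Data) : Prop :=
  ∃ L : List Data, c = E.stateCommitment (E.st₀ strat) L ∧
    (∀ r' < rs.length, r + ν ≤ r' → ∃ U, E.IsUnion rs r' U ∧ L <+: U) ∧
    (∀ r' < rs.length, r' + ν ≤ r → ∃ I, E.IsInter rs r' I ∧ I <+: L)

end Env

/-! ## Merkle trees and Merkle mountain ranges -/

section Merkle

variable (hash : Data → Data)

/-- The root of the Merkle tree of height `h` over the leaves `D o, …, D (o + 2 ^ h - 1)`. -/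
def merkleRoot (D : ℕ → Data) : ℕ → ℕ → Data
  | 0, o => hash (D o)
  | h + 1, o => hash (.cons (merkleRoot D h o) (merkleRoot D h (o + 2 ^ h)))

/-- The Merkle proof (siblings from the leaf upwards) of the leaf with index `i` in that tree. -/
def merkleProof (D : ℕ → Data) (h o i : ℕ) : Data :=
  ofList ((List.range h).map fun k => merkleRoot hash D k (o + ((i / 2 ^ k) ^^^ 1) * 2 ^ k))

/-- The hash obtained from leaf `v` with index `i` and proof `π` after `k` levels. -/
def merkleClimb (i : ℕ) (v π : Data) : ℕ → Data
  | 0 => hash v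
  | k + 1 =>
    if i.testBit k then hash (.cons (π.nth k) (merkleClimb i v π k))
    else hash (.cons (merkleClimb i v π k) (π.nth k))

/-- The trees (height, index of the first leaf) of a Merkle mountain range with `N` leaves: one for
each binary digit `1` of `N`, the largest tree first. -/
def mmrTrees (N : ℕ) : List (ℕ × ℕ) :=
  ((List.range (N + 1)).reverse.filter fun h => N.testBit h).map
    fun h => (h, N / 2 ^ (h + 1) * 2 ^ (h + 1))

/-- The number of the tree that contains leaf `i`. -/
def mmrIndex (N i : ℕ) : ℕ :=
  (mmrTrees N).findIdx fun t => decide (t.2 ≤ i) && decide (i < t.2 + 2 ^ t.1)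

def mmrTree (N i : ℕ) : ℕ × ℕ := (mmrTrees N).getD (mmrIndex N i) (0, 0)

def mmrPeaks (D : ℕ → Data) (N : ℕ) : Data :=
  ofList ((mmrTrees N).map fun t => merkleRoot hash D t.1 t.2)

def mmrProof (D : ℕ → Data) (N i : ℕ) : Data :=
  merkleProof hash D (mmrTree N i).1 (mmrTree N i).2 (i - (mmrTree N i).2)

/-- Verification of the proof `π` that `v` is leaf `i` below the given peaks. -/
def mmrVerify (N : ℕ) (peaks : Data) (i : ℕ) (v π : Data) : Bool :=
  decide (merkleClimb hash (i - (mmrTree N i).2) v π (mmrTree N i).1 = peaks.nth (mmrIndex N i))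

end Merkle

/-! ## The tournament -/

/-- Queries of the verifier to a prover. -/
inductive Query : Type
  /-- The state commitment. -/
  | commitment : Query
  /-- The peaks of the MMR, the latest committee, its Merkle proof, and the signatures of its members
  on the state commitment. -/
  | header : Query
  /-- The children of the node of height `h` (at least `1`) whose leftmost leaf is `o`. -/
  | children (h o : ℕ) : Query
  /-- The committee at leaf `j`, the committee at leaf `j - 1`, the Merkle proof of the latter, and
  the handover proof between them. -/
  | leaf (j : ℕ) : Query

def Query.toData : Query → Data
  | .commitment => ofList [num 0]
  | .header => ofList [num 1]
  | .children h o => ofList [num 2, num h, num o]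
  | .leaf j => ofList [num 3, num j]

/-- A participant of the tournament: its number, the honest party that runs it (`none` for an
adversarial prover), and its claimed state commitment. -/
structure Prover where
  id : ℕ
  party : Option ℕ
  claim : Data

namespace Env

variable (E : Env)

/-- `sigs` holds, at more than half of the positions of the committee `S`, a valid signature of the
member at this position on `msg` for epoch `j`. -/
def quorum (S : Data) (j : ℕ) (msg sigs : Data) : Bool :=
  decide (E.m < 2 * (List.range E.m).countP fun k => E.verify (member S k) j msg (sigs.nth k))

/-- From a list of signatures select, for each position of the committee `S`, a valid one. -/
def selectSigs (S : Data) (j : ℕ) (msg : Data) (sigs : List Data) : Data :=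
  ofList ((List.range E.m).map fun k => (sigs.find? (E.verify (member S k) j msg)).getD .nil)

/-- The commitment of party `i` to its state at the beginning of the epoch of round `r`. -/
def honestClaim (strat : List Data → Data) (rs : List Round) (r i : ℕ) : Data :=
  E.stateCommitment (E.st₀ strat) (ledger rs (r / E.C * E.C) i)

/-- The answers of an honest prover, run by party `i`, in round `r`. Its handover tree is the MMR over
the committees of the epochs `0, …, r / C`. -/
def honestAnswer (strat : List Data → Data) (rs : List Round) (r i : ℕ) : Query → Data
  | .commitment => E.honestClaim strat rs r i
  | .header =>
    let e := r / E.C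
    let D := E.committee strat rs
    ofList [mmrPeaks E.hash D (e + 1), D e, mmrProof E.hash D (e + 1) e,
      E.selectSigs (D e) e (stateMsg (E.honestClaim strat rs r i))
        ((rs[e * E.C]?.map fun q => q.stateSigs.toList).getD [])]
  | .children h o =>
    let D := E.committee strat rs
    .cons (merkleRoot E.hash D (h - 1) o) (merkleRoot E.hash D (h - 1) (o + 2 ^ (h - 1)))
  | .leaf 0 => ofList [E.committee strat rs 0]
  | .leaf (j + 1) =>
    let D := E.committee strat rs
    ofList [D (j + 1), D j, mmrProof E.hash D (r / E.C + 1) j,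
      E.selectSigs (D j) j (handoverMsg (j + 1) (D (j + 1)))
        ((rs[(j + 1) * E.C - 1]?.map fun q => q.handoverSigs.toList).getD [])]

/-- The tournament is run over the list of messages that the adversary has received. -/
abbrev Game := StateM (List Data)

/-- The verifier sends a query to a prover. The adversary sees all queries and all honest answers, and
answers for all adversarial provers. -/
def ask (strat : List Data → Data) (honest : ℕ → Query → Data) (id : ℕ) (party : Option ℕ)
    (q : Query) : Game Data :=
  match party with
  | some i => do
    modify (· ++ [ofList [num id, q.toData, honest i q]])
    pure (honest i q)
  | none => do
    modify (· ++ [ofList [num id, q.toData]])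
    return strat (← get)

/-- The verifier's check of the final answer `a` (leaf, previous leaf, Merkle proof, handover proof) of
a prover with the given peaks, where `x` is the hash at leaf `j` of its tree. -/
def checkLeaf (S₀ : Data) (N : ℕ) (peaks : Data) (j : ℕ) (x a : Data) : Bool :=
  decide (E.hash (a.nth 0) = x) &&
    if j = 0 then decide (a.nth 0 = S₀)
    else
      mmrVerify E.hash N peaks (j - 1) (a.nth 1) (a.nth 2) &&
        E.quorum (a.nth 1) (j - 1) (handoverMsg j (a.nth 0)) (a.nth 3)

/-- The bisection game between two provers, from the node of height `h` with leftmost leaf `o`, where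
the provers claim the different values `x` and `y`. The verifier opens the node on both sides and
descends to the left child if the left children differ, otherwise to the right child. The result
tells who has passed all checks. -/
def bisection (strat : List Data → Data) (honest : ℕ → Query → Data) (S₀ : Data) (N : ℕ)
    (P Q : Prover) (peaksP peaksQ : Data) : ℕ → ℕ → Data → Data → Game (Bool × Bool)
  | 0, j, x, y => do
    let a ← ask strat honest P.id P.party (.leaf j)
    let b ← ask strat honest Q.id Q.party (.leaf j)
    pure (E.checkLeaf S₀ N peaksP j x a, E.checkLeaf S₀ N peaksQ j y b)
  | h + 1, o, x, y => do
    let a ← ask strat honest P.id P.party (.children (h + 1) o)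
    let b ← ask strat honest Q.id Q.party (.children (h + 1) o)
    let okP := decide (E.hash (.cons a.fst a.snd) = x)
    let okQ := decide (E.hash (.cons b.fst b.snd) = y)
    if okP && okQ then
      if a.fst ≠ b.fst then
        bisection strat honest S₀ N P Q peaksP peaksQ h o a.fst b.fst
      else
        bisection strat honest S₀ N P Q peaksP peaksQ h (o + 2 ^ h) a.snd b.snd
    else pure (okP, okQ)

/-- The check of a header (peaks, latest committee, Merkle proof, signatures) for the claim `c`. -/
def checkHeader (N : ℕ) (c a : Data) : Bool :=
  mmrVerify E.hash N (a.nth 0) (N - 1) (a.nth 1) (a.nth 2) &&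
    E.quorum (a.nth 1) (N - 1) (stateMsg c) (a.nth 3)

/-- A step of the tournament, between two provers with different claims: who stays in the tournament.
A prover that fails a check is eliminated. If both provers pass, or have sent the same peaks, then
both are eliminated. -/
def playStep (strat : List Data → Data) (honest : ℕ → Query → Data) (S₀ : Data) (N : ℕ)
    (P Q : Prover) : Game (Bool × Bool) := do
  let a ← ask strat honest P.id P.party .header
  let b ← ask strat honest Q.id Q.party .header
  let okP := E.checkHeader N P.claim a
  let okQ := E.checkHeader N Q.claim b
  if okP && okQ then
    match (List.range (mmrTrees N).length).find?
        (fun d => decide ((a.nth 0).nth d ≠ (b.nth 0).nth d)) with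
    | none => pure (false, false)
    | some d =>
      let t := (mmrTrees N).getD d (0, 0)
      let (u, v) ← E.bisection strat honest S₀ N P Q (a.nth 0) (b.nth 0) t.1 t.2
        ((a.nth 0).nth d) ((b.nth 0).nth d)
      pure (u && !v, v && !u)
  else pure (okP, okQ)

/-- The pairs of remaining provers with different claims. -/
def disagreeing (ps : List Prover) : List (Prover × Prover) :=
  (ps.product ps).filter fun x => decide (x.1.claim ≠ x.2.claim)

/-- Steps of the tournament, until all remaining provers have the same claim, which is accepted. The
pair for the next step is chosen by the adversary. `fuel` bounds the number of steps; as each step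
eliminates a prover, the number of provers suffices. -/
def steps (strat : List Data → Data) (honest : ℕ → Query → Data) (S₀ : Data) (N : ℕ) :
    ℕ → List Prover → Game (Option Data)
  | 0, _ => pure none
  | fuel + 1, ps =>
    match disagreeing ps with
    | [] => pure (ps.head?.map Prover.claim)
    | x :: l => do
      modify (· ++ [ofList (ps.map fun P => num P.id)])
      let d := strat (← get)
      let pair := (x :: l).getD (d.size % (l.length + 1)) x
      let (stayP, stayQ) ← E.playStep strat honest S₀ N pair.1 pair.2
      steps strat honest S₀ N fuel
        (ps.filter fun R => (R.id != pair.1.id || stayP) && (R.id != pair.2.id || stayQ))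

/-- The provers collected by the verifier. The adversary chooses the set of provers: an entry
`cons _ i` of its message is the prover run by party `i`, which is honest as long as the party is,
and all other entries are adversarial provers. -/
def openingParty (rs : List Round) (e : Data) : Option ℕ :=
  match e with
  | .nil => none
  | .cons _ p => if p.toNat < E.K ∧ corrupted rs p.toNat = false then some p.toNat else none

/-- The whole tournament, held in round `r` after the rounds `rs = 0, …, r`: the list of provers and
the commitment that the verifier accepts in the end. -/
def tournamentGame (strat : List Data → Data) (rs : List Round) (r : ℕ) :
    Game (List Prover × Option Data) := do
  modify (· ++ [.nil])
  let d := strat (← get)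
  let honest := E.honestAnswer strat rs r
  let ps ← d.toList.zipIdx.mapM fun x => do
    let party := E.openingParty rs x.1
    let c ← ask strat honest x.2 party .commitment
    pure ({ id := x.2, party := party, claim := c } : Prover)
  let res ← E.steps strat honest (E.committeeOf (E.st₀ strat)) (r / E.C + 1) ps.length ps
  pure (ps, res)

/-- The tournament in round `r` of the execution with adversary `strat`, with the list of all messages
that the adversary has received by its end. -/
def tournament (strat : List Data → Data) (r : ℕ) : (List Prover × Option Data) × List Data :=
  let rs := E.exec strat (r + 1)
  (E.tournamentGame strat rs r).run (E.view strat rs)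

/-- The behaviour towards the protocol of an adversary that has taken part in the tournament of round
`r`: in later rounds its messages also depend on the messages of the tournament, which come right
after the genesis messages and the messages of rounds `0, …, r`. -/
def withTournament (strat : List Data → Data) (r : ℕ) : List Data → Data := fun h =>
  if h.length < r + 3 then strat h else strat ((E.tournament strat r).2 ++ h.drop (r + 3))

/-- In the tournament of round `r`, in an execution of `T` rounds, at least one prover is honest, but
the verifier does not end with a commitment that satisfies state security with latency `C`. -/
def TournamentFails (strat : List Data → Data) (T r : ℕ) : Prop :=
  (∃ P ∈ (E.tournament strat r).1.1, P.party.isSome) ∧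
    ¬ ∃ c, (E.tournament strat r).1.2 = some c ∧
      E.StateSecure (E.withTournament strat r) (E.exec (E.withTournament strat r) T) E.C r c

end Env

/-! ## The random experiment -/

section World

variable (H : HashFamily) (S : SignatureScheme) (X : StateMachine) (PoS : PoSProtocol)

/-- The coins of the honest side of an execution of `T n` rounds: hash key, protocol, key generation
of each party, and, for each party and each epoch, the signature on the state commitment, the
signature on the handover message, and the update of the key. -/
abbrev World (T : Polynomial ℕ) (n : ℕ) : Type :=
  Coins (H.coins.eval n) × Coins (PoS.coins.eval n) ×
    (Fin (PoS.parties.eval n) → Coins (S.coins.eval n)) ×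
    (Fin (PoS.parties.eval n) → Fin (T.eval n) → Fin 3 → Coins (S.coins.eval n))

variable {H S PoS}

/-- Key generation coins of party `i`. -/
def World.genCoins {T : Polynomial ℕ} {n : ℕ} (ω : World H S PoS T n) (i : ℕ) :
    Coins (S.coins.eval n) :=
  if h : i < PoS.parties.eval n then ω.2.2.1 ⟨i, h⟩ else fun _ => false

/-- Coins of party `i` in epoch `j` for task `a`. -/
def World.opCoins {T : Polynomial ℕ} {n : ℕ} (ω : World H S PoS T n) (i j : ℕ) (a : Fin 3) :
    Coins (S.coins.eval n) :=
  if h : i < PoS.parties.eval n ∧ j < T.eval n then ω.2.2.2 ⟨i, h.1⟩ ⟨j, h.2⟩ a else fun _ => false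

/-- The secret key of party `i` in epoch `j`. -/
def World.key {T : Polynomial ℕ} {n : ℕ} (ω : World H S PoS T n) (i j : ℕ) : Data :=
  S.keyAt n (ω.genCoins i) (fun t => ω.opCoins i t 2) j

def World.env {T : Polynomial ℕ} {n : ℕ} (ω : World H S PoS T n) (m C : ℕ) : Env :=
  let s := H.gen n ω.1
  let pk := fun i => (S.gen n (ω.genCoins i)).1
  let pks := (List.range (PoS.parties.eval n)).map pk
  { m := m
    C := C
    K := PoS.parties.eval n
    hashKey := s
    pk := pk
    sk := ω.key
    signState := fun i j msg => S.sign n (ω.key i j) msg (ω.opCoins i j 0)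
    signHandover := fun i j msg => S.sign n (ω.key i j) msg (ω.opCoins i j 1)
    verify := S.verify n
    hash := H.hash n s
    δ := X.δ
    commit := X.commit n s
    committeeOf := X.committee
    genesis := PoS.genesis n ω.2.1 s pks
    step := PoS.step n ω.2.1 s pks }

variable (H S PoS)

/-- The protocol is safe: against every efficient adversary, executions are safe with overwhelming
probability. -/
def SafeProtocol (m C : ℕ) (T : Polynomial ℕ) : Prop :=
  ∀ A : Adversary, Negligible fun n =>
    pr fun ω : World H S PoS T n × Coins (A.coins.eval n) =>
      let E := ω.1.env X m C
      ¬ E.Safe (E.exec (A.next n ω.2) (T.eval n))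

/-- Against every efficient adversary, the sync committees of all epochs have an honest majority with
overwhelming probability. -/
def HonestCommittees (m C : ℕ) (T : Polynomial ℕ) : Prop :=
  ∀ A : Adversary, Negligible fun n =>
    pr fun ω : World H S PoS T n × Coins (A.coins.eval n) =>
      let E := ω.1.env X m C
      ¬ E.HonestMajority (A.next n ω.2) (E.exec (A.next n ω.2) (T.eval n))

end World

end Superlight

/-!
The proof has a combinatorial part, about a single execution, and a cryptographic part, the
reductions.

*The tournament in a single execution* (`Env.tournamentFails`). Suppose that the execution is safe,
that all committees have honest majorities, that no two different inputs hashed in the tournament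
collide, and that the adversary shows no signature of a party that is honest in the period in question
on a message that this party does not sign. All honest provers make the same claim, by safety. An
honest prover passes every check, since the honest members of a committee have signed what it shows.
Against a different claim it wins, for the following reason. More than half of the positions of the
latest committee sign the claim for the epoch, so an opponent that shows the true latest committee
would have to forge; hence some peak differs. In the bisection game the following invariants hold for
the current node, at which the two provers differ (`Env.Sound.bisection`): every Merkle proof to the
opponent's peaks for a leaf below the node passes through the opponent's value of the node, and every
such proof for a leaf to the left of the node leads to the honest committee. At the leaf where the
game ends the opponent thus shows the honest committee at the previous leaf, and a quorum of that
committee on a false handover message, which again contains a forgery. So the claim of the honest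
provers is accepted, and it is secure with the latency of one epoch: the ledgers of honest parties at
the same round are equal, and the beginning of the epoch of round `r` is less than `C` rounds before
`r` (`Env.stateSecure`).

*The reductions.* Hypotheses about all efficient adversaries have to be turned into bounds for the
given one, against which the tournament is played.
* For safety and honest majorities, an adversary against the protocol computes the transcript of the
  tournament from its own view, and then continues with it (`exec_tournamentMove`).
* A collision finder simulates the whole world, with a hash key that is given to it, and searches the
  transcript (`collisionOutput_eq`).
* A forger simulates the world except for a single party, up to a single period `t`: the signatures of
  this party in the periods up to `t` are obtained from the challenger, which gives away the key of
  period `t + 1` at the break-in, so that all later operations can be carried out with it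
  (`exec_simWorld`). An execution in which the party is honest until then is simulated perfectly, and
  a forgery shown in the tournament wins the attack game (`forges_of_forgesAt`).

The round of the tournament need not be computable, and the forger does not know its target; the
reductions guess both. A reduction uses one string of coins for the guess and for everything that it
simulates. Cutting this string into pieces is a homomorphism onto the coins of the simulated
experiment, hence preserves the uniform distribution (`pr_comp_hom`), and the guess costs a polynomial
factor (`pr_le_of_guess`).

Reductions have to be efficient in the concrete model of computation, programs on binary trees. The
predicate `PT` says that a function between types with an encoding by trees is computed by such a
program in polynomial time, and closure properties of `PT` are proved so that `fun_prop` derives it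
for composed functions. The tournament, a stateful recursion of which the size of intermediate values
is not evident, is rephrased by bounded iterations (`GCtx.tournament`), and shown to agree with the
original one (`GCtx.Fits.tournament`).
-/

namespace Superlight
open Data

/-! ### Polynomial-time functions between encoded types -/

theorem poly_mono (P : Polynomial ℕ) {a b : ℕ} (h : a ≤ b) : P.eval a ≤ P.eval b := by
  rw [Polynomial.eval_eq_sum, Polynomial.eval_eq_sum]
  exact Finset.sum_le_sum fun i _ => Nat.mul_le_mul_left _ (Nat.pow_le_pow_left h i)

theorem Data.one_le_size (d : Data) : 1 ≤ d.size := by cases d <;> simp [size]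

theorem Data.fst_size_le (d : Data) : d.fst.size ≤ d.size := by
  cases d <;> simp only [size, fst] <;> omega

theorem Data.snd_size_le (d : Data) : d.snd.size ≤ d.size := by
  cases d <;> simp only [size, snd] <;> omega

/-- Each step of a program costs at least the size of the trees it touches: so running times bound
the sizes of inputs and outputs. -/
theorem Prog.Run.size_le {p : Prog} {x y : Data} {t : ℕ} (h : p.Run x y t) :
    x.size ≤ t ∧ y.size ≤ t := by
  induction h with
  | id x => simp
  | nil x => exact ⟨le_rfl, x.one_le_size⟩
  | fst x => exact ⟨le_rfl, x.fst_size_le⟩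
  | snd x => exact ⟨le_rfl, x.snd_size_le⟩
  | eq x =>
    refine ⟨by omega, ?_⟩
    cases decide (x.fst = x.snd) <;> simp [ofBool, size]
  | _ => (try simp only [size] at *); constructor <;> omega

/-- An encoding of a type by binary trees. It need not be injective. -/
class Enc (α : Type) where
  enc : α → Data

open Enc (enc)

/-- A natural number depending on `x` that is at most polynomial in the size of the encoding of `x`. -/
@[fun_prop]
def PB {α : Type} [Enc α] (f : α → ℕ) : Prop :=
  ∃ P : Polynomial ℕ, ∀ x, f x ≤ P.eval (enc x).size

/-- A function between encoded types that is computed by a polynomial-time program. -/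
@[fun_prop]
def PT {α β : Type} [Enc α] [Enc β] (f : α → β) : Prop :=
  ∃ (p : Prog) (P : Polynomial ℕ), ∀ x, ∃ t ≤ P.eval (enc x).size, p.Run (enc x) (enc (f x)) t

instance : Enc Data := ⟨fun d => d⟩
instance : Enc Unit := ⟨fun _ => .nil⟩
instance : Enc Bool := ⟨ofBool⟩
instance : Enc ℕ := ⟨num⟩
instance {α β : Type} [Enc α] [Enc β] : Enc (α × β) := ⟨fun p => .cons (enc p.1) (enc p.2)⟩
instance {α : Type} [Enc α] : Enc (List α) := ⟨fun l => ofList (l.map enc)⟩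
instance {α : Type} [Enc α] : Enc (Option α) :=
  ⟨fun o => match o with | none => .nil | some a => .cons .nil (enc a)⟩

variable {α β γ σ : Type} [Enc α] [Enc β] [Enc γ] [Enc σ]

theorem enc_pair (a : α) (b : β) : enc (a, b) = .cons (enc a) (enc b) := rfl
theorem enc_list_nil : enc ([] : List α) = .nil := rfl
theorem enc_list_cons (a : α) (l : List α) : enc (a :: l) = .cons (enc a) (enc l) := rfl
theorem enc_data (d : Data) : enc d = d := rfl

theorem enc_listData (l : List Data) : enc l = ofList l := by
  change ofList (l.map fun d => d) = ofList l
  simp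

theorem PB.mono {f g : α → ℕ} (hg : PB g) (h : ∀ x, f x ≤ g x) : PB f := by
  obtain ⟨P, hP⟩ := hg
  exact ⟨P, fun x => (h x).trans (hP x)⟩

@[fun_prop]
theorem PB.const (c : ℕ) : PB fun _ : α => c := ⟨Polynomial.C c, fun x => by simp⟩

@[fun_prop]
theorem PB.add {f g : α → ℕ} (hf : PB f) (hg : PB g) : PB fun x => f x + g x := by
  obtain ⟨P, hP⟩ := hf
  obtain ⟨Q, hQ⟩ := hg
  exact ⟨P + Q, fun x => by rw [Polynomial.eval_add]; exact Nat.add_le_add (hP x) (hQ x)⟩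

@[fun_prop]
theorem PB.mul {f g : α → ℕ} (hf : PB f) (hg : PB g) : PB fun x => f x * g x := by
  obtain ⟨P, hP⟩ := hf
  obtain ⟨Q, hQ⟩ := hg
  exact ⟨P * Q, fun x => by rw [Polynomial.eval_mul]; exact Nat.mul_le_mul (hP x) (hQ x)⟩

theorem PB.poly {f : α → ℕ} (hf : PB f) (Q : Polynomial ℕ) : PB fun x => Q.eval (f x) := by
  obtain ⟨P, hP⟩ := hf
  exact ⟨Q.comp P, fun x => by rw [Polynomial.eval_comp]; exact poly_mono Q (hP x)⟩

theorem PT.pb {f : α → β} (hf : PT f) : PB fun x => (enc (f x)).size := by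
  obtain ⟨p, P, h⟩ := hf
  refine ⟨P, fun x => ?_⟩
  obtain ⟨t, ht, hr⟩ := h x
  exact hr.size_le.2.trans ht

theorem PB.size_self : PB fun x : α => (enc x).size := ⟨Polynomial.X, fun x => by simp⟩

@[fun_prop]
theorem PT.id : PT fun x : α => x :=
  ⟨.id, .X, fun x => ⟨(enc x).size, by simp, .id _⟩⟩

@[fun_prop]
theorem PT.comp {g : β → γ} {f : α → β} (hg : PT g) (hf : PT f) : PT fun x => g (f x) := by
  obtain ⟨Q, hQ⟩ : ∃ Q : Polynomial ℕ, ∀ x, (enc (f x)).size ≤ Q.eval (enc x).size := hf.pb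
  obtain ⟨p, P, h⟩ := hf
  obtain ⟨p', P', h'⟩ := hg
  refine ⟨.comp p p', P + P'.comp Q + 1, fun x => ?_⟩
  obtain ⟨t, ht, hr⟩ := h x
  obtain ⟨t', ht', hr'⟩ := h' (f x)
  refine ⟨_, ?_, .comp hr hr'⟩
  have := poly_mono P' (hQ x)
  simp only [Polynomial.eval_add, Polynomial.eval_comp, Polynomial.eval_one]
  omega

@[fun_prop]
theorem PT.pair {f : α → β} {g : α → γ} (hf : PT f) (hg : PT g) : PT fun x => (f x, g x) := by
  obtain ⟨p, P, h⟩ := hf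
  obtain ⟨p', P', h'⟩ := hg
  refine ⟨.pair p p', P + P' + 1, fun x => ?_⟩
  obtain ⟨t, ht, hr⟩ := h x
  obtain ⟨t', ht', hr'⟩ := h' x
  refine ⟨_, ?_, .pair hr hr'⟩
  simp only [Polynomial.eval_add, Polynomial.eval_one]
  omega

/-- Functions whose encoded values agree are computed by the same programs. -/
theorem PT.congr_enc {f : α → β} (hf : PT f) {g : α → γ} (h : ∀ x, enc (g x) = enc (f x)) : PT g := by
  obtain ⟨p, P, hp⟩ := hf
  exact ⟨p, P, fun x => by rw [h x]; exact hp x⟩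

theorem PT.congr {f g : α → β} (hf : PT f) (h : ∀ x, g x = f x) : PT g :=
  hf.congr_enc fun x => by rw [h x]

@[fun_prop]
theorem PT.dataFst {f : α → Data} (hf : PT f) : PT fun x => (f x).fst :=
  PT.comp (g := Data.fst) ⟨.fst, .X, fun x => ⟨_, by simp, .fst _⟩⟩ hf

@[fun_prop]
theorem PT.dataSnd {f : α → Data} (hf : PT f) : PT fun x => (f x).snd :=
  PT.comp (g := Data.snd) ⟨.snd, .X, fun x => ⟨_, by simp, .snd _⟩⟩ hf

@[fun_prop]
theorem PT.dataCons {f g : α → Data} (hf : PT f) (hg : PT g) : PT fun x => Data.cons (f x) (g x) :=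
  (hf.pair hg).congr_enc fun _ => rfl

theorem PT.toData {f : α → β} (hf : PT f) : PT fun x => enc (f x) := hf.congr_enc fun _ => rfl

@[fun_prop]
theorem PT.prodFst {f : α → β × γ} (hf : PT f) : PT fun x => (f x).1 :=
  hf.toData.dataFst.congr_enc fun _ => rfl

@[fun_prop]
theorem PT.prodSnd {f : α → β × γ} (hf : PT f) : PT fun x => (f x).2 :=
  hf.toData.dataSnd.congr_enc fun _ => rfl

theorem PT.constData (d : Data) : PT fun _ : α => d := by
  induction d with
  | nil => exact ⟨.nil, .X, fun x => ⟨_, by simp, .nil _⟩⟩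
  | cons a b ha hb => exact ha.dataCons hb

/-- Constant functions are efficient, since a program can build any fixed tree. -/
@[fun_prop]
theorem PT.const (b : β) : PT fun _ : α => b := (PT.constData (enc b)).congr_enc fun _ => rfl

/-- Branching on whether a tree is empty. -/
theorem PT.condData {c : α → Data} {f g h : α → β} (hc : PT c) (hf : PT f) (hg : PT g)
    (h1 : ∀ x, c x ≠ .nil → h x = f x) (h2 : ∀ x, c x = .nil → h x = g x) : PT h := by
  obtain ⟨pc, Pc, hc⟩ := hc
  obtain ⟨pf, Pf, hf⟩ := hf
  obtain ⟨pg, Pg, hg⟩ := hg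
  refine ⟨.cond pc pf pg, Pc + Pf + Pg + 1, fun x => ?_⟩
  obtain ⟨t, ht, hrc⟩ := hc x
  simp only [Polynomial.eval_add, Polynomial.eval_one]
  by_cases hx : c x = .nil
  · obtain ⟨u, hu, hr⟩ := hg x
    have hrc' : pc.Run (enc x) .nil t := by rw [← hx]; exact hrc
    rw [h2 x hx]
    exact ⟨_, by omega, .condFalse hrc' hr⟩
  · obtain ⟨u, hu, hr⟩ := hf x
    rw [h1 x hx]
    exact ⟨_, by omega, .condTrue hrc hx hr⟩

@[fun_prop]
theorem PT.ite {p : α → Prop} [∀ x, Decidable (p x)] {f g : α → β} (hc : PT fun x => decide (p x))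
    (hf : PT f) (hg : PT g) : PT fun x => if p x then f x else g x := by
  refine PT.condData hc.toData hf hg (fun x hx => ?_) (fun x hx => ?_)
  · have : p x := by
      by_contra hn
      exact hx (by change ofBool _ = _; simp [hn, ofBool])
    simp [this]
  · have : ¬ p x := by
      intro hn
      change ofBool _ = _ at hx
      simp [hn, ofBool] at hx
    simp [this]

/-- The encoding determines the value. -/
class EncInj (α : Type) [Enc α] : Prop where
  inj : Function.Injective (enc : α → Data)

instance : EncInj Data := ⟨fun _ _ h => h⟩

theorem ofList_injective : Function.Injective ofList := by
  intro l
  induction l with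
  | nil => intro l' h; cases l' <;> simp_all [ofList]
  | cons a l ih =>
    intro l' h
    cases l' with
    | nil => simp [ofList] at h
    | cons b l' =>
      simp only [ofList, Data.cons.injEq] at h
      rw [h.1, ih h.2]

theorem num_injective : Function.Injective num := fun a b h => by
  simpa using congrArg List.length (ofList_injective h)

instance : EncInj ℕ := ⟨num_injective⟩
instance : EncInj Bool := ⟨fun a b h => by cases a <;> cases b <;> first | rfl | cases h⟩

@[fun_prop]
theorem PT.decideEq [EncInj β] {f g : α → β} [∀ x, Decidable (f x = g x)] (hf : PT f) (hg : PT g) :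
    PT fun x => decide (f x = g x) := by
  have : PT fun q : Data × Data => decide (q.1 = q.2) := by
    refine ⟨.eq, .X + 3, fun q => ⟨_, ?_, .eq _⟩⟩
    simp
  refine (this.comp (hf.toData.pair hg.toData)).congr fun x => ?_
  simp [EncInj.inj.eq_iff]

@[fun_prop]
theorem PT.decideBool {f : α → Bool} [∀ x, Decidable (f x = true)] (hf : PT f) :
    PT fun x => decide (f x = true) := hf.congr fun x => by simp

@[fun_prop]
theorem PT.not {f : α → Bool} (hf : PT f) : PT fun x => !f x := by
  refine (PT.ite (p := fun x => f x = true) (hf.congr fun x => by simp)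
    (PT.const false) (PT.const true)).congr fun x => ?_
  cases f x <;> rfl

@[fun_prop]
theorem PT.and {f g : α → Bool} (hf : PT f) (hg : PT g) : PT fun x => f x && g x := by
  refine (PT.ite (p := fun x => f x = true) (hf.congr fun x => by simp)
    hg (PT.const false)).congr fun x => ?_
  cases f x <;> rfl

@[fun_prop]
theorem PT.or {f g : α → Bool} (hf : PT f) (hg : PT g) : PT fun x => f x || g x := by
  refine (PT.ite (p := fun x => f x = true) (hf.congr fun x => by simp)
    (PT.const true) hg).congr fun x => ?_
  cases f x <;> rfl

@[fun_prop]
theorem PT.decideAnd {p q : α → Prop} [∀ x, Decidable (p x)] [∀ x, Decidable (q x)]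
    [∀ x, Decidable (p x ∧ q x)] (hp : PT fun x => decide (p x)) (hq : PT fun x => decide (q x)) :
    PT fun x => decide (p x ∧ q x) := (hp.and hq).congr fun x => by simp

@[fun_prop]
theorem PT.decideNot {p : α → Prop} [∀ x, Decidable (p x)]
    [∀ x, Decidable (¬ p x)] (hp : PT fun x => decide (p x)) :
    PT fun x => decide (¬ p x) := hp.not.congr fun x => by simp

@[fun_prop]
theorem PT.listCons {f : α → β} {l : α → List β} (hf : PT f) (hl : PT l) :
    PT fun x => f x :: l x := (hf.pair hl).congr_enc fun _ => rfl

@[fun_prop]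
theorem PT.tail {l : α → List β} (hl : PT l) : PT fun x => (l x).tail :=
  hl.toData.dataSnd.congr_enc fun x => by cases l x <;> rfl

@[fun_prop]
theorem PT.ofList {l : α → List Data} (hl : PT l) : PT fun x => Data.ofList (l x) :=
  hl.toData.congr_enc fun x => by rw [enc_data, enc_data, enc_listData]

theorem ofList_toList (d : Data) : Data.ofList d.toList = d := by
  induction d with
  | nil => rfl
  | cons a b _ hb => simp [toList, Data.ofList, hb]

theorem toList_ofList (l : List Data) : (Data.ofList l).toList = l := by
  induction l with
  | nil => rfl
  | cons a l ih => simp [toList, Data.ofList, ih]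

@[fun_prop]
theorem PT.toList {f : α → Data} (hf : PT f) : PT fun x => (f x).toList :=
  hf.congr_enc fun x => by rw [enc_listData, ofList_toList, enc_data]

/-- Case distinction on a list. -/
theorem PT.listCases {l : α → List β} {f : α → γ} {g : α → β → List β → γ} (hl : PT l) (hf : PT f)
    (hg : PT fun p : α × β × List β => g p.1 p.2.1 p.2.2) {h : α → γ}
    (h1 : ∀ x, l x = [] → h x = f x) (h2 : ∀ x b t, l x = b :: t → h x = g x b t) : PT h := by
  obtain ⟨pl, Pl, hl'⟩ := hl
  obtain ⟨pf, Pf, hf⟩ := hf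
  obtain ⟨pg, Pg, hg⟩ := hg
  refine ⟨.cond pl (.comp (.pair .id pl) pg) pf,
    Pl + Pf + (.X + Pl + 1) + Pg.comp (.X + Pl + 1) + 2, fun x => ?_⟩
  obtain ⟨t, ht, hr⟩ := hl' x
  have hs := hr.size_le.2
  simp only [Polynomial.eval_add, Polynomial.eval_one, Polynomial.eval_comp, Polynomial.eval_X,
    Polynomial.eval_ofNat]
  rcases hx : l x with _ | ⟨b, tl⟩
  · obtain ⟨u, hu, hru⟩ := hf x
    rw [h1 x hx]
    rw [hx] at hr
    exact ⟨_, by omega, .condFalse hr hru⟩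
  · obtain ⟨u, hu, hru⟩ := hg (x, b, tl)
    rw [h2 x b tl hx]
    rw [hx] at hr hs
    have hm : Pg.eval (enc (x, b, tl)).size ≤ Pg.eval ((enc x).size + Pl.eval (enc x).size + 1) := by
      refine poly_mono _ ?_
      rw [enc_list_cons] at hs
      simp only [enc_pair, size] at hs ⊢
      omega
    exact ⟨_, by omega, .condTrue hr (by rw [enc_list_cons]; simp)
      (.comp (.pair (.id _) hr) hru)⟩

/-- Case distinction on an option. -/
theorem PT.optionCases {o : α → Option β} {f : α → γ} {g : α → β → γ} (ho : PT o) (hf : PT f)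
    (hg : PT fun p : α × β => g p.1 p.2) {h : α → γ}
    (h1 : ∀ x, o x = none → h x = f x) (h2 : ∀ x b, o x = some b → h x = g x b) : PT h := by
  have hl : PT fun x => (o x).toList := by
    have h0 : PT fun x => enc (o x).toList :=
      PT.condData ho.toData (ho.toData.dataSnd.dataCons (PT.constData .nil)) (PT.constData .nil)
        (fun x hx => by
          cases hx' : o x with
          | none => exact absurd (by rw [hx']; rfl) hx
          | some b => rfl)
        (fun x hx => by
          cases hx' : o x with
          | none => rfl
          | some b => rw [hx'] at hx; cases hx)
    exact h0.congr_enc fun _ => rfl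
  refine PT.listCases (g := fun x b _ => g x b) hl hf ?_ (fun x hx => ?_) (fun x b t hx => ?_)
  · exact hg.comp (PT.id.prodFst.pair PT.id.prodSnd.prodFst)
  · exact h1 x (by cases hx' : o x <;> simp_all)
  · exact h2 x b (by cases hx' : o x <;> simp_all)

@[fun_prop]
theorem PT.optionSome {f : α → β} (hf : PT f) : PT fun x => Option.some (f x) :=
  ((PT.constData .nil).pair hf).congr_enc fun _ => rfl

/-- While loops with polynomially many iterations and values of polynomial size. -/
theorem PT.iterate_while {c : σ → Bool} {f : σ → σ} {g : α → σ} {k : α → ℕ} (hc : PT c) (hf : PT f)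
    (hg : PT g) (hk : PB k) (hgo : ∀ x, ∀ i < k x, c (f^[i] (g x)) = true)
    (hend : ∀ x, c (f^[k x] (g x)) = false)
    (hs : ∃ P : Polynomial ℕ, ∀ x i, i ≤ k x → (enc (f^[i] (g x))).size ≤ P.eval (enc x).size) :
    PT fun x => f^[k x] (g x) := by
  obtain ⟨pc, Pc, hc⟩ := hc
  obtain ⟨pf, Pf, hf⟩ := hf
  obtain ⟨pg, Pg, hg⟩ := hg
  obtain ⟨Pk, hk⟩ := hk
  obtain ⟨P, hs⟩ := hs
  -- A round of the loop costs at most `B`, which bounds condition, body and overhead.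
  refine ⟨.comp pg (.loop pc pf), Pg + (Pk + 1) * (Pc.comp P + Pf.comp P + 1) + 1, fun x => ?_⟩
  set B := Pc.eval (P.eval (enc x).size) + Pf.eval (P.eval (enc x).size) + 1 with hB
  have key : ∀ j i, i + j = k x → ∃ t ≤ (j + 1) * B,
      (Prog.loop pc pf).Run (enc (f^[i] (g x))) (enc (f^[k x] (g x))) t := by
    intro j
    induction j with
    | zero =>
      intro i hi
      obtain rfl : i = k x := by omega
      obtain ⟨t, ht, hr⟩ := hc (f^[k x] (g x))
      rw [hend x] at hr
      have := poly_mono Pc (hs x _ le_rfl)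
      exact ⟨t + 1, by rw [zero_add, one_mul]; omega, .loopStop hr⟩
    | succ j ih =>
      intro i hi
      obtain ⟨w, hw, hrw⟩ := ih (i + 1) (by omega)
      obtain ⟨t, ht, hr⟩ := hc (f^[i] (g x))
      obtain ⟨u, hu, hru⟩ := hf (f^[i] (g x))
      have h1 := poly_mono Pc (hs x i (by omega))
      have h2 := poly_mono Pf (hs x i (by omega))
      rw [← Function.iterate_succ_apply' f] at hru
      rw [hgo x i (by omega)] at hr
      refine ⟨t + u + w + 1, ?_, .loopStep hr (by simp [enc, ofBool]) hru hrw⟩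
      have : (j + 1 + 1) * B = (j + 1) * B + B := by ring
      omega
  obtain ⟨t, ht, hr⟩ := key (k x) 0 (by omega)
  obtain ⟨u, hu, hru⟩ := hg x
  refine ⟨_, ?_, .comp hru hr⟩
  simp only [Polynomial.eval_add, Polynomial.eval_one, Polynomial.eval_comp, Polynomial.eval_mul,
    ← hB]
  have : (k x + 1) * B ≤ (Pk.eval (enc x).size + 1) * B :=
    Nat.mul_le_mul_right _ (Nat.add_le_add_right (hk x) 1)
  omega

theorem length_le_enc (l : List α) : l.length ≤ (enc l).size := by
  induction l with
  | nil => simp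
  | cons a l ih => rw [enc_list_cons]; simp only [size, List.length_cons]; omega

theorem enc_drop_size (i : ℕ) (l : List α) : (enc (l.drop i)).size ≤ (enc l).size := by
  induction l generalizing i with
  | nil => simp
  | cons a l ih =>
    cases i with
    | zero => simp
    | succ i =>
      have := ih i
      rw [List.drop_succ_cons, enc_list_cons]
      simp only [size]
      omega

/-- Bounded iteration over a list. -/
theorem PT.foldl {l : α → List β} {f : α → γ → β → γ} {g : α → γ} (hl : PT l) (hg : PT g)
    (hf : PT fun p : α × γ × β => f p.1 p.2.1 p.2.2) {B : α → ℕ} (hB : PB B)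
    (hb : ∀ x l', l' <+: l x → (enc (l'.foldl (f x) (g x))).size ≤ B x) :
    PT fun x => (l x).foldl (f x) (g x) := by
  -- The state of the loop consists of the parameter, the accumulator and the rest of the list.
  let step : α × γ × List β → α × γ × List β := fun s =>
    match s.2.2 with
    | [] => s
    | b :: t => (s.1, f s.1 s.2.1 b, t)
  have hstep : PT step := by
    refine PT.listCases (l := fun s : α × γ × List β => s.2.2) (f := fun s => s)
      (g := fun s b t => (s.1, f s.1 s.2.1 b, t)) (by fun_prop) (by fun_prop) ?_ (fun s hs => ?_)
      (fun s b t hs => ?_)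
    · have : PT fun p : (α × γ × List β) × β × List β => f p.1.1 p.1.2.1 p.2.1 :=
        hf.comp (f := fun p : (α × γ × List β) × β × List β => (p.1.1, p.1.2.1, p.2.1)) (by fun_prop)
      fun_prop
    · simp [step, hs]
    · simp [step, hs]
  have hiter : ∀ x i, i ≤ (l x).length →
      step^[i] (x, g x, l x) = (x, ((l x).take i).foldl (f x) (g x), (l x).drop i) := by
    intro x i
    induction i with
    | zero => intro _; simp
    | succ i ih =>
      intro hi
      have hd := List.drop_eq_getElem_cons (by omega : i < (l x).length)
      rw [Function.iterate_succ_apply', ih (by omega), List.take_add_one,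
        List.getElem?_eq_getElem (by omega), List.foldl_append]
      simp only [step, hd]
      rfl
  have hcond : PT fun s : α × γ × List β => (!s.2.2.isEmpty) := by
    refine PT.listCases (l := fun s : α × γ × List β => s.2.2) (f := fun _ => false)
      (g := fun _ _ _ => true) (by fun_prop) (by fun_prop) (by fun_prop) (fun s hs => by simp [hs])
      (fun s b t hs => by simp [hs])
  have hlen : PB fun x => (l x).length := hl.pb.mono fun x => length_le_enc (l x)
  have := PT.iterate_while (g := fun x => (x, g x, l x)) (k := fun x => (l x).length) hcond hstep
    (by fun_prop) hlen (fun x i hi => by rw [hiter x i hi.le]; simpa using hi)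
    (fun x => by rw [hiter x _ le_rfl]; simp) ?_
  · refine this.prodSnd.prodFst.congr fun x => ?_
    rw [hiter x _ le_rfl]
    simp
  · have hP : PB fun x => (enc x).size + (B x + (enc (l x)).size + 1) + 1 := by
      have := hl.pb
      have := PB.size_self (α := α)
      fun_prop
    obtain ⟨P, hP⟩ := hP
    refine ⟨P, fun x i hi => le_trans ?_ (hP x)⟩
    rw [hiter x i hi]
    have h1 := hb x _ (List.take_prefix i (l x))
    have h2 := enc_drop_size i (l x)
    simp only [enc_pair, size]
    omega

/-! ### Polynomial-time operations on lists and numbers -/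

theorem enc_append_size (l l' : List α) :
    (enc (l ++ l')).size + 1 = (enc l).size + (enc l').size := by
  induction l with
  | nil => rw [enc_list_nil, List.nil_append]; simp only [size]; omega
  | cons a l ih => rw [List.cons_append, enc_list_cons, enc_list_cons]; simp only [size]; omega

theorem enc_reverse_size (l : List α) : (enc l.reverse).size = (enc l).size := by
  induction l with
  | nil => rfl
  | cons a l ih =>
    have := enc_append_size l.reverse [a]
    rw [List.reverse_cons]
    rw [enc_list_cons a []] at this
    rw [enc_list_cons]
    simp only [enc_list_nil, size] at this ⊢
    omega

theorem enc_sublist_size {l l' : List α} (h : l.Sublist l') : (enc l).size ≤ (enc l').size := by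
  induction h with
  | slnil => exact le_rfl
  | cons a _ ih => rw [enc_list_cons]; simp only [size]; omega
  | cons_cons a _ ih => rw [enc_list_cons, enc_list_cons]; simp only [size]; omega

theorem enc_mem_size {a : α} {l : List α} (h : a ∈ l) : (enc a).size < (enc l).size := by
  have := enc_sublist_size (List.singleton_sublist.mpr h)
  rw [enc_list_cons, enc_list_nil] at this
  simp only [size] at this
  omega

theorem enc_size_le_of_forall {l : List α} {b : ℕ} (h : ∀ a ∈ l, (enc a).size ≤ b) :
    (enc l).size ≤ l.length * (b + 1) + 1 := by
  induction l with
  | nil => simp [enc_list_nil, size]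
  | cons a l ih =>
    have h1 := h a (by simp)
    have h2 := ih fun c hc => h c (by simp [hc])
    rw [enc_list_cons, List.length_cons]
    simp only [size]
    have : (l.length + 1) * (b + 1) = l.length * (b + 1) + (b + 1) := by ring
    omega

theorem enc_nat_size (n : ℕ) : (enc n).size = 2 * n + 1 := by
  change (num n).size = _
  induction n with
  | zero => rfl
  | succ n ih =>
    rw [num, List.replicate_succ] at *
    simp only [Data.ofList, size] at *
    omega

theorem PT.pbNat {f : α → ℕ} (hf : PT f) : PB f :=
  hf.pb.mono fun x => by rw [enc_nat_size]; omega

@[fun_prop]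
theorem PT.reverse {l : α → List β} (hl : PT l) : PT fun x => (l x).reverse := by
  have := PT.foldl (f := fun _ acc b => b :: acc) (g := fun _ => ([] : List β)) hl (by fun_prop)
    (by fun_prop) hl.pb (fun x l' hl' => by
      have : l'.foldl (fun acc b => b :: acc) [] = l'.reverse := by simp
      rw [this, enc_reverse_size]
      exact enc_sublist_size hl'.sublist)
  exact this.congr fun x => by simp

@[fun_prop]
theorem PT.append {l m : α → List β} (hl : PT l) (hm : PT m) : PT fun x => l x ++ m x := by
  have := PT.foldl (l := fun x => (l x).reverse) (f := fun _ acc b => b :: acc)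
    (g := fun x => m x) (by fun_prop) (by fun_prop)
    (by fun_prop) (hl.pb.add hm.pb) (fun x l' hl' => by
      have h1 : l'.foldl (fun acc b => b :: acc) (m x) = l'.reverse ++ m x := by simp
      have h2 := enc_append_size l'.reverse (m x)
      have h3 := enc_sublist_size hl'.sublist
      rw [enc_reverse_size] at h2 h3
      rw [h1]
      omega)
  exact this.congr fun x => by simp

theorem PT.flatMap {l : α → List β} {f : α → β → List γ} (hl : PT l)
    (hf : PT fun p : α × β => f p.1 p.2) : PT fun x => (l x).flatMap (f x) := by
  have hfold : ∀ x (l' : List β) acc,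
      l'.foldl (fun acc b => acc ++ f x b) acc = acc ++ l'.flatMap (f x) := by
    intro x l'
    induction l' with
    | nil => simp
    | cons b l' ih => intro acc; simp [ih]
  obtain ⟨P, hP⟩ := hf.pb
  have hB : PB fun x => (enc (l x)).size * P.eval ((enc x).size + (enc (l x)).size + 1) + 1 := by
    have h1 := hl.pb
    have h2 : PB fun x => (enc x).size + (enc (l x)).size + 1 := by
      have := PB.size_self (α := α)
      fun_prop
    have h3 := h2.poly P
    fun_prop
  have := PT.foldl (f := fun x acc b => acc ++ f x b) (g := fun _ => ([] : List γ)) hl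
    (by fun_prop) (by
      have : PT fun p : α × List γ × β => f p.1 p.2.2 :=
        hf.comp (f := fun p : α × List γ × β => (p.1, p.2.2)) (by fun_prop)
      fun_prop) hB (fun x l' hl' => by
      have hlen := length_le_enc l'
      have hle := enc_sublist_size hl'.sublist
      have hsz : (enc (l'.flatMap (f x))).size ≤
          l'.length * P.eval ((enc x).size + (enc (l x)).size + 1) + 1 := by
        have hmem : ∀ b ∈ l', (enc (f x b)).size ≤ P.eval ((enc x).size + (enc (l x)).size + 1) := by
          intro b hb
          refine (hP (x, b)).trans (poly_mono _ ?_)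
          have := enc_mem_size (hl'.subset hb)
          simp only [enc_pair, size]
          omega
        clear hlen hle hl'
        induction l' with
        | nil => simp [enc_list_nil, size]
        | cons b l' ih =>
          have h1 := hmem b (by simp)
          have h2 := ih fun c hc => hmem c (by simp [hc])
          have h3 := enc_append_size (f x b) (l'.flatMap (f x))
          rw [List.flatMap_cons, List.length_cons, add_mul]
          omega
      rw [hfold]
      exact hsz.trans (by gcongr; omega))
  exact this.congr fun x => by simp [hfold]

theorem PT.map {l : α → List β} {f : α → β → γ} (hl : PT l)
    (hf : PT fun p : α × β => f p.1 p.2) : PT fun x => (l x).map (f x) :=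
  (PT.flatMap (f := fun x b => [f x b]) hl (by fun_prop)).congr fun x => by
    rw [List.map_eq_flatMap]

theorem PT.filter {l : α → List β} {f : α → β → Bool} (hl : PT l)
    (hf : PT fun p : α × β => f p.1 p.2) : PT fun x => (l x).filter (f x) :=
  (PT.flatMap (f := fun x b => if f x b = true then [b] else []) hl (by fun_prop)).congr fun x => by
    induction l x with
    | nil => rfl
    | cons b t ih => by_cases h : f x b = true <;> simp_all

@[fun_prop]
theorem PT.isEmpty {l : α → List β} (hl : PT l) : PT fun x => (l x).isEmpty :=
  PT.listCases (f := fun _ => true) (g := fun _ _ _ => false) hl (by fun_prop) (by fun_prop)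
    (fun x hx => by simp [hx]) (fun x b t hx => by simp [hx])

@[fun_prop]
theorem PT.head? {l : α → List β} (hl : PT l) : PT fun x => (l x).head? :=
  PT.listCases (f := fun _ => none) (g := fun _ b _ => some b) hl (by fun_prop) (by fun_prop)
    (fun x hx => by simp [hx]) (fun x b t hx => by simp [hx])

@[fun_prop]
theorem PT.optionGetD {o : α → Option β} {f : α → β} (ho : PT o) (hf : PT f) :
    PT fun x => (o x).getD (f x) :=
  PT.optionCases (g := fun _ b => b) ho hf (by fun_prop) (fun x hx => by simp [hx])
    (fun x b hx => by simp [hx])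

@[fun_prop]
theorem PT.isSome {o : α → Option β} (ho : PT o) : PT fun x => (o x).isSome :=
  PT.optionCases (f := fun _ => false) (g := fun _ _ => true) ho (by fun_prop) (by fun_prop)
    (fun x hx => by simp [hx]) (fun x b hx => by simp [hx])

theorem PT.optionMap {o : α → Option β} {f : α → β → γ} (ho : PT o)
    (hf : PT fun p : α × β => f p.1 p.2) : PT fun x => (o x).map (f x) :=
  PT.optionCases (f := fun _ => none) (g := fun x b => some (f x b)) ho (by fun_prop) (by fun_prop)
    (fun x hx => by simp [hx]) (fun x b hx => by simp [hx])

theorem PT.find? {l : α → List β} {f : α → β → Bool} (hl : PT l)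
    (hf : PT fun p : α × β => f p.1 p.2) : PT fun x => (l x).find? (f x) :=
  (PT.filter hl hf).head?.congr fun x => by rw [List.head?_filter]

theorem PT.any {l : α → List β} {f : α → β → Bool} (hl : PT l)
    (hf : PT fun p : α × β => f p.1 p.2) : PT fun x => (l x).any (f x) :=
  (PT.find? hl hf).isSome.congr fun x => by
    rw [Bool.eq_iff_iff]
    simp

/-- Lists of empty values are encoded like numbers. -/
theorem enc_replicate_unit (n : ℕ) : enc (List.replicate n ()) = enc n := by
  change Data.ofList _ = num n
  rw [List.map_replicate]
  rfl

@[fun_prop]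
theorem PT.length {l : α → List β} (hl : PT l) : PT fun x => (l x).length :=
  (PT.map (f := fun _ _ => ()) hl (by fun_prop)).congr_enc fun x => by
    rw [← enc_replicate_unit, List.map_const']

theorem PT.replicateUnit {n : α → ℕ} (hn : PT n) : PT fun x => List.replicate (n x) () :=
  hn.congr_enc fun _ => enc_replicate_unit _

theorem PT.countP {l : α → List β} {f : α → β → Bool} (hl : PT l)
    (hf : PT fun p : α × β => f p.1 p.2) : PT fun x => (l x).countP (f x) :=
  (PT.filter hl hf).length.congr fun x => by rw [List.countP_eq_length_filter]

/-- Bounded iteration. -/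
theorem PT.iterate {n : α → ℕ} {f : α → γ → γ} {g : α → γ} (hn : PT n) (hg : PT g)
    (hf : PT fun p : α × γ => f p.1 p.2) {B : α → ℕ} (hB : PB B)
    (hb : ∀ x, ∀ i ≤ n x, (enc ((f x)^[i] (g x))).size ≤ B x) : PT fun x => (f x)^[n x] (g x) := by
  have hfold : ∀ x (l' : List Unit), l'.foldl (fun acc _ => f x acc) (g x) = (f x)^[l'.length] (g x) := by
    intro x l'
    induction l' using List.reverseRecOn with
    | nil => rfl
    | append_singleton l b ih =>
      rw [List.foldl_append, ih, List.length_append, List.length_singleton,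
        Function.iterate_succ_apply']
      rfl
  have := PT.foldl (l := fun x => List.replicate (n x) ()) (f := fun x acc _ => f x acc)
    hn.replicateUnit hg
    (hf.comp (f := fun p : α × γ × Unit => (p.1, p.2.1)) (by fun_prop)) hB (fun x l' hl' => by
      rw [hfold]
      exact hb x _ (by simpa using hl'.length_le))
  exact this.congr fun x => by rw [hfold, List.length_replicate]

@[fun_prop]
theorem PT.natAdd {f g : α → ℕ} (hf : PT f) (hg : PT g) : PT fun x => f x + g x :=
  (hf.replicateUnit.append hg.replicateUnit).congr_enc fun x => by
    rw [List.replicate_append_replicate, enc_replicate_unit]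

@[fun_prop]
theorem PT.natSub {f g : α → ℕ} (hf : PT f) (hg : PT g) : PT fun x => f x - g x := by
  have hpred : PT fun n : ℕ => n - 1 :=
    (PT.replicateUnit PT.id).tail.congr_enc fun n => by
      rw [List.tail_replicate, enc_replicate_unit]
  have hit : ∀ a i : ℕ, (fun n => n - 1)^[i] a = a - i := by
    intro a i
    induction i with
    | zero => rfl
    | succ i ih => rw [Function.iterate_succ_apply', ih]; omega
  refine (PT.iterate (f := fun _ n => n - 1) hg hf (hpred.comp (by fun_prop)) hf.pb
    (fun x i _ => ?_)).congr fun x => (hit _ _).symm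
  rw [hit, enc_nat_size, enc_nat_size]
  omega

@[fun_prop]
theorem PT.natMul {f g : α → ℕ} (hf : PT f) (hg : PT g) : PT fun x => f x * g x :=
  (PT.flatMap (f := fun x _ => List.replicate (g x) ()) hf.replicateUnit
    (PT.replicateUnit (by fun_prop))).length.congr fun x => by simp

@[fun_prop]
theorem PT.decideLe {f g : α → ℕ} [∀ x, Decidable (f x ≤ g x)] (hf : PT f) (hg : PT g) :
    PT fun x => decide (f x ≤ g x) :=
  (PT.decideEq (hf.natSub hg) (PT.const 0)).congr fun x => by simp [Nat.sub_eq_zero_iff_le]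

@[fun_prop]
theorem PT.decideLt {f g : α → ℕ} [∀ x, Decidable (f x < g x)] (hf : PT f) (hg : PT g) :
    PT fun x => decide (f x < g x) :=
  (PT.decideLe (hf.natAdd (PT.const 1)) hg).congr fun _ => decide_eq_decide.mpr Nat.lt_iff_add_one_le

theorem PT.range {n : α → ℕ} (hn : PT n) : PT fun x => List.range (n x) := by
  have hit : ∀ i : ℕ, (fun l : List ℕ => l ++ [l.length])^[i] [] = List.range i := by
    intro i
    induction i with
    | zero => rfl
    | succ i ih => rw [Function.iterate_succ_apply', ih, List.range_succ, List.length_range]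
  refine (PT.iterate (f := fun _ (l : List ℕ) => l ++ [l.length]) (g := fun _ => [])
    (B := fun x => n x * (2 * n x + 1 + 1) + 1) hn (by fun_prop) (by fun_prop)
    (by have := hn.pbNat; fun_prop) (fun x i hi => ?_)).congr fun x => (hit (n x)).symm
  rw [hit]
  refine (enc_size_le_of_forall (b := 2 * n x + 1) fun a ha => ?_).trans ?_
  · rw [enc_nat_size]; have := List.mem_range.mp ha; omega
  · rw [List.length_range]; exact Nat.add_le_add_right (Nat.mul_le_mul_right _ hi) 1

attribute [fun_prop] PT.range

@[fun_prop]
theorem PT.natDiv {f g : α → ℕ} (hf : PT f) (hg : PT g) : PT fun x => f x / g x := by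
  have : PT fun x => if g x = 0 then 0 else
      (List.range (f x)).countP fun k => decide ((k + 1) * g x ≤ f x) :=
    PT.ite (by fun_prop) (by fun_prop) (PT.countP (by fun_prop) (by fun_prop))
  refine this.congr fun x => ?_
  split_ifs with h
  · rw [h, Nat.div_zero]
  · have hg' : 0 < g x := by omega
    have hkey : ∀ a b, b ≤ a → (List.range a).countP (fun k => decide (k < b)) = b := by
      intro a b hab
      induction a with
      | zero => simp_all
      | succ a ih =>
        rw [List.range_succ, List.countP_append]
        rcases Nat.lt_or_ge a b with h' | h'
        · obtain rfl : b = a + 1 := by omega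
          have : (List.range a).countP (fun k => decide (k < a + 1)) = a := by
            rw [List.countP_eq_length.mpr, List.length_range]
            intro k hk
            have := List.mem_range.mp hk
            simp; omega
          rw [this]
          simp
        · rw [ih h']
          simp [show ¬ a < b by omega]
    rw [← hkey (f x) (f x / g x) (Nat.div_le_self _ _)]
    refine List.countP_congr fun k _ => ?_
    have := Nat.le_div_iff_mul_le (x := k + 1) (y := f x) hg'
    simp only [decide_eq_true_eq]
    rw [← this, Nat.lt_iff_add_one_le]

@[fun_prop]
theorem PT.natMod {f g : α → ℕ} (hf : PT f) (hg : PT g) : PT fun x => f x % g x :=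
  (hf.natSub (hg.natMul (hf.natDiv hg))).congr fun _ => Nat.mod_eq_sub_mul_div

@[fun_prop]
theorem PT.natPow {f : α → ℕ} (hf : PT f) (k : ℕ) : PT fun x => f x ^ k := by
  induction k with
  | zero => simpa using PT.const 1
  | succ k ih => exact (ih.natMul hf).congr fun x => pow_succ _ _

@[fun_prop]
theorem PT.polyEval (P : Polynomial ℕ) {f : α → ℕ} (hf : PT f) : PT fun x => P.eval (f x) := by
  induction P using Polynomial.induction_on' with
  | add p q hp hq => exact (hp.natAdd hq).congr fun x => Polynomial.eval_add
  | monomial k a => exact ((PT.const a).natMul (hf.natPow k)).congr fun x => Polynomial.eval_monomial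

@[fun_prop]
theorem PT.drop {n : α → ℕ} {l : α → List β} (hn : PT n) (hl : PT l) :
    PT fun x => (l x).drop (n x) := by
  have hit : ∀ (l : List β) i, List.tail^[i] l = l.drop i := by
    intro l i
    induction i with
    | zero => rfl
    | succ i ih => rw [Function.iterate_succ_apply', ih, List.tail_drop]
  refine (PT.iterate (f := fun _ (l : List β) => l.tail) hn hl (by fun_prop) hl.pb
    (fun x i _ => ?_)).congr fun x => (hit _ _).symm
  rw [hit]
  exact enc_drop_size _ _

@[fun_prop]
theorem PT.take {n : α → ℕ} {l : α → List β} (hn : PT n) (hl : PT l) :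
    PT fun x => (l x).take (n x) := by
  have : PT fun x => ((l x).reverse.drop ((l x).length - n x)).reverse := by fun_prop
  refine this.congr fun x => ?_
  rw [List.drop_reverse, List.reverse_reverse]
  rcases Nat.le_total (n x) (l x).length with h | h
  · rw [Nat.sub_sub_self h]
  · rw [List.take_of_length_le h, List.take_of_length_le (by omega)]

@[fun_prop]
theorem PT.getElem? {n : α → ℕ} {l : α → List β} (hl : PT l) (hn : PT n) :
    PT fun x => (l x)[n x]? := by
  have : PT fun x => ((l x).drop (n x)).head? := by fun_prop
  exact this.congr fun x => by rw [List.head?_drop]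

@[fun_prop]
theorem PT.getD {n : α → ℕ} {l : α → List β} {d : α → β} (hl : PT l) (hn : PT n) (hd : PT d) :
    PT fun x => (l x).getD (n x) (d x) :=
  ((hl.getElem? hn).optionGetD hd).congr fun x => by rw [List.getD_eq_getElem?_getD]

@[fun_prop]
theorem PT.nth {n : α → ℕ} {d : α → Data} (hd : PT d) (hn : PT n) : PT fun x => (d x).nth (n x) := by
  unfold Data.nth
  fun_prop

@[fun_prop]
theorem PT.toNat {d : α → Data} (hd : PT d) : PT fun x => (d x).toNat := by
  unfold Data.toNat
  fun_prop

@[fun_prop]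
theorem PT.num {n : α → ℕ} (hn : PT n) : PT fun x => Data.num (n x) := hn.congr_enc fun _ => rfl

@[fun_prop]
theorem PT.stateMsg {c : α → Data} (hc : PT c) : PT fun x => stateMsg (c x) := by
  unfold Superlight.stateMsg
  fun_prop

@[fun_prop]
theorem PT.handoverMsg {j : α → ℕ} {c : α → Data} (hj : PT j) (hc : PT c) :
    PT fun x => handoverMsg (j x) (c x) := by
  unfold Superlight.handoverMsg
  fun_prop

theorem PT.findIdx {l : α → List β} {f : α → β → Bool} (hl : PT l)
    (hf : PT fun p : α × β => f p.1 p.2) : PT fun x => (l x).findIdx (f x) := by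
  -- Search for the first index at which the remaining list starts with an element of the given kind.
  have h1 : PT fun p : α × ℕ => (((l p.1).drop p.2).head?.map (f p.1)).getD true :=
    (PT.optionMap (f := fun (p : α × ℕ) b => f p.1 b) (by fun_prop)
      (hf.comp (f := fun q : (α × ℕ) × β => (q.1.1, q.2)) (by fun_prop))).optionGetD (by fun_prop)
  have h2 : PT fun x => ((List.range ((l x).length + 1)).find? fun i =>
      (((l x).drop i).head?.map (f x)).getD true).getD 0 :=
    (PT.find? (f := fun x i => (((l x).drop i).head?.map (f x)).getD true) (by fun_prop)
      h1).optionGetD (by fun_prop)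
  refine h2.congr fun x => ?_
  have : (List.range ((l x).length + 1)).find? (fun i =>
      (((l x).drop i).head?.map (f x)).getD true) = some ((l x).findIdx (f x)) := by
    rw [List.find?_range_eq_some]
    refine ⟨?_, ?_, ?_⟩
    · rw [List.head?_drop]
      rcases Nat.lt_or_ge ((l x).findIdx (f x)) (l x).length with h | h
      · simpa [List.getElem?_eq_getElem h] using List.findIdx_getElem (w := h)
      · simp [List.getElem?_eq_none h]
    · have := List.findIdx_le_length (xs := l x) (p := f x)
      exact List.mem_range.mpr (by omega)
    · intro j hj
      have hj' := hj.trans_le (List.findIdx_le_length (xs := l x) (p := f x))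
      rw [List.head?_drop, List.getElem?_eq_getElem hj']
      simpa using List.not_of_lt_findIdx hj
  rw [this]
  rfl

/-- The size of a tree, computed with a stack of subtrees that remain to be visited. -/
@[fun_prop]
theorem PT.dataSize {d : α → Data} (hd : PT d) : PT fun x => (d x).size := by
  refine PT.comp (g := Data.size) ?_ hd
  let step : List Data × ℕ → List Data × ℕ := fun s =>
    match s.1 with
    | [] => s
    | .nil :: t => (t, s.2 + 1)
    | .cons a b :: t => (a :: b :: t, s.2 + 1)
  have hstep : PT step := by
    refine PT.listCases (l := fun s : List Data × ℕ => s.1) (f := fun s => s)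
      (g := fun s d t => if d = Data.nil then (t, s.2 + 1) else (d.fst :: d.snd :: t, s.2 + 1))
      (by fun_prop) (by fun_prop) (by fun_prop) (fun s hs => by simp [step, hs])
      (fun s d t hs => by cases d <;> simp [step, hs, Data.fst, Data.snd])
  have hinv : ∀ (d : Data) i, i ≤ d.size →
      ((step^[i] ([d], 0)).1.map size).sum + i = d.size ∧ (step^[i] ([d], 0)).2 = i := by
    intro d i
    induction i with
    | zero => simp
    | succ i ih =>
      intro hi
      obtain ⟨h1, h2⟩ := ih (by omega)
      rw [Function.iterate_succ_apply']
      generalize step^[i] ([d], 0) = s at *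
      rcases s with ⟨l, c⟩
      match l with
      | [] => simp at h1; omega
      | .nil :: t => simp [step, size] at *; omega
      | .cons a b :: t => simp [step, size] at *; omega
  have hsum : ∀ l : List Data, (enc l).size ≤ 2 * (l.map size).sum + 1 := by
    intro l
    induction l with
    | nil => simp [enc_list_nil, size]
    | cons a l ih =>
      rw [enc_list_cons, List.map_cons, List.sum_cons]
      have := a.one_le_size
      simp only [enc_data, size] at *
      omega
  have := PT.iterate_while (c := fun s : List Data × ℕ => !s.1.isEmpty) (f := step)
    (g := fun d : Data => ([d], 0)) (k := fun d => d.size) (by fun_prop) hstep (by fun_prop)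
    PB.size_self (fun d i hi => by
      have := (hinv d i hi.le).1
      rcases h : (step^[i] ([d], 0)).1 with _ | _
      · rw [h] at this; simp at this; omega
      · simp) (fun d => by
      have := (hinv d _ le_rfl).1
      rcases h : (step^[d.size] ([d], 0)).1 with _ | ⟨a, l⟩
      · simp
      · rw [h, List.map_cons, List.sum_cons] at this
        have := a.one_le_size
        omega)
    ⟨.C 4 * .X + 3, fun d i hi => by
      obtain ⟨h1, h2⟩ := hinv d i hi
      have h3 := hsum (step^[i] ([d], 0)).1
      have h4 : enc (step^[i] ([d], 0)) = .cons (enc (step^[i] ([d], 0)).1)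
        (enc (step^[i] ([d], 0)).2) := rfl
      rw [h4]
      simp only [size, Polynomial.eval_add, Polynomial.eval_mul, Polynomial.eval_C,
        Polynomial.eval_X, Polynomial.eval_ofNat, enc_nat_size, enc_data, h2]
      omega⟩
  exact this.prodSnd.congr fun d => ((hinv d _ le_rfl).2).symm

/-- Replace a tree of more than `b` nodes by the empty tree. -/
def clip (b : ℕ) (d : Data) : Data := if d.size ≤ b then d else .nil

@[fun_prop]
theorem PT.clip {b : α → ℕ} {d : α → Data} (hb : PT b) (hd : PT d) : PT fun x => clip (b x) (d x) := by
  unfold Superlight.clip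
  fun_prop

theorem clip_size_le {b : ℕ} {d : Data} : (clip b d).size ≤ b + 1 := by
  unfold clip
  split_ifs
  · omega
  · simp [size]

theorem clip_of_le {b : ℕ} {d : Data} (h : d.size ≤ b) : clip b d = d := if_pos h

/-- The power `2 ^ k`, capped at `N + 1`. -/
def cappedPow (N k : ℕ) : ℕ := (fun p => min (2 * p) (N + 1))^[k] 1

theorem cappedPow_eq (N k : ℕ) : cappedPow N k = min (2 ^ k) (N + 1) := by
  unfold cappedPow
  induction k with
  | zero => simp
  | succ k ih => rw [Function.iterate_succ_apply', ih, pow_succ]; omega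

@[fun_prop]
theorem PT.natMin {f g : α → ℕ} (hf : PT f) (hg : PT g) : PT fun x => min (f x) (g x) := by
  have : PT fun x => if f x ≤ g x then f x else g x := by fun_prop
  exact this.congr fun x => min_def _ _

@[fun_prop]
theorem PT.cappedPow {N k : α → ℕ} (hN : PT N) (hk : PT k) : PT fun x => cappedPow (N x) (k x) :=
  PT.iterate (f := fun x p => min (2 * p) (N x + 1)) (g := fun _ => 1)
    (B := fun x => 2 * (N x + 1) + 1) hk (by fun_prop) (by fun_prop)
    (by have := hN.pbNat; fun_prop) (fun x i _ => by
      have := cappedPow_eq (N x) i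
      unfold Superlight.cappedPow at this
      rw [this, enc_nat_size]
      omega)

@[fun_prop]
theorem PT.divPow {i k : α → ℕ} (hi : PT i) (hk : PT k) : PT fun x => i x / 2 ^ k x := by
  have : PT fun x => i x / Superlight.cappedPow (i x) (k x) := by fun_prop
  refine this.congr fun x => ?_
  rw [cappedPow_eq]
  rcases Nat.lt_or_ge (2 ^ k x) (i x + 1) with h | h
  · rw [min_eq_left h.le]
  · rw [min_eq_right h, Nat.div_eq_of_lt (by omega), Nat.div_eq_of_lt (by omega)]

@[fun_prop]
theorem PT.testBit {i k : α → ℕ} (hi : PT i) (hk : PT k) : PT fun x => (i x).testBit (k x) := by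
  have : PT fun x => decide (i x / 2 ^ k x % 2 = 1) := by fun_prop
  exact this.congr fun x => Nat.testBit_eq_decide_div_mod_eq

/-- A family of trees that is efficiently computable in the sense of `PolyTime` can be evaluated
along every polynomial-time reparametrization. -/
theorem PT.of_polyTime {ι : Type} {inp out : ι → Data} (h : PolyTime inp out) {f : α → ι}
    (hf : PT fun x => inp (f x)) : PT fun x => out (f x) := by
  obtain ⟨Q, hQ⟩ : ∃ Q : Polynomial ℕ, ∀ x, (inp (f x)).size ≤ Q.eval (enc x).size := hf.pb
  obtain ⟨p, P, hp⟩ := hf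
  obtain ⟨p', P', hp'⟩ := h
  refine ⟨.comp p p', P + P'.comp Q + 1, fun x => ?_⟩
  obtain ⟨t, ht, hr⟩ := hp x
  obtain ⟨t', ht', hr'⟩ := hp' (f x)
  have := poly_mono P' (hQ x)
  refine ⟨_, ?_, .comp hr hr'⟩
  simp only [Polynomial.eval_add, Polynomial.eval_comp, Polynomial.eval_one]
  omega

/-! ### The given algorithms, with coins read from lists -/

/-- The first `k` entries of a list of bits, padded with `false`, as coins. -/
def toCoins (k : ℕ) (l : List Bool) : Coins k := fun i => l.getD i false

theorem Coins.toData_toCoins (k : ℕ) (l : List Bool) :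
    (toCoins k l).toData = enc ((List.range k).map fun i => l.getD i false) := by
  unfold Coins.toData toCoins
  change _ = Data.ofList (((List.range k).map fun i => l.getD i false).map ofBool)
  congr 1
  apply List.ext_getElem <;> simp

theorem toCoins_ofFn {k : ℕ} (ω : Coins k) : toCoins k (List.ofFn ω) = ω := by
  funext i
  simp [toCoins, List.getD_eq_getElem?_getD]

theorem Coins.toData_eq_enc {k : ℕ} (ω : Coins k) : ω.toData = enc (List.ofFn ω) := by
  change Data.ofList _ = Data.ofList ((List.ofFn ω).map ofBool)
  rw [List.map_ofFn]
  rfl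

@[fun_prop]
theorem PT.toCoins {k : α → ℕ} {l : α → List Bool} (hk : PT k) (hl : PT l) :
    PT fun x => (toCoins (k x) (l x)).toData := by
  simp only [Coins.toData_toCoins]
  exact PT.toData (PT.map (f := fun x i => (l x).getD i false) (by fun_prop) (by fun_prop))

/-- The message of an adversary whose coins are read from the beginning of a list of bits. -/
def Adversary.nextL (A : Adversary) (n : ℕ) (l : List Bool) (h : List Data) : Data :=
  A.next n (toCoins _ l) h

/-- The hash key generated with coins from a list of bits. -/
def HashFamily.genL (H : HashFamily) (n : ℕ) (l : List Bool) : Data := H.gen n (toCoins _ l)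

/-- The key pair generated with coins from a list of bits. -/
def SignatureScheme.genL (S : SignatureScheme) (n : ℕ) (l : List Bool) : Data × Data :=
  S.gen n (toCoins _ l)

/-- The evolution of a key with coins from a list of bits. -/
def SignatureScheme.updateL (S : SignatureScheme) (n : ℕ) (key : Data) (l : List Bool) : Data :=
  S.update n key (toCoins _ l)

/-- The signature computed with coins from a list of bits. -/
def SignatureScheme.signL (S : SignatureScheme) (n : ℕ) (key msg : Data) (l : List Bool) : Data :=
  S.sign n key msg (toCoins _ l)

/-- The genesis state computed with coins from a list of bits. -/
def PoSProtocol.genesisL (PoS : PoSProtocol) (n : ℕ) (l : List Bool) (s : Data) (pks : List Data)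
    (move : Data) : Data := PoS.genesis n (toCoins _ l) s pks move

/-- The outcome of a round computed with coins from a list of bits. -/
def PoSProtocol.stepL (PoS : PoSProtocol) (n : ℕ) (l : List Bool) (s : Data) (pks moves : List Data) :
    Data := PoS.step n (toCoins _ l) s pks moves

@[fun_prop]
theorem PT.nextL (A : Adversary) {n : α → ℕ} {l : α → List Bool} {h : α → List Data} (hn : PT n)
    (hl : PT l) (hh : PT h) : PT fun x => A.nextL (n x) (l x) (h x) :=
  PT.of_polyTime A.next_poly (f := fun x => ⟨n x, Superlight.toCoins _ (l x), h x⟩) (by fun_prop)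

@[fun_prop]
theorem PT.hashGenL (H : HashFamily) {n : α → ℕ} {l : α → List Bool} (hn : PT n)
    (hl : PT l) : PT fun x => H.genL (n x) (l x) :=
  PT.of_polyTime H.gen_poly (f := fun x => ⟨n x, Superlight.toCoins _ (l x)⟩) (by fun_prop)

@[fun_prop]
theorem PT.hash (H : HashFamily) {n : α → ℕ} {s d : α → Data} (hn : PT n)
    (hs : PT s) (hd : PT d) : PT fun x => H.hash (n x) (s x) (d x) :=
  PT.of_polyTime H.hash_poly (f := fun x => ⟨n x, s x, d x⟩) (by fun_prop)

@[fun_prop]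
theorem PT.sigGenL (S : SignatureScheme) {n : α → ℕ} {l : α → List Bool} (hn : PT n)
    (hl : PT l) : PT fun x => S.genL (n x) (l x) :=
  (PT.of_polyTime S.gen_poly (f := fun x => ⟨n x, Superlight.toCoins _ (l x)⟩)
    (by fun_prop)).congr_enc fun _ => rfl

@[fun_prop]
theorem PT.updateL (S : SignatureScheme) {n : α → ℕ} {k : α → Data} {l : α → List Bool} (hn : PT n)
    (hk : PT k) (hl : PT l) : PT fun x => S.updateL (n x) (k x) (l x) :=
  PT.of_polyTime S.update_poly (f := fun x => ⟨n x, k x, Superlight.toCoins _ (l x)⟩) (by fun_prop)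

@[fun_prop]
theorem PT.signL (S : SignatureScheme) {n : α → ℕ} {k msg : α → Data} {l : α → List Bool}
    (hn : PT n) (hk : PT k) (hmsg : PT msg) (hl : PT l) :
    PT fun x => S.signL (n x) (k x) (msg x) (l x) :=
  PT.of_polyTime S.sign_poly (f := fun x => ⟨n x, k x, msg x, Superlight.toCoins _ (l x)⟩)
    (by fun_prop)

@[fun_prop]
theorem PT.verify (S : SignatureScheme) {n j : α → ℕ} {k msg sig : α → Data}
    (hn : PT n) (hk : PT k) (hj : PT j) (hmsg : PT msg) (hsig : PT sig) :
    PT fun x => S.verify (n x) (k x) (j x) (msg x) (sig x) :=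
  (PT.of_polyTime S.verify_poly (f := fun x => ⟨n x, k x, j x, msg x, sig x⟩)
    (by fun_prop)).congr_enc fun _ => rfl

@[fun_prop]
theorem PT.foldlδ (X : StateMachine) {st : α → Data} {l : α → List Data} (hst : PT st) (hl : PT l) :
    PT fun x => (l x).foldl X.δ (st x) :=
  PT.of_polyTime X.apply_poly (f := fun x => ⟨st x, l x⟩) (by fun_prop)

@[fun_prop]
theorem PT.commit (X : StateMachine) {n : α → ℕ} {s d : α → Data} (hn : PT n)
    (hs : PT s) (hd : PT d) : PT fun x => X.commit (n x) (s x) (d x) :=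
  PT.of_polyTime X.commit_poly (f := fun x => ⟨n x, s x, d x⟩) (by fun_prop)

@[fun_prop]
theorem PT.committee (X : StateMachine) {st : α → Data} (hst : PT st) :
    PT fun x => X.committee (st x) :=
  PT.of_polyTime X.committee_poly (f := fun x => st x) hst

@[fun_prop]
theorem PT.genesisL (PoS : PoSProtocol) {n : α → ℕ} {l : α → List Bool} {s move : α → Data}
    {pks : α → List Data} (hn : PT n) (hl : PT l) (hs : PT s) (hp : PT pks) (hm : PT move) :
    PT fun x => PoS.genesisL (n x) (l x) (s x) (pks x) (move x) :=
  PT.of_polyTime PoS.genesis_poly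
    (f := fun x => ⟨n x, Superlight.toCoins _ (l x), s x, pks x, move x⟩) (by fun_prop)

@[fun_prop]
theorem PT.stepL (PoS : PoSProtocol) {n : α → ℕ} {l : α → List Bool} {s : α → Data}
    {pks moves : α → List Data} (hn : PT n) (hl : PT l) (hs : PT s) (hp : PT pks) (hm : PT moves) :
    PT fun x => PoS.stepL (n x) (l x) (s x) (pks x) (moves x) :=
  PT.of_polyTime PoS.step_poly
    (f := fun x => ⟨n x, Superlight.toCoins _ (l x), s x, pks x, moves x⟩) (by fun_prop)

/-- An adversary given by a polynomial-time function on lists of coins, with clipped messages. -/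
noncomputable def Adversary.ofPT (coins len : Polynomial ℕ) (g : ℕ → List Bool → List Data → Data)
    (hg : PT fun p : ℕ × List Bool × List Data => g p.1 p.2.1 p.2.2) : Adversary where
  coins := coins
  len := len + 1
  next n ω h := clip (len.eval n) (g n (List.ofFn ω) h)
  next_size n ω h := by
    simp only [Polynomial.eval_add, Polynomial.eval_one]
    exact clip_size_le
  next_poly := by
    -- Only the arrangement of the three arguments in the input differs.
    have h1 : PT fun p : ℕ × List Bool × List Data => clip (len.eval p.1) (g p.1 p.2.1 p.2.2) := by
      fun_prop
    have h2 : PT fun d : Data => Data.cons d.fst (.cons d.snd.fst d.snd.snd.fst) := by fun_prop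
    obtain ⟨p, P, hp⟩ := h1
    obtain ⟨p', P', hp'⟩ := h2
    obtain ⟨Q, hQ⟩ : ∃ Q : Polynomial ℕ, ∀ d : Data,
      (enc (Data.cons d.fst (.cons d.snd.fst d.snd.snd.fst))).size ≤ Q.eval (enc d).size :=
      (show PT fun d : Data => Data.cons d.fst (.cons d.snd.fst d.snd.snd.fst) by fun_prop).pb
    refine ⟨.comp p' p, P' + P.comp Q + 1, fun x => ?_⟩
    obtain ⟨t', ht', hr'⟩ := hp' (Data.ofList [Data.num x.1, x.2.1.toData, Data.ofList x.2.2])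
    obtain ⟨t, ht, hr⟩ := hp (x.1, List.ofFn x.2.1, x.2.2)
    have he : enc (x.1, List.ofFn x.2.1, x.2.2) =
        Data.cons (Data.num x.1) (.cons x.2.1.toData (Data.ofList x.2.2)) := by
      rw [enc_pair, enc_pair, ← Coins.toData_eq_enc, enc_listData]
      rfl
    have hm := poly_mono P (hQ (Data.ofList [Data.num x.1, x.2.1.toData, Data.ofList x.2.2]))
    rw [he] at hr ht
    refine ⟨_, ?_, .comp hr' hr⟩
    simp only [Polynomial.eval_add, Polynomial.eval_comp, Polynomial.eval_one]
    exact Nat.add_le_add_right (Nat.add_le_add ht' (ht.trans hm)) 1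

/-! ### Merkle mountain ranges in polynomial time -/

/-- The hashes at height `k` of the Merkle trees over all intervals of length `2 ^ k` of the list
`Ds` of `N` leaves, by the first index of the interval. Entries that would need leaves beyond the
end are meaningless. -/
def merkleRow (hash : Data → Data) (Ds : List Data) (N k : ℕ) : List Data :=
  (List.range k).foldl (fun row i => (List.range N).map fun o =>
      hash (.cons (row.getD o .nil) (row.getD (o + cappedPow N i) .nil)))
    ((List.range N).map fun o => hash (Ds.getD o .nil))

/-- The value of the node of height `k` with leftmost leaf `o`, read off from the table. A recursive
computation would visit `2 ^ k` leaves, which is efficient only where `2 ^ k ≤ N`. -/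
def merkleNode (hash : Data → Data) (Ds : List Data) (N k o : ℕ) : Data :=
  (merkleRow hash Ds N k).getD o .nil

/-- The capped powers of two in the table do not matter for nodes within the range of the leaves. -/
theorem merkleNode_eq {hash : Data → Data} {Ds : List Data} {D : ℕ → Data} {N : ℕ}
    (hD : ∀ o < N, Ds.getD o .nil = D o) (k o : ℕ) (h : o + 2 ^ k ≤ N) :
    merkleNode hash Ds N k o = merkleRoot hash D k o := by
  induction k generalizing o with
  | zero =>
    have ho : o < N := by simpa using h
    have := hD o ho
    simp only [merkleNode, merkleRow, merkleRoot, List.range_zero, List.foldl_nil,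
      List.getD_eq_getElem?_getD, List.getElem?_map, List.getElem?_range ho] at *
    simp [this]
  | succ k ih =>
    have hp : 2 ^ (k + 1) = 2 ^ k + 2 ^ k := by ring
    have h1 : 1 ≤ 2 ^ k := Nat.one_le_two_pow
    have ho : o < N := by omega
    have hc : cappedPow N k = 2 ^ k := by rw [cappedPow_eq]; omega
    have e1 := ih o (by omega)
    have e2 := ih (o + 2 ^ k) (by omega)
    have hrow : merkleRow hash Ds N (k + 1) = (List.range N).map fun o =>
        hash (.cons ((merkleRow hash Ds N k).getD o .nil)
          ((merkleRow hash Ds N k).getD (o + cappedPow N k) .nil)) := by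
      rw [merkleRow, List.range_succ, List.foldl_append]
      rfl
    unfold merkleNode at *
    rw [hrow, List.getD_eq_getElem?_getD, List.getElem?_map, List.getElem?_range ho, hc, merkleRoot,
      ← e1, ← e2]
    rfl

/-- Merkle proofs, read off from the tables of node values. -/
def merkleProofP (hash : Data → Data) (Ds : List Data) (N h o i : ℕ) : Data :=
  ofList ((List.range h).map fun k =>
    merkleNode hash Ds N k (o + (if i / 2 ^ k % 2 = 0 then i / 2 ^ k + 1 else i / 2 ^ k - 1) *
      cappedPow N k))

/-- The peaks, read off from the tables of node values. -/
def mmrPeaksP (hash : Data → Data) (Ds : List Data) (N : ℕ) : Data :=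
  ofList ((mmrTrees N).map fun t => merkleNode hash Ds N t.1 t.2)

/-- The Merkle proof of leaf `i` in its tree, read off from the tables of node values. -/
def mmrProofP (hash : Data → Data) (Ds : List Data) (N i : ℕ) : Data :=
  merkleProofP hash Ds N (mmrTree N i).1 (mmrTree N i).2 (i - (mmrTree N i).2)

theorem merkleClimb_eq_foldl (hash : Data → Data) (i : ℕ) (v π : Data) (k : ℕ) :
    merkleClimb hash i v π k = (List.range k).foldl (fun acc j =>
      if i.testBit j then hash (.cons (π.nth j) acc) else hash (.cons acc (π.nth j))) (hash v) := by
  induction k with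
  | zero => rfl
  | succ k ih =>
    rw [List.range_succ, List.foldl_append, ← ih]
    rfl

theorem PB.hashSize (H : HashFamily) {n : α → ℕ} (hn : PT n) : PB fun x => H.len.eval (n x) :=
  hn.pbNat.poly _

theorem PT.merkleRow (H : HashFamily) {n N k : α → ℕ} {s : α → Data} {Ds : α → List Data} (hn : PT n)
    (hs : PT s) (hDs : PT Ds) (hN : PT N) (hk : PT k) :
    PT fun x => merkleRow (H.hash (n x) (s x)) (Ds x) (N x) (k x) := by
  have hB : PB fun x => N x * (H.len.eval (n x) + 1) + 1 := by
    have := hN.pbNat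
    have := PB.hashSize H hn
    fun_prop
  refine PT.foldl (f := fun x row i => (List.range (N x)).map fun o =>
      H.hash (n x) (s x) (.cons (row.getD o .nil) (row.getD (o + Superlight.cappedPow (N x) i) .nil)))
    (g := fun x => (List.range (N x)).map fun o => H.hash (n x)
        (s x) ((Ds x).getD o .nil)) (by fun_prop)
    (PT.map (f := fun x o => H.hash (n x) (s x) ((Ds x).getD o .nil)) (by fun_prop) (by fun_prop))
    (PT.map (f := fun (p : α × List Data × ℕ) o => H.hash (n p.1) (s p.1)
      (.cons (p.2.1.getD o .nil) (p.2.1.getD (o + Superlight.cappedPow (N p.1) p.2.2) .nil)))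
      (by fun_prop) (by fun_prop)) hB (fun x l' _ => ?_)
  have key : ∀ g : ℕ → Data, (enc ((List.range (N x)).map fun o => H.hash (n x) (s x) (g o))).size ≤
      N x * (H.len.eval (n x) + 1) + 1 := by
    intro g
    refine (enc_size_le_of_forall (b := H.len.eval (n x)) fun a ha => ?_).trans (by simp)
    obtain ⟨o, _, rfl⟩ := List.mem_map.mp ha
    exact H.hash_size _ _ _
  induction l' using List.reverseRecOn with
  | nil => exact key _
  | append_singleton l' b _ =>
    rw [List.foldl_append]
    exact key _

attribute [fun_prop] PT.merkleRow

@[fun_prop]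
theorem PT.merkleNode (H : HashFamily) {n N k o : α → ℕ} {s : α → Data} {Ds : α → List Data}
    (hn : PT n) (hs : PT s) (hDs : PT Ds) (hN : PT N) (hk : PT k) (ho : PT o) :
    PT fun x => merkleNode (H.hash (n x) (s x)) (Ds x) (N x) (k x) (o x) := by
  unfold Superlight.merkleNode
  fun_prop

@[fun_prop]
theorem PT.merkleProofP (H : HashFamily) {n N h o i : α → ℕ} {s : α → Data} {Ds : α → List Data}
    (hn : PT n) (hs : PT s) (hDs : PT Ds) (hN : PT N) (hh : PT h) (ho : PT o) (hi : PT i) :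
    PT fun x => merkleProofP (H.hash (n x) (s x)) (Ds x) (N x) (h x) (o x) (i x) :=
  (PT.map (f := fun x k => Superlight.merkleNode (H.hash (n x) (s x)) (Ds x) (N x) k
    (o x + (if i x / 2 ^ k % 2 = 0 then i x / 2 ^ k + 1 else i x / 2 ^ k - 1) *
      Superlight.cappedPow (N x) k)) hh.range (by fun_prop)).ofList

@[fun_prop]
theorem PT.mmrTrees {N : α → ℕ} (hN : PT N) : PT fun x => mmrTrees (N x) := by
  have : PT fun x => ((List.range (N x + 1)).reverse.filter fun h => (N x).testBit h).map
      fun h => (h, N x / Superlight.cappedPow (N x) (h + 1) * Superlight.cappedPow (N x) (h + 1)) :=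
    PT.map (f := fun x h => (h, N x / Superlight.cappedPow (N x) (h + 1) *
        Superlight.cappedPow (N x) (h + 1)))
      (PT.filter (f := fun x h => (N x).testBit h) (by fun_prop) (by fun_prop)) (by fun_prop)
  refine this.congr fun x => ?_
  unfold Superlight.mmrTrees
  refine List.map_congr_left fun h _ => ?_
  rw [cappedPow_eq]
  rcases Nat.lt_or_ge (2 ^ (h + 1)) (N x + 1) with h' | h'
  · rw [min_eq_left h'.le]
  · rw [min_eq_right h', Nat.div_eq_of_lt (by omega), Nat.div_eq_of_lt (by omega), zero_mul, zero_mul]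

@[fun_prop]
theorem PT.mmrIndex {N i : α → ℕ} (hN : PT N) (hi : PT i) : PT fun x => mmrIndex (N x) (i x) := by
  unfold Superlight.mmrIndex
  -- The length of an interval that contains `i` beyond its start is compared after capping.
  have : PT fun x => (Superlight.mmrTrees (N x)).findIdx fun t => decide (t.2 ≤ i x) &&
      decide (i x < t.2 + Superlight.cappedPow (i x) t.1) :=
    PT.findIdx (f := fun x (t : ℕ × ℕ) => decide (t.2 ≤ i x) &&
      decide (i x < t.2 + Superlight.cappedPow (i x) t.1)) (by fun_prop) (by fun_prop)
  refine this.congr fun x => ?_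
  congr 1
  funext t
  rw [cappedPow_eq]
  congr 2
  rw [eq_iff_iff]
  omega

@[fun_prop]
theorem PT.mmrTree {N i : α → ℕ} (hN : PT N) (hi : PT i) : PT fun x => mmrTree (N x) (i x) := by
  unfold Superlight.mmrTree
  fun_prop

@[fun_prop]
theorem PT.mmrPeaksP (H : HashFamily) {n N : α → ℕ} {s : α → Data} {Ds : α → List Data}
    (hn : PT n) (hs : PT s) (hDs : PT Ds) (hN : PT N) :
    PT fun x => mmrPeaksP (H.hash (n x) (s x)) (Ds x) (N x) :=
  (PT.map (f := fun x (t : ℕ × ℕ) => Superlight.merkleNode (H.hash (n x) (s x)) (Ds x) (N x) t.1 t.2)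
    (by fun_prop) (by fun_prop)).ofList

@[fun_prop]
theorem PT.mmrProofP (H : HashFamily) {n N i : α → ℕ} {s : α → Data} {Ds : α → List Data}
    (hn : PT n) (hs : PT s) (hDs : PT Ds) (hN : PT N) (hi : PT i) :
    PT fun x => mmrProofP (H.hash (n x) (s x)) (Ds x) (N x) (i x) := by
  unfold Superlight.mmrProofP
  fun_prop

@[fun_prop]
theorem PT.merkleClimb (H : HashFamily) {n i k : α → ℕ} {s v π : α → Data}
    (hn : PT n) (hs : PT s) (hi : PT i) (hv : PT v) (hπ : PT π) (hk : PT k) :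
    PT fun x => merkleClimb (H.hash (n x) (s x)) (i x) (v x) (π x) (k x) := by
  simp only [merkleClimb_eq_foldl]
  refine PT.foldl (f := fun x acc j => if (i x).testBit j = true then
    H.hash (n x) (s x) (.cons ((π x).nth j) acc) else H.hash (n x) (s x) (.cons acc ((π x).nth j)))
    (g := fun x => H.hash (n x) (s x) (v x)) (by fun_prop) (by fun_prop) (by fun_prop)
    (PB.hashSize H hn) (fun x l' _ => ?_)
  induction l' using List.reverseRecOn with
  | nil => exact H.hash_size _ _ _
  | append_singleton l' b _ =>
    rw [List.foldl_append, List.foldl_cons, List.foldl_nil]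
    split_ifs <;> exact H.hash_size _ _ _

@[fun_prop]
theorem PT.mmrVerify (H : HashFamily) {n N i : α → ℕ} {s v π peaks : α → Data}
    (hn : PT n) (hs : PT s) (hN : PT N) (hp : PT peaks) (hi : PT i) (hv : PT v) (hπ : PT π) :
    PT fun x => mmrVerify (H.hash (n x) (s x)) (N x) (peaks x) (i x) (v x) (π x) := by
  unfold Superlight.mmrVerify
  fun_prop

/-! ### Records as data -/

instance : Enc Outcome := ⟨fun o => enc (o.reply, o.ledgers, o.granted, o.nextCommittee)⟩
instance : Enc Round := ⟨fun q => enc (q.move, q.out, q.stateSigs, q.handoverSigs, q.leaks)⟩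
instance : Enc Prover := ⟨fun P => enc (P.id, P.party, P.claim)⟩

theorem PT.outcomeTuple {o : α → Outcome} (ho : PT o) :
    PT fun x => ((o x).reply, (o x).ledgers, (o x).granted, (o x).nextCommittee) :=
  ho.congr_enc fun _ => rfl

theorem PT.roundTuple {q : α → Round} (hq : PT q) : PT fun x =>
    ((q x).move, (q x).out, (q x).stateSigs, (q x).handoverSigs, (q x).leaks) :=
  hq.congr_enc fun _ => rfl

theorem PT.proverTuple {P : α → Prover} (hP : PT P) :
    PT fun x => ((P x).id, (P x).party, (P x).claim) := hP.congr_enc fun _ => rfl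

@[fun_prop] theorem PT.reply {o : α → Outcome} (ho : PT o) : PT fun x => (o x).reply :=
  ho.outcomeTuple.prodFst
@[fun_prop] theorem PT.ledgers {o : α → Outcome} (ho : PT o) : PT fun x => (o x).ledgers :=
  ho.outcomeTuple.prodSnd.prodFst
@[fun_prop] theorem PT.granted {o : α → Outcome} (ho : PT o) : PT fun x => (o x).granted :=
  ho.outcomeTuple.prodSnd.prodSnd.prodFst
@[fun_prop] theorem PT.nextCommittee {o : α → Outcome} (ho : PT o) :
    PT fun x => (o x).nextCommittee := ho.outcomeTuple.prodSnd.prodSnd.prodSnd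
@[fun_prop] theorem PT.roundMove {q : α → Round} (hq : PT q) : PT fun x => (q x).move :=
  hq.roundTuple.prodFst
@[fun_prop] theorem PT.roundOut {q : α → Round} (hq : PT q) : PT fun x => (q x).out :=
  hq.roundTuple.prodSnd.prodFst
@[fun_prop] theorem PT.stateSigs {q : α → Round} (hq : PT q) : PT fun x => (q x).stateSigs :=
  hq.roundTuple.prodSnd.prodSnd.prodFst
@[fun_prop] theorem PT.handoverSigs {q : α → Round} (hq : PT q) : PT fun x => (q x).handoverSigs :=
  hq.roundTuple.prodSnd.prodSnd.prodSnd.prodFst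
@[fun_prop] theorem PT.leaks {q : α → Round} (hq : PT q) : PT fun x => (q x).leaks :=
  hq.roundTuple.prodSnd.prodSnd.prodSnd.prodSnd
@[fun_prop] theorem PT.proverId {P : α → Prover} (hP : PT P) : PT fun x => (P x).id :=
  hP.proverTuple.prodFst
@[fun_prop] theorem PT.proverParty {P : α → Prover} (hP : PT P) : PT fun x => (P x).party :=
  hP.proverTuple.prodSnd.prodFst
@[fun_prop] theorem PT.proverClaim {P : α → Prover} (hP : PT P) : PT fun x => (P x).claim :=
  hP.proverTuple.prodSnd.prodSnd

@[fun_prop]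
theorem PT.outcomeMk {a b c d : α → Data} (ha : PT a) (hb : PT b) (hc : PT c) (hd : PT d) :
    PT fun x => Outcome.mk (a x) (b x) (c x) (d x) :=
  (ha.pair (hb.pair (hc.pair hd))).congr_enc fun _ => rfl

@[fun_prop]
theorem PT.roundMk {a b c d : α → Data} {o : α → Outcome} (ha : PT a) (ho : PT o) (hb : PT b)
    (hc : PT c) (hd : PT d) : PT fun x => Round.mk (a x) (o x) (b x) (c x) (d x) :=
  (ha.pair (ho.pair (hb.pair (hc.pair hd)))).congr_enc fun _ => rfl

@[fun_prop]
theorem PT.proverMk {i : α → ℕ} {p : α → Option ℕ} {c : α → Data} (hi : PT i) (hp : PT p)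
    (hc : PT c) : PT fun x => Prover.mk (i x) (p x) (c x) :=
  (hi.pair (hp.pair hc)).congr_enc fun _ => rfl

@[fun_prop]
theorem PT.outcomeOfData {d : α → Data} (hd : PT d) : PT fun x => Outcome.ofData (d x) := by
  unfold Outcome.ofData
  fun_prop

@[fun_prop]
theorem PT.outcomeToData {o : α → Outcome} (ho : PT o) : PT fun x => (o x).toData := by
  unfold Outcome.toData
  fun_prop

@[fun_prop]
theorem PT.roundMsg {q : α → Round} (hq : PT q) : PT fun x => (q x).msg := by
  unfold Round.msg
  fun_prop

@[fun_prop]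
theorem PT.outcomeLedger {o : α → Outcome} {i : α → ℕ} (ho : PT o) (hi : PT i) :
    PT fun x => (o x).ledger (i x) := by
  unfold Outcome.ledger
  fun_prop

@[fun_prop]
theorem PT.grants {o : α → Outcome} {i : α → ℕ} (ho : PT o) (hi : PT i) :
    PT fun x => (o x).Grants (i x) := by
  have : PT fun x => (o x).granted.toList.any fun d => decide (d.toNat = i x) :=
    PT.any (f := fun x (d : Data) => decide (d.toNat = i x)) (by fun_prop) (by fun_prop)
  refine this.congr fun x => ?_
  unfold Outcome.Grants
  rw [Bool.eq_iff_iff]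
  simp

@[fun_prop]
theorem PT.corrupted {rs : α → List Round} {i : α → ℕ} (hrs : PT rs) (hi : PT i) :
    PT fun x => Env.corrupted (rs x) (i x) :=
  PT.any (f := fun x (q : Round) => q.out.Grants (i x)) hrs (by fun_prop)

@[fun_prop]
theorem PT.outcome {rs : α → List Round} {i : α → ℕ} (hrs : PT rs) (hi : PT i) :
    PT fun x => Env.outcome (rs x) (i x) :=
  (PT.optionMap (f := fun _ (q : Round) => q.out) (hrs.getElem? hi) (by fun_prop)).optionGetD
    (by fun_prop)

@[fun_prop]
theorem PT.ledger {rs : α → List Round} {i j : α → ℕ} (hrs : PT rs) (hi : PT i) (hj : PT j) :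
    PT fun x => Env.ledger (rs x) (i x) (j x) := by
  unfold Env.ledger
  fun_prop

/-! ### The tournament in polynomial time -/

/-- The data on which the tournament depends: security parameter, hash key, coins of the adversary,
round of the tournament, genesis state, and the rounds of the execution so far. -/
structure GCtx where
  n : ℕ
  s : Data
  l : List Bool
  r : ℕ
  st₀ : Data
  rs : List Round

instance : Enc GCtx := ⟨fun c => enc (c.n, c.s, c.l, c.r, c.st₀, c.rs)⟩

theorem PT.ctxTuple {c : α → GCtx} (hc : PT c) :
    PT fun x => ((c x).n, (c x).s, (c x).l, (c x).r, (c x).st₀, (c x).rs) := hc.congr_enc fun _ => rfl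

@[fun_prop]
theorem PT.ctxMk {n r : α → ℕ} {s st : α → Data} {l : α → List Bool} {rs : α → List Round} (hn : PT n)
    (hs : PT s) (hl : PT l) (hr : PT r) (hst : PT st) (hrs : PT rs) :
    PT fun x => GCtx.mk (n x) (s x) (l x) (r x) (st x) (rs x) :=
  (hn.pair (hs.pair (hl.pair (hr.pair (hst.pair hrs))))).congr_enc fun _ => rfl

@[fun_prop] theorem PT.ctxN {c : α → GCtx} (hc : PT c) : PT fun x => (c x).n := hc.ctxTuple.prodFst
@[fun_prop] theorem PT.ctxS {c : α → GCtx} (hc : PT c) : PT fun x => (c x).s :=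
  hc.ctxTuple.prodSnd.prodFst
@[fun_prop] theorem PT.ctxL {c : α → GCtx} (hc : PT c) : PT fun x => (c x).l :=
  hc.ctxTuple.prodSnd.prodSnd.prodFst
@[fun_prop] theorem PT.ctxR {c : α → GCtx} (hc : PT c) : PT fun x => (c x).r :=
  hc.ctxTuple.prodSnd.prodSnd.prodSnd.prodFst
@[fun_prop] theorem PT.ctxSt₀ {c : α → GCtx} (hc : PT c) : PT fun x => (c x).st₀ :=
  hc.ctxTuple.prodSnd.prodSnd.prodSnd.prodSnd.prodFst
@[fun_prop] theorem PT.ctxRs {c : α → GCtx} (hc : PT c) : PT fun x => (c x).rs :=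
  hc.ctxTuple.prodSnd.prodSnd.prodSnd.prodSnd.prodSnd

namespace GCtx

section Defs
variable (H : HashFamily) (S : SignatureScheme) (X : StateMachine) (PoS : PoSProtocol) (A : Adversary)
  (m C : ℕ) (c : GCtx)

/-- The number of leaves of the honest handover tree. -/
def leaves : ℕ := c.r / C + 1

/-- The hash function with the given key. -/
def hash (d : Data) : Data := H.hash c.n c.s d

/-- The strategy of the adversary with the given coins. -/
def strat (h : List Data) : Data := A.nextL c.n c.l h

/-- The honest committee of epoch `j`. -/
def committee (j : ℕ) : Data :=
  if j = 0 then X.committee c.st₀ else (Env.outcome c.rs (j * C - 1)).nextCommittee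

/-- The leaves of the honest handover tree. -/
def committees : List Data := (List.range (c.leaves C)).map (c.committee X C)

/-- The claim of the honest prover run by party `i`. -/
def claim (i : ℕ) : Data :=
  X.commit c.n c.s ((Env.ledger c.rs (c.r / C * C) i).foldl X.δ c.st₀)

/-- For each position of a committee a valid signature among `sigs`, if there is one. -/
def selectSigs (com : Data) (j : ℕ) (msg : Data) (sigs : List Data) : Data :=
  ofList ((List.range m).map fun k => (sigs.find? (S.verify c.n (com.nth k) j msg)).getD .nil)

/-- A node of the honest handover tree. -/
def node (k o : ℕ) : Data := merkleNode (c.hash H) (c.committees X C) (c.leaves C) k o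

/-- The answers of an honest prover, computed from tables of node values. -/
def honest (i : ℕ) : Query → Data
  | .commitment => c.claim X C i
  | .header =>
    ofList [mmrPeaksP (c.hash H) (c.committees X C) (c.leaves C), c.committee X C (c.r / C),
      mmrProofP (c.hash H) (c.committees X C) (c.leaves C) (c.r / C),
      c.selectSigs S m (c.committee X C (c.r / C)) (c.r / C) (stateMsg (c.claim X C i))
        ((c.rs[c.r / C * C]?.map fun q => q.stateSigs.toList).getD [])]
  | .children h o =>
    .cons (c.node H X C (h - 1) o) (c.node H X C (h - 1) (o + cappedPow (c.leaves C) (h - 1)))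
  | .leaf j =>
    if j = 0 then ofList [c.committee X C 0] else
      ofList [c.committee X C j, c.committee X C (j - 1),
        mmrProofP (c.hash H) (c.committees X C) (c.leaves C) (j - 1),
        c.selectSigs S m (c.committee X C (j - 1)) (j - 1) (handoverMsg j (c.committee X C j))
          ((c.rs[j * C - 1]?.map fun q => q.handoverSigs.toList).getD [])]

/-- One query to a prover: its answer and the new list of messages received by the adversary. -/
def ask (id : ℕ) (party : Option ℕ) (q : Query) (s : List Data) : Data × List Data :=
  match party with
  | some i => (c.honest H S X m C i q, s ++ [ofList [num id, q.toData, c.honest H S X m C i q]])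
  | none => (c.strat A (s ++ [ofList [num id, q.toData]]), s ++ [ofList [num id, q.toData]])

/-- More than half of the positions of the committee have valid signatures. -/
def quorum (com : Data) (j : ℕ) (msg sigs : Data) : Bool :=
  decide (m < 2 * (List.range m).countP fun k => S.verify c.n (com.nth k) j msg (sigs.nth k))

/-- The checks at the leaf where the bisection game ends. -/
def checkLeaf (peaks : Data) (j : ℕ) (x a : Data) : Bool :=
  decide (c.hash H (a.nth 0) = x) &&
    if j = 0 then decide (a.nth 0 = X.committee c.st₀)
    else
      mmrVerify (c.hash H) (c.leaves C) peaks (j - 1) (a.nth 1) (a.nth 2) &&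
        c.quorum S m (a.nth 1) (j - 1) (handoverMsg j (a.nth 0)) (a.nth 3)

/-- The checks at the beginning of a step of the tournament. -/
def checkHeader (cl a : Data) : Bool :=
  mmrVerify (c.hash H) (c.leaves C) (a.nth 0) (c.leaves C - 1) (a.nth 1) (a.nth 2) &&
    c.quorum S m (a.nth 1) (c.leaves C - 1) (stateMsg cl) (a.nth 3)

end Defs

/-- State of the bisection game: height, leftmost leaf and the two values of the current node,
messages received by the adversary, and the result once the game is over. -/
structure BisState where
  h : ℕ
  o : ℕ
  x : Data
  y : Data
  msgs : List Data
  res : Option (Bool × Bool)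

instance : Enc BisState := ⟨fun b => enc (b.h, b.o, b.x, b.y, b.msgs, b.res)⟩

section Defs
variable (H : HashFamily) (S : SignatureScheme) (X : StateMachine) (PoS : PoSProtocol) (A : Adversary)
  (m C : ℕ) (c : GCtx)

/-- One step of the bisection game; capping makes the leaf index polynomially bounded. -/
def bisStep (P Q : Prover) (pp pq : Data) (b : BisState) : BisState :=
  if b.res.isSome then b
  else if b.h = 0 then
    let a := c.ask H S X A m C P.id P.party (.leaf b.o) b.msgs
    let a' := c.ask H S X A m C Q.id Q.party (.leaf b.o) a.2
    ⟨0, b.o, .nil, .nil, a'.2,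
      some (c.checkLeaf H S X m C pp b.o b.x a.1, c.checkLeaf H S X m C pq b.o b.y a'.1)⟩
  else
    let a := c.ask H S X A m C P.id P.party (.children b.h b.o) b.msgs
    let a' := c.ask H S X A m C Q.id Q.party (.children b.h b.o) a.2
    let okP := decide (c.hash H (.cons a.1.fst a.1.snd) = b.x)
    let okQ := decide (c.hash H (.cons a'.1.fst a'.1.snd) = b.y)
    if okP && okQ then
      if a.1.fst ≠ a'.1.fst then ⟨b.h - 1, b.o, a.1.fst, a'.1.fst, a'.2, none⟩
      else ⟨b.h - 1, min (b.o + cappedPow (c.leaves C) (b.h - 1)) (c.leaves C), a.1.snd, a'.1.snd,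
        a'.2, none⟩
    else ⟨b.h, b.o, .nil, .nil, a'.2, some (okP, okQ)⟩

/-- The bisection game, as an iteration: a tree of height `h` is left after `h + 1` steps. -/
def bisection (P Q : Prover) (pp pq : Data) (b : BisState) : BisState :=
  (c.bisStep H S X A m C P Q pp pq)^[b.h + 1] b

/-- A step of the tournament, with the survival of the two provers as its result. -/
def playStep (P Q : Prover) (s : List Data) : (Bool × Bool) × List Data :=
  let a := c.ask H S X A m C P.id P.party .header s
  let b := c.ask H S X A m C Q.id Q.party .header a.2
  let okP := c.checkHeader H S m C P.claim a.1
  let okQ := c.checkHeader H S m C Q.claim b.1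
  if okP && okQ then
    match (List.range (mmrTrees (c.leaves C)).length).find?
        (fun d => decide ((a.1.nth 0).nth d ≠ (b.1.nth 0).nth d)) with
    | none => ((false, false), b.2)
    | some d =>
      let t := (mmrTrees (c.leaves C)).getD d (0, 0)
      let w := c.bisection H S X A m C P Q (a.1.nth 0) (b.1.nth 0)
        ⟨t.1, t.2, (a.1.nth 0).nth d, (b.1.nth 0).nth d, b.2, none⟩
      let uv := w.res.getD (false, false)
      ((uv.1 && !uv.2, uv.2 && !uv.1), w.msgs)
  else ((okP, okQ), b.2)

/-- One step of the tournament; the last component is the result once the tournament is over. -/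
def tourStep (z : List Prover × List Data × Option (Option Data)) :
    List Prover × List Data × Option (Option Data) :=
  if z.2.2.isSome then z
  else
    match Env.disagreeing z.1 with
    | [] => (z.1, z.2.1, some (z.1.head?.map Prover.claim))
    | x :: l =>
      let s := z.2.1 ++ [ofList (z.1.map fun P => num P.id)]
      let d := c.strat A s
      let pair := (x :: l).getD (d.size % (l.length + 1)) x
      let w := c.playStep H S X A m C pair.1 pair.2 s
      (z.1.filter fun R => (R.id != pair.1.id || w.1.1) && (R.id != pair.2.id || w.1.2), w.2, none)

/-- The steps of the tournament, as an iteration. -/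
def steps (fuel : ℕ) (ps : List Prover) (s : List Data) : Option Data × List Data :=
  let z := (c.tourStep H S X A m C)^[fuel] (ps, s, none)
  (z.2.2.getD none, z.2.1)

/-- The party that runs the prover described by the adversary; a corrupted or nonexistent one counts
as adversarial. -/
def openingParty (e : Data) : Option ℕ :=
  if e = .nil then none
  else if e.snd.toNat < PoS.parties.eval c.n ∧ Env.corrupted c.rs e.snd.toNat = false then
    some e.snd.toNat
  else none

/-- The provers, with their claims. -/
def opening (d : Data) (s : List Data) : List Prover × List Data :=
  d.toList.foldl (fun z e =>
    let a := c.ask H S X A m C z.1.length (c.openingParty PoS e) .commitment z.2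
    (z.1 ++ [⟨z.1.length, c.openingParty PoS e, a.1⟩], a.2)) ([], s)

/-- The tournament: its provers, the accepted claim, and all messages received by the adversary. -/
def tournament (s : List Data) : (List Prover × Option Data) × List Data :=
  let s' := s ++ [.nil]
  let w := c.opening H S X PoS A m C (c.strat A s') s'
  let z := c.steps H S X A m C w.1.length w.1 w.2
  ((w.1, z.1), z.2)

end Defs
end GCtx

section
variable (H : HashFamily) (S : SignatureScheme) (X : StateMachine) (PoS : PoSProtocol) (A : Adversary)
  (m C : ℕ) {c : α → GCtx}

@[fun_prop]
theorem PT.ctxLeaves (hc : PT c) : PT fun x => (c x).leaves C := by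
  unfold GCtx.leaves
  fun_prop

@[fun_prop]
theorem PT.ctxHash {d : α → Data} (hc : PT c) (hd : PT d) : PT fun x => (c x).hash H (d x) := by
  unfold GCtx.hash
  fun_prop

@[fun_prop]
theorem PT.ctxStrat {h : α → List Data} (hc : PT c) (hh : PT h) : PT fun x => (c x).strat A (h x) := by
  unfold GCtx.strat
  fun_prop

@[fun_prop]
theorem PT.ctxCommittee {j : α → ℕ} (hc : PT c) (hj : PT j) :
    PT fun x => (c x).committee X C (j x) := by
  unfold GCtx.committee
  fun_prop

@[fun_prop]
theorem PT.ctxCommittees (hc : PT c) : PT fun x => (c x).committees X C :=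
  PT.map (f := fun x j => (c x).committee X C j) (by fun_prop) (by fun_prop)

@[fun_prop]
theorem PT.ctxClaim {i : α → ℕ} (hc : PT c) (hi : PT i) : PT fun x => (c x).claim X C (i x) := by
  unfold GCtx.claim
  fun_prop

@[fun_prop]
theorem PT.ctxSelectSigs {com msg : α → Data} {j : α → ℕ} {sigs : α → List Data} (hc : PT c)
    (hcom : PT com) (hj : PT j) (hmsg : PT msg) (hs : PT sigs) :
    PT fun x => (c x).selectSigs S m (com x) (j x) (msg x) (sigs x) :=
  (PT.map (f := fun x k => ((sigs x).find? (S.verify (c x).n ((com x).nth k) (j x) (msg x))).getD .nil)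
    (by fun_prop) (PT.optionGetD (PT.find? (f := fun (p : α × ℕ) sg =>
      S.verify (c p.1).n ((com p.1).nth p.2) (j p.1) (msg p.1) sg) (by fun_prop) (by fun_prop))
      (by fun_prop))).ofList

@[fun_prop]
theorem PT.ctxNode {k o : α → ℕ} (hc : PT c) (hk : PT k) (ho : PT o) :
    PT fun x => (c x).node H X C (k x) (o x) := by
  unfold GCtx.node
  exact PT.merkleNode H (by fun_prop) (by fun_prop) (by fun_prop) (by fun_prop) hk ho

@[fun_prop]
theorem PT.ctxPeaks (hc : PT c) :
    PT fun x => Superlight.mmrPeaksP ((c x).hash H) ((c x).committees X C) ((c x).leaves C) :=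
  PT.mmrPeaksP H (by fun_prop) (by fun_prop) (by fun_prop) (by fun_prop)

@[fun_prop]
theorem PT.ctxProof {i : α → ℕ} (hc : PT c) (hi : PT i) :
    PT fun x => Superlight.mmrProofP ((c x).hash H) ((c x).committees X C) ((c x).leaves C) (i x) :=
  PT.mmrProofP H (by fun_prop) (by fun_prop) (by fun_prop) (by fun_prop) hi

@[fun_prop]
theorem PT.ctxMmrVerify {N i : α → ℕ} {v π peaks : α → Data} (hc : PT c)
    (hN : PT N) (hp : PT peaks) (hi : PT i) (hv : PT v) (hπ : PT π) :
    PT fun x => Superlight.mmrVerify ((c x).hash H) (N x) (peaks x) (i x) (v x) (π x) :=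
  PT.mmrVerify H (by fun_prop) (by fun_prop) hN hp hi hv hπ

@[fun_prop]
theorem PT.honestCommitment {i : α → ℕ} (hc : PT c) (hi : PT i) :
    PT fun x => (c x).honest H S X m C (i x) .commitment := by
  simp only [GCtx.honest]
  fun_prop

theorem PT.sigLists {f : Round → Data} (hf : PT f) {k : α → ℕ} (hc : PT c) (hk : PT k) :
    PT fun x => ((c x).rs[k x]?.map fun q => (f q).toList).getD [] :=
  (PT.optionMap (f := fun _ (q : Round) => (f q).toList) (by fun_prop) (by fun_prop)).optionGetD
    (by fun_prop)

@[fun_prop]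
theorem PT.honestHeader {i : α → ℕ} (hc : PT c) (hi : PT i) :
    PT fun x => (c x).honest H S X m C (i x) .header := by
  simp only [GCtx.honest]
  have := PT.sigLists (f := Round.stateSigs) (by fun_prop) hc
    (show PT fun x => (c x).r / C * C by fun_prop)
  fun_prop

@[fun_prop]
theorem PT.honestChildren {i h o : α → ℕ} (hc : PT c) (hh : PT h) (ho : PT o) :
    PT fun x => (c x).honest H S X m C (i x) (.children (h x) (o x)) := by
  simp only [GCtx.honest]
  fun_prop

@[fun_prop]
theorem PT.honestLeaf {i j : α → ℕ} (hc : PT c) (hj : PT j) :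
    PT fun x => (c x).honest H S X m C (i x) (.leaf (j x)) := by
  simp only [GCtx.honest]
  have := PT.sigLists (f := Round.handoverSigs) (by fun_prop) hc
    (show PT fun x => j x * C - 1 by fun_prop)
  fun_prop

theorem PT.ask {id : α → ℕ} {party : α → Option ℕ} {q : α → Query} {s : α → List Data} (hc : PT c)
    (hid : PT id) (hp : PT party) (hq : PT fun x => (q x).toData) (hs : PT s)
    (hh : PT fun p : α × ℕ => (c p.1).honest H S X m C p.2 (q p.1)) :
    PT fun x => (c x).ask H S X A m C (id x) (party x) (q x) (s x) :=
  PT.optionCases (o := party)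
    (f := fun x => ((c x).strat A (s x ++ [Data.ofList [Data.num (id x), (q x).toData]]),
      s x ++ [Data.ofList [Data.num (id x), (q x).toData]]))
    (g := fun x i => ((c x).honest H S X m C i (q x),
      s x ++ [Data.ofList [Data.num (id x), (q x).toData,
          (c x).honest H S X m C i (q x)]])) hp (by fun_prop)
    (by have : PT fun p : α × ℕ => (q p.1).toData := hq.comp (by fun_prop)
        fun_prop)
    (fun x hx => by simp only [GCtx.ask, hx])
    (fun x i hx => by simp only [GCtx.ask, hx])

@[fun_prop]
theorem PT.askCommitment {id : α → ℕ} {party : α → Option ℕ} {s : α → List Data} (hc : PT c)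
    (hid : PT id) (hp : PT party) (hs : PT s) :
    PT fun x => (c x).ask H S X A m C (id x) (party x) .commitment (s x) :=
  PT.ask H S X A m C hc hid hp (by fun_prop) hs (by fun_prop)

@[fun_prop]
theorem PT.askHeader {id : α → ℕ} {party : α → Option ℕ} {s : α → List Data} (hc : PT c)
    (hid : PT id) (hp : PT party) (hs : PT s) :
    PT fun x => (c x).ask H S X A m C (id x) (party x) .header (s x) :=
  PT.ask H S X A m C hc hid hp (by fun_prop) hs (by fun_prop)

@[fun_prop]
theorem PT.askChildren {id h o : α → ℕ} {party : α → Option ℕ} {s : α → List Data} (hc : PT c)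
    (hid : PT id) (hp : PT party) (hh : PT h) (ho : PT o) (hs : PT s) :
    PT fun x => (c x).ask H S X A m C (id x) (party x) (.children (h x) (o x)) (s x) :=
  PT.ask H S X A m C hc hid hp (by simp only [Query.toData]; fun_prop) hs (by fun_prop)

@[fun_prop]
theorem PT.askLeaf {id j : α → ℕ} {party : α → Option ℕ} {s : α → List Data} (hc : PT c)
    (hid : PT id) (hp : PT party) (hj : PT j) (hs : PT s) :
    PT fun x => (c x).ask H S X A m C (id x) (party x) (.leaf (j x)) (s x) :=
  PT.ask H S X A m C hc hid hp (by simp only [Query.toData]; fun_prop) hs (by fun_prop)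

@[fun_prop]
theorem PT.ctxQuorum {com msg sigs : α → Data} {j : α → ℕ} (hc : PT c)
    (hcom : PT com) (hj : PT j) (hmsg : PT msg) (hs : PT sigs) :
    PT fun x => (c x).quorum S m (com x) (j x) (msg x) (sigs x) :=
  PT.decideLt (by fun_prop) ((PT.const 2).natMul (PT.countP (f := fun x k =>
    S.verify (c x).n ((com x).nth k) (j x) (msg x) ((sigs x).nth k)) (by fun_prop) (by fun_prop)))

@[fun_prop]
theorem PT.checkLeaf {pk y a : α → Data} {j : α → ℕ} (hc : PT c) (hpk : PT pk) (hj : PT j) (hy : PT y)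
    (ha : PT a) : PT fun x => (c x).checkLeaf H S X m C (pk x) (j x) (y x) (a x) := by
  unfold GCtx.checkLeaf
  fun_prop

@[fun_prop]
theorem PT.checkHeader {cl a : α → Data} (hc : PT c) (hcl : PT cl)
    (ha : PT a) : PT fun x => (c x).checkHeader H S m C (cl x) (a x) := by
  unfold GCtx.checkHeader
  fun_prop

open GCtx

theorem PT.bisTuple {b : α → BisState} (hb : PT b) :
    PT fun x => ((b x).h, (b x).o, (b x).x, (b x).y, (b x).msgs, (b x).res) := hb.congr_enc fun _ => rfl
@[fun_prop] theorem PT.bisH {b : α → BisState} (hb : PT b) : PT fun x => (b x).h := hb.bisTuple.prodFst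
@[fun_prop] theorem PT.bisO {b : α → BisState} (hb : PT b) : PT fun x => (b x).o :=
  hb.bisTuple.prodSnd.prodFst
@[fun_prop] theorem PT.bisX {b : α → BisState} (hb : PT b) : PT fun x => (b x).x :=
  hb.bisTuple.prodSnd.prodSnd.prodFst
@[fun_prop] theorem PT.bisY {b : α → BisState} (hb : PT b) : PT fun x => (b x).y :=
  hb.bisTuple.prodSnd.prodSnd.prodSnd.prodFst
@[fun_prop] theorem PT.bisMsgs {b : α → BisState} (hb : PT b) : PT fun x => (b x).msgs :=
  hb.bisTuple.prodSnd.prodSnd.prodSnd.prodSnd.prodFst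
@[fun_prop] theorem PT.bisRes {b : α → BisState} (hb : PT b) : PT fun x => (b x).res :=
  hb.bisTuple.prodSnd.prodSnd.prodSnd.prodSnd.prodSnd

@[fun_prop]
theorem PT.bisMk {h o : α → ℕ} {y z : α → Data} {s : α → List Data} {r : α → Option (Bool × Bool)}
    (hh : PT h) (ho : PT o) (hy : PT y) (hz : PT z) (hs : PT s) (hr : PT r) :
    PT fun x => BisState.mk (h x) (o x) (y x) (z x) (s x) (r x) :=
  (hh.pair (ho.pair (hy.pair (hz.pair (hs.pair hr))))).congr_enc fun _ => rfl

@[fun_prop]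
theorem PT.bisStep {P Q : α → Prover} {pp pq : α → Data} {b : α → BisState} (hc : PT c) (hP : PT P)
    (hQ : PT Q) (hpp : PT pp) (hpq : PT pq) (hb : PT b) :
    PT fun x => (c x).bisStep H S X A m C (P x) (Q x) (pp x) (pq x) (b x) := by
  unfold GCtx.bisStep
  fun_prop

end

namespace GCtx
section
variable (H : HashFamily) (S : SignatureScheme) (X : StateMachine) (PoS : PoSProtocol) (A : Adversary)
  (m C : ℕ)

theorem strat_size (c : GCtx) (h : List Data) : (c.strat A h).size ≤ A.len.eval c.n :=
  A.next_size _ _ _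

theorem n_le_size (c : GCtx) : c.n ≤ (enc c).size := by
  have h : enc c = .cons (enc c.n) (enc (c.s, c.l, c.r, c.st₀, c.rs)) := rfl
  rw [h]
  simp only [Data.size, enc_nat_size]
  omega

theorem enc_snoc_size (s : List Data) (d : Data) :
    (enc (s ++ [d])).size = (enc s).size + d.size + 1 := by
  have h := enc_append_size s [d]
  rw [enc_list_cons d [], enc_list_nil] at h
  simp only [enc_data, Data.size] at h
  omega

/-- A query adds a message of polynomial size, and its answer has polynomial size, whatever messages
the adversary has received before. -/
theorem ask_bound {ι : Type} [Enc ι] {q : ι → Query} (hq : PT fun x => (q x).toData)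
    (hh : PT fun p : (GCtx × ι) × ℕ => p.1.1.honest H S X m C p.2 (q p.1.2)) :
    ∃ W : Polynomial ℕ, ∀ (c : GCtx) id party (x : ι) s,
      (c.ask H S X A m C id party (q x) s).1.size ≤
        W.eval ((enc c).size + id + (enc party).size + (enc x).size) ∧
      (enc (c.ask H S X A m C id party (q x) s).2).size ≤
        (enc s).size + W.eval ((enc c).size + id + (enc party).size + (enc x).size) := by
  obtain ⟨P, hP⟩ := hq.pb
  obtain ⟨P', hP'⟩ := hh.pb
  refine ⟨A.len + P + P'.comp (.X + 2) + 2 * .X + 10, fun c id party x s => ?_⟩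
  have h1 := hP x
  have h2 := poly_mono P (by omega :
    (enc x).size ≤ (enc c).size + id + (enc party).size + (enc x).size)
  have h3 := poly_mono A.len (by have := c.n_le_size; omega :
    c.n ≤ (enc c).size + id + (enc party).size + (enc x).size)
  simp only [Polynomial.eval_add, Polynomial.eval_comp, Polynomial.eval_X, Polynomial.eval_mul,
    Polynomial.eval_ofNat]
  simp only [enc_data] at h1
  cases party with
  | none =>
    have h4 := c.strat_size A (s ++ [ofList [num id, (q x).toData]])
    have h5 := enc_snoc_size s (ofList [num id, (q x).toData])
    have h7 : (ofList [num id, (q x).toData]).size = (num id).size + ((q x).toData.size + 1 + 1) + 1 :=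
      rfl
    have h6 := enc_nat_size id
    change (num id).size = _ at h6
    simp only [ask]
    constructor <;> omega
  | some i =>
    have h4 := hP' ((c, x), i)
    have h4' := poly_mono P' (show (enc ((c, x), i)).size ≤
        (enc c).size + id + (enc (some i)).size + (enc x).size + 2 by
      have : (enc (some i)).size = 1 + (enc i).size + 1 := rfl
      simp only [enc_pair, Data.size]
      omega)
    simp only [enc_data] at h4
    have h5 := enc_snoc_size s (ofList [num id, (q x).toData, c.honest H S X m C i (q x)])
    have h7 : (ofList [num id, (q x).toData, c.honest H S X m C i (q x)]).size = (num id).size +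
      ((q x).toData.size + ((c.honest H S X m C i (q x)).size + 1 + 1) + 1) + 1 := rfl
    have h6 := enc_nat_size id
    change (num id).size = _ at h6
    simp only [ask]
    constructor <;> omega

theorem prover_size (P : Prover) : P.id + (enc P.party).size ≤ (enc P).size := by
  have h : enc P = .cons (enc P.id) (.cons (enc P.party) (enc P.claim)) := rfl
  rw [h]
  simp only [Data.size, enc_nat_size]
  omega

/-- A step of bisection adds only a polynomial amount to all components, and this amount does not
depend on the messages received before: iterations therefore stay polynomially bounded. The cap in
`bisStep` keeps the leaf index below `k` also after the step to a right child. -/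
theorem bisStep_growth : ∃ W : Polynomial ℕ, ∀ (c : GCtx) (P Q : Prover) pp pq (b : BisState) (k : ℕ),
    b.h ≤ k → b.o ≤ k → c.leaves C ≤ k →
    (c.bisStep H S X A m C P Q pp pq b).h ≤ k ∧ (c.bisStep H S X A m C P Q pp pq b).o ≤ k ∧
    (c.bisStep H S X A m C P Q pp pq b).x.size ≤
      b.x.size + W.eval ((enc c).size + (enc P).size + (enc Q).size + k) ∧
    (c.bisStep H S X A m C P Q pp pq b).y.size ≤
      b.y.size + W.eval ((enc c).size + (enc P).size + (enc Q).size + k) ∧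
    (enc (c.bisStep H S X A m C P Q pp pq b).msgs).size ≤
      (enc b.msgs).size + W.eval ((enc c).size + (enc P).size + (enc Q).size + k) := by
  obtain ⟨W₁, h₁⟩ := ask_bound H S X A m C (ι := ℕ × ℕ) (q := fun x => .children x.1 x.2)
    (by simp only [Query.toData]; fun_prop) (by fun_prop)
  obtain ⟨W₂, h₂⟩ := ask_bound H S X A m C (ι := ℕ) (q := fun x => .leaf x)
    (by simp only [Query.toData]; fun_prop) (by fun_prop)
  refine ⟨2 * (W₁.comp (4 * .X + 3) + W₂.comp (4 * .X + 3)) + 1, fun c P Q pp pq b k hh ho hk => ?_⟩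
  simp only [Polynomial.eval_add, Polynomial.eval_comp, Polynomial.eval_X, Polynomial.eval_mul,
    Polynomial.eval_ofNat, Polynomial.eval_one]
  generalize hw : (enc c).size + (enc P).size + (enc Q).size + k = w
  have hP := prover_size P
  have hQ := prover_size Q
  have e1 : (enc (b.h, b.o)).size ≤ 4 * k + 3 := by
    simp only [enc_pair, Data.size, enc_nat_size]; omega
  have e2 : (enc b.o).size ≤ 4 * k + 3 := by
    simp only [enc_nat_size]; omega
  unfold bisStep
  dsimp only
  split_ifs
  · exact ⟨hh, ho, by omega, by omega, by omega⟩
  · have g1 := h₂ c P.id P.party b.o b.msgs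
    have g2 := h₂ c Q.id Q.party b.o (c.ask H S X A m C P.id P.party (.leaf b.o) b.msgs).2
    have l1 := poly_mono W₂ (by omega :
      (enc c).size + P.id + (enc P.party).size + (enc b.o).size ≤ 4 * w + 3)
    have l2 := poly_mono W₂ (by omega :
      (enc c).size + Q.id + (enc Q.party).size + (enc b.o).size ≤ 4 * w + 3)
    simp only [Data.size]
    exact ⟨by omega, ho, by omega, by omega, by omega⟩
  all_goals
    have g1 := h₁ c P.id P.party (b.h, b.o) b.msgs
    have g2 := h₁ c Q.id Q.party (b.h, b.o)
      (c.ask H S X A m C P.id P.party (.children b.h b.o) b.msgs).2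
    have l1 := poly_mono W₁ (by omega :
      (enc c).size + P.id + (enc P.party).size + (enc (b.h, b.o)).size ≤ 4 * w + 3)
    have l2 := poly_mono W₁ (by omega :
      (enc c).size + Q.id + (enc Q.party).size + (enc (b.h, b.o)).size ≤ 4 * w + 3)
    have f1 := (c.ask H S X A m C P.id P.party (.children b.h b.o) b.msgs).1.fst_size_le
    have f2 := (c.ask H S X A m C P.id P.party (.children b.h b.o) b.msgs).1.snd_size_le
    have f3 := (c.ask H S X A m C Q.id Q.party (.children b.h b.o)
      (c.ask H S X A m C P.id P.party (.children b.h b.o) b.msgs).2).1.fst_size_le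
    have f4 := (c.ask H S X A m C Q.id Q.party (.children b.h b.o)
      (c.ask H S X A m C P.id P.party (.children b.h b.o) b.msgs).2).1.snd_size_le
    simp only [Data.size] at g1 g2 ⊢
    refine ⟨by omega, by omega, by omega, by omega, by omega⟩

/-- Sizes after `i` steps of bisection. -/
theorem bisStep_iterate_growth : ∃ W : Polynomial ℕ, ∀ (c : GCtx) (P Q : Prover) pp pq (b : BisState)
    (k i : ℕ), b.h ≤ k → b.o ≤ k → c.leaves C ≤ k →
    let b' := (c.bisStep H S X A m C P Q pp pq)^[i] b
    let w := i * W.eval ((enc c).size + (enc P).size + (enc Q).size + k)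
    b'.h ≤ k ∧ b'.o ≤ k ∧ b'.x.size ≤ b.x.size + w ∧ b'.y.size ≤ b.y.size + w ∧
    (enc b'.msgs).size ≤ (enc b.msgs).size + w := by
  obtain ⟨W, hW⟩ := bisStep_growth H S X A m C
  refine ⟨W, fun c P Q pp pq b k i hh ho hk => ?_⟩
  induction i with
  | zero => simp [hh, ho]
  | succ i ih =>
    obtain ⟨i1, i2, i3, i4, i5⟩ := ih
    have := hW c P Q pp pq _ k i1 i2 hk
    simp only [Function.iterate_succ_apply', add_mul, one_mul] at *
    refine ⟨this.1, this.2.1, by omega, by omega, by omega⟩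

end
end GCtx

section
variable (H : HashFamily) (S : SignatureScheme) (X : StateMachine) (PoS : PoSProtocol) (A : Adversary)
  (m C : ℕ) {c : α → GCtx}
open GCtx

@[fun_prop]
theorem PT.bisection {P Q : α → Prover} {pp pq : α → Data} {b : α → BisState} (hc : PT c) (hP : PT P)
    (hQ : PT Q) (hpp : PT pp) (hpq : PT pq) (hb : PT b) :
    PT fun x => (c x).bisection H S X A m C (P x) (Q x) (pp x) (pq x) (b x) := by
  obtain ⟨W, hW⟩ := bisStep_iterate_growth H S X A m C
  have hk : PB fun x => (b x).h + (b x).o + (c x).leaves C := (show PT _ by fun_prop).pbNat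
  have hw : PB fun x => W.eval ((enc (c x)).size + (enc (P x)).size + (enc (Q x)).size +
      ((b x).h + (b x).o + (c x).leaves C)) := by
    have h1 := hc.pb
    have h2 := hP.pb
    have h3 := hQ.pb
    exact PB.poly (by fun_prop) W
  refine PT.iterate (n := fun x => (b x).h + 1)
    (f := fun x => (c x).bisStep H S X A m C (P x) (Q x) (pp x) (pq x)) (g := b)
    (B := fun x => 4 * ((b x).h + (b x).o + (c x).leaves C) + (enc (b x).x).size + (enc (b x).y).size +
      (enc (b x).msgs).size + 3 * (((b x).h + 1) * W.eval ((enc (c x)).size + (enc (P x)).size +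
        (enc (Q x)).size + ((b x).h + (b x).o + (c x).leaves C))) + 20) (by fun_prop) hb (by fun_prop)
    ?_ (fun x i hi => ?_)
  · have h1 : PB fun x => (b x).h + 1 := (show PT _ by fun_prop).pbNat
    have h2 := (PT.bisX hb).pb
    have h3 := (PT.bisY hb).pb
    have h4 := (PT.bisMsgs hb).pb
    fun_prop
  · have := hW (c x) (P x) (Q x) (pp x) (pq x) (b x) ((b x).h + (b x).o + (c x).leaves C) i
      (by omega) (by omega) (by omega)
    generalize ((c x).bisStep H S X A m C (P x) (Q x) (pp x) (pq x))^[i] (b x) = b' at *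
    have he : enc b' = .cons (enc b'.h) (.cons (enc b'.o) (.cons b'.x (.cons b'.y
      (.cons (enc b'.msgs) (enc b'.res))))) := rfl
    have hr : (enc b'.res).size ≤ 9 := by
      cases b'.res with
      | none => decide
      | some uv => obtain ⟨u, v⟩ := uv; cases u <;> cases v <;> decide
    rw [he]
    simp only [Data.size, enc_nat_size, enc_data] at this ⊢
    generalize W.eval _ = w at *
    have := Nat.mul_le_mul_right w hi
    omega

@[fun_prop]
theorem PT.playStep {P Q : α → Prover} {s : α → List Data} (hc : PT c) (hP : PT P)
    (hQ : PT Q) (hs : PT s) : PT fun x => (c x).playStep H S X A m C (P x) (Q x) (s x) := by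
  have ha : PT fun x => (c x).ask H S X A m C (P x).id (P x).party .header (s x) := by fun_prop
  have hb : PT fun x => (c x).ask H S X A m C (Q x).id (Q x).party .header
    ((c x).ask H S X A m C (P x).id (P x).party .header (s x)).2 := by fun_prop
  unfold GCtx.playStep
  -- Abstract from the two headers.
  generalize hA : (fun x => (c x).ask H S X A m C (P x).id (P x).party .header (s x)) = a at *
  generalize hB : (fun x => (c x).ask H S X A m C (Q x).id (Q x).party .header
    ((c x).ask H S X A m C (P x).id (P x).party .header (s x)).2) = b at *
  simp only [show ∀ x, (c x).ask H S X A m C (P x).id (P x).party .header (s x) = a x from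
    fun x => congrFun hA x] at *
  simp only [show ∀ x, (c x).ask H S X A m C (Q x).id (Q x).party .header (a x).2 = b x from
    fun x => congrFun hB x] at *
  have hd : PT fun x => (List.range (Superlight.mmrTrees ((c x).leaves C)).length).find?
        (fun d => decide (((a x).1.nth 0).nth d ≠ ((b x).1.nth 0).nth d)) :=
    PT.find? (f := fun x d => decide (((a x).1.nth 0).nth d ≠ ((b x).1.nth 0).nth d))
      (by fun_prop) (by fun_prop)
  refine PT.ite (by fun_prop) ?_ (by fun_prop)
  refine PT.optionCases (f := fun x => ((false, false), (b x).2)) (g := fun x d =>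
      let t := (Superlight.mmrTrees ((c x).leaves C)).getD d (0, 0)
      let w := (c x).bisection H S X A m C (P x) (Q x) ((a x).1.nth 0) ((b x).1.nth 0)
        ⟨t.1, t.2, ((a x).1.nth 0).nth d, ((b x).1.nth 0).nth d, (b x).2, none⟩
      let uv := w.res.getD (false, false)
      ((uv.1 && !uv.2, uv.2 && !uv.1), w.msgs)) hd (by fun_prop) (by fun_prop)
    (fun x hx => by simp only [hx]) (fun x d hx => by simp only [hx])

theorem mmrTrees_mem {N : ℕ} {t : ℕ × ℕ} (ht : t ∈ mmrTrees N) : t.2 + 2 ^ t.1 ≤ N := by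
  obtain ⟨h, hh, rfl⟩ := List.mem_map.mp ht
  have hb := (List.mem_filter.mp hh).2
  rw [Nat.testBit_eq_decide_div_mod_eq, decide_eq_true_eq] at hb
  have h1 := Nat.div_add_mod N (2 ^ h)
  have h2 : N / 2 ^ (h + 1) = N / 2 ^ h / 2 := by rw [pow_succ, Nat.div_div_eq_div_mul]
  have h3 := Nat.div_add_mod (N / 2 ^ h) 2
  have h4 : N / 2 ^ (h + 1) * 2 ^ (h + 1) + 2 ^ h = 2 ^ h * (2 * (N / 2 ^ h / 2) + 1) := by
    rw [h2]; ring
  simp only [h4]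
  rw [hb] at h3
  rw [h3]
  omega

theorem mmrTrees_getD_le (N d : ℕ) :
    ((mmrTrees N).getD d (0, 0)).1 ≤ N ∧ ((mmrTrees N).getD d (0, 0)).2 ≤ N := by
  rcases Nat.lt_or_ge d (mmrTrees N).length with h | h
  · rw [List.getD_eq_getElem _ _ h]
    have := mmrTrees_mem (List.getElem_mem h)
    have := Nat.lt_two_pow_self (n := (mmrTrees N)[d].1)
    omega
  · rw [List.getD_eq_default _ _ h]
    simp

/-- A step of the tournament adds a polynomial amount to the messages received by the adversary. -/
theorem GCtx.playStep_growth : ∃ W : Polynomial ℕ, ∀ (c : GCtx) (P Q : Prover) (s : List Data),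
    (enc (c.playStep H S X A m C P Q s).2).size ≤
      (enc s).size + W.eval ((enc c).size + (enc P).size + (enc Q).size) := by
  obtain ⟨W₁, h₁⟩ := ask_bound H S X A m C (ι := Unit) (q := fun _ => .header)
    (by fun_prop) (by fun_prop)
  obtain ⟨W₂, h₂⟩ := bisStep_iterate_growth H S X A m C
  obtain ⟨L, hL⟩ := (show PT fun c : GCtx => c.leaves C by fun_prop).pbNat
  refine ⟨2 * W₁.comp (.X + 1) + (L + 1) * W₂.comp (.X + L), fun c P Q s => ?_⟩
  have hP := prover_size P
  have hQ := prover_size Q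
  simp only [Polynomial.eval_add, Polynomial.eval_comp, Polynomial.eval_X, Polynomial.eval_mul,
    Polynomial.eval_ofNat, Polynomial.eval_one]
  generalize hw : (enc c).size + (enc P).size + (enc Q).size = w
  have g1 := (h₁ c P.id P.party () s).2
  have g2 := (h₁ c Q.id Q.party () (c.ask H S X A m C P.id P.party .header s).2).2
  have hu : (enc ()).size = 1 := rfl
  have l1 := poly_mono W₁ (by omega :
    (enc c).size + P.id + (enc P.party).size + (enc ()).size ≤ w + 1)
  have l2 := poly_mono W₁ (by omega :
    (enc c).size + Q.id + (enc Q.party).size + (enc ()).size ≤ w + 1)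
  unfold playStep
  dsimp only
  split_ifs with c1
  · split
    · dsimp only
      omega
    · rename_i d _
      have ht := mmrTrees_getD_le (c.leaves C) d
      dsimp only
      generalize (mmrTrees (c.leaves C)).getD d (0, 0) = t at *
      unfold bisection
      have g3 := (h₂ c P Q
        (((c.ask H S X A m C P.id P.party .header s).1).nth 0)
        ((c.ask H S X A m C Q.id Q.party .header (c.ask H S X A m C P.id P.party .header s).2).1.nth 0)
        ⟨t.1, t.2, ((c.ask H S X A m C P.id P.party .header s).1.nth 0).nth d,
          ((c.ask H S X A m C Q.id Q.party .header
            (c.ask H S X A m C P.id P.party .header s).2).1.nth 0).nth d,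
          (c.ask H S X A m C Q.id Q.party .header
            (c.ask H S X A m C P.id P.party .header s).2).2, none⟩ (c.leaves C) (t.1 + 1)
          ht.1 ht.2 le_rfl).2.2.2.2
      have l3 : c.leaves C ≤ L.eval w := (hL c).trans (poly_mono _ (by omega))
      have l4 := poly_mono W₂ (by omega :
        (enc c).size + (enc P).size + (enc Q).size + c.leaves C ≤ w + L.eval w)
      have l5 := Nat.mul_le_mul (by omega : t.1 + 1 ≤ L.eval w + 1) l4
      dsimp only at g3 ⊢
      omega
  · dsimp only
    omega

end

theorem mem_of_disagreeing {ps : List Prover} {x : Prover × Prover} (h : x ∈ Env.disagreeing ps) :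
    x.1 ∈ ps ∧ x.2 ∈ ps ∧ x.1.claim ≠ x.2.claim := by
  have h' := List.mem_filter.mp h
  have h2 := List.pair_mem_product.mp h'.1
  exact ⟨h2.1, h2.2, by simpa using h'.2⟩

@[fun_prop]
theorem PT.disagreeing {ps : α → List Prover} (hps : PT ps) :
    PT fun x => Env.disagreeing (ps x) := by
  have h1 : PT fun x => (ps x).product (ps x) :=
    PT.flatMap (f := fun x P => (ps x).map (Prod.mk P)) hps
      (PT.map (f := fun (p : α × Prover) Q => (p.2, Q)) (by fun_prop) (by fun_prop))
  exact PT.filter (f := fun _ (x : Prover × Prover) => decide (x.1.claim ≠ x.2.claim)) h1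
    (by fun_prop)

section
variable (H : HashFamily) (S : SignatureScheme) (X : StateMachine) (PoS : PoSProtocol) (A : Adversary)
  (m C : ℕ) {c : α → GCtx}
open GCtx

theorem ids_size (ps : List Prover) : (ofList (ps.map fun P => num P.id)).size ≤ (enc ps).size := by
  induction ps with
  | nil => exact le_rfl
  | cons P ps ih =>
    have h1 : (num P.id).size = 2 * P.id + 1 := enc_nat_size _
    have h2 : enc P = .cons (enc P.id) (enc (P.party, P.claim)) := rfl
    rw [enc_list_cons, h2]
    simp only [List.map_cons, ofList, Data.size, enc_nat_size] at ih ⊢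
    omega

theorem PT.tourStep {z : α → List Prover × List Data × Option (Option Data)} (hc : PT c) (hz : PT z) :
    PT fun x => (c x).tourStep H S X A m C (z x) := by
  unfold GCtx.tourStep
  refine PT.ite (by fun_prop) hz ?_
  refine PT.listCases (l := fun x => Env.disagreeing (z x).1)
    (f := fun x => ((z x).1, (z x).2.1, Option.some ((z x).1.head?.map Prover.claim)))
    (g := fun x y l =>
      let s := (z x).2.1 ++ [Data.ofList ((z x).1.map fun P => Data.num P.id)]
      let d := (c x).strat A s
      let pair := (y :: l).getD (d.size % (l.length + 1)) y
      let w := (c x).playStep H S X A m C pair.1 pair.2 s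
      ((z x).1.filter fun (R : Prover) => (R.id != pair.1.id || w.1.1) && (R.id != pair.2.id || w.1.2),
        w.2, none)) (by fun_prop) ?_ ?_ (fun x hx => by simp only [hx])
    (fun x y l hx => by simp only [hx])
  · have : PT fun x => (z x).1.head?.map Prover.claim :=
      PT.optionMap (f := fun _ (P : Prover) => P.claim) (by fun_prop) (by fun_prop)
    fun_prop
  · have hs : PT fun p : α × (Prover × Prover) × List (Prover × Prover) =>
        (z p.1).2.1 ++ [Data.ofList ((z p.1).1.map fun P => Data.num P.id)] := by
      have : PT fun p : α × (Prover × Prover) × List (Prover × Prover) =>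
          (z p.1).1.map fun P => Data.num P.id :=
        PT.map (f := fun (_ : α × (Prover × Prover) × List (Prover × Prover)) (P : Prover) =>
          Data.num P.id) (by fun_prop) (by fun_prop)
      fun_prop
    have hpair : PT fun p : α × (Prover × Prover) × List (Prover × Prover) =>
        (p.2.1 :: p.2.2).getD (((c p.1).strat A ((z p.1).2.1 ++
          [Data.ofList ((z p.1).1.map fun P => Data.num P.id)])).size % (p.2.2.length + 1)) p.2.1 := by
      fun_prop
    have hw : PT fun p : α × (Prover × Prover) × List (Prover × Prover) =>
        (c p.1).playStep H S X A m C
          ((p.2.1 :: p.2.2).getD (((c p.1).strat A ((z p.1).2.1 ++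
          [Data.ofList ((z p.1).1.map fun P => Data.num P.id)])).size % (p.2.2.length + 1)) p.2.1).1
          ((p.2.1 :: p.2.2).getD (((c p.1).strat A ((z p.1).2.1 ++
          [Data.ofList ((z p.1).1.map fun P => Data.num P.id)])).size % (p.2.2.length + 1)) p.2.1).2
          ((z p.1).2.1 ++ [Data.ofList ((z p.1).1.map fun P => Data.num P.id)]) := by
      fun_prop
    refine PT.pair (PT.filter (f := fun (p : α × (Prover × Prover) × List (Prover × Prover))
        (R : Prover) =>
      let s := (z p.1).2.1 ++ [Data.ofList ((z p.1).1.map fun P => Data.num P.id)]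
      let d := (c p.1).strat A s
      let pair := (p.2.1 :: p.2.2).getD (d.size % (p.2.2.length + 1)) p.2.1
      let w := (c p.1).playStep H S X A m C pair.1 pair.2 s
      (R.id != pair.1.id || w.1.1) && (R.id != pair.2.id || w.1.2)) (by fun_prop) ?_) (by fun_prop)
    have hw' := hw.comp
      (f := fun q : (α × (Prover × Prover) × List (Prover × Prover)) × Prover => q.1) (by fun_prop)
    have hp' := hpair.comp
      (f := fun q : (α × (Prover × Prover) × List (Prover × Prover)) × Prover => q.1) (by fun_prop)
    refine PT.and (PT.or ?_ hw'.prodFst.prodFst) (PT.or ?_ hw'.prodFst.prodSnd)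
    · exact (PT.decideEq (PT.proverId PT.id.prodSnd) (PT.proverId hp'.prodFst)).not.congr
        fun q => by rfl
    · exact (PT.decideEq (PT.proverId PT.id.prodSnd) (PT.proverId hp'.prodSnd)).not.congr
        fun q => by rfl

attribute [fun_prop] PT.tourStep

/-- Steps only remove provers, so that all bounds can be given in terms of the initial provers `ps`.
-/
theorem GCtx.tourStep_growth : ∃ W : Polynomial ℕ, ∀ (c : GCtx) (ps : List Prover)
    (z : List Prover × List Data × Option (Option Data)), z.1.Sublist ps →
    (c.tourStep H S X A m C z).1.Sublist ps ∧
    (enc (c.tourStep H S X A m C z).2.1).size ≤ (enc z.2.1).size + W.eval ((enc c).size + (enc ps).size) ∧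
    (enc (c.tourStep H S X A m C z).2.2).size ≤ (enc z.2.2).size + (enc ps).size + 5 := by
  obtain ⟨W, hW⟩ := playStep_growth H S X A m C
  refine ⟨.X + 1 + W.comp (2 * .X), fun c ps z hz => ?_⟩
  simp only [Polynomial.eval_add, Polynomial.eval_comp, Polynomial.eval_X, Polynomial.eval_mul,
    Polynomial.eval_ofNat, Polynomial.eval_one]
  unfold GCtx.tourStep
  split_ifs with h
  · exact ⟨hz, by omega, by omega⟩
  · split
    · refine ⟨hz, by dsimp only; omega, ?_⟩
      have : (enc (z.1.head?.map Prover.claim)).size ≤ (enc ps).size + 3 := by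
        cases hh : z.1.head? with
        | none => exact Nat.le_add_left 1 ((enc ps).size + 2)
        | some P =>
          have h1 := enc_mem_size (hz.subset (List.mem_of_head? hh))
          have h2 : enc P = .cons (enc P.id) (.cons (enc P.party) P.claim) := rfl
          have h3 : enc ((some P).map Prover.claim) = .cons .nil P.claim := rfl
          rw [h3]
          rw [h2] at h1
          simp only [Data.size] at h1 ⊢
          omega
      have h3 : enc (some (z.1.head?.map Prover.claim)) =
        .cons .nil (enc (z.1.head?.map Prover.claim)) := rfl
      dsimp only
      rw [h3]
      simp only [Data.size]
      omega
    · rename_i x l hd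
      dsimp only
      generalize hpair : (x :: l).getD _ x = pair
      have hmem : pair ∈ Env.disagreeing z.1 := by
        rw [hd, ← hpair]
        rw [List.getD_eq_getElem?_getD]
        generalize (_ % _ : ℕ) = i
        cases h : (x :: l)[i]? with
        | none => simp
        | some y => exact List.mem_of_getElem? h
      obtain ⟨m1, m2, -⟩ := mem_of_disagreeing hmem
      refine ⟨List.filter_sublist.trans hz, ?_, ?_⟩
      · have g := hW c pair.1 pair.2 (z.2.1 ++ [ofList (z.1.map fun P => num P.id)])
        have g1 := enc_mem_size (hz.subset m1)
        have g2 := enc_mem_size (hz.subset m2)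
        have g3 := poly_mono W (by omega : (enc c).size + (enc pair.1).size + (enc pair.2).size ≤
          2 * ((enc c).size + (enc ps).size))
        have g4 := ids_size z.1
        have g5 := enc_sublist_size hz
        have g6 := enc_snoc_size z.2.1 (ofList (z.1.map fun P => num P.id))
        omega
      · change 1 ≤ _
        omega

@[fun_prop]
theorem PT.steps {fuel : α → ℕ} {ps : α → List Prover} {s : α → List Data} (hc : PT c)
    (hf : PT fuel) (hps : PT ps) (hs : PT s) :
    PT fun x => (c x).steps H S X A m C (fuel x) (ps x) (s x) := by
  obtain ⟨W, hW⟩ := GCtx.tourStep_growth H S X A m C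
  have hw : PB fun x => W.eval ((enc (c x)).size + (enc (ps x)).size) := by
    have h1 := hc.pb
    have h2 := hps.pb
    exact PB.poly (by fun_prop) W
  have hz : PT fun x => ((c x).tourStep H S X A m C)^[fuel x] (ps x, s x, none) := by
    refine PT.iterate (n := fuel) (f := fun x => (c x).tourStep H S X A m C)
      (g := fun x => (ps x, s x, none))
      (B := fun x => (enc (ps x)).size + ((enc (s x)).size + fuel x *
        W.eval ((enc (c x)).size + (enc (ps x)).size)) + (1 + fuel x * ((enc (ps x)).size + 5)) + 2)
      hf (by fun_prop) (by fun_prop) ?_ (fun x i hi => ?_)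
    · have h1 := hf.pbNat
      have h2 := hps.pb
      have h3 := hs.pb
      fun_prop
    · have key : (((c x).tourStep H S X A m C)^[i] (ps x, s x, none)).1.Sublist (ps x) ∧
          (enc (((c x).tourStep H S X A m C)^[i] (ps x, s x, none)).2.1).size ≤ (enc (s x)).size +
            i * W.eval ((enc (c x)).size + (enc (ps x)).size) ∧
          (enc (((c x).tourStep H S X A m C)^[i] (ps x, s x, none)).2.2).size ≤
            1 + i * ((enc (ps x)).size + 5) := by
        clear hi
        induction i with
        | zero => exact ⟨List.Sublist.refl _, by simp, by rw [Nat.zero_mul]; exact le_rfl⟩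
        | succ i ih =>
          have := hW (c x) (ps x) _ ih.1
          rw [Function.iterate_succ_apply', add_mul, add_mul]
          exact ⟨this.1, by omega, by omega⟩
      generalize ((c x).tourStep H S X A m C)^[i] (ps x, s x, none) = z at *
      obtain ⟨k1, k2, k3⟩ := key
      have e : enc z = .cons (enc z.1) (.cons (enc z.2.1) (enc z.2.2)) := rfl
      have k4 := enc_sublist_size k1
      rw [e]
      simp only [Data.size]
      have k5 := Nat.mul_le_mul_right (W.eval ((enc (c x)).size + (enc (ps x)).size)) hi
      have k6 := Nat.mul_le_mul_right ((enc (ps x)).size + 5) hi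
      omega
  unfold GCtx.steps
  fun_prop

@[fun_prop]
theorem PT.openingParty {e : α → Data} (hc : PT c) (he : PT e) :
    PT fun x => (c x).openingParty PoS (e x) := by
  unfold GCtx.openingParty
  fun_prop

theorem GCtx.openingParty_size (c : GCtx) (e : Data) :
    (enc (c.openingParty PoS e)).size ≤ 2 * (PoS.parties.eval c.n) + 3 := by
  unfold GCtx.openingParty
  split_ifs with h1 h2
  · change 1 ≤ _; omega
  · have : (enc (some e.snd.toNat)).size = 1 + (enc e.snd.toNat).size + 1 := rfl
    rw [this, enc_nat_size]
    omega
  · change 1 ≤ _; omega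

@[fun_prop]
theorem PT.opening {d : α → Data} {s : α → List Data} (hc : PT c) (hd : PT d) (hs : PT s) :
    PT fun x => (c x).opening H S X PoS A m C (d x) (s x) := by
  obtain ⟨W, hW⟩ := ask_bound H S X A m C (ι := Unit) (q := fun _ => .commitment)
    (by fun_prop) (by fun_prop)
  have hK : PB fun x => PoS.parties.eval (c x).n := (show PT _ by fun_prop).pbNat
  have hlen : PB fun x => (d x).toList.length := (show PT _ by fun_prop).pbNat
  let w : α → ℕ := fun x => W.eval ((enc (c x)).size + (d x).toList.length +
    (2 * PoS.parties.eval (c x).n + 3) + 1)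
  have hw : PB w := by
    have h1 := hc.pb
    exact PB.poly (by fun_prop) W
  refine PT.foldl (l := fun x => (d x).toList) (f := fun x (z : List Prover × List Data) e =>
    let a := (c x).ask H S X A m C z.1.length ((c x).openingParty PoS e) .commitment z.2
    (z.1 ++ [⟨z.1.length, (c x).openingParty PoS e, a.1⟩], a.2)) (g := fun x => ([], s x))
    (B := fun x => ((d x).toList.length * (2 * (d x).toList.length + 1 +
      (2 * PoS.parties.eval (c x).n + 3) + w x + 3) + 1) +
      ((enc (s x)).size + (d x).toList.length * w x) + 1)
    (by fun_prop) (by fun_prop) (by fun_prop) ?_ (fun x l' hl' => ?_)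
  · have h3 := hs.pb
    fun_prop
  · have hl := hl'.length_le
    have key : ∀ l' : List Data, l'.length ≤ (d x).toList.length →
        let z := l'.foldl (fun (z : List Prover × List Data) e =>
          let a := (c x).ask H S X A m C z.1.length ((c x).openingParty PoS e) .commitment z.2
          (z.1 ++ [⟨z.1.length, (c x).openingParty PoS e, a.1⟩], a.2)) ([], s x)
        z.1.length = l'.length ∧
        (enc z.1).size ≤ l'.length * (2 * (d x).toList.length + 1 +
          (2 * PoS.parties.eval (c x).n + 3) + w x + 3) + 1 ∧
        (enc z.2).size ≤ (enc (s x)).size + l'.length * w x := by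
      intro l' hl
      induction l' using List.reverseRecOn with
      | nil => refine ⟨rfl, ?_, ?_⟩ <;> simp [enc_list_nil, Data.size]
      | append_singleton l' e ih =>
        rw [List.length_append, List.length_singleton] at hl
        obtain ⟨i1, i2, i3⟩ := ih (by omega)
        simp only [List.foldl_append, List.foldl_cons, List.foldl_nil]
        generalize l'.foldl _ ([], s x) = z at *
        have g1 := (c x).openingParty_size PoS e
        have g2 := hW (c x) z.1.length ((c x).openingParty PoS e) () z.2
        have g3 : W.eval ((enc (c x)).size + z.1.length +
            (enc ((c x).openingParty PoS e)).size + (enc ()).size) ≤ w x :=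
          poly_mono W (Nat.add_le_add_right (Nat.add_le_add (by omega :
              (enc (c x)).size + z.1.length ≤ (enc (c x)).size + (d x).toList.length) g1) 1)
        have g4 := enc_append_size z.1 [⟨z.1.length, (c x).openingParty PoS e,
          ((c x).ask H S X A m C z.1.length ((c x).openingParty PoS e) .commitment z.2).1⟩]
        have g5 : ∀ (i : ℕ) (p : Option ℕ) (cl : Data), (enc [Prover.mk i p cl]).size =
          2 * i + 1 + ((enc p).size + cl.size + 1) + 1 + 1 + 1 := by
          intro i p cl
          have e1 : enc [Prover.mk i p cl] =
            .cons (.cons (enc i) (.cons (enc p) cl)) .nil := rfl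
          rw [e1]
          simp only [Data.size, enc_nat_size]
        rw [g5] at g4
        simp only [List.length_append, List.length_singleton, add_mul, one_mul] at *
        generalize l'.length * _ = u1 at *
        refine ⟨by omega, by omega, by omega⟩
    obtain ⟨-, k2, k3⟩ := key l' hl
    rw [← Prod.mk.eta (p := l'.foldl _ _), enc_pair]
    simp only [Data.size]
    refine Nat.add_le_add_right (Nat.add_le_add (k2.trans ?_) (k3.trans ?_)) 1
    · exact Nat.add_le_add_right (Nat.mul_le_mul_right _ hl) 1
    · exact Nat.add_le_add_left (Nat.mul_le_mul_right _ hl) _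

@[fun_prop]
theorem PT.tournament {s : α → List Data} (hc : PT c) (hs : PT s) :
    PT fun x => (c x).tournament H S X PoS A m C (s x) := by
  unfold GCtx.tournament
  fun_prop

end

/-! ### Merkle mountain ranges -/

/-- The trees of a Merkle mountain range cover all leaves. -/
theorem mmrTrees_exists {N i : ℕ} (hi : i < N) :
    ∃ t ∈ mmrTrees N, t.2 ≤ i ∧ i < t.2 + 2 ^ t.1 := by
  have hex : ∃ h, i / 2 ^ (h + 1) = N / 2 ^ (h + 1) := by
    refine ⟨N, ?_⟩
    have h1 : N < 2 ^ (N + 1) := N.lt_two_pow_self.trans (Nat.pow_lt_pow_right (by omega) (by omega))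
    rw [Nat.div_eq_of_lt h1, Nat.div_eq_of_lt (hi.trans h1)]
  -- the position of the first binary digit in which `i` and `N` differ
  obtain ⟨h, hh, hmin⟩ : ∃ h, i / 2 ^ (h + 1) = N / 2 ^ (h + 1) ∧ i / 2 ^ h ≠ N / 2 ^ h := by
    refine ⟨Nat.find hex, Nat.find_spec hex, ?_⟩
    cases hf : Nat.find hex with
    | zero => simpa using hi.ne
    | succ k => exact Nat.find_min hex (by omega : k < Nat.find hex)
  have hp : 2 ^ (h + 1) = 2 ^ h * 2 := pow_succ 2 h
  rw [hp, ← Nat.div_div_eq_div_mul, ← Nat.div_div_eq_div_mul] at hh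
  have hle : i / 2 ^ h ≤ N / 2 ^ h := Nat.div_le_div_right hi.le
  have hpos : 0 < 2 ^ h := Nat.two_pow_pos h
  have e1 : i / 2 ^ h = 2 * (N / 2 ^ h / 2) := by omega
  have e2 : N / 2 ^ h = 2 * (N / 2 ^ h / 2) + 1 := by omega
  have ho : N / 2 ^ (h + 1) * 2 ^ (h + 1) = i / 2 ^ h * 2 ^ h := by
    rw [hp, ← Nat.div_div_eq_div_mul, e1]
    ring_nf
  have hN : h < N + 1 := by
    have : 2 ^ h ≤ N := by
      by_contra hc
      rw [Nat.div_eq_of_lt (not_le.mp hc)] at e2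
      omega
    exact (Nat.lt_two_pow_self.trans_le this).trans (Nat.lt_succ_self N)
  refine ⟨(h, N / 2 ^ (h + 1) * 2 ^ (h + 1)), ?_, ?_⟩
  · refine List.mem_map.mpr ⟨h, ?_, rfl⟩
    simp only [List.mem_filter, List.mem_reverse, List.mem_range, hN, true_and,
      Nat.testBit_eq_decide_div_mod_eq, decide_eq_true_eq]
    omega
  · dsimp only
    rw [ho]
    have := Nat.div_add_mod i (2 ^ h)
    have h3 := Nat.mod_lt i hpos
    rw [mul_comm] at this
    omega

theorem mmrIndex_lt {N i : ℕ} (hi : i < N) : mmrIndex N i < (mmrTrees N).length := by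
  obtain ⟨t, ht, h1, h2⟩ := mmrTrees_exists hi
  exact List.findIdx_lt_length_of_exists ⟨t, ht, by simp [h1, h2]⟩

theorem mmrTree_mem {N i : ℕ} (hi : i < N) : mmrTree N i ∈ mmrTrees N := by
  unfold mmrTree
  rw [List.getD_eq_getElem _ _ (mmrIndex_lt hi)]
  exact List.getElem_mem _

theorem mmrTree_spec {N i : ℕ} (hi : i < N) :
    (mmrTree N i).2 ≤ i ∧ i < (mmrTree N i).2 + 2 ^ (mmrTree N i).1 := by
  unfold mmrTree
  rw [List.getD_eq_getElem _ _ (mmrIndex_lt hi)]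
  have := List.findIdx_getElem (w := mmrIndex_lt hi)
  rw [Bool.and_eq_true, decide_eq_true_eq, decide_eq_true_eq] at this
  exact this

/-- The sibling of a node, in terms of arithmetic operations that are available as programs. -/
theorem sibling_eq (a : ℕ) : a ^^^ 1 = if a % 2 = 0 then a + 1 else a - 1 := by
  rcases Nat.even_or_odd' a with ⟨b, rfl | rfl⟩
  · simp
  · have h := Nat.xor_assoc (2 * b) 1 1
    have h1 : 2 * b ^^^ 1 = 2 * b + 1 := by simp
    rw [h1] at h
    rw [if_neg (by omega), h]
    simp

theorem sibling_lt {h k i : ℕ} (hk : k < h) (hi : i < 2 ^ h) :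
    ((i / 2 ^ k) ^^^ 1) * 2 ^ k + 2 ^ k ≤ 2 ^ h := by
  obtain ⟨d, rfl⟩ := Nat.exists_eq_add_of_lt hk
  have e : 2 ^ (k + d + 1) = 2 ^ (d + 1) * 2 ^ k := by ring
  have h1 : i / 2 ^ k < 2 ^ (d + 1) := by
    rw [Nat.div_lt_iff_lt_mul (Nat.two_pow_pos k), ← e]
    exact hi
  have h2 : (i / 2 ^ k) ^^^ 1 < 2 ^ (d + 1) := Nat.xor_lt_two_pow h1 (Nat.one_lt_two_pow (by omega))
  rw [e, ← Nat.succ_mul]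
  exact Nat.mul_le_mul_right _ h2

theorem mmrPeaksP_eq {hash : Data → Data} {Ds : List Data} {D : ℕ → Data} {N : ℕ}
    (hD : ∀ o < N, Ds.getD o .nil = D o) : mmrPeaksP hash Ds N = mmrPeaks hash D N := by
  unfold mmrPeaksP mmrPeaks
  congr 1
  exact List.map_congr_left fun t ht => merkleNode_eq hD _ _ (mmrTrees_mem ht)

theorem mmrProofP_eq {hash : Data → Data} {Ds : List Data} {D : ℕ → Data} {N i : ℕ}
    (hD : ∀ o < N, Ds.getD o .nil = D o) (hi : i < N) :
    mmrProofP hash Ds N i = mmrProof hash D N i := by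
  unfold mmrProofP mmrProof merkleProofP merkleProof
  congr 1
  refine List.map_congr_left fun k hk => ?_
  have h1 := mmrTrees_mem (mmrTree_mem hi)
  have h2 := mmrTree_spec hi
  have h3 := sibling_lt (List.mem_range.mp hk) (by omega : i - (mmrTree N i).2 < 2 ^ (mmrTree N i).1)
  have h4 : 2 ^ k ≤ N := by omega
  rw [← sibling_eq, cappedPow_eq, min_eq_left (by omega), merkleNode_eq hD _ _ (by omega)]

namespace Env

variable (E : Env) (strat : List Data → Data) (honest : ℕ → Query → Data) (S₀ : Data) (N : ℕ)
  (P Q : Prover) (pp pq : Data)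

theorem Game.run_bind {α β : Type} (x : Game α) (f : α → Game β) (s : List Data) :
    (x >>= f).run s = (f (x.run s).1).run (x.run s).2 := rfl

theorem Game.run_ite {α : Type} (p : Prop) [Decidable p] (x y : Game α) (s : List Data) :
    (if p then x else y).run s = if p then x.run s else y.run s := by
  split_ifs <;> rfl

theorem ask_some (id i : ℕ) (q : Query) (s : List Data) :
    (ask strat honest id (some i) q).run s =
      (honest i q, s ++ [ofList [num id, q.toData, honest i q]]) := rfl

theorem bisection_zero (j : ℕ) (x y : Data) (s : List Data) :
    (E.bisection strat honest S₀ N P Q pp pq 0 j x y).run s =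
      let a := (ask strat honest P.id P.party (.leaf j)).run s
      let b := (ask strat honest Q.id Q.party (.leaf j)).run a.2
      ((E.checkLeaf S₀ N pp j x a.1, E.checkLeaf S₀ N pq j y b.1), b.2) := rfl

theorem bisection_succ (h o : ℕ) (x y : Data) (s : List Data) :
    (E.bisection strat honest S₀ N P Q pp pq (h + 1) o x y).run s =
      let a := (ask strat honest P.id P.party (.children (h + 1) o)).run s
      let b := (ask strat honest Q.id Q.party (.children (h + 1) o)).run a.2
      let okP := decide (E.hash (.cons a.1.fst a.1.snd) = x)
      let okQ := decide (E.hash (.cons b.1.fst b.1.snd) = y)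
      if okP && okQ then
        if a.1.fst ≠ b.1.fst then
          (E.bisection strat honest S₀ N P Q pp pq h o a.1.fst b.1.fst).run b.2
        else (E.bisection strat honest S₀ N P Q pp pq h (o + 2 ^ h) a.1.snd b.1.snd).run b.2
      else ((okP, okQ), b.2) := by
  simp only [bisection, Game.run_bind, Game.run_ite]
  rfl

theorem playStep_run (s : List Data) :
    (E.playStep strat honest S₀ N P Q).run s =
      let a := (ask strat honest P.id P.party .header).run s
      let b := (ask strat honest Q.id Q.party .header).run a.2
      let okP := E.checkHeader N P.claim a.1
      let okQ := E.checkHeader N Q.claim b.1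
      if okP && okQ then
        match (List.range (mmrTrees N).length).find?
            (fun d => decide ((a.1.nth 0).nth d ≠ (b.1.nth 0).nth d)) with
        | none => ((false, false), b.2)
        | some d =>
          let t := (mmrTrees N).getD d (0, 0)
          let w := (E.bisection strat honest S₀ N P Q (a.1.nth 0) (b.1.nth 0) t.1 t.2
            ((a.1.nth 0).nth d) ((b.1.nth 0).nth d)).run b.2
          ((w.1.1 && !w.1.2, w.1.2 && !w.1.1), w.2)
      else ((okP, okQ), b.2) := by
  simp only [playStep, Game.run_bind, Game.run_ite]
  split_ifs
  · split <;> rfl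
  · rfl

theorem steps_succ (fuel : ℕ) (ps : List Prover) (s : List Data) :
    (E.steps strat honest S₀ N (fuel + 1) ps).run s =
      match disagreeing ps with
      | [] => (ps.head?.map Prover.claim, s)
      | x :: l =>
        let s' := s ++ [ofList (ps.map fun P => num P.id)]
        let d := strat s'
        let pair := (x :: l).getD (d.size % (l.length + 1)) x
        let w := (E.playStep strat honest S₀ N pair.1 pair.2).run s'
        (E.steps strat honest S₀ N fuel
          (ps.filter fun R => (R.id != pair.1.id || w.1.1) && (R.id != pair.2.id || w.1.2))).run
            w.2 := by
  rw [steps]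
  split <;> rfl

/-- The opening of the tournament. -/
def opening (rs : List Round) (d : Data) (s : List Data) : List Prover × List Data :=
  d.toList.foldl (fun z e =>
    let a := (ask strat honest z.1.length (E.openingParty rs e) .commitment).run z.2
    (z.1 ++ [⟨z.1.length, E.openingParty rs e, a.1⟩], a.2)) ([], s)

/-- The monadic opening of the tournament is a left fold; the number of a prover is the number of
its predecessors. -/
theorem opening_eq (rs : List Round) (d : Data) (s : List Data) :
    (d.toList.zipIdx.mapM (m := Game) fun x => do
      let party := E.openingParty rs x.1
      let c ← ask strat honest x.2 party .commitment
      pure ({ id := x.2, party := party, claim := c } : Prover)).run s =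
      E.opening strat honest rs d s := by
  have key : ∀ (l : List Data) (ps : List Prover) (s : List Data),
      l.foldl (fun z e =>
        let a := (ask strat honest z.1.length (E.openingParty rs e) .commitment).run z.2
        (z.1 ++ [⟨z.1.length, E.openingParty rs e, a.1⟩], a.2)) (ps, s) =
      let w := ((l.zipIdx ps.length).mapM (m := Game) fun x => do
        let party := E.openingParty rs x.1
        let c ← ask strat honest x.2 party .commitment
        pure ({ id := x.2, party := party, claim := c } : Prover)).run s
      (ps ++ w.1, w.2) := by
    intro l
    induction l with
    | nil => exact fun ps s => Prod.ext (List.append_nil _).symm rfl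
    | cons e l ih =>
      intro ps s
      rw [List.foldl_cons, ih, List.zipIdx_cons, List.mapM_cons]
      simp only [Game.run_bind, List.length_append, List.length_singleton]
      refine Prod.ext ?_ rfl
      exact List.append_assoc _ _ _
  have := key d.toList [] s
  exact this.symm

theorem tournamentGame_run (rs : List Round) (r : ℕ) (s : List Data) :
    (E.tournamentGame strat rs r).run s =
      let s' := s ++ [.nil]
      let w := E.opening strat (E.honestAnswer strat rs r) rs (strat s') s'
      let z := (E.steps strat (E.honestAnswer strat rs r) (E.committeeOf (E.st₀ strat)) (r / E.C + 1)
        w.1.length w.1).run w.2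
      ((w.1, z.1), z.2) := by
  dsimp only
  rw [← opening_eq]
  rfl

end Env

/-- The data `c` describe the tournament of the environment `E` with the adversary `A`. -/
structure GCtx.Fits (H : HashFamily) (S : SignatureScheme) (X : StateMachine) (PoS : PoSProtocol)
    (A : Adversary) (m C : ℕ) (c : GCtx) (E : Env) : Prop where
  m_eq : E.m = m
  C_eq : E.C = C
  K_eq : E.K = PoS.parties.eval c.n
  hash_eq : E.hash = H.hash c.n c.s
  verify_eq : E.verify = S.verify c.n
  δ_eq : E.δ = X.δ
  commit_eq : E.commit = X.commit c.n c.s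
  committee_eq : E.committeeOf = X.committee
  st₀_eq : E.st₀ (c.strat A) = c.st₀

namespace GCtx.Fits
variable {H : HashFamily} {S : SignatureScheme} {X : StateMachine} {PoS : PoSProtocol} {A : Adversary}
  {m C : ℕ} {c : GCtx} {E : Env} (f : c.Fits H S X PoS A m C E)
include f

theorem committee (j : ℕ) : E.committee (c.strat A) c.rs j = c.committee X C j := by
  cases j with
  | zero => simp [Env.committee, GCtx.committee, f.committee_eq, f.st₀_eq]
  | succ j => simp [Env.committee, GCtx.committee, f.C_eq]

theorem committees (o : ℕ) (ho : o < c.leaves C) :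
    (c.committees X C).getD o .nil = E.committee (c.strat A) c.rs o := by
  simp [GCtx.committees, ho, f.committee]

theorem hash : c.hash H = E.hash := by
  rw [f.hash_eq]
  rfl

theorem claim (i : ℕ) : E.honestClaim (c.strat A) c.rs c.r i = c.claim X C i := by
  rw [Env.honestClaim, Env.stateCommitment, f.st₀_eq, f.commit_eq, f.δ_eq, f.C_eq]
  rfl

theorem selectSigs (com : Data) (j : ℕ) (msg : Data) (sigs : List Data) :
    E.selectSigs com j msg sigs = c.selectSigs S m com j msg sigs := by
  rw [Env.selectSigs, f.verify_eq, f.m_eq]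
  rfl

theorem quorum (com : Data) (j : ℕ) (msg sigs : Data) :
    c.quorum S m com j msg sigs = E.quorum com j msg sigs := by
  rw [Env.quorum, f.verify_eq, f.m_eq]
  rfl

/-- The queries that occur in a tournament. -/
def _root_.Superlight.Query.InRange (N : ℕ) : Query → Prop
  | .commitment => True
  | .header => True
  | .children h o => 1 ≤ h ∧ o + 2 ^ h ≤ N
  | .leaf j => j < N

/-- The honest answers agree only for queries within the range of the tree, since the tables contain
meaningless values beyond. -/
theorem honest (i : ℕ) (q : Query) (hq : q.InRange (c.leaves C)) :
    c.honest H S X m C i q = E.honestAnswer (c.strat A) c.rs c.r i q := by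
  have hN : c.leaves C = c.r / C + 1 := rfl
  cases q with
  | commitment => exact (f.claim i).symm
  | header =>
    simp only [GCtx.honest, Env.honestAnswer, f.claim, f.selectSigs, ← f.committee, f.hash, f.C_eq]
    rw [mmrPeaksP_eq f.committees, mmrProofP_eq f.committees (by omega), hN]
  | children h o =>
    obtain ⟨h1, h2⟩ := hq
    obtain ⟨k, rfl⟩ := Nat.exists_eq_add_of_le' h1
    have hp : 2 ^ (k + 1) = 2 ^ k + 2 ^ k := by ring
    have h3 : 1 ≤ 2 ^ k := Nat.one_le_two_pow
    simp only [GCtx.honest, Env.honestAnswer, GCtx.node, f.hash, Nat.add_sub_cancel]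
    rw [cappedPow_eq, min_eq_left (by omega), merkleNode_eq f.committees k o (by omega),
      merkleNode_eq f.committees k (o + 2 ^ k) (by omega)]
  | leaf j =>
    have hj : j < c.leaves C := hq
    cases j with
    | zero => simp [GCtx.honest, Env.honestAnswer, f.committee]
    | succ j =>
      simp only [GCtx.honest, Env.honestAnswer, f.selectSigs, ← f.committee, f.hash, f.C_eq,
        Nat.add_sub_cancel, Nat.succ_ne_zero, if_false]
      rw [mmrProofP_eq f.committees (by omega), hN]

theorem ask (id : ℕ) (party : Option ℕ) (q : Query) (s : List Data) (hq : q.InRange (c.leaves C)) :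
    (Env.ask (c.strat A) (E.honestAnswer (c.strat A) c.rs c.r) id party q).run s =
      c.ask H S X A m C id party q s := by
  cases party with
  | none => rfl
  | some i => rw [Env.ask_some, ← f.honest i q hq]; rfl

theorem checkLeaf (peaks : Data) (j : ℕ) (x a : Data) :
    E.checkLeaf (E.committeeOf (E.st₀ (c.strat A))) (c.leaves C) peaks j x a =
      c.checkLeaf H S X m C peaks j x a := by
  simp only [GCtx.checkLeaf, Env.checkLeaf, f.quorum, f.hash, f.committee_eq, f.st₀_eq]

theorem checkHeader (cl a : Data) :
    E.checkHeader (c.leaves C) cl a = c.checkHeader H S m C cl a := by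
  simp only [GCtx.checkHeader, Env.checkHeader, f.quorum, f.hash]

omit f in
theorem bisStep_done {P Q : Prover} {pp pq : Data} (k : ℕ) {b : BisState} (hb : b.res.isSome) :
    (c.bisStep H S X A m C P Q pp pq)^[k] b = b := by
  induction k with
  | zero => rfl
  | succ k ih =>
    rw [Function.iterate_succ_apply, show c.bisStep H S X A m C P Q pp pq b = b by
      simp [bisStep, hb], ih]

theorem bisection (P Q : Prover) (pp pq : Data) (h o : ℕ) (x y : Data) (s : List Data)
    (ho : o + 2 ^ h ≤ c.leaves C) :
    (E.bisection (c.strat A) (E.honestAnswer (c.strat A) c.rs c.r)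
      (E.committeeOf (E.st₀ (c.strat A))) (c.leaves C) P Q pp pq h o x y).run s =
    let w := c.bisection H S X A m C P Q pp pq ⟨h, o, x, y, s, none⟩
    (w.res.getD (false, false), w.msgs) := by
  induction h generalizing o x y s with
  | zero =>
    have hl : (Query.leaf o).InRange (c.leaves C) := by
      have : 2 ^ 0 = 1 := rfl
      change o < _
      omega
    rw [Env.bisection_zero]
    simp only [f.ask _ _ _ _ hl, f.checkLeaf]
    rfl
  | succ h ih =>
    have hl : (Query.children (h + 1) o).InRange (c.leaves C) := ⟨by omega, ho⟩
    have hp : 2 ^ (h + 1) = 2 ^ h + 2 ^ h := by ring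
    have h1 : 1 ≤ 2 ^ h := Nat.one_le_two_pow
    rw [Env.bisection_succ]
    simp only [f.ask _ _ _ _ hl, ← f.hash]
    unfold GCtx.bisection
    dsimp only
    rw [Function.iterate_succ_apply]
    conv_rhs => rw [GCtx.bisStep]
    dsimp only
    simp only [Option.isSome_none, Bool.false_eq_true, if_false, Nat.succ_ne_zero, Nat.add_sub_cancel]
    split_ifs with c1 c2
    · rw [ih _ _ _ _ (by omega)]
      rfl
    · rw [cappedPow_eq, min_eq_left (by omega : 2 ^ h ≤ _), min_eq_left (by omega),
        ih _ _ _ _ (by omega)]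
      rfl
    · rw [bisStep_done _ rfl]
      rfl

theorem playStep (P Q : Prover) (s : List Data) :
    (E.playStep (c.strat A) (E.honestAnswer (c.strat A) c.rs c.r)
      (E.committeeOf (E.st₀ (c.strat A))) (c.leaves C) P Q).run s =
    c.playStep H S X A m C P Q s := by
  rw [Env.playStep_run]
  unfold GCtx.playStep
  simp only [f.ask _ _ .header _ trivial, f.checkHeader]
  split_ifs
  · split <;> rename_i h
    · rfl
    rename_i d
    have hd := List.mem_range.mp (List.mem_of_find?_eq_some h)
    rw [f.bisection _ _ _ _ _ _ _ _ _ (mmrTrees_mem (by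
      rw [List.getD_eq_getElem _ _ hd]
      exact List.getElem_mem _))]
  · rfl

omit f in
theorem tourStep_done (k : ℕ) {z : List Prover × List Data × Option (Option Data)}
    (hz : z.2.2.isSome) : (c.tourStep H S X A m C)^[k] z = z := by
  induction k with
  | zero => rfl
  | succ k ih =>
    rw [Function.iterate_succ_apply, show c.tourStep H S X A m C z = z by simp [tourStep, hz], ih]

theorem steps (fuel : ℕ) (ps : List Prover) (s : List Data) :
    (E.steps (c.strat A) (E.honestAnswer (c.strat A) c.rs c.r)
      (E.committeeOf (E.st₀ (c.strat A))) (c.leaves C) fuel ps).run s =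
    c.steps H S X A m C fuel ps s := by
  induction fuel generalizing ps s with
  | zero => rfl
  | succ fuel ih =>
    rw [Env.steps_succ, GCtx.steps, Function.iterate_succ_apply]
    conv_rhs => rw [tourStep]
    dsimp only
    simp only [Option.isSome_none, Bool.false_eq_true, if_false]
    split
    · rw [tourStep_done _ rfl]
      rfl
    · simp only [f.playStep]
      rw [ih]
      rfl

theorem openingParty (e : Data) : E.openingParty c.rs e = c.openingParty PoS e := by
  unfold GCtx.openingParty
  cases e with
  | nil => rfl
  | cons a b => simp only [Env.openingParty, f.K_eq]; rfl

theorem opening (d : Data) (s : List Data) :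
    E.opening (c.strat A) (E.honestAnswer (c.strat A) c.rs c.r) c.rs d s =
      c.opening H S X PoS A m C d s := by
  unfold GCtx.opening Env.opening
  simp only [f.ask _ _ .commitment _ trivial, f.openingParty]

/-- The tournament computed from the data `c` is the tournament of `E`. -/
theorem tournament (s : List Data) :
    (E.tournamentGame (c.strat A) c.rs c.r).run s = c.tournament H S X PoS A m C s := by
  rw [Env.tournamentGame_run]
  simp only [f.opening, f.C_eq]
  have := f.steps
  unfold leaves at this
  simp only [this]
  rfl

end GCtx.Fits

/-- The trees of a Merkle mountain range are disjoint, and ordered from left to right. -/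
theorem mmrTrees_pairwise (N : ℕ) : (mmrTrees N).Pairwise fun t t' => t.2 + 2 ^ t.1 ≤ t'.2 := by
  unfold mmrTrees
  rw [List.pairwise_map, List.pairwise_filter, List.pairwise_reverse]
  refine List.pairwise_lt_range.imp fun {k h} hlt hh hk => ?_
  rw [Nat.testBit_eq_decide_div_mod_eq, decide_eq_true_eq] at hh
  obtain ⟨d, rfl⟩ := Nat.exists_eq_add_of_lt hlt
  -- both sides are `N` with its lowest binary digits cleared
  have e1 : N / 2 ^ (k + d + 1 + 1) * 2 ^ (k + d + 1 + 1) + 2 ^ (k + d + 1) =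
      N / 2 ^ (k + d + 1) * 2 ^ (k + d + 1) := by
    have h1 : N / 2 ^ (k + d + 1 + 1) = N / 2 ^ (k + d + 1) / 2 := by
      rw [Nat.div_div_eq_div_mul, ← pow_succ]
    have h2 := Nat.div_add_mod (N / 2 ^ (k + d + 1)) 2
    rw [hh] at h2
    conv_rhs => rw [← h2]
    rw [h1, pow_succ 2 (k + d + 1)]
    ring
  rw [e1]
  have e2 : 2 ^ (k + d + 1) = 2 ^ d * 2 ^ (k + 1) := by ring
  rw [e2, ← mul_assoc]
  refine Nat.mul_le_mul_right _ ?_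
  rw [mul_comm (2 ^ d), ← Nat.div_div_eq_div_mul]
  exact Nat.div_mul_le_self _ _

theorem mmrIndex_eq {N i d : ℕ} (hd : d < (mmrTrees N).length) (h1 : ((mmrTrees N)[d]).2 ≤ i)
    (h2 : i < ((mmrTrees N)[d]).2 + 2 ^ ((mmrTrees N)[d]).1) : mmrIndex N i = d := by
  unfold mmrIndex
  rw [List.findIdx_eq hd]
  refine ⟨by simp [h1, h2], fun j hj => ?_⟩
  have := List.pairwise_iff_getElem.mp (mmrTrees_pairwise N) j d (by omega) hd hj
  simp only [Bool.and_eq_false_iff, decide_eq_false_iff_not]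
  omega

theorem mmrIndex_lt_of_lt {N i d : ℕ} (hi : i < N) (hd : d < (mmrTrees N).length)
    (h : i < ((mmrTrees N)[d]).2) : mmrIndex N i < d := by
  by_contra hc
  have h1 := mmrTree_spec hi
  have hl := mmrIndex_lt hi
  have e : mmrTree N i = (mmrTrees N)[mmrIndex N i] := by
    unfold mmrTree
    rw [List.getD_eq_getElem _ _ hl]
  rw [e] at h1
  rcases (not_lt.mp hc).lt_or_eq with h2 | h2
  · have := List.pairwise_iff_getElem.mp (mmrTrees_pairwise N) d _ hd hl h2
    have := Nat.one_le_two_pow (n := ((mmrTrees N)[d]).1)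
    omega
  · simp only [← h2] at h1
    omega

theorem nth_ofList (l : List Data) (i : ℕ) : (ofList l).nth i = l.getD i .nil := by
  rw [Data.nth, toList_ofList]

theorem nth_mmrPeaks (hash : Data → Data) (D : ℕ → Data) {N d : ℕ} (hd : d < (mmrTrees N).length) :
    (mmrPeaks hash D N).nth d = merkleRoot hash D ((mmrTrees N)[d]).1 ((mmrTrees N)[d]).2 := by
  rw [mmrPeaks, nth_ofList, List.getD_eq_getElem _ _ (by simpa using hd)]
  simp

/-- The argument of the hash at level `k` of `merkleClimb`. -/
def climbInput (hash : Data → Data) (i : ℕ) (v π : Data) : ℕ → Data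
  | 0 => v
  | k + 1 =>
    if i.testBit k then .cons (π.nth k) (merkleClimb hash i v π k)
    else .cons (merkleClimb hash i v π k) (π.nth k)

theorem merkleClimb_eq (hash : Data → Data) (i : ℕ) (v π : Data) (k : ℕ) :
    merkleClimb hash i v π k = hash (climbInput hash i v π k) := by
  cases k with
  | zero => rfl
  | succ k =>
    rw [merkleClimb, climbInput]
    split_ifs <;> rfl

/-- A Merkle path of an honest tree is determined by its end. -/
theorem eq_leaf_of_merkleClimb {hash : Data → Data} {D : ℕ → Data} {o i : ℕ} {v π : Data} {h : ℕ}
    {I : Data → Prop} (hcol : ∀ a b, I a → I b → hash a = hash b → a = b)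
    (hclimb : ∀ k ≤ h, I (climbInput hash i v π k)) (hleaf : I (D (o + i)))
    (hnode : ∀ k < h, I (.cons (merkleRoot hash D k (o + i / 2 ^ (k + 1) * 2 ^ (k + 1)))
      (merkleRoot hash D k (o + i / 2 ^ (k + 1) * 2 ^ (k + 1) + 2 ^ k))))
    (heq : merkleClimb hash i v π h = merkleRoot hash D h (o + i / 2 ^ h * 2 ^ h)) :
    v = D (o + i) := by
  induction h with
  | zero =>
    refine hcol _ _ (hclimb 0 le_rfl) hleaf ?_
    simpa [merkleClimb, merkleRoot, climbInput] using heq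
  | succ h ih =>
    refine ih (fun k hk => hclimb k (by omega)) (fun k hk => hnode k (by omega)) ?_
    rw [merkleClimb_eq, merkleRoot] at heq
    have := hcol _ _ (hclimb _ le_rfl) (hnode h (by omega)) heq
    rw [climbInput, Nat.testBit_eq_decide_div_mod_eq] at this
    have hp : 2 ^ (h + 1) = 2 ^ h * 2 := pow_succ 2 h
    rw [hp, ← Nat.div_div_eq_div_mul] at this
    split_ifs at this with hb
    · rw [decide_eq_true_eq] at hb
      injection this with h1 h2
      rw [h2]
      congr 1
      have : i / 2 ^ h = 2 * (i / 2 ^ h / 2) + 1 := by omega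
      conv_rhs => rw [this]
      ring
    · rw [decide_eq_true_eq] at hb
      injection this with h1 h2
      rw [h1]
      congr 1
      have : i / 2 ^ h = 2 * (i / 2 ^ h / 2) := by omega
      conv_rhs => rw [this]
      ring

theorem merkleClimb_merkleProof (hash : Data → Data) (D : ℕ → Data) (h o i k : ℕ) (hk : k ≤ h) :
    merkleClimb hash i (D (o + i)) (merkleProof hash D h o i) k =
      merkleRoot hash D k (o + i / 2 ^ k * 2 ^ k) := by
  induction k with
  | zero => simp [merkleClimb, merkleRoot]
  | succ k ih =>
    have hn : (merkleProof hash D h o i).nth k =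
        merkleRoot hash D k (o + ((i / 2 ^ k) ^^^ 1) * 2 ^ k) := by
      rw [merkleProof, nth_ofList, List.getD_eq_getElem _ _ (by simpa using hk)]
      simp
    have hp : 2 ^ (k + 1) = 2 ^ k * 2 := pow_succ 2 k
    rw [merkleClimb, ih (by omega), hn, Nat.testBit_eq_decide_div_mod_eq, merkleRoot, hp,
      ← Nat.div_div_eq_div_mul, sibling_eq]
    split_ifs with h1 h2 h2
    · rw [decide_eq_true_eq] at h1
      omega
    · rw [decide_eq_true_eq] at h1
      have h3 : i / 2 ^ k = 2 * (i / 2 ^ k / 2) + 1 := by omega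
      generalize i / 2 ^ k / 2 = q at *
      rw [h3, Nat.add_sub_cancel]
      congr 3 <;> ring
    · have h3 : i / 2 ^ k = 2 * (i / 2 ^ k / 2) := by omega
      generalize i / 2 ^ k / 2 = q at *
      rw [h3]
      congr 3 <;> ring
    · rw [decide_eq_true_eq] at h1
      omega

theorem mmrVerify_mmrProof (hash : Data → Data) (D : ℕ → Data) {N i : ℕ} (hi : i < N) :
    mmrVerify hash N (mmrPeaks hash D N) i (D i) (mmrProof hash D N i) = true := by
  have h1 := mmrTree_spec hi
  have hl := mmrIndex_lt hi
  rw [mmrVerify, decide_eq_true_eq, nth_mmrPeaks _ _ hl, mmrProof]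
  have e : (mmrTrees N)[mmrIndex N i] = mmrTree N i := by
    unfold mmrTree
    rw [List.getD_eq_getElem _ _ hl]
  rw [e]
  generalize mmrTree N i = t at *
  have := merkleClimb_merkleProof hash D t.1 t.2 (i - t.2) t.1 le_rfl
  rw [Nat.div_eq_of_lt (by omega : i - t.2 < 2 ^ t.1), Nat.add_sub_cancel' h1.1] at this
  simpa using this

/-- The hash inputs that occur in a tournament over `N` leaves with honest committees `D`, where the
adversary's answers satisfy `Ans`. -/
inductive HashInput (hash : Data → Data) (D : ℕ → Data) (N : ℕ) (Ans : Data → Prop) : Data → Prop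
  | children {a : Data} : Ans a → HashInput hash D N Ans (.cons a.fst a.snd)
  | leaf {a : Data} : Ans a → HashInput hash D N Ans (a.nth 0)
  | climb {a : Data} {i k : ℕ} : Ans a → i < N → k ≤ (mmrTree N i).1 →
      HashInput hash D N Ans (climbInput hash (i - (mmrTree N i).2) (a.nth 1) (a.nth 2) k)
  | honestLeaf {o : ℕ} : o < N → HashInput hash D N Ans (D o)
  | honestNode {k o : ℕ} : o + 2 ^ (k + 1) ≤ N →
      HashInput hash D N Ans (.cons (merkleRoot hash D k o) (merkleRoot hash D k (o + 2 ^ k)))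

/-- The answer `a` contains a Merkle proof that verifies at leaf `i`, and the honest node of height
`k` above this leaf is reached: then the leaf is the honest one. -/
theorem leaf_eq_of_climb {hash : Data → Data} {D : ℕ → Data} {N : ℕ} {Ans : Data → Prop}
    (hcol : ∀ a b, HashInput hash D N Ans a → HashInput hash D N Ans b → hash a = hash b → a = b)
    {a : Data} (ha : Ans a) {i k : ℕ} (hi : i < N) (hk : k ≤ (mmrTree N i).1)
    (heq : merkleClimb hash (i - (mmrTree N i).2) (a.nth 1) (a.nth 2) k = merkleRoot hash D k
      ((mmrTree N i).2 + (i - (mmrTree N i).2) / 2 ^ k * 2 ^ k)) : a.nth 1 = D i := by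
  have h1 := mmrTree_spec hi
  have h2 := mmrTrees_mem (mmrTree_mem hi)
  have hcl : ∀ k ≤ (mmrTree N i).1, HashInput hash D N Ans
      (climbInput hash (i - (mmrTree N i).2) (a.nth 1) (a.nth 2) k) :=
    fun k hk => .climb ha hi hk
  generalize mmrTree N i = t at *
  have e : t.2 + (i - t.2) = i := Nat.add_sub_cancel' h1.1
  have := eq_leaf_of_merkleClimb (o := t.2) (i := i - t.2) hcol (fun j hj => hcl j (by omega))
    (by rw [e]; exact .honestLeaf hi) (fun j hj => .honestNode ?_) heq
  · rwa [e] at this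
  · have e1 : 2 ^ t.1 = 2 ^ (t.1 - (j + 1)) * 2 ^ (j + 1) := by
      rw [← pow_add]; congr 1; omega
    have e2 : (i - t.2) / 2 ^ (j + 1) < 2 ^ (t.1 - (j + 1)) := by
      rw [Nat.div_lt_iff_lt_mul (Nat.two_pow_pos _), ← e1]
      omega
    have e3 := Nat.mul_le_mul_right (2 ^ (j + 1)) e2
    rw [← e1, Nat.succ_mul] at e3
    omega

theorem Data.fst_cons (a b : Data) : (Data.cons a b).fst = a := rfl

theorem Data.snd_cons (a b : Data) : (Data.cons a b).snd = b := rfl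

namespace Env

/-! ### Possible runs of the tournament -/

section Runs
variable (E : Env) (strat : List Data → Data) (honest : ℕ → Query → Data) (S₀ : Data) (N : ℕ)

/-- An answer of the prover `P` to the query `q`, where `Ans` holds for all answers of the
adversary. -/
def Answers (Ans : Data → Prop) (P : Prover) (q : Query) (a : Data) : Prop :=
  match P.party with
  | some i => a = honest i q
  | none => Ans a

/-- The possible results of a bisection game, without the messages seen by the adversary. -/
def BisectionRun (Ans : Data → Prop) (P Q : Prover) (pp pq : Data) :
    ℕ → ℕ → Data → Data → Bool × Bool → Prop
  | 0, j, x, y, w => ∃ a b, Answers honest Ans P (.leaf j) a ∧ Answers honest Ans Q (.leaf j) b ∧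
      w = (E.checkLeaf S₀ N pp j x a, E.checkLeaf S₀ N pq j y b)
  | h + 1, o, x, y, w => ∃ a b, Answers honest Ans P (.children (h + 1) o) a ∧
      Answers honest Ans Q (.children (h + 1) o) b ∧
      if E.hash (.cons a.fst a.snd) = x ∧ E.hash (.cons b.fst b.snd) = y then
        if a.fst ≠ b.fst then BisectionRun Ans P Q pp pq h o a.fst b.fst w
        else BisectionRun Ans P Q pp pq h (o + 2 ^ h) a.snd b.snd w
      else w = (decide (E.hash (.cons a.fst a.snd) = x), decide (E.hash (.cons b.fst b.snd) = y))

/-- The possible results of a step of the tournament. -/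
def StepRun (Ans : Data → Prop) (P Q : Prover) (w : Bool × Bool) : Prop :=
  ∃ a b, Answers honest Ans P .header a ∧ Answers honest Ans Q .header b ∧
    if E.checkHeader N P.claim a ∧ E.checkHeader N Q.claim b then
      match (List.range (mmrTrees N).length).find?
          (fun d => decide ((a.nth 0).nth d ≠ (b.nth 0).nth d)) with
      | none => w = (false, false)
      | some d => ∃ w', BisectionRun E honest S₀ N Ans P Q (a.nth 0) (b.nth 0)
          ((mmrTrees N).getD d (0, 0)).1 ((mmrTrees N).getD d (0, 0)).2
          ((a.nth 0).nth d) ((b.nth 0).nth d) w' ∧ w = (w'.1 && !w'.2, w'.2 && !w'.1)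
    else w = (E.checkHeader N P.claim a, E.checkHeader N Q.claim b)

variable {E strat honest S₀ N}

/-- The game is symmetric, so that honest provers need to be treated in the first position only. -/
theorem BisectionRun.swap {Ans : Data → Prop} {P Q : Prover} {pp pq : Data} {h o : ℕ} {x y : Data}
    {w : Bool × Bool} (hw : BisectionRun E honest S₀ N Ans P Q pp pq h o x y w) :
    BisectionRun E honest S₀ N Ans Q P pq pp h o y x w.swap := by
  induction h generalizing o x y with
  | zero =>
    obtain ⟨a, b, ha, hb, rfl⟩ := hw
    exact ⟨b, a, hb, ha, rfl⟩
  | succ h ih =>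
    obtain ⟨a, b, ha, hb, hw⟩ := hw
    refine ⟨b, a, hb, ha, ?_⟩
    split_ifs at hw with h1 h2
    · rw [if_pos h1.symm, if_pos (Ne.symm h2)]
      exact ih hw
    · rw [if_pos h1.symm, if_neg fun h => h2 (Ne.symm h)]
      exact ih hw
    · rw [if_neg fun h => h1 h.symm, hw]
      rfl

theorem StepRun.swap {Ans : Data → Prop} {P Q : Prover} {w : Bool × Bool}
    (hw : StepRun E honest S₀ N Ans P Q w) : StepRun E honest S₀ N Ans Q P w.swap := by
  obtain ⟨a, b, ha, hb, hw⟩ := hw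
  refine ⟨b, a, hb, ha, ?_⟩
  have e : (fun d => decide ((b.nth 0).nth d ≠ (a.nth 0).nth d)) =
    fun d => decide ((a.nth 0).nth d ≠ (b.nth 0).nth d) :=
    funext fun d => decide_eq_decide.mpr ne_comm
  rw [e]
  split_ifs at hw with h1
  · rw [if_pos h1.symm]
    generalize List.find? _ _ = o at hw ⊢
    cases o with
    | none => rw [hw]; rfl
    | some d =>
      obtain ⟨w', h1, h2⟩ := hw
      exact ⟨_, h1.swap, by rw [h2]; rfl⟩
  · rw [if_neg fun h => h1 h.symm, hw]
    rfl

theorem prefix_ask (id : ℕ) (party : Option ℕ) (q : Query) (s : List Data) :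
    s <+: ((ask strat honest id party q).run s).2 := by
  cases party <;> exact List.prefix_append _ _

theorem prefix_bisection (P Q : Prover) (pp pq : Data) (h o : ℕ) (x y : Data) (s : List Data) :
    s <+: ((E.bisection strat honest S₀ N P Q pp pq h o x y).run s).2 := by
  induction h generalizing o x y s with
  | zero => exact (prefix_ask _ _ _ _).trans (prefix_ask _ _ _ _)
  | succ h ih =>
    rw [bisection_succ]
    dsimp only
    have h1 := (prefix_ask (strat := strat) (honest := honest) P.id P.party
      (.children (h + 1) o) s).trans (prefix_ask
          (strat := strat) (honest := honest) Q.id Q.party (.children (h + 1) o) _)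
    split_ifs
    · exact h1.trans (ih _ _ _ _)
    · exact h1.trans (ih _ _ _ _)
    · exact h1

theorem prefix_playStep (P Q : Prover) (s : List Data) :
    s <+: ((E.playStep strat honest S₀ N P Q).run s).2 := by
  rw [playStep_run]
  dsimp only
  have h1 := (prefix_ask (strat := strat) (honest := honest) P.id P.party .header s).trans
    (prefix_ask (strat := strat) (honest := honest) Q.id Q.party .header _)
  split_ifs
  · split
    · exact h1
    · exact h1.trans (prefix_bisection _ _ _ _ _ _ _ _ _)
  · exact h1

theorem prefix_steps (fuel : ℕ) (ps : List Prover) (s : List Data) :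
    s <+: ((E.steps strat honest S₀ N fuel ps).run s).2 := by
  induction fuel generalizing ps s with
  | zero => exact List.prefix_rfl
  | succ fuel ih =>
    rw [steps_succ]
    split
    · exact List.prefix_rfl
    · exact ((List.prefix_append _ _).trans (prefix_playStep _ _ _)).trans (ih _ _)

theorem answers_ask {fin : List Data} (P : Prover) (q : Query) (s : List Data)
    (h : ((ask strat honest P.id P.party q).run s).2 <+: fin) :
    Answers honest (fun a => ∃ p, p <+: fin ∧ a = strat p) P q
      ((ask strat honest P.id P.party q).run s).1 := by
  unfold Answers
  split <;> rename_i hp <;> rw [hp] at h ⊢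
  · rfl
  · exact ⟨_, h, rfl⟩

/-- The answers of the adversary in an actual game are its reactions to prefixes of the final list
of messages. -/
theorem bisectionRun {fin : List Data} (P Q : Prover) (pp pq : Data) (h o : ℕ) (x y : Data)
    (s : List Data)
    (hf : ((E.bisection strat honest S₀ N P Q pp pq h o x y).run s).2 <+: fin) :
    BisectionRun E honest S₀ N (fun a => ∃ p, p <+: fin ∧ a = strat p) P Q pp pq h o x y
      ((E.bisection strat honest S₀ N P Q pp pq h o x y).run s).1 := by
  induction h generalizing o x y s with
  | zero =>
    exact ⟨_, _, answers_ask _ _ _ ((prefix_ask _ _ _ _).trans hf), answers_ask _ _ _ hf, rfl⟩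
  | succ h ih =>
    rw [bisection_succ] at hf ⊢
    dsimp only at hf ⊢
    have key : ((ask strat honest Q.id Q.party (.children (h + 1) o)).run
        ((ask strat honest P.id P.party (.children (h + 1) o)).run s).2).2 <+: fin := by
      split_ifs at hf
      · exact (prefix_bisection _ _ _ _ _ _ _ _ _).trans hf
      · exact (prefix_bisection _ _ _ _ _ _ _ _ _).trans hf
      · exact hf
    refine ⟨_, _, answers_ask _ _ _ ((prefix_ask _ _ _ _).trans key), answers_ask _ _ _ key, ?_⟩
    simp only [Bool.and_eq_true, decide_eq_true_eq] at hf ⊢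
    split_ifs at hf ⊢
    · exact ih _ _ _ _ hf
    · exact ih _ _ _ _ hf
    · rfl

/-- The result of an actual step is one of the possible results, where the adversary's answers are
reactions to prefixes of the final list of messages. -/
theorem stepRun {fin : List Data} (P Q : Prover) (s : List Data)
    (hf : ((E.playStep strat honest S₀ N P Q).run s).2 <+: fin) :
    StepRun E honest S₀ N (fun a => ∃ p, p <+: fin ∧ a = strat p) P Q
      ((E.playStep strat honest S₀ N P Q).run s).1 := by
  rw [playStep_run] at hf ⊢
  dsimp only at hf ⊢
  have key : ((ask strat honest Q.id Q.party .header).run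
      ((ask strat honest P.id P.party .header).run s).2).2 <+: fin := by
    split_ifs at hf
    · split at hf
      · exact hf
      · exact (prefix_bisection _ _ _ _ _ _ _ _ _).trans hf
    · exact hf
  refine ⟨_, _, answers_ask _ _ _ ((prefix_ask _ _ _ _).trans key), answers_ask _ _ _ key, ?_⟩
  simp only [Bool.and_eq_true] at hf ⊢
  split_ifs at hf ⊢
  · split at hf <;> rename_i hd <;> simp only
    exact ⟨_, bisectionRun _ _ _ _ _ _ _ _ _ hf, rfl⟩
  · rfl

end Runs

/-! ### Honest provers win -/

/-- What the honest prover relies on, in a tournament in round `r` after the rounds `rs`, where `Ans`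
holds for all answers of the adversary: honest provers make the same claim `c₀` and pass all checks,
there are no hash collisions, and a quorum of an honest committee is only ever available for the
honest messages. -/
structure Sound (E : Env) (strat : List Data → Data) (rs : List Round) (r : ℕ) (Ans : Data → Prop)
    (c₀ : Data) : Prop where
  claim : ∀ i < E.K, corrupted rs i = false → E.honestClaim strat rs r i = c₀
  header : ∀ i < E.K, corrupted rs i = false →
    E.checkHeader (r / E.C + 1) c₀ (E.honestAnswer strat rs r i .header) = true
  leaf : ∀ i < E.K, corrupted rs i = false → ∀ j < r / E.C + 1,
    E.checkLeaf (E.committee strat rs 0) (r / E.C + 1)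
      (mmrPeaks E.hash (E.committee strat rs) (r / E.C + 1)) j (E.hash (E.committee strat rs j))
      (E.honestAnswer strat rs r i (.leaf j)) = true
  collision : ∀ a b, HashInput E.hash (E.committee strat rs) (r / E.C + 1) Ans a →
    HashInput E.hash (E.committee strat rs) (r / E.C + 1) Ans b → E.hash a = E.hash b → a = b
  stateQuorum : ∀ c a, Ans c → Ans a →
    E.quorum (E.committee strat rs (r / E.C)) (r / E.C) (stateMsg c) (a.nth 3) = true → c = c₀
  handoverQuorum : ∀ a j, Ans a → j + 1 < r / E.C + 1 →
    E.quorum (E.committee strat rs j) j (handoverMsg (j + 1) (a.nth 0)) (a.nth 3) = true →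
    a.nth 0 = E.committee strat rs (j + 1)

namespace Sound
variable {E : Env} {strat : List Data → Data} {rs : List Round} {r : ℕ} {Ans : Data → Prop} {c₀ : Data}

/-- An honest prover wins the bisection game. The invariants for the current node of the tree `t`:
Merkle paths below it, to the peaks of the opponent, pass through the opponent's value `y` of the
node, and those to the left of it lead to honest leaves. -/
theorem bisection (hs : Sound E strat rs r Ans c₀) {P Q : Prover} {i : ℕ} (hP : P.party = some i)
    (hiK : i < E.K) (hic : corrupted rs i = false) (hQ : Q.party = none) {pq : Data} {t : ℕ × ℕ}
    (htree : ∀ i < r / E.C + 1, t.2 ≤ i → i < t.2 + 2 ^ t.1 → mmrTree (r / E.C + 1) i = t)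
    (htN : t.2 + 2 ^ t.1 ≤ r / E.C + 1)
    {h q : ℕ} {y : Data} {w : Bool × Bool} (hh : h ≤ t.1) (hq : (q + 1) * 2 ^ h ≤ 2 ^ t.1)
    (hw : E.BisectionRun (E.honestAnswer strat rs r) (E.committee strat rs 0) (r / E.C + 1) Ans P Q
      (mmrPeaks E.hash (E.committee strat rs) (r / E.C + 1)) pq h (t.2 + q * 2 ^ h)
      (merkleRoot E.hash (E.committee strat rs) h (t.2 + q * 2 ^ h)) y w)
    (hne : merkleRoot E.hash (E.committee strat rs) h (t.2 + q * 2 ^ h) ≠ y)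
    (hA : ∀ a k, Ans a → k < 2 ^ t.1 → k / 2 ^ h = q →
      mmrVerify E.hash (r / E.C + 1) pq (t.2 + k) (a.nth 1) (a.nth 2) = true →
      merkleClimb E.hash k (a.nth 1) (a.nth 2) h = y)
    (hB : ∀ a k, Ans a → k < t.2 + q * 2 ^ h →
      mmrVerify E.hash (r / E.C + 1) pq k (a.nth 1) (a.nth 2) = true →
      a.nth 1 = E.committee strat rs k) :
    w = (true, false) := by
  induction h generalizing q y with
  | zero =>
    obtain ⟨a, b, ha, hb, rfl⟩ := hw
    simp only [Answers, hP] at ha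
    simp only [Answers, hQ] at hb
    simp only [pow_zero, mul_one] at *
    have hj : t.2 + q < r / E.C + 1 := by omega
    rw [ha]
    refine Prod.ext (hs.leaf i hiK hic _ hj) ?_
    by_contra hc
    -- If the opponent passed the checks at the leaf, then its committee would be the honest one: at
    -- leaf `0` by the check, and otherwise since the committee at the previous leaf, which is
    -- honest by `hB`, has only signed the honest one.
    simp only [Bool.not_eq_false, checkLeaf, Bool.and_eq_true, decide_eq_true_eq] at hc
    obtain ⟨h1, h2⟩ := hc
    apply hne
    rw [merkleRoot, ← h1]
    congr 1
    split_ifs at h2 with h0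
    · rw [h0]
      exact (of_decide_eq_true h2).symm
    · simp only [Bool.and_eq_true] at h2
      obtain ⟨j, hj'⟩ := Nat.exists_eq_succ_of_ne_zero h0
      rw [hj', Nat.succ_sub_one] at h2
      have e1 := hB b j hb (by omega) h2.1
      rw [e1] at h2
      rw [hj']
      exact (hs.handoverQuorum b j hb (by omega) h2.2).symm
  | succ h ih =>
    obtain ⟨a, b, ha, hb, hw⟩ := hw
    simp only [Answers, hP] at ha
    simp only [Answers, hQ] at hb
    have hp : 2 ^ (h + 1) = 2 ^ h * 2 := pow_succ 2 h
    have eo : t.2 + q * 2 ^ (h + 1) = t.2 + 2 * q * 2 ^ h := by rw [hp]; ring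
    have eo' : t.2 + (2 * q + 1) * 2 ^ h = t.2 + q * 2 ^ (h + 1) + 2 ^ h := by rw [hp]; ring
    have hle : t.2 + q * 2 ^ (h + 1) + 2 ^ (h + 1) ≤ r / E.C + 1 := by
      rw [Nat.succ_mul] at hq
      omega
    subst ha
    simp only [honestAnswer, Nat.add_sub_cancel, Data.fst_cons, Data.snd_cons] at hw
    rw [← eo', eo] at hw
    have hx : merkleRoot E.hash (E.committee strat rs) (h + 1) (t.2 + q * 2 ^ (h + 1)) = E.hash
        (.cons (merkleRoot E.hash (E.committee strat rs) h (t.2 + 2 * q * 2 ^ h))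
          (merkleRoot E.hash (E.committee strat rs) h (t.2 + (2 * q + 1) * 2 ^ h))) := by
      rw [merkleRoot, eo', eo]
    rw [← eo, hx] at hw
    rw [eo] at hw
    by_cases hy : E.hash (.cons b.fst b.snd) = y
    swap
    · rw [if_neg (by tauto)] at hw
      simp [hw, hy]
    rw [if_pos ⟨rfl, hy⟩] at hw
    have hcol := hs.collision
    have hbI : HashInput E.hash (E.committee strat rs) (r / E.C + 1) Ans (.cons b.fst b.snd) :=
      .children hb
    -- by collision resistance, paths through the node pass through the opponent's opening of it
    have hA' : ∀ a k, Ans a → k < 2 ^ t.1 → k / 2 ^ (h + 1) = q →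
        mmrVerify E.hash (r / E.C + 1) pq (t.2 + k) (a.nth 1) (a.nth 2) = true →
        climbInput E.hash k (a.nth 1) (a.nth 2) (h + 1) = .cons b.fst b.snd := by
      intro a k ha hk hkq hv
      have h1 := hA a k ha hk hkq hv
      rw [merkleClimb_eq, ← hy] at h1
      refine hcol _ _ ?_ hbI h1
      have h2 := HashInput.climb (hash := E.hash) (D := E.committee strat rs) (i := t.2 + k)
        (k := h + 1) ha (by omega : t.2 + k < r / E.C + 1) (by rw [htree] <;> omega)
      rwa [htree _ (by omega) (by omega) (by omega), Nat.add_sub_cancel_left] at h2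
    have hL : ∀ a k, Ans a → k < 2 ^ t.1 → k / 2 ^ h = 2 * q →
        mmrVerify E.hash (r / E.C + 1) pq (t.2 + k) (a.nth 1) (a.nth 2) = true →
        merkleClimb E.hash k (a.nth 1) (a.nth 2) h = b.fst := by
      intro a k ha hk hkq hv
      have h1 := hA' a k ha hk (by rw [hp, ← Nat.div_div_eq_div_mul, hkq]; omega) hv
      rw [climbInput, Nat.testBit_eq_decide_div_mod_eq, hkq, if_neg (by simp)] at h1
      injection h1
    have hR : ∀ a k, Ans a → k < 2 ^ t.1 → k / 2 ^ h = 2 * q + 1 →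
        mmrVerify E.hash (r / E.C + 1) pq (t.2 + k) (a.nth 1) (a.nth 2) = true →
        merkleClimb E.hash k (a.nth 1) (a.nth 2) h = b.snd := by
      intro a k ha hk hkq hv
      have h1 := hA' a k ha hk (by rw [hp, ← Nat.div_div_eq_div_mul, hkq]; omega) hv
      rw [climbInput, Nat.testBit_eq_decide_div_mod_eq, hkq, if_pos (by simp)] at h1
      injection h1
    have hq' : (2 * q + 1 + 1) * 2 ^ h ≤ 2 ^ t.1 := by
      refine le_trans (le_of_eq ?_) hq
      rw [hp]; ring
    -- To the left child: the leaves to the left stay the same. To the right child: now the leaves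
    -- of the left subtree are to the left, and there the opponent agrees with the honest tree.
    split_ifs at hw with hc
    · refine ih (by omega) ?_ hw hc hL ?_
      · exact le_trans (Nat.mul_le_mul_right _ (by omega)) hq'
      · rwa [← eo]
    · rw [not_not] at hc
      refine ih (by omega) hq' hw ?_ hR fun a k ha hk hv => ?_
      · intro hc'
        apply hne
        rw [hx, hc, hc', hy]
      · rw [eo', eo] at hk
        rcases lt_or_ge k (t.2 + q * 2 ^ (h + 1)) with hlt | hge
        · exact hB a k ha hlt hv
        · rw [eo] at hge
          obtain ⟨k, rfl⟩ := Nat.exists_eq_add_of_le (show t.2 ≤ k by omega)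
          have hpos : 0 < 2 ^ h := Nat.two_pow_pos h
          have hkq : k / 2 ^ h = 2 * q := by
            refine (Nat.div_eq_iff hpos).mpr ⟨?_, ?_⟩ <;> omega
          have hk2 : k < 2 ^ t.1 := by
            rw [Nat.succ_mul, Nat.succ_mul] at hq'
            omega
          have e := htree (t.2 + k) (by omega) (by omega) (by omega)
          refine leaf_eq_of_climb hcol ha (by omega) (k := h) (by rw [e]; omega) ?_
          rw [e, Nat.add_sub_cancel_left, hL a k ha hk2 hkq hv, ← hc, hkq]

/-- An honest prover stays in the tournament and eliminates its opponent. -/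
theorem playStep (hs : Sound E strat rs r Ans c₀) {P Q : Prover} {i : ℕ} (hP : P.party = some i)
    (hiK : i < E.K) (hic : corrupted rs i = false) (hPc : P.claim = c₀) (hQ : Q.party = none)
    (hQc : Ans Q.claim) (hne : Q.claim ≠ c₀) {w : Bool × Bool}
    (hw : E.StepRun (E.honestAnswer strat rs r) (E.committee strat rs 0) (r / E.C + 1) Ans P Q w) :
    w = (true, false) := by
  obtain ⟨a, b, ha, hb, hw⟩ := hw
  simp only [Answers, hP] at ha
  simp only [Answers, hQ] at hb
  have h1 := hs.header i hiK hic
  rw [← ha, ← hPc] at h1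
  by_cases h2 : E.checkHeader (r / E.C + 1) Q.claim b = true
  swap
  · rw [if_neg (by tauto)] at hw
    rw [hw, h1]
    simpa using h2
  rw [if_pos ⟨h1, h2⟩] at hw
  have hap : a.nth 0 = mmrPeaks E.hash (E.committee strat rs) (r / E.C + 1) := by
    rw [ha]
    simp only [honestAnswer, nth_ofList]
    rfl
  rw [hap] at hw
  have hcol := hs.collision
  -- leaves in trees with the honest peak are honest
  have key : ∀ (b' : Data) (k : ℕ), Ans b' → k < r / E.C + 1 →
      (b.nth 0).nth (mmrIndex (r / E.C + 1) k) = (mmrPeaks E.hash (E.committee strat rs)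
        (r / E.C + 1)).nth (mmrIndex (r / E.C + 1) k) →
      mmrVerify E.hash (r / E.C + 1) (b.nth 0) k (b'.nth 1) (b'.nth 2) = true →
      b'.nth 1 = E.committee strat rs k := by
    intro b' k hb' hk heq hv
    refine leaf_eq_of_climb hcol hb' hk le_rfl ?_
    have hl := mmrIndex_lt hk
    rw [mmrVerify, decide_eq_true_eq, heq, nth_mmrPeaks _ _ hl] at hv
    have e : (mmrTrees (r / E.C + 1))[mmrIndex (r / E.C + 1) k] = mmrTree (r / E.C + 1) k := by
      unfold mmrTree
      rw [List.getD_eq_getElem _ _ hl]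
    have h3 := mmrTree_spec hk
    rw [e] at hv
    rw [hv, Nat.div_eq_of_lt (by omega : k - (mmrTree (r / E.C + 1) k).2 <
      2 ^ (mmrTree (r / E.C + 1) k).1)]
    simp
  split at hw <;> rename_i hd
  · exfalso
    -- If all peaks are honest, then the latest committee is, so that the claim is the honest one.
    rw [List.find?_eq_none] at hd
    simp only [checkHeader, Bool.and_eq_true, Nat.add_sub_cancel] at h2
    have h4 : mmrIndex (r / E.C + 1) (r / E.C) < (mmrTrees (r / E.C + 1)).length :=
      mmrIndex_lt (by omega)
    have h3 := key b (r / E.C) hb (by omega)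
      (Eq.symm (by simpa using (hd _ (List.mem_range.mpr h4)))) h2.1
    rw [h3] at h2
    exact hne (hs.stateQuorum _ _ hQc hb h2.2)
  · rename_i d
    obtain ⟨w', hw', rfl⟩ := hw
    have hd1 := List.mem_range.mp (List.mem_of_find?_eq_some hd)
    have hd2 := List.find?_some hd
    have hd3 : ∀ d' < d, (b.nth 0).nth d' =
        (mmrPeaks E.hash (E.committee strat rs) (r / E.C + 1)).nth d' := by
      intro d' hd'
      rw [List.find?_range_eq_some] at hd
      simpa [eq_comm] using hd.2.2 d' hd'
    rw [decide_eq_true_eq] at hd2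
    have e : (mmrTrees (r / E.C + 1)).getD d (0, 0) = (mmrTrees (r / E.C + 1))[d] :=
      List.getD_eq_getElem _ _ hd1
    rw [nth_mmrPeaks _ _ hd1] at hw' hd2
    rw [e] at hw'
    have htN := mmrTrees_mem (List.getElem_mem hd1)
    have htree : ∀ i < r / E.C + 1, ((mmrTrees (r / E.C + 1))[d]).2 ≤ i →
        i < ((mmrTrees (r / E.C + 1))[d]).2 + 2 ^ ((mmrTrees (r / E.C + 1))[d]).1 →
        mmrTree (r / E.C + 1) i = (mmrTrees (r / E.C + 1))[d] := by
      intro i _ hi1 hi2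
      rw [mmrTree, mmrIndex_eq hd1 hi1 hi2, e]
    have hlt : ∀ i < ((mmrTrees (r / E.C + 1))[d]).2, mmrIndex (r / E.C + 1) i < d :=
      fun i hi => mmrIndex_lt_of_lt (hi.trans_le ((Nat.le_add_right _ _).trans htN)) hd1 hi
    have hidx : ∀ i, ((mmrTrees (r / E.C + 1))[d]).2 ≤ i →
        i < ((mmrTrees (r / E.C + 1))[d]).2 + 2 ^ ((mmrTrees (r / E.C + 1))[d]).1 →
        mmrIndex (r / E.C + 1) i = d := fun i hi1 hi2 => mmrIndex_eq hd1 hi1 hi2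
    generalize (mmrTrees (r / E.C + 1))[d] = t at *
    have : w' = (true, false) := by
      refine hs.bisection hP hiK hic hQ (t := t) (q := 0) htree htN le_rfl (by simp)
          (y := (b.nth 0).nth d)
        (pq := b.nth 0) (by simpa using hw') (by simpa using hd2) ?_ ?_
      · intro a k ha hk _ hv
        rw [mmrVerify, decide_eq_true_eq, htree (t.2 + k) (by omega) (by omega)
          (by omega), hidx (t.2 + k) (by omega) (by omega), Nat.add_sub_cancel_left] at hv
        exact hv
      · intro a k ha hk hv
        have hk' : k < t.2 := by simpa using hk
        exact key a k ha (hk'.trans_le ((Nat.le_add_right _ _).trans htN)) (hd3 _ (hlt k hk')) hv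
    rw [this]
    rfl

/-- The provers that take part in a tournament: honest ones, and adversarial ones whose claims satisfy
`Ans`. -/
def Good (E : Env) (rs : List Round) (Ans : Data → Prop) (c₀ : Data) (P : Prover) : Prop :=
  (∃ i, P.party = some i ∧ i < E.K ∧ corrupted rs i = false ∧ P.claim = c₀) ∨
    (P.party = none ∧ Ans P.claim)

/-- An honest prover stays until the end, and each step eliminates some prover. -/
theorem steps {fin : List Data} (hs : Sound E strat rs r (fun a => ∃ p, p <+: fin ∧ a = strat p) c₀)
    (fuel : ℕ) (ps : List Prover) (s : List Data) (hfuel : ps.length ≤ fuel)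
    (hid : (ps.map Prover.id).Nodup)
    (hps : ∀ P ∈ ps, Good E rs (fun a => ∃ p, p <+: fin ∧ a = strat p) c₀ P)
    (hex : ∃ P ∈ ps, P.party.isSome)
    (hf : ((E.steps strat (E.honestAnswer strat rs r) (E.committee strat rs 0) (r / E.C + 1)
      fuel ps).run s).2 <+: fin) :
    ((E.steps strat (E.honestAnswer strat rs r) (E.committee strat rs 0) (r / E.C + 1)
      fuel ps).run s).1 = some c₀ := by
  obtain ⟨P₀, hP₀, hsome⟩ := hex
  induction fuel generalizing ps s with
  | zero =>
    have := List.length_pos_of_mem hP₀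
    omega
  | succ fuel ih =>
    obtain ⟨i, hi, hiK, hic, hcl⟩ : ∃ i, P₀.party = some i ∧ i < E.K ∧ corrupted rs i = false ∧
        P₀.claim = c₀ := by
      rcases hps P₀ hP₀ with h | h
      · exact h
      · rw [h.1] at hsome
        cases hsome
    rw [steps_succ] at hf ⊢
    cases hd : disagreeing ps with
    | nil =>
      dsimp only
      -- all claims agree with the claim of the honest prover
      cases ps with
      | nil => cases hP₀
      | cons P ps =>
        have h1 : (P, P₀) ∉ disagreeing (P :: ps) := by simp [hd]
        have h2 : P.claim = P₀.claim := by
          by_contra hc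
          exact h1 (List.mem_filter.mpr ⟨List.mem_product.mpr ⟨by simp, hP₀⟩, by simpa using hc⟩)
        simp [h2, hcl]
    | cons x l =>
      simp only [hd] at hf ⊢
      generalize hs' : s ++ [ofList (ps.map fun P => num P.id)] = s' at *
      generalize hpair : (x :: l).getD _ x = pair at *
      have hmem : pair ∈ disagreeing ps := by
        rw [hd, ← hpair, List.getD_eq_getElem?_getD]
        generalize ((strat s').size % (l.length + 1) : ℕ) = i
        cases h : (x :: l)[i]? with
        | none => simp
        | some y => exact List.mem_of_getElem? h
      obtain ⟨m1, m2, hne⟩ := mem_of_disagreeing hmem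
      have hw := stepRun pair.1 pair.2 s' ((prefix_steps _ _ _).trans hf)
      generalize hwe : (E.playStep strat (E.honestAnswer strat rs r) (E.committee strat rs 0)
        (r / E.C + 1) pair.1 pair.2).run s' = w at *
      have inj : ∀ P ∈ ps, ∀ Q ∈ ps, P.id = Q.id → P = Q := fun P hP Q hQ h =>
        List.inj_on_of_nodup_map hid hP hQ h
      -- an honest prover in the pair wins, and in any case somebody is eliminated
      have hL : pair.1.party.isSome → w.1 = (true, false) := by
        intro h
        rcases hps _ m1 with ⟨i, h1, h2, h3, h4⟩ | h'
        · rcases hps _ m2 with ⟨i', h1', h2', h3', h4'⟩ | h'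
          · exact absurd (h4.trans h4'.symm) hne
          · exact hs.playStep h1 h2 h3 h4 h'.1 h'.2 (fun hc => hne (h4.trans hc.symm)) hw
        · rw [h'.1] at h
          cases h
      have hR : pair.2.party.isSome → w.1 = (false, true) := by
        intro h
        rcases hps _ m2 with ⟨i, h1, h2, h3, h4⟩ | h'
        · rcases hps _ m1 with ⟨i', h1', h2', h3', h4'⟩ | h'
          · exact absurd (h4'.trans h4.symm) hne
          · have := hs.playStep h1 h2 h3 h4 h'.1 h'.2 (fun hc => hne (hc.trans h4.symm)) hw.swap
            rw [← Prod.swap_swap w.1, this]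
            rfl
        · rw [h'.1] at h
          cases h
      have hout : w.1 ≠ (true, true) := by
        rw [← hwe, playStep_run]
        dsimp only
        split_ifs with h
        · split
          · simp
          · simp only [ne_eq, Prod.mk.injEq, Bool.and_eq_true, Bool.not_eq_true', not_and]
            rintro ⟨h1, h2⟩ h3
            rw [h2] at h3
            cases h3
        · intro hc
          rw [Prod.mk.injEq] at hc
          rw [hc.1, hc.2] at h
          exact h rfl
      have hsub : (ps.filter fun R => (R.id != pair.1.id || w.1.1) &&
          (R.id != pair.2.id || w.1.2)).length < ps.length := by
        rw [List.length_filter_lt_length_iff_exists]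
        by_cases h1 : w.1.1 = true
        · refine ⟨pair.2, m2, ?_⟩
          have : w.1.2 = false := by
            by_contra hc
            exact hout (Prod.ext h1 (by simpa using hc))
          simp [this]
        · exact ⟨pair.1, m1, by simp [h1]⟩
      refine ih _ _ (by omega) (hid.sublist (List.filter_sublist.map _))
        (fun P hP => hps P (List.mem_filter.mp hP).1) hf (List.mem_filter.mpr ⟨hP₀, ?_⟩)
      rw [Bool.and_eq_true, Bool.or_eq_true, Bool.or_eq_true, bne_iff_ne, bne_iff_ne]
      constructor
      · by_cases h : P₀.id = pair.1.id
        · rw [inj _ hP₀ _ m1 h] at hsome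
          rw [hL hsome]
          exact Or.inr rfl
        · exact Or.inl h
      · by_cases h : P₀.id = pair.2.id
        · rw [inj _ hP₀ _ m2 h] at hsome
          rw [hR hsome]
          exact Or.inr rfl
        · exact Or.inl h

/-- The provers of a tournament have different numbers, and each of them is run by an honest party
or answered for by the adversary. -/
theorem opening {fin : List Data} (hs : Sound E strat rs r (fun a => ∃ p, p <+: fin ∧ a = strat p) c₀)
    (d : Data) (s : List Data) (hf : (E.opening strat (E.honestAnswer strat rs r) rs d s).2 <+: fin) :
    (E.opening strat (E.honestAnswer strat rs r) rs d s).1.map Prover.id =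
      List.range d.toList.length ∧
    ∀ P ∈ (E.opening strat (E.honestAnswer strat rs r) rs d s).1,
      Good E rs (fun a => ∃ p, p <+: fin ∧ a = strat p) c₀ P := by
  unfold Env.opening at *
  generalize d.toList = l at *
  induction l using List.reverseRecOn with
  | nil => simp
  | append_singleton l e ih =>
    simp only [List.foldl_append, List.foldl_cons, List.foldl_nil] at hf ⊢
    obtain ⟨i1, i2⟩ := ih ((prefix_ask _ _ _ _).trans hf)
    generalize l.foldl _ ([], s) = z at *
    have hl : z.1.length = l.length := by simpa using congrArg List.length i1
    refine ⟨by simp [i1, hl, List.range_succ], fun P hP => ?_⟩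
    rcases List.mem_append.mp hP with hP | hP
    · exact i2 P hP
    · rw [List.mem_singleton] at hP
      have := answers_ask (fin := fin) (honest := E.honestAnswer strat rs r) (strat := strat)
        ⟨z.1.length, E.openingParty rs e, .nil⟩ .commitment z.2 hf
      subst hP
      unfold Answers at this
      dsimp only at this
      cases hp : E.openingParty rs e with
      | none =>
        rw [hp] at this
        exact Or.inr ⟨rfl, this⟩
      | some i =>
        rw [hp] at this
        have h2 : i < E.K ∧ corrupted rs i = false := by
          unfold openingParty at hp
          split at hp
          · cases hp
          · split_ifs at hp with h
            cases hp
            exact h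
        exact Or.inl ⟨i, rfl, h2.1, h2.2, this.trans (hs.claim i h2.1 h2.2)⟩

/-- The verifier accepts the claim of the honest provers. -/
theorem tournament (E : Env) (strat : List Data → Data) (r : ℕ) (c₀ : Data)
    (hs : Sound E strat (E.exec strat (r + 1)) r
      (fun a => ∃ p, p <+: (E.tournament strat r).2 ∧ a = strat p) c₀)
    (hex : ∃ P ∈ (E.tournament strat r).1.1, P.party.isSome) :
    (E.tournament strat r).1.2 = some c₀ := by
  unfold Env.tournament at *
  rw [tournamentGame_run] at *
  dsimp only at hs hex ⊢
  have hO := hs.opening _ _ (prefix_steps _ _ _)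
  exact hs.steps _ _ _ le_rfl (by rw [hO.1]; exact List.nodup_range) hO.2 hex List.prefix_rfl

end Sound

end Env

/-! ### Counting positions of a committee -/

/-- Counting positions with a list, as the verifier does, and with a type, as the definition of
honest majorities does, comes to the same. -/
theorem countP_range (m : ℕ) (p : ℕ → Bool) :
    (List.range m).countP p = ((Finset.range m).filter fun k => p k = true).card := by
  induction m with
  | zero => rfl
  | succ m ih =>
    rw [List.range_succ, List.countP_append, ih, Finset.range_add_one, Finset.filter_insert]
    split_ifs with h <;> simp [h]

theorem card_fin_subtype (m : ℕ) (p : ℕ → Prop) [DecidablePred p] :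
    Nat.card {k : Fin m // p k} = ((Finset.range m).filter p).card := by
  rw [Nat.card_eq_fintype_card, Fintype.card_subtype, ← Finset.card_map Fin.valEmbedding]
  congr 1
  ext k
  simp only [Finset.mem_map, Finset.mem_filter, Finset.mem_univ, true_and, Fin.valEmbedding_apply,
    Finset.mem_range]
  exact ⟨fun ⟨a, h, e⟩ => e ▸ ⟨a.2, h⟩, fun h => ⟨⟨k, h.1⟩, h.2, rfl⟩⟩

namespace Env
variable (E : Env)

/-! ### Executions -/

section Exec
variable (strat : List Data → Data)

theorem length_exec (k : ℕ) : (E.exec strat k).length = k := by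
  induction k with
  | zero => rfl
  | succ k ih => simp [exec, ih]

theorem exec_prefix {k k' : ℕ} (h : k ≤ k') : E.exec strat k <+: E.exec strat k' := by
  induction k', h using Nat.le_induction with
  | base => exact List.prefix_rfl
  | succ k' _ ih => exact ih.trans (List.prefix_append _ _)

theorem take_exec {k k' : ℕ} (h : k ≤ k') : (E.exec strat k').take k = E.exec strat k := by
  have := List.prefix_iff_eq_take.mp (E.exec_prefix strat h)
  rw [length_exec] at this
  exact this.symm

theorem getElem?_exec {k k' : ℕ} (h : k < k') :
    (E.exec strat k')[k]? = some (E.nextRound strat (E.exec strat k)) := by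
  obtain ⟨l, hl⟩ := E.exec_prefix strat (Nat.succ_le_of_lt h)
  rw [← hl, exec, List.getElem?_append_left (by simp [length_exec]),
    List.getElem?_append_right (by simp [length_exec]), length_exec, Nat.sub_self]
  rfl

theorem outcome_exec {ρ k k' : ℕ} (h : ρ < k) (hk : k ≤ k') :
    outcome (E.exec strat k') ρ = outcome (E.exec strat k) ρ := by
  rw [outcome, outcome, getElem?_exec E strat (h.trans_le hk), getElem?_exec E strat h]

theorem ledger_exec {ρ k k' : ℕ} (h : ρ < k) (hk : k ≤ k') (i : ℕ) :
    ledger (E.exec strat k') ρ i = ledger (E.exec strat k) ρ i := by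
  rw [ledger, ledger, E.outcome_exec strat h hk]

theorem honest_exec {ρ k k' : ℕ} (h : ρ < k) (hk : k ≤ k') (i : ℕ) :
    E.Honest (E.exec strat k') ρ i ↔ E.Honest (E.exec strat k) ρ i := by
  rw [Honest, Honest, E.take_exec strat (by omega), E.take_exec strat (by omega)]

theorem committee_exec {j k k' : ℕ} (h : j * E.C ≤ k) (hk : k ≤ k') (hC : 0 < E.C) :
    E.committee strat (E.exec strat k') j = E.committee strat (E.exec strat k) j := by
  cases j with
  | zero => rfl
  | succ j =>
    have : 0 < (j + 1) * E.C := Nat.mul_pos (by omega) hC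
    rw [committee, committee, E.outcome_exec strat (by omega) hk]

theorem honest_mono {rs : List Round} {ρ ρ' i : ℕ} (h : ρ ≤ ρ') (hi : E.Honest rs ρ' i) :
    E.Honest rs ρ i := by
  refine ⟨hi.1, ?_⟩
  have h1 := hi.2
  rw [corrupted, List.any_eq_false] at h1 ⊢
  exact fun q hq => h1 q ((List.take_subset_take_left rs (by omega)) hq)

end Exec

section WithTournament
variable (strat : List Data → Data) (r : ℕ)

theorem withTournament_of_lt {h : List Data} (hh : h.length < r + 3) :
    E.withTournament strat r h = strat h := if_pos hh

theorem genesisMove_withTournament : E.genesisMove (E.withTournament strat r) = E.genesisMove strat :=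
  E.withTournament_of_lt strat r (by simp)

theorem st₀_withTournament : E.st₀ (E.withTournament strat r) = E.st₀ strat := by
  rw [st₀, st₀, genesisMove_withTournament]

theorem committee_withTournament (rs : List Round) :
    E.committee (E.withTournament strat r) rs = E.committee strat rs := by
  funext j
  cases j with
  | zero => rw [committee, committee, st₀_withTournament]
  | succ j => rfl

theorem exec_withTournament {k : ℕ} (hk : k ≤ r + 1) :
    E.exec (E.withTournament strat r) k = E.exec strat k := by
  induction k with
  | zero => rfl
  | succ k ih =>
    rw [exec, exec, ih (by omega)]
    have hv : E.view (E.withTournament strat r) (E.exec strat k) = E.view strat (E.exec strat k) := by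
      rw [view, view, st₀_withTournament]
    have hl : (E.view strat (E.exec strat k)).length < r + 3 := by
      simp [view, length_exec]
      omega
    unfold nextRound
    rw [hv, genesisMove_withTournament, st₀_withTournament, committee_withTournament,
      E.withTournament_of_lt strat r hl]

end WithTournament

/-! ### From safety and honest majorities to soundness -/

section Soundness
variable (strat : List Data → Data) (r : ℕ)

/-- The signatures that the adversary shows in a tournament: period, message and signature. -/
inductive SigCandidate (E : Env) (r : ℕ) (Ans : Data → Prop) : ℕ → Data → Data → Prop
  | state {c a : Data} {k : ℕ} : Ans c → Ans a → k < E.m →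
      SigCandidate E r Ans (r / E.C) (stateMsg c) ((a.nth 3).nth k)
  | handover {a : Data} {j k : ℕ} : Ans a → j < r / E.C → k < E.m →
      SigCandidate E r Ans j (handoverMsg (j + 1) (a.nth 0)) ((a.nth 3).nth k)

/-- Party `i` is honest in all rounds up to `r` of the epochs up to `t`. -/
def HonestUntil (rs : List Round) (r t i : ℕ) : Prop :=
  i < E.K ∧ ∀ ρ ≤ r, ρ / E.C ≤ t → E.Honest rs ρ i

/-- The valid signature `sig` of party `i` on `msg` for epoch `t` has not been made by this party,
which is honest at that time. -/
def Forged (rs : List Round) (i t : ℕ) (msg sig : Data) : Prop :=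
  E.HonestUntil rs r t i ∧ t ≤ r / E.C ∧ E.verify (E.pk i) t msg sig = true ∧
    msg ≠ stateMsg (E.stateCommitment (E.st₀ strat) (ledger rs (t * E.C) i)) ∧
    msg ≠ handoverMsg (t + 1) (E.committee strat rs (t + 1))

/-- The messages of a key-evolving scheme are distinct. -/
theorem stateMsg_ne_handoverMsg (c : Data) (j : ℕ) (d : Data) : stateMsg c ≠ handoverMsg j d := by
  intro h
  simp [stateMsg, handoverMsg, num, ofList] at h

/-- A quorum and a majority share a position. -/
theorem exists_overlap {com msg sigs : Data} {j : ℕ} {p : ℕ → Prop}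
    (h1 : E.quorum com j msg sigs = true) (h2 : E.m < 2 * Nat.card {k : Fin E.m // p k}) :
    ∃ k < E.m, p k ∧ E.verify (member com k) j msg (sigs.nth k) = true := by
  classical
  rw [quorum, decide_eq_true_eq, countP_range] at h1
  rw [card_fin_subtype] at h2
  obtain ⟨k, hk⟩ := Finset.inter_nonempty_of_card_lt_card_add_card (s := Finset.range E.m)
    (Finset.filter_subset _ _) (Finset.filter_subset p _)
    (by rw [Finset.card_range]; omega : _ < ((Finset.range E.m).filter fun k =>
      E.verify (member com k) j msg (sigs.nth k) = true).card + _)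
  simp only [Finset.mem_inter, Finset.mem_filter, Finset.mem_range] at hk
  exact ⟨k, hk.1.1, hk.2.2, hk.1.2⟩

/-- If a majority has signed, then the signatures selected by an honest prover form a quorum. -/
theorem quorum_selectSigs {com msg : Data} {sigs : List Data} {j : ℕ} {p : ℕ → Prop}
    (h1 : E.m < 2 * Nat.card {k : Fin E.m // p k})
    (h2 : ∀ k < E.m, p k → ∃ sig ∈ sigs, E.verify (member com k) j msg sig = true) :
    E.quorum com j msg (E.selectSigs com j msg sigs) = true := by
  classical
  rw [quorum, decide_eq_true_eq, countP_range]
  rw [card_fin_subtype] at h1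
  refine h1.trans_le (Nat.mul_le_mul_left 2 (Finset.card_le_card fun k hk => ?_))
  simp only [Finset.mem_filter, Finset.mem_range] at hk ⊢
  refine ⟨hk.1, ?_⟩
  rw [selectSigs, nth_ofList, List.getD_eq_getElem _ _ (by simpa using hk.1)]
  obtain ⟨sig, hs, hv⟩ := h2 k hk.1 hk.2
  obtain ⟨sig', hs'⟩ := Option.isSome_iff_exists.mp (List.find?_isSome.mpr ⟨sig, hs, hv⟩)
  simp only [List.getElem_map, List.getElem_range, hs', Option.getD_some]
  exact List.find?_some hs'

variable {E strat r}

/-- An honest member of a committee takes part in the rounds of its epoch. -/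
theorem honestUntil_active {k t i ρ : ℕ} (hC : 0 < E.C)
    (h : E.HonestUntil (E.exec strat (r + 1)) r t i) (hρ : ρ ≤ r) (ht : ρ / E.C = t)
    (hk : k < E.m) (hmem : member (E.committee strat (E.exec strat (r + 1)) t) k = E.pk i) :
    (!(corrupted (E.exec strat ρ) i ||
      (E.nextRound strat (E.exec strat ρ)).out.Grants i) &&
      E.IsMember i (E.committee strat (E.exec strat ρ) t)) = true := by
  have h1 := (h.2 ρ hρ ht.le).2
  rw [E.take_exec strat (by omega), exec] at h1
  have h2 : E.IsMember i (E.committee strat (E.exec strat ρ) t) = true := by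
    rw [E.committee_exec strat (k := ρ) (by rw [← ht]; exact Nat.div_mul_le_self _ _) (by omega) hC]
      at hmem
    exact List.any_eq_true.mpr ⟨k, List.mem_range.mpr hk, by simpa using hmem⟩
  rw [h2]
  simpa [corrupted] using h1

/-- An honest member of a committee has signed its state at the beginning of the epoch. -/
theorem stateSig_mem {k t i : ℕ} (hC : 0 < E.C)
    (h : E.HonestUntil (E.exec strat (r + 1)) r t i) (ht : t * E.C ≤ r)
    (hk : k < E.m) (hmem : member (E.committee strat (E.exec strat (r + 1)) t) k = E.pk i) :
    E.signState i t (stateMsg (E.stateCommitment (E.st₀ strat)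
      (ledger (E.exec strat (r + 1)) (t * E.C) i))) ∈
    (((E.exec strat (r + 1))[t * E.C]?.map fun q => q.stateSigs.toList).getD []) := by
  have hact := honestUntil_active hC h ht (Nat.mul_div_cancel _ hC) hk hmem
  rw [ledger, outcome, E.getElem?_exec strat (by omega)]
  simp only [Option.map_some, Option.getD_some]
  have : (E.nextRound strat (E.exec strat (t * E.C))).stateSigs.toList =
      (List.range E.K).map fun i =>
        if (!(corrupted (E.exec strat (t * E.C)) i ||
          (E.nextRound strat (E.exec strat (t * E.C))).out.Grants i) &&
            E.IsMember i (E.committee strat (E.exec strat (t * E.C)) t)) = true then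
          E.signState i t (stateMsg (E.stateCommitment (E.st₀ strat)
            ((E.nextRound strat (E.exec strat (t * E.C))).out.ledger i)))
        else .nil := by
    conv_lhs => unfold nextRound
    simp only [length_exec, Nat.mul_mod_left, if_true, toList_ofList, Nat.mul_div_cancel _ hC]
    rfl
  rw [this]
  exact List.mem_map.mpr ⟨i, List.mem_range.mpr h.1, by rw [if_pos hact]⟩

/-- An honest member of a committee has signed the next committee at the end of the epoch. -/
theorem handoverSig_mem {k t i : ℕ} (hC : 0 < E.C)
    (h : E.HonestUntil (E.exec strat (r + 1)) r t i) (ht : (t + 1) * E.C ≤ r + 1)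
    (hk : k < E.m) (hmem : member (E.committee strat (E.exec strat (r + 1)) t) k = E.pk i) :
    E.signHandover i t (handoverMsg (t + 1) (E.committee strat (E.exec strat (r + 1)) (t + 1))) ∈
    (((E.exec strat (r + 1))[(t + 1) * E.C - 1]?.map fun q => q.handoverSigs.toList).getD []) := by
  have hpos : 0 < (t + 1) * E.C := Nat.mul_pos (by omega) hC
  have hdiv : ((t + 1) * E.C - 1) / E.C = t := by
    rw [Nat.succ_mul]
    refine (Nat.div_eq_iff hC).mpr ?_
    omega
  have hact := honestUntil_active hC h (by omega) hdiv hk hmem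
  rw [committee, outcome, E.getElem?_exec strat (by omega)]
  simp only [Option.map_some, Option.getD_some]
  have : (E.nextRound strat (E.exec strat ((t + 1) * E.C - 1))).handoverSigs.toList =
      (List.range E.K).map fun i =>
        if (!(corrupted (E.exec strat ((t + 1) * E.C - 1)) i ||
          (E.nextRound strat (E.exec strat ((t + 1) * E.C - 1))).out.Grants i) &&
            E.IsMember i (E.committee strat (E.exec strat ((t + 1) * E.C - 1)) t)) = true then
          E.signHandover i t (handoverMsg (t + 1)
            (E.nextRound strat (E.exec strat ((t + 1) * E.C - 1))).out.nextCommittee)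
        else .nil := by
    conv_lhs => unfold nextRound
    simp only [length_exec, Nat.sub_add_cancel hpos, Nat.mul_mod_left, if_true, toList_ofList, hdiv]
    rfl
  rw [this]
  exact List.mem_map.mpr ⟨i, List.mem_range.mpr h.1, by rw [if_pos hact]⟩

/-- Honest majorities, and the absence of collisions and forgeries, give the honest prover all that
it relies on. -/
theorem sound (hC : 0 < E.C) {Ans : Data → Prop} {c₀ : Data}
    (hclaim : ∀ i < E.K, corrupted (E.exec strat (r + 1)) i = false →
      E.honestClaim strat (E.exec strat (r + 1)) r i = c₀)
    (hmaj : ∀ j ≤ r / E.C, E.m < 2 * Nat.card {k : Fin E.m // ∃ i,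
      member (E.committee strat (E.exec strat (r + 1)) j) k = E.pk i ∧
        E.HonestUntil (E.exec strat (r + 1)) r j i})
    (hstate : ∀ i < E.K, ∀ j ≤ r / E.C, ∀ msg,
      E.verify (E.pk i) j msg (E.signState i j msg) = true)
    (hhand : ∀ i < E.K, ∀ j ≤ r / E.C, ∀ msg,
      E.verify (E.pk i) j msg (E.signHandover i j msg) = true)
    (hcol : ∀ a b, HashInput E.hash (E.committee strat (E.exec strat (r + 1))) (r / E.C + 1) Ans a →
      HashInput E.hash (E.committee strat (E.exec strat (r + 1))) (r / E.C + 1) Ans b →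
      E.hash a = E.hash b → a = b)
    (hforge : ∀ i t msg sig, SigCandidate E r Ans t msg sig →
      ¬ E.Forged strat r (E.exec strat (r + 1)) i t msg sig) :
    Sound E strat (E.exec strat (r + 1)) r Ans c₀ := by
  have hle : r / E.C * E.C ≤ r := Nat.div_mul_le_self _ _
  have hunc : ∀ i, E.HonestUntil (E.exec strat (r + 1)) r (r / E.C) i →
      i < E.K ∧ corrupted (E.exec strat (r + 1)) i = false := by
    intro i hi
    have := (hi.2 r le_rfl le_rfl).2
    rw [E.take_exec strat le_rfl] at this
    exact ⟨hi.1, this⟩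
  refine ⟨hclaim, fun i hi hc => ?_, fun i hi hc j hj => ?_, hcol, fun c a hc ha hq => ?_,
    fun a j ha hj hq => ?_⟩
  · simp only [checkHeader, honestAnswer, nth_ofList, List.getD_cons_zero, List.getD_cons_succ,
      Nat.add_sub_cancel, Bool.and_eq_true]
    refine ⟨mmrVerify_mmrProof _ _ (by omega), ?_⟩
    rw [hclaim i hi hc]
    refine E.quorum_selectSigs (p := fun k => ∃ i, member (E.committee strat (E.exec strat (r + 1))
        (r / E.C)) k =
        E.pk i ∧ E.HonestUntil (E.exec strat (r + 1)) r (r / E.C) i) (hmaj _ le_rfl) fun k hk hp => ?_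
    obtain ⟨i', hmem, hu⟩ := hp
    refine ⟨_, stateSig_mem hC hu hle hk hmem, ?_⟩
    have := hclaim i' (hunc i' hu).1 (hunc i' hu).2
    rw [honestClaim] at this
    rw [hmem, this]
    exact hstate i' hu.1 _ le_rfl _
  · cases j with
    | zero => simp [checkLeaf, honestAnswer, nth_ofList]
    | succ j =>
      simp only [checkLeaf, honestAnswer, nth_ofList, List.getD_cons_zero, List.getD_cons_succ,
          Nat.add_sub_cancel, Bool.and_eq_true,
        Nat.succ_ne_zero, if_false, decide_eq_true_eq]
      refine ⟨trivial, mmrVerify_mmrProof _ _ (by omega), ?_⟩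
      refine E.quorum_selectSigs (p := fun k => ∃ i,
          member (E.committee strat (E.exec strat (r + 1)) j) k =
        E.pk i ∧ E.HonestUntil (E.exec strat (r + 1)) r j i) (hmaj j (by omega)) fun k hk hp => ?_
      obtain ⟨i', hmem, hu⟩ := hp
      have h1 : (j + 1) * E.C ≤ r / E.C * E.C := Nat.mul_le_mul_right _ (by omega)
      refine ⟨_, handoverSig_mem hC hu (by omega) hk hmem, ?_⟩
      rw [hmem]
      exact hhand i' hu.1 _ (by omega) _
  · by_contra hne
    obtain ⟨k, hk, ⟨i, hmem, hu⟩, hv⟩ := E.exists_overlap (p := fun k => ∃ i,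
        member (E.committee strat (E.exec strat (r + 1)) (r / E.C)) k =
        E.pk i ∧ E.HonestUntil (E.exec strat (r + 1)) r (r / E.C) i) hq (hmaj _ le_rfl)
    rw [hmem] at hv
    refine hforge i _ _ _ (.state hc ha hk) ⟨hu, le_rfl, hv, fun h => hne ?_,
      stateMsg_ne_handoverMsg _ _ _⟩
    rw [← hclaim i (hunc i hu).1 (hunc i hu).2, honestClaim]
    simpa [stateMsg] using h
  · by_contra hne
    obtain ⟨k, hk, ⟨i, hmem, hu⟩, hv⟩ := E.exists_overlap (p := fun k => ∃ i,
        member (E.committee strat (E.exec strat (r + 1)) j) k =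
        E.pk i ∧ E.HonestUntil (E.exec strat (r + 1)) r j i) hq (hmaj j (by omega))
    rw [hmem] at hv
    refine hforge i _ _ _ (.handover ha (by omega) hk) ⟨hu, by omega, hv,
      (stateMsg_ne_handoverMsg _ _ _).symm, fun h => hne ?_⟩
    simpa [handoverMsg] using h

/-- An honest majority is not empty. -/
theorem HonestMajority.exists_honest {rs : List Round} (hmaj : E.HonestMajority strat rs) {ρ : ℕ}
    (hρ : ρ < rs.length) : ∃ i, E.Honest rs ρ i := by
  have h1 := hmaj (ρ / E.C) ((Nat.div_mul_le_self _ _).trans_lt hρ)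
  have h2 : Nat.card {k : Fin E.m // ∃ i, member (E.committee strat rs (ρ / E.C)) k = E.pk i ∧
      i < E.K ∧ ∀ ρ' < rs.length, ρ' / E.C ≤ ρ / E.C → E.Honest rs ρ' i} ≠ 0 := by omega
  obtain ⟨⟨k, i, -, -, h⟩⟩ := (Nat.card_ne_zero.mp h2).1
  exact ⟨i, h ρ hρ le_rfl⟩

/-- In safe executions with honest majorities, the state of an honest party at the beginning of the
epoch of round `r` is secure with the latency of one epoch. -/
theorem stateSecure (hC : 0 < E.C) {rs : List Round} (hsafe : E.Safe rs)
    (hmaj : E.HonestMajority strat rs) (hr : r < rs.length) {i : ℕ}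
    (hi : E.Honest rs (r / E.C * E.C) i) :
    E.StateSecure strat rs E.C r
      (E.stateCommitment (E.st₀ strat) (ledger rs (r / E.C * E.C) i)) := by
  have hle : r / E.C * E.C ≤ r := Nat.div_mul_le_self _ _
  have hlt : r < r / E.C * E.C + E.C := by
    have := Nat.div_add_mod' r E.C
    have := Nat.mod_lt r hC
    omega
  have heq : ∀ ρ < rs.length, ∀ i j, E.Honest rs ρ i → E.Honest rs ρ j →
      ledger rs ρ i <+: ledger rs ρ j := fun ρ hρ i j h1 h2 => hsafe j i ρ ρ le_rfl hρ h2 h1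
  refine ⟨_, rfl, fun r' hr' h => ?_, fun r' hr' h => ?_⟩
  · obtain ⟨j, hj⟩ := hmaj.exists_honest hr'
    exact ⟨_, ⟨⟨j, hj, rfl⟩, fun i' hi' => heq r' hr' _ _ hi' hj⟩,
      hsafe j i r' _ (by omega) hr' hj hi⟩
  · obtain ⟨j, hj⟩ := hmaj.exists_honest hr'
    exact ⟨_, ⟨⟨j, hj, rfl⟩, fun i' hi' => heq r' hr' _ _ hj hi'⟩,
      hsafe i j _ r' (by omega) (by omega) hi hj⟩

/-- A tournament only fails if the execution is not safe, a committee lacks an honest majority, or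
the adversary has shown a hash collision or a forged signature. -/
theorem tournamentFails (hC : 0 < E.C) {T : ℕ} (hr : r < T)
    (hsafe : E.Safe (E.exec (E.withTournament strat r) T))
    (hmaj : E.HonestMajority (E.withTournament strat r) (E.exec (E.withTournament strat r) T))
    (hstate : ∀ i < E.K, ∀ j ≤ r / E.C, ∀ msg,
      E.verify (E.pk i) j msg (E.signState i j msg) = true)
    (hhand : ∀ i < E.K, ∀ j ≤ r / E.C, ∀ msg,
      E.verify (E.pk i) j msg (E.signHandover i j msg) = true)
    {Ans : Data → Prop} (hAns : Ans = fun a => ∃ p, p <+: (E.tournament strat r).2 ∧ a = strat p)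
    (hfail : E.TournamentFails strat T r) :
    (∃ a b, HashInput E.hash (E.committee strat (E.exec strat (r + 1))) (r / E.C + 1) Ans a ∧
      HashInput E.hash (E.committee strat (E.exec strat (r + 1))) (r / E.C + 1) Ans b ∧ a ≠ b ∧
      E.hash a = E.hash b) ∨
    ∃ i t msg sig, SigCandidate E r Ans t msg sig ∧
      E.Forged strat r (E.exec strat (r + 1)) i t msg sig := by
  by_contra hcon
  rw [not_or] at hcon
  obtain ⟨hcol, hforge⟩ := hcon
  push Not at hcol hforge
  obtain ⟨hex, hnot⟩ := hfail
  apply hnot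
  have hle : r / E.C * E.C ≤ r := Nat.div_mul_le_self _ _
  have hpre : E.exec strat (r + 1) = E.exec (E.withTournament strat r) (r + 1) :=
    (E.exec_withTournament strat r le_rfl).symm
  have hon : ∀ i < E.K, corrupted (E.exec strat (r + 1)) i = false →
      E.Honest (E.exec (E.withTournament strat r) T) r i := by
    intro i hi hc
    rw [E.honest_exec _ (Nat.lt_succ_self r) (by omega), ← hpre]
    refine ⟨hi, ?_⟩
    rwa [E.take_exec strat le_rfl]
  have hon' : ∀ i < E.K, corrupted (E.exec strat (r + 1)) i = false →
      E.Honest (E.exec (E.withTournament strat r) T) (r / E.C * E.C) i :=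
    fun i hi hc => E.honest_mono hle (hon i hi hc)
  have hled : ∀ i, ledger (E.exec strat (r + 1)) (r / E.C * E.C) i =
      ledger (E.exec (E.withTournament strat r) T) (r / E.C * E.C) i := by
    intro i
    rw [hpre]
    exact (E.ledger_exec _ (Nat.lt_succ_of_le hle) (by omega) i).symm
  have hlen : r / E.C * E.C < (E.exec (E.withTournament strat r) T).length := by
    rw [length_exec]
    omega
  have key : ∃ i₀ < E.K, corrupted (E.exec strat (r + 1)) i₀ = false := by
    obtain ⟨i, hi⟩ := hmaj.exists_honest (ρ := r) (by rw [length_exec]; exact hr)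
    rw [E.honest_exec _ (Nat.lt_succ_self r) (by omega), ← hpre] at hi
    refine ⟨i, hi.1, ?_⟩
    rw [← E.take_exec strat le_rfl]
    exact hi.2
  obtain ⟨i₀, hi₀, hc₀⟩ := key
  have hs : Sound E strat (E.exec strat (r + 1)) r Ans
      (E.honestClaim strat (E.exec strat (r + 1)) r i₀) := by
    refine sound hC (fun i hi hc => ?_) (fun j hj => ?_) hstate hhand
      (fun a b ha hb h => by_contra fun hne => hcol a b ha hb hne h) hforge
    · rw [honestClaim, honestClaim, hled, hled]
      congr 1
      have h1 := hsafe i i₀ _ _ le_rfl hlen (hon' i hi hc) (hon' i₀ hi₀ hc₀)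
      have h2 := hsafe i₀ i _ _ le_rfl hlen (hon' i₀ hi₀ hc₀) (hon' i hi hc)
      exact h2.eq_of_length (le_antisymm h2.length_le h1.length_le)
    · have hj1 : j * E.C ≤ r / E.C * E.C := Nat.mul_le_mul_right _ hj
      have h1 := hmaj j (by omega)
      rw [E.committee_exec _ (k := r + 1) (by omega) (by omega) hC, ← hpre,
        committee_withTournament, length_exec] at h1
      refine h1.trans_le (Nat.mul_le_mul_left 2 ?_)
      refine Nat.card_mono (Set.toFinite _) ?_
      rintro k ⟨i, hk, hi, h⟩
      refine ⟨i, hk, hi, fun ρ hρ hj => ?_⟩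
      have := h ρ (by omega) hj
      rwa [E.honest_exec _ (Nat.lt_succ_of_le hρ) (by omega), ← hpre] at this
  rw [hAns] at hs
  refine ⟨_, Sound.tournament E strat r _ hs hex, ?_⟩
  rw [honestClaim, ← E.st₀_withTournament strat r, hled]
  exact stateSecure hC hsafe hmaj (by rw [length_exec]; exact hr) (hon' i₀ hi₀ hc₀)

end Soundness
end Env

/-! ### Executions as functions of the adversary's messages -/

namespace Env
variable (E : Env)

/-- The round that follows the rounds `rs`, when the adversary sends `move`. -/
def roundWith (gm st₀ move : Data) (rs : List Round) : Round :=
  let j := rs.length / E.C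
  let out := Outcome.ofData (E.step (gm :: rs.map Round.move ++ [move]))
  let S := if j = 0 then E.committeeOf st₀ else (outcome rs (j * E.C - 1)).nextCommittee
  { move := move
    out := out
    stateSigs :=
      if rs.length % E.C = 0 then
        ofList ((List.range E.K).map fun i =>
          if !(corrupted rs i || out.Grants i) && E.IsMember i S then
            E.signState i j (stateMsg (E.stateCommitment st₀ (out.ledger i)))
          else .nil)
      else .nil
    handoverSigs :=
      if (rs.length + 1) % E.C = 0 then
        ofList ((List.range E.K).map fun i =>
          if !(corrupted rs i || out.Grants i) && E.IsMember i S then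
            E.signHandover i j (handoverMsg (j + 1) out.nextCommittee) else .nil)
      else .nil
    leaks :=
      ofList ((List.range E.K).map fun i =>
        if out.Grants i && !corrupted rs i then E.sk i j else .nil) }

theorem nextRound_eq (strat : List Data → Data) (rs : List Round) :
    E.nextRound strat rs =
      E.roundWith (E.genesisMove strat) (E.st₀ strat) (strat (E.view strat rs)) rs := by
  have h : E.committee strat rs (rs.length / E.C) =
      if rs.length / E.C = 0 then E.committeeOf (E.st₀ strat)
      else (outcome rs (rs.length / E.C * E.C - 1)).nextCommittee := by
    cases rs.length / E.C with
    | zero => rfl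
    | succ j => rfl
  unfold nextRound roundWith
  dsimp only
  rw [h]

/-- The rounds without signatures and leaks. -/
def skeleton (gm : Data) (moves : List Data) : List Round :=
  (List.range moves.length).map fun ρ =>
    ⟨moves.getD ρ .nil, Outcome.ofData (E.step (gm :: moves.take (ρ + 1))), .nil, .nil, .nil⟩

/-- A round depends on the previous ones only through messages and outcomes, not through the
signatures and keys in them. All rounds can thus be computed independently of each other, without a
recursion in which sizes would have to be controlled. -/
theorem roundWith_congr (gm st₀ move : Data) {rs rs' : List Round}
    (h : rs.map (fun q => (q.move, q.out)) = rs'.map fun q => (q.move, q.out)) :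
    E.roundWith gm st₀ move rs = E.roundWith gm st₀ move rs' := by
  have h1 : rs.length = rs'.length := by simpa using congrArg List.length h
  have h2 : rs.map Round.move = rs'.map Round.move := by
    simpa [Function.comp_def] using congrArg (List.map Prod.fst) h
  have h3 : rs.map Round.out = rs'.map Round.out := by
    simpa [Function.comp_def] using congrArg (List.map Prod.snd) h
  have h4 : corrupted rs = corrupted rs' := by
    funext i
    have e : ∀ rs : List Round, corrupted rs i = (rs.map Round.out).any fun o => o.Grants i := by
      intro rs
      rw [corrupted, List.any_map]
      rfl
    rw [e, e, h3]
  have h5 : outcome rs = outcome rs' := by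
    funext ρ
    rw [outcome, outcome, ← List.getElem?_map, ← List.getElem?_map, h3]
  unfold roundWith
  rw [h1, h2, h4, h5]

/-- The rounds of an execution with given messages of the adversary. -/
def roundsWith (gm st₀ : Data) (moves : List Data) : List Round :=
  (List.range moves.length).map fun ρ =>
    E.roundWith gm st₀ (moves.getD ρ .nil) (E.skeleton gm (moves.take ρ))

/-- Given messages determine the rounds one after the other. -/
theorem roundsWith_snoc (gm st₀ move : Data) (moves : List Data) :
    E.roundsWith gm st₀ (moves ++ [move]) = E.roundsWith gm st₀ moves ++
      [E.roundWith gm st₀ move (E.skeleton gm moves)] := by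
  unfold roundsWith
  rw [List.length_append, List.length_singleton, List.range_succ, List.map_append]
  congr 1
  · refine List.map_congr_left fun ρ hρ => ?_
    rw [List.mem_range] at hρ
    rw [List.getD_append _ _ _ _ hρ, List.take_append_of_le_length hρ.le]
  · simp

theorem skeleton_roundsWith (gm st₀ : Data) (moves : List Data) :
    (E.skeleton gm moves).map (fun q => (q.move, q.out)) =
      (E.roundsWith gm st₀ moves).map fun q => (q.move, q.out) := by
  unfold skeleton roundsWith
  rw [List.map_map, List.map_map]
  refine List.map_congr_left fun ρ hρ => ?_
  rw [List.mem_range] at hρ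
  refine Prod.ext rfl ?_
  dsimp only [Function.comp_apply, roundWith]
  congr 3
  have : (E.skeleton gm (moves.take ρ)).map Round.move = moves.take ρ := by
    unfold skeleton
    apply List.ext_getElem
    · simp
    · intro i h1 h2
      simp at h1
      simp [List.getElem?_take, h1]
  change _ = (_ : List Data) ++ _
  rw [this, List.take_add_one, List.getElem?_eq_getElem hρ,
    List.getD_eq_getElem _ _ hρ]
  rfl

/-- The messages that the adversary sends in the first `k` rounds. -/
def movesOf (strat : List Data → Data) (k : ℕ) : List Data :=
  (List.range k).foldl (fun mv _ => mv ++ [strat (E.setupMsg :: E.st₀ strat ::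
    (E.roundsWith (E.genesisMove strat) (E.st₀ strat) mv).map Round.msg)]) []

/-- An execution, computed from the messages of the adversary. -/
theorem exec_eq_roundsWith (strat : List Data → Data) (k : ℕ) :
    E.exec strat k = E.roundsWith (E.genesisMove strat) (E.st₀ strat) (E.movesOf strat k) := by
  induction k with
  | zero => rfl
  | succ k ih =>
    have hm : E.movesOf strat (k + 1) = E.movesOf strat k ++
        [strat (E.view strat (E.exec strat k))] := by
      conv_lhs => rw [movesOf, List.range_succ, List.foldl_append]
      rw [view, ih]
      rfl
    rw [exec, hm, roundsWith_snoc, ← ih, nextRound_eq,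
      E.roundWith_congr _ _ _ (E.skeleton_roundsWith _ (E.st₀ strat) _), ← ih]

end Env

/-! ### The simulated world -/

section Layout
variable (H : HashFamily) (S : SignatureScheme) (PoS : PoSProtocol) (A : Adversary) (T : Polynomial ℕ)

/-- The number of values that a guess (of a round, a party and an epoch) can take. -/
noncomputable def guesses (n : ℕ) : ℕ := (T.eval n + 1) * (PoS.parties.eval n + 1) * (T.eval n + 1)

/-- A reduction uses a single string of coins for everything that it simulates: first the coins of
the adversary, then those for its guess, of the protocol, of the key generations, of the signatures
and key updates, and of the hash function. -/
noncomputable def posOffset (n : ℕ) : ℕ := A.coins.eval n + guesses PoS T n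

/-- Where the coins of the key generations begin. -/
noncomputable def genOffset (n : ℕ) : ℕ := posOffset PoS A T n + PoS.coins.eval n

/-- Where the coins of the operations with keys begin: three for each party and period, for the two
signatures and the update. -/
noncomputable def opOffset (n : ℕ) : ℕ := genOffset PoS A T n + PoS.parties.eval n * S.coins.eval n

/-- Where the coins of the hash function begin. -/
noncomputable def hashOffset (n : ℕ) : ℕ :=
  opOffset S PoS A T n + PoS.parties.eval n * T.eval n * 3 * S.coins.eval n

/-- The coins of a reduction from the key generation of party `i` on. -/
noncomputable def genBits (n : ℕ) (l : List Bool) (i : ℕ) : List Bool :=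
  l.drop (genOffset PoS A T n + i * S.coins.eval n)

/-- The coins of a reduction from operation `a` of party `i` in period `j` on. -/
noncomputable def opBits (n : ℕ) (l : List Bool) (i j a : ℕ) : List Bool :=
  l.drop (opOffset S PoS A T n + ((i * T.eval n + j) * 3 + a) * S.coins.eval n)

end Layout

/-- What a simulated world depends on: security parameter, hash key, coins of the reduction, the
targeted party and period, and the list of everything that the reduction has received in the attack
on the signature scheme. If there is no party of number `i`, nothing received is used. -/
structure SimCtx where
  n : ℕ
  s : Data
  l : List Bool
  i : ℕ
  t : ℕ
  recv : List Data

instance : Enc SimCtx := ⟨fun q => enc (q.n, q.s, q.l, q.i, q.t, q.recv)⟩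

theorem PT.simTuple {q : α → SimCtx} (hq : PT q) :
    PT fun x => ((q x).n, (q x).s, (q x).l, (q x).i, (q x).t, (q x).recv) := hq.congr_enc fun _ => rfl

@[fun_prop]
theorem PT.simMk {n i t : α → ℕ} {s : α → Data} {l : α → List Bool} {recv : α → List Data} (hn : PT n)
    (hs : PT s) (hl : PT l) (hi : PT i) (ht : PT t) (hr : PT recv) :
    PT fun x => SimCtx.mk (n x) (s x) (l x) (i x) (t x) (recv x) :=
  (hn.pair (hs.pair (hl.pair (hi.pair (ht.pair hr))))).congr_enc fun _ => rfl

@[fun_prop] theorem PT.simN {q : α → SimCtx} (hq : PT q) : PT fun x => (q x).n := hq.simTuple.prodFst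
@[fun_prop] theorem PT.simS {q : α → SimCtx} (hq : PT q) : PT fun x => (q x).s :=
  hq.simTuple.prodSnd.prodFst
@[fun_prop] theorem PT.simL {q : α → SimCtx} (hq : PT q) : PT fun x => (q x).l :=
  hq.simTuple.prodSnd.prodSnd.prodFst
@[fun_prop] theorem PT.simI {q : α → SimCtx} (hq : PT q) : PT fun x => (q x).i :=
  hq.simTuple.prodSnd.prodSnd.prodSnd.prodFst
@[fun_prop] theorem PT.simT {q : α → SimCtx} (hq : PT q) : PT fun x => (q x).t :=
  hq.simTuple.prodSnd.prodSnd.prodSnd.prodSnd.prodFst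
@[fun_prop] theorem PT.simRecv {q : α → SimCtx} (hq : PT q) : PT fun x => (q x).recv :=
  hq.simTuple.prodSnd.prodSnd.prodSnd.prodSnd.prodSnd

namespace SimCtx

section Defs
variable (H : HashFamily) (S : SignatureScheme) (X : StateMachine) (PoS : PoSProtocol) (A : Adversary)
  (m C : ℕ) (T : Polynomial ℕ) (q : SimCtx)

/-- The public keys. The first thing received from the challenger is the public key of the target.
-/
noncomputable def pk (j : ℕ) : Data :=
  if j = q.i then q.recv.getD 0 .nil else (S.genL q.n (genBits S PoS A T q.n q.l j)).1

/-- Keys of the targeted party are only known from the break-in on. -/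
noncomputable def key (j e : ℕ) : Data :=
  (List.range (e - if j = q.i then q.t + 1 else 0)).foldl (fun k u => clip (S.keyLen.eval q.n)
      (S.updateL q.n k (opBits S PoS A T q.n q.l j ((if j = q.i then q.t + 1 else 0) + u) 2)))
    (if j = q.i then q.recv.getD (3 * q.t + 4) .nil else (S.genL q.n (genBits S PoS A T q.n q.l j)).2)

/-- Signatures on state commitments. In the periods up to `t` those of the targeted party come from
the challenger, which has received one message from the forger before and three per period. -/
noncomputable def signState (j e : ℕ) (msg : Data) : Data :=
  if j = q.i ∧ e ≤ q.t then q.recv.getD (1 + 3 * e) .nil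
  else S.signL q.n (q.key S PoS A T j e) msg (opBits S PoS A T q.n q.l j e 0)

/-- Signatures on handover messages, those of the targeted party in the periods up to `t` being
taken from the challenger's replies. -/
noncomputable def signHandover (j e : ℕ) (msg : Data) : Data :=
  if j = q.i ∧ e ≤ q.t then q.recv.getD (2 + 3 * e) .nil
  else S.signL q.n (q.key S PoS A T j e) msg (opBits S PoS A T q.n q.l j e 1)

/-- All public keys. -/
noncomputable def pks : List Data := (List.range (PoS.parties.eval q.n)).map (q.pk S PoS A T)

/-- The simulated environment. -/
noncomputable def env : Env where
  m := m
  C := C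
  K := PoS.parties.eval q.n
  hashKey := q.s
  pk := q.pk S PoS A T
  sk := q.key S PoS A T
  signState := q.signState S PoS A T
  signHandover := q.signHandover S PoS A T
  verify := S.verify q.n
  hash := H.hash q.n q.s
  δ := X.δ
  commit := X.commit q.n q.s
  committeeOf := X.committee
  genesis := PoS.genesisL q.n (q.l.drop (posOffset PoS A T q.n)) q.s (q.pks S PoS A T)
  step := PoS.stepL q.n (q.l.drop (posOffset PoS A T q.n)) q.s (q.pks S PoS A T)

/-- The strategy of the adversary with the simulated coins. -/
def strat (h : List Data) : Data := A.nextL q.n q.l h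

/-- The simulated execution. -/
noncomputable def exec (k : ℕ) : List Round := (q.env H S X PoS A m C T).exec (q.strat A) k

end Defs
end SimCtx

section
variable (H : HashFamily) (S : SignatureScheme) (X : StateMachine) (PoS : PoSProtocol) (A : Adversary)
  (m C : ℕ) (T : Polynomial ℕ) {q : α → SimCtx}

@[fun_prop]
theorem PT.guesses {n : α → ℕ} (hn : PT n) : PT fun x => Superlight.guesses PoS T (n x) := by
  unfold Superlight.guesses
  fun_prop

@[fun_prop]
theorem PT.posOffset {n : α → ℕ} (hn : PT n) : PT fun x => Superlight.posOffset PoS A T (n x) := by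
  unfold Superlight.posOffset
  fun_prop

@[fun_prop]
theorem PT.genOffset {n : α → ℕ} (hn : PT n) : PT fun x => Superlight.genOffset PoS A T (n x) := by
  unfold Superlight.genOffset
  fun_prop

@[fun_prop]
theorem PT.opOffset {n : α → ℕ} (hn : PT n) : PT fun x => Superlight.opOffset S PoS A T (n x) := by
  unfold Superlight.opOffset
  fun_prop

@[fun_prop]
theorem PT.hashOffset {n : α → ℕ} (hn : PT n) : PT fun x => Superlight.hashOffset S PoS A T (n x) := by
  unfold Superlight.hashOffset
  fun_prop

@[fun_prop]
theorem PT.genBits {n i : α → ℕ} {l : α → List Bool} (hn : PT n) (hl : PT l) (hi : PT i) :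
    PT fun x => Superlight.genBits S PoS A T (n x) (l x) (i x) := by
  unfold Superlight.genBits
  fun_prop

@[fun_prop]
theorem PT.opBits {n i j a : α → ℕ} {l : α → List Bool} (hn : PT n) (hl : PT l) (hi : PT i) (hj : PT j)
    (ha : PT a) : PT fun x => Superlight.opBits S PoS A T (n x) (l x) (i x) (j x) (a x) := by
  unfold Superlight.opBits
  fun_prop

@[fun_prop]
theorem PT.simPk {j : α → ℕ} (hq : PT q) (hj : PT j) : PT fun x => (q x).pk S PoS A T (j x) := by
  unfold SimCtx.pk
  fun_prop

@[fun_prop]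
theorem PT.simKey {j e : α → ℕ} (hq : PT q) (hj : PT j) (he : PT e) :
    PT fun x => (q x).key S PoS A T (j x) (e x) := by
  unfold SimCtx.key
  have hinit : PT fun x => if j x = (q x).i then (q x).recv.getD (3 * (q x).t + 4) .nil
      else (S.genL (q x).n (Superlight.genBits S PoS A T (q x).n (q x).l (j x))).2 := by fun_prop
  have hlen : PT fun x => S.keyLen.eval (q x).n := by fun_prop
  refine PT.foldl (f := fun x (k : Data) (u : ℕ) => Superlight.clip (S.keyLen.eval (q x).n)
      (S.updateL (q x).n k (Superlight.opBits S PoS A T (q x).n (q x).l (j x)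
        ((if j x = (q x).i then (q x).t + 1 else 0) + u) 2)))
    (B := fun x => (enc (if j x = (q x).i then (q x).recv.getD (3 * (q x).t + 4) .nil
      else (S.genL (q x).n (Superlight.genBits S PoS A T (q x).n (q x).l (j x))).2)).size +
      (S.keyLen.eval (q x).n + 1)) (by fun_prop) hinit (by fun_prop) ?_ fun x l' _ => ?_
  · have h1 := hinit.pb
    have h2 := hlen.pbNat
    fun_prop
  · cases l' using List.reverseRecOn with
    | nil => exact Nat.le_add_right _ _
    | append_singleton l' u =>
      simp only [List.foldl_append, List.foldl_cons, List.foldl_nil]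
      exact (clip_size_le (b := S.keyLen.eval (q x).n)).trans (Nat.le_add_left _ _)

@[fun_prop]
theorem PT.simSignState {j e : α → ℕ} {msg : α → Data} (hq : PT q) (hj : PT j) (he : PT e)
    (hm : PT msg) : PT fun x => (q x).signState S PoS A T (j x) (e x) (msg x) := by
  unfold SimCtx.signState
  fun_prop

@[fun_prop]
theorem PT.simSignHandover {j e : α → ℕ} {msg : α → Data} (hq : PT q) (hj : PT j) (he : PT e)
    (hm : PT msg) : PT fun x => (q x).signHandover S PoS A T (j x) (e x) (msg x) := by
  unfold SimCtx.signHandover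
  fun_prop

@[fun_prop]
theorem PT.simPks (hq : PT q) : PT fun x => (q x).pks S PoS A T :=
  PT.map (f := fun x j => (q x).pk S PoS A T j) (by fun_prop) (by fun_prop)

@[fun_prop]
theorem PT.simStrat {h : α → List Data} (hq : PT q) (hh : PT h) : PT fun x => (q x).strat A (h x) := by
  unfold SimCtx.strat
  fun_prop

@[fun_prop]
theorem PT.simSetup (hq : PT q) : PT fun x => ((q x).env H S X PoS A m C T).setupMsg :=
  (show PT fun x => Data.cons (q x).s (Data.ofList ((q x).pks S PoS A T)) by fun_prop)

@[fun_prop]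
theorem PT.simGenesisMove (hq : PT q) :
    PT fun x => ((q x).env H S X PoS A m C T).genesisMove ((q x).strat A) := by
  unfold Env.genesisMove
  fun_prop

@[fun_prop]
theorem PT.simSt₀ (hq : PT q) :
    PT fun x => ((q x).env H S X PoS A m C T).st₀ ((q x).strat A) := by
  unfold Env.st₀
  have : PT fun x => PoS.genesisL (q x).n ((q x).l.drop (Superlight.posOffset PoS A T (q x).n)) (q x).s
      ((q x).pks S PoS A T) (((q x).env H S X PoS A m C T).genesisMove ((q x).strat A)) := by fun_prop
  exact this

@[fun_prop]
theorem PT.simIsMember {i : α → ℕ} {com : α → Data} (hq : PT q) (hi : PT i) (hc : PT com) :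
    PT fun x => ((q x).env H S X PoS A m C T).IsMember (i x) (com x) :=
  PT.any (f := fun x k => decide ((com x).nth k = (q x).pk S PoS A T (i x))) (by fun_prop)
    (by fun_prop)

@[fun_prop]
theorem PT.simStateCommitment {st : α → Data} {L : α → List Data} (hq : PT q) (hst : PT st)
    (hL : PT L) : PT fun x => ((q x).env H S X PoS A m C T).stateCommitment (st x) (L x) := by
  have : PT fun x => X.commit (q x).n (q x).s ((L x).foldl X.δ (st x)) := by fun_prop
  exact this

@[fun_prop]
theorem PT.simRoundWith {gm st move : α → Data} {rs : α → List Round} (hq : PT q) (hg : PT gm)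
    (hst : PT st) (hm : PT move) (hrs : PT rs) :
    PT fun x => ((q x).env H S X PoS A m C T).roundWith (gm x) (st x) (move x) (rs x) := by
  have hmv : PT fun x => (rs x).map Round.move :=
    PT.map (f := fun _ (r : Round) => r.move) hrs (by fun_prop)
  have hout : PT fun x => Outcome.ofData (((q x).env H S X PoS A m C T).step
      (gm x :: (rs x).map Round.move ++ [move x])) := by fun_prop
  have hcom : PT fun x => if (rs x).length / C = 0 then X.committee (st x)
      else (Env.outcome (rs x) ((rs x).length / C * C - 1)).nextCommittee := by fun_prop
  have hK : PT fun x => List.range (PoS.parties.eval (q x).n) := by fun_prop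
  have hout' := hout.comp (f := fun p : α × ℕ => p.1) (by fun_prop)
  have hcom' := hcom.comp (f := fun p : α × ℕ => p.1) (by fun_prop)
  have hq' : PT fun p : α × ℕ => q p.1 := by fun_prop
  have hactive : PT fun p : α × ℕ => !(Env.corrupted (rs p.1) p.2 ||
      (Outcome.ofData (((q p.1).env H S X PoS A m C T).step
        (gm p.1 :: (rs p.1).map Round.move ++ [move p.1]))).Grants p.2) &&
      ((q p.1).env H S X PoS A m C T).IsMember p.2 (if (rs p.1).length / C = 0 then X.committee (st p.1)
      else (Env.outcome (rs p.1) ((rs p.1).length / C * C - 1)).nextCommittee) := by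
    fun_prop
  refine PT.roundMk hm hout (PT.ite (by fun_prop) (PT.ofList (PT.map hK (PT.ite ?_ ?_ ?_)))
      (by fun_prop))
    (PT.ite (by fun_prop) (PT.ofList (PT.map hK (PT.ite ?_ ?_ ?_))) (by fun_prop))
    (PT.ofList (PT.map hK (PT.ite ?_ ?_ ?_)))
  · exact hactive.decideBool
  · change PT fun p : α × ℕ => (q p.1).signState S PoS A T p.2 ((rs p.1).length / C) _
    fun_prop
  · fun_prop
  · exact hactive.decideBool
  · change PT fun p : α × ℕ => (q p.1).signHandover S PoS A T p.2 ((rs p.1).length / C)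
      (Superlight.handoverMsg ((rs p.1).length / C + 1) _)
    exact PT.simSignHandover S PoS A T hq' (by fun_prop) (by fun_prop)
      (PT.handoverMsg (by fun_prop) hout'.nextCommittee)
  · fun_prop
  · fun_prop
  · change PT fun p : α × ℕ => (q p.1).key S PoS A T p.2 ((rs p.1).length / C)
    fun_prop
  · fun_prop

@[fun_prop]
theorem PT.simRoundsWith {gm st : α → Data} {mv : α → List Data} (hq : PT q) (hg : PT gm)
    (hst : PT st) (hm : PT mv) :
    PT fun x => ((q x).env H S X PoS A m C T).roundsWith (gm x) (st x) (mv x) := by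
  refine PT.map (f := fun x ρ => ((q x).env H S X PoS A m C T).roundWith (gm x) (st x)
    ((mv x).getD ρ .nil) (((q x).env H S X PoS A m C T).skeleton (gm x)
        ((mv x).take ρ))) (by fun_prop) ?_
  have : PT fun p : α × ℕ => ((q p.1).env H S X PoS A m C T).skeleton (gm p.1) ((mv p.1).take p.2) :=
    PT.map (f := fun (p : α × ℕ) (ρ : ℕ) => Round.mk (((mv p.1).take p.2).getD ρ .nil)
      (Outcome.ofData (((q p.1).env H S X PoS A m C T).step
        (gm p.1 :: ((mv p.1).take p.2).take (ρ + 1)))) .nil .nil .nil) (by fun_prop) (by fun_prop)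
  fun_prop

/-- The messages of the adversary can be computed one by one, since the sizes of its messages are
bounded by its own polynomial. -/
@[fun_prop]
theorem PT.simMovesOf {k : α → ℕ} (hq : PT q) (hk : PT k) :
    PT fun x => ((q x).env H S X PoS A m C T).movesOf ((q x).strat A) (k x) := by
  have hlen : PT fun x => A.len.eval (q x).n := by fun_prop
  refine PT.foldl (f := fun x (mv : List Data) (_ : ℕ) => mv ++ [(q x).strat A
    (((q x).env H S X PoS A m C T).setupMsg :: ((q x).env H S X PoS A m C T).st₀ ((q x).strat A) ::
    (((q x).env H S X PoS A m C T).roundsWith (((q x).env H S X PoS A m C T).genesisMove ((q x).strat A))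
      (((q x).env H S X PoS A m C T).st₀ ((q x).strat A)) mv).map Round.msg)])
    (B := fun x => k x * (A.len.eval (q x).n + 1)
        + 1) (by fun_prop) (by fun_prop) ?_ ?_ fun x l' hl' => ?_
  · have hr : PT fun p : α × List Data × ℕ => (((q p.1).env H S X PoS A m C T).roundsWith
      (((q p.1).env H S X PoS A m C T).genesisMove ((q p.1).strat A))
      (((q p.1).env H S X PoS A m C T).st₀ ((q p.1).strat A)) p.2.1).map Round.msg :=
      PT.map (f := fun _ (r : Round) => r.msg) (by fun_prop) (by fun_prop)
    fun_prop
  · have h1 := hlen.pbNat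
    have h2 := hk.pbNat
    fun_prop
  · have hl : l'.length ≤ k x := by simpa using hl'.length_le
    refine le_trans ?_ (Nat.add_le_add_right (Nat.mul_le_mul_right _ hl) 1)
    clear hl hl'
    induction l' using List.reverseRecOn with
    | nil => simp [enc_list_nil, Data.size]
    | append_singleton l' u ih =>
      simp only [List.foldl_append, List.foldl_cons, List.foldl_nil, List.length_append,
        List.length_singleton]
      refine (GCtx.enc_snoc_size _ _).le.trans ?_
      refine (Nat.add_le_add_right (Nat.add_le_add ih (A.next_size _ _ _)) 1).trans ?_
      rw [Nat.succ_mul]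
      omega

@[fun_prop]
theorem PT.simExec {k : α → ℕ} (hq : PT q) (hk : PT k) :
    PT fun x => (q x).exec H S X PoS A m C T (k x) := by
  unfold SimCtx.exec
  simp only [Env.exec_eq_roundsWith]
  fun_prop

end

/-! ### Searching the transcript of a tournament -/

namespace GCtx
section Defs
variable (H : HashFamily) (S : SignatureScheme) (X : StateMachine) (PoS : PoSProtocol) (A : Adversary)
  (m C : ℕ) (c : GCtx)

/-- All answers of the adversary in a tournament with the transcript `fin`. -/
def answers (fin : List Data) : List Data :=
  (List.range (fin.length + 1)).map fun k => c.strat A (fin.take k)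

/-- All hash inputs that occur in a tournament, where `as` are the answers of the adversary. -/
def hashInputs (as : List Data) : List Data :=
  (as.flatMap fun a => .cons a.fst a.snd :: a.nth 0 ::
    (List.range (c.leaves C)).flatMap fun i => (List.range (c.leaves C + 1)).map fun k =>
      climbInput (c.hash H) (i - (mmrTree (c.leaves C) i).2) (a.nth 1) (a.nth 2) k) ++
  (c.committees X C ++ (List.range (c.leaves C)).flatMap fun o =>
    (List.range (c.leaves C)).map fun k =>
      .cons (c.node H X C k o) (c.node H X C k (o + cappedPow (c.leaves C) k)))

/-- Two inputs with the same hash, if there are such among the candidates. -/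
def findCollision (l : List Data) : Data :=
  (((l.product l).find? fun x => !decide (x.1 = x.2) && decide (c.hash H x.1 = c.hash H x.2)).map
    fun x => .cons x.1 x.2).getD .nil

/-- All signatures that the adversary shows in a tournament: period, message and signature. -/
def sigCandidates (as : List Data) : List (ℕ × Data × Data) :=
  as.flatMap fun a => (List.range m).flatMap fun k =>
    as.map (fun d => (c.r / C, stateMsg d, (a.nth 3).nth k)) ++
    (List.range (c.r / C)).map fun j => (j, handoverMsg (j + 1) (a.nth 0), (a.nth 3).nth k)

end Defs

section Spec
variable {H : HashFamily} {S : SignatureScheme} {X : StateMachine} {PoS : PoSProtocol} {A : Adversary}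
  {m C : ℕ} {c : GCtx} {E : Env}

theorem mem_answers {fin p : List Data} (hp : p <+: fin) : c.strat A p ∈ c.answers A fin := by
  refine List.mem_map.mpr ⟨p.length, List.mem_range.mpr (Nat.lt_succ_of_le hp.length_le), ?_⟩
  rw [← List.prefix_iff_eq_take.mp hp]

/-- The list contains all inputs whose collision could make the tournament fail. -/
theorem Fits.mem_hashInputs (f : c.Fits H S X PoS A m C E) {Ans : Data → Prop} {as : List Data}
    (has : ∀ a, Ans a → a ∈ as) {x : Data}
    (hx : HashInput E.hash (E.committee (c.strat A) c.rs) (c.leaves C) Ans x) :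
    x ∈ c.hashInputs H X C as := by
  unfold hashInputs
  rw [List.mem_append, List.mem_append]
  cases hx with
  | children ha => exact Or.inl (List.mem_flatMap.mpr ⟨_, has _ ha, by simp⟩)
  | leaf ha => exact Or.inl (List.mem_flatMap.mpr ⟨_, has _ ha, by simp⟩)
  | @climb a i k ha hi hk =>
    refine Or.inl (List.mem_flatMap.mpr ⟨_, has _ ha,
        List.mem_cons_of_mem _ (List.mem_cons_of_mem _ ?_)⟩)
    have h1 := mmrTrees_mem (mmrTree_mem hi)
    have h2 := Nat.lt_two_pow_self (n := (mmrTree (c.leaves C) i).1)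
    exact List.mem_flatMap.mpr ⟨i, List.mem_range.mpr hi, List.mem_map.mpr
      ⟨k, List.mem_range.mpr (by omega), by rw [f.hash]⟩⟩
  | honestLeaf ho =>
    refine Or.inr (Or.inl (List.mem_map.mpr ⟨_, List.mem_range.mpr ho, (f.committee _).symm⟩))
  | @honestNode k o h =>
    have hp : 2 ^ (k + 1) = 2 ^ k + 2 ^ k := by ring
    have h1 := Nat.lt_two_pow_self (n := k)
    refine Or.inr (Or.inr (List.mem_flatMap.mpr ⟨o, List.mem_range.mpr (by omega), List.mem_map.mpr
      ⟨k, List.mem_range.mpr (by omega), ?_⟩⟩))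
    unfold node
    rw [f.hash, cappedPow_eq, min_eq_left (by omega), merkleNode_eq f.committees k o (by omega),
      merkleNode_eq f.committees k (o + 2 ^ k) (by omega)]

theorem findCollision_spec {l : List Data} {a b : Data} (ha : a ∈ l) (hb : b ∈ l) (hne : a ≠ b)
    (h : c.hash H a = c.hash H b) : (c.findCollision H l).fst ≠ (c.findCollision H l).snd ∧
      c.hash H (c.findCollision H l).fst = c.hash H (c.findCollision H l).snd := by
  unfold findCollision
  have h1 : ((l.product l).find? fun x =>
      !decide (x.1 = x.2) && decide (c.hash H x.1 = c.hash H x.2)).isSome := by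
    rw [List.find?_isSome]
    exact ⟨(a, b), List.mem_product.mpr ⟨ha, hb⟩, by simp [hne, h]⟩
  obtain ⟨x, hx⟩ := Option.isSome_iff_exists.mp h1
  rw [hx]
  simpa [Data.fst, Data.snd] using List.find?_some hx

/-- The list contains all signatures that could make the tournament fail. -/
theorem Fits.mem_sigCandidates (f : c.Fits H S X PoS A m C E) {Ans : Data → Prop} {as : List Data}
    (has : ∀ a, Ans a → a ∈ as) {t : ℕ} {msg sig : Data} (h : E.SigCandidate c.r Ans t msg sig) :
    (t, msg, sig) ∈ c.sigCandidates m C as := by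
  unfold sigCandidates
  have hm := f.m_eq
  have hC := f.C_eq
  cases h with
  | @state d a k hd ha hk =>
    refine List.mem_flatMap.mpr ⟨a, has _ ha, List.mem_flatMap.mpr ⟨k, List.mem_range.mpr (hm ▸ hk),
      List.mem_append_left _ (List.mem_map.mpr ⟨d, has _ hd, by rw [hC]⟩)⟩⟩
  | @handover a _ k ha hj hk =>
    exact List.mem_flatMap.mpr ⟨a, has _ ha, List.mem_flatMap.mpr ⟨k, List.mem_range.mpr (hm ▸ hk),
      List.mem_append_right _ (List.mem_map.mpr ⟨t, List.mem_range.mpr (hC ▸ hj), rfl⟩)⟩⟩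

end Spec
end GCtx

section
variable (H : HashFamily) (S : SignatureScheme) (X : StateMachine) (PoS : PoSProtocol) (A : Adversary)
  (m C : ℕ) {c : α → GCtx}

@[fun_prop]
theorem PT.answers {fin : α → List Data} (hc : PT c) (hf : PT fin) :
    PT fun x => (c x).answers A (fin x) :=
  PT.map (f := fun x k => (c x).strat A ((fin x).take k)) (by fun_prop) (by fun_prop)

@[fun_prop]
theorem PT.climbInput {i k : α → ℕ} {v π : α → Data} (hc : PT c) (hi : PT i) (hv : PT v) (hπ : PT π)
    (hk : PT k) : PT fun x => Superlight.climbInput ((c x).hash H) (i x) (v x) (π x) (k x) := by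
  have h : PT fun x => Superlight.merkleClimb ((c x).hash H) (i x) (v x) (π x) (k x - 1) :=
    PT.merkleClimb H (by fun_prop) (by fun_prop) hi hv hπ (by fun_prop)
  have h2 : PT fun x => if k x = 0 then v x else if (i x).testBit (k x - 1) = true then
      .cons ((π x).nth (k x - 1)) (Superlight.merkleClimb ((c x).hash H) (i x) (v x) (π x) (k x - 1))
      else .cons (Superlight.merkleClimb ((c x).hash H) (i x) (v x) (π x) (k x - 1))
        ((π x).nth (k x - 1)) := by fun_prop
  refine h2.congr fun x => ?_
  cases k x with
  | zero => rfl
  | succ k => simp [Superlight.climbInput]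

@[fun_prop]
theorem PT.hashInputs {as : α → List Data} (hc : PT c) (has : PT as) :
    PT fun x => (c x).hashInputs H X C (as x) := by
  refine PT.append (PT.flatMap has ?_) (PT.append (by fun_prop) (PT.flatMap (by fun_prop)
    (PT.map (by fun_prop) (by fun_prop))))
  have : PT fun p : α × Data => (List.range ((c p.1).leaves C)).flatMap fun i =>
      (List.range ((c p.1).leaves C + 1)).map fun k => Superlight.climbInput ((c p.1).hash H)
        (i - (Superlight.mmrTree ((c p.1).leaves C) i).2) (p.2.nth 1) (p.2.nth 2) k :=
    PT.flatMap (by fun_prop) (PT.map (by fun_prop) (by fun_prop))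
  fun_prop

@[fun_prop]
theorem PT.findCollision {l : α → List Data} (hc : PT c) (hl : PT l) :
    PT fun x => (c x).findCollision H (l x) := by
  have h1 : PT fun x => (l x).product (l x) :=
    PT.flatMap (f := fun x a => (l x).map (Prod.mk a)) hl
      (PT.map (f := fun (p : α × Data) b => (p.2, b)) (by fun_prop) (by fun_prop))
  have h2 : PT fun x => ((l x).product (l x)).find? fun y =>
      !decide (y.1 = y.2) && decide ((c x).hash H y.1 = (c x).hash H y.2) :=
    PT.find? (f := fun x (y : Data × Data) =>
      !decide (y.1 = y.2) && decide ((c x).hash H y.1 = (c x).hash H y.2)) h1 (by fun_prop)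
  exact (PT.optionMap (f := fun _ (y : Data × Data) => Data.cons y.1 y.2) h2
    (by fun_prop)).optionGetD (by fun_prop)

@[fun_prop]
theorem PT.sigCandidates {as : α → List Data} (hc : PT c) (has : PT as) :
    PT fun x => (c x).sigCandidates m C (as x) := by
  refine PT.flatMap has (PT.flatMap (by fun_prop) (PT.append (PT.map (by fun_prop) (by fun_prop))
    (PT.map (by fun_prop) ?_)))
  fun_prop

end

/-! ### The reductions -/

section Guess
variable (PoS : PoSProtocol) (A : Adversary) (T : Polynomial ℕ)

/-- The number with the given binary digits (least significant first), modulo `M`. -/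
def bitsMod (M : ℕ) (l : List Bool) : ℕ :=
  l.reverse.foldl (fun x b => (2 * x + if b then 1 else 0) % M) 0

/-- The value of the guess, read from its coins. -/
noncomputable def guess (n : ℕ) (l : List Bool) : ℕ :=
  bitsMod (guesses PoS T n) ((l.drop (A.coins.eval n)).take (guesses PoS T n))

/-- The guessed round of the tournament. -/
noncomputable def guessRound (n : ℕ) (l : List Bool) : ℕ := guess PoS A T n l % (T.eval n + 1)

/-- The guessed party whose signature is forged. -/
noncomputable def guessParty (n : ℕ) (l : List Bool) : ℕ :=
  guess PoS A T n l / (T.eval n + 1) % (PoS.parties.eval n + 1)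

/-- The guessed period for which a signature is forged. -/
noncomputable def guessPeriod (n : ℕ) (l : List Bool) : ℕ :=
  guess PoS A T n l / (T.eval n + 1) / (PoS.parties.eval n + 1)

theorem guesses_pos (n : ℕ) : 0 < guesses PoS T n := by
  unfold guesses
  positivity

theorem PT.bitsMod {M : α → ℕ} {l : α → List Bool} (hM : PT M) (hl : PT l) (hpos : ∀ x, 0 < M x) :
    PT fun x => bitsMod (M x) (l x) := by
  refine PT.foldl (f := fun x (y : ℕ) (b : Bool) => (2 * y + if b then 1 else 0) % M x)
    (g := fun _ => 0) (l := fun x => (l x).reverse) (B := fun x => 2 * M x + 1)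
    (by fun_prop) (by fun_prop) (by fun_prop) ?_ fun x l' _ => ?_
  · have := hM.pbNat
    fun_prop
  · rw [enc_nat_size]
    cases l' using List.reverseRecOn with
    | nil => simp
    | append_singleton l' b =>
      simp only [List.foldl_append, List.foldl_cons, List.foldl_nil]
      have := Nat.mod_lt (2 * l'.foldl (fun (y : ℕ) (b : Bool) => (2 * y + if b then 1 else 0)
          % M x) 0 +
        if b then 1 else 0) (hpos x)
      omega

variable {n : α → ℕ} {l : α → List Bool}

@[fun_prop]
theorem PT.guess (hn : PT n) (hl : PT l) : PT fun x => guess PoS A T (n x) (l x) :=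
  PT.bitsMod (by fun_prop) (by fun_prop) fun x => guesses_pos PoS T (n x)

@[fun_prop]
theorem PT.guessRound (hn : PT n) (hl : PT l) : PT fun x => guessRound PoS A T (n x) (l x) := by
  unfold Superlight.guessRound
  fun_prop

@[fun_prop]
theorem PT.guessParty (hn : PT n) (hl : PT l) : PT fun x => guessParty PoS A T (n x) (l x) := by
  unfold Superlight.guessParty
  fun_prop

@[fun_prop]
theorem PT.guessPeriod (hn : PT n) (hl : PT l) : PT fun x => guessPeriod PoS A T (n x) (l x) := by
  unfold Superlight.guessPeriod
  fun_prop

end Guess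

/-- The data of a tournament, read off from the messages that the adversary has received before. -/
def GCtx.ofView (A : Adversary) (n : ℕ) (l : List Bool) (r : ℕ) (h : List Data) : GCtx :=
  ⟨n, (h.getD 0 .nil).fst, l, r, h.getD 1 .nil, (List.range (h.length - 2)).map fun k =>
    ⟨A.nextL n l (h.take (k + 2)), Outcome.ofData ((h.getD (k + 2) .nil).nth 0),
      (h.getD (k + 2) .nil).nth 1, (h.getD (k + 2) .nil).nth 2, (h.getD (k + 2) .nil).nth 3⟩⟩

namespace Env
variable (E : Env) (strat : List Data → Data)

/-- The query for the signature of party `i` on its state commitment in epoch `j`. -/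
def stateQuery (i j : ℕ) : Data :=
  if E.IsMember i (E.committee strat (E.exec strat (j * E.C)) j) then
    .cons (num 0) (stateMsg (E.stateCommitment (E.st₀ strat)
      ((E.nextRound strat (E.exec strat (j * E.C))).out.ledger i)))
  else .nil

/-- The query for the signature of party `i` on the handover message of epoch `j`. -/
def handoverQuery (i j : ℕ) : Data :=
  if E.IsMember i (E.committee strat (E.exec strat ((j + 1) * E.C - 1)) j) then
    .cons (num 0) (handoverMsg (j + 1) (E.nextRound strat
      (E.exec strat ((j + 1) * E.C - 1))).out.nextCommittee)
  else .nil

/-- A signature of party `i` for period `t` from the list `sigs`, on a message that this party does not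
sign. -/
def forgery (sigs : List (ℕ × Data × Data)) (r i t : ℕ) : Data :=
  ((sigs.find? fun x => decide (x.1 = t) && E.verify (E.pk i) t x.2.1 x.2.2 &&
      !decide (x.2.1 = stateMsg (E.stateCommitment (E.st₀ strat)
        (ledger (E.exec strat (r + 1)) (t * E.C) i))) &&
      !decide (x.2.1 = handoverMsg (t + 1) (E.committee strat (E.exec strat (r + 1)) (t + 1)))).map
    fun x => ofList [num t, x.2.1, x.2.2]).getD .nil

end Env

section Reductions
variable (H : HashFamily) (S : SignatureScheme) (X : StateMachine) (PoS : PoSProtocol) (A : Adversary)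
  (m C : ℕ) (T : Polynomial ℕ)

/-- The behaviour towards the protocol of an adversary that has taken part in the tournament of the
guessed round. -/
noncomputable def tournamentMove (n : ℕ) (l : List Bool) (h : List Data) : Data :=
  if h.length < guessRound PoS A T n l + 3 then A.nextL n l h
  else A.nextL n l (((GCtx.ofView A n l (guessRound PoS A T n l)
    (h.take (guessRound PoS A T n l + 3))).tournament H S X PoS A m C
      (h.take (guessRound PoS A T n l + 3))).2 ++ h.drop (guessRound PoS A T n l + 3))

namespace SimCtx
variable (q : SimCtx)

/-- What the adversary has received before the simulated round `k`. -/
noncomputable def view (k : ℕ) : List Data :=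
  (q.env H S X PoS A m C T).view (q.strat A) (q.exec H S X PoS A m C T k)

/-- The data of the tournament of round `r` in the simulated world. -/
noncomputable def gctx (r : ℕ) : GCtx :=
  ⟨q.n, q.s, q.l, r, (q.env H S X PoS A m C T).st₀ (q.strat A), q.exec H S X PoS A m C T (r + 1)⟩

/-- The answers of the adversary in the tournament of round `r`. -/
noncomputable def answers (r : ℕ) : List Data :=
  (q.gctx H S X PoS A m C T r).answers A ((q.gctx H S X PoS A m C T r).tournament H S X PoS A m C
    (q.view H S X PoS A m C T (r + 1))).2

/-- Two inputs with the same hash, from the tournament of round `r`. -/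
noncomputable def collision (r : ℕ) : Data :=
  (q.gctx H S X PoS A m C T r).findCollision H
    ((q.gctx H S X PoS A m C T r).hashInputs H X C (q.answers H S X PoS A m C T r))

/-- The query for a signature on a state commitment, computed in the simulated world. -/
noncomputable def stateQuery (i j : ℕ) : Data := (q.env H S X PoS A m C T).stateQuery (q.strat A) i j

/-- The query for a signature on a handover message, computed in the simulated world. -/
noncomputable def handoverQuery (i j : ℕ) : Data :=
  (q.env H S X PoS A m C T).handoverQuery (q.strat A) i j

/-- A forgery for party `i` and period `t` from the tournament of round `r`. -/
noncomputable def forgery (r i t : ℕ) : Data :=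
  (q.env H S X PoS A m C T).forgery (q.strat A)
    ((q.gctx H S X PoS A m C T r).sigCandidates m C (q.answers H S X PoS A m C T r)) r i t

/-- The moves of the forger: for each period up to the targeted one the two signing queries and the
evolution of the key, then the break-in (unless the execution does not go beyond the targeted
period), and finally the forgery. -/
noncomputable def forgerMove (r : ℕ) : Data :=
  let k := q.recv.length - 1
  if k < 3 * q.t + 3 then
    if k % 3 = 0 then q.stateQuery H S X PoS A m C T q.i (k / 3)
    else if k % 3 = 1 then
      if (k / 3 + 1) * C ≤ r + 1 then q.handoverQuery H S X PoS A m C T q.i (k / 3) else .nil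
    else if k / 3 < r / C then .cons (num 1) .nil else .nil
  else if q.t < r / C then
    if k = 3 * q.t + 3 then .cons (num 2) .nil else q.forgery H S X PoS A m C T r q.i q.t
  else if k = 3 * T.eval q.n + 4 then q.forgery H S X PoS A m C T r q.i q.t else .nil

end SimCtx

/-- The output of the collision finder. -/
noncomputable def collisionOutput (n : ℕ) (l : List Bool) (recv : List Data) : Data :=
  (SimCtx.mk n (recv.getD 0 .nil) l (PoS.parties.eval n) 0 []).collision H S X PoS A m C T
    (guessRound PoS A T n l)

/-- The messages of the forger, whose target is the guessed party and period. -/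
noncomputable def forgerOutput (n : ℕ) (l : List Bool) (recv : List Data) : Data :=
  (SimCtx.mk n (H.genL n (l.drop (hashOffset S PoS A T n))) l (guessParty PoS A T n l)
    (guessPeriod PoS A T n l) recv).forgerMove H S X PoS A m C T (guessRound PoS A T n l)

variable {q : α → SimCtx} {r i j t : α → ℕ}

@[fun_prop]
theorem PT.ofView {n r : α → ℕ} {l : α → List Bool} {h : α → List Data} (hn : PT n) (hl : PT l)
    (hr : PT r) (hh : PT h) : PT fun x => GCtx.ofView A (n x) (l x) (r x) (h x) := by
  refine PT.ctxMk hn (by fun_prop) hl hr (by fun_prop) (PT.map (by fun_prop) ?_)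
  fun_prop

@[fun_prop]
theorem PT.tournamentMove {n : α → ℕ} {l : α → List Bool} {h : α → List Data} (hn : PT n) (hl : PT l)
    (hh : PT h) : PT fun x => tournamentMove H S X PoS A m C T (n x) (l x) (h x) := by
  unfold Superlight.tournamentMove
  fun_prop

@[fun_prop]
theorem PT.simView {k : α → ℕ} (hq : PT q) (hk : PT k) :
    PT fun x => (q x).view H S X PoS A m C T (k x) := by
  unfold SimCtx.view Env.view
  have : PT fun x => ((q x).exec H S X PoS A m C T (k x)).map Round.msg :=
    PT.map (f := fun _ (r : Round) => r.msg) (by fun_prop) (by fun_prop)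
  fun_prop

@[fun_prop]
theorem PT.simGctx (hq : PT q) (hr : PT r) : PT fun x => (q x).gctx H S X PoS A m C T (r x) := by
  unfold SimCtx.gctx
  fun_prop

@[fun_prop]
theorem PT.simAnswers (hq : PT q) (hr : PT r) :
    PT fun x => (q x).answers H S X PoS A m C T (r x) := by
  unfold SimCtx.answers
  fun_prop

@[fun_prop]
theorem PT.simCollision (hq : PT q) (hr : PT r) :
    PT fun x => (q x).collision H S X PoS A m C T (r x) := by
  unfold SimCtx.collision
  fun_prop

@[fun_prop]
theorem PT.simCommittee {rs : α → List Round} (hq : PT q) (hrs : PT rs) (hj : PT j) :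
    PT fun x => ((q x).env H S X PoS A m C T).committee ((q x).strat A) (rs x) (j x) := by
  have h : PT fun x => if j x = 0 then X.committee (((q x).env H S X PoS A m C T).st₀ ((q x).strat A))
      else (Env.outcome (rs x) (j x * C - 1)).nextCommittee := by fun_prop
  refine h.congr fun x => ?_
  cases j x <;> rfl

@[fun_prop]
theorem PT.simNextRound {k : α → ℕ} (hq : PT q) (hk : PT k) :
    PT fun x => ((q x).env H S X PoS A m C T).nextRound ((q x).strat A)
      ((q x).exec H S X PoS A m C T (k x)) := by
  simp only [Env.nextRound_eq]
  have : PT fun x => ((q x).env H S X PoS A m C T).view ((q x).strat A)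
    ((q x).exec H S X PoS A m C T (k x)) := PT.simView H S X PoS A m C T hq hk
  fun_prop

theorem SimCtx.env_C (q : SimCtx) : (q.env H S X PoS A m C T).C = C := rfl

@[fun_prop]
theorem PT.simStateQuery (hq : PT q) (hi : PT i) (hj : PT j) :
    PT fun x => (q x).stateQuery H S X PoS A m C T (i x) (j x) := by
  unfold SimCtx.stateQuery Env.stateQuery
  simp only [SimCtx.env_C]
  have h1 := PT.simNextRound H S X PoS A m C T (k := fun x => j x * C) hq (by fun_prop)
  have h2 : PT fun x => (q x).exec H S X PoS A m C T (j x * C) := by fun_prop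
  unfold SimCtx.exec at h1 h2
  fun_prop

@[fun_prop]
theorem PT.simHandoverQuery (hq : PT q) (hi : PT i) (hj : PT j) :
    PT fun x => (q x).handoverQuery H S X PoS A m C T (i x) (j x) := by
  unfold SimCtx.handoverQuery Env.handoverQuery
  simp only [SimCtx.env_C]
  have h1 := PT.simNextRound H S X PoS A m C T (k := fun x => (j x + 1) * C - 1) hq (by fun_prop)
  have h2 : PT fun x => (q x).exec H S X PoS A m C T ((j x + 1) * C - 1) := by fun_prop
  unfold SimCtx.exec at h1 h2
  fun_prop

@[fun_prop]
theorem PT.simForgery (hq : PT q) (hr : PT r) (hi : PT i) (ht : PT t) :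
    PT fun x => (q x).forgery H S X PoS A m C T (r x) (i x) (t x) := by
  unfold SimCtx.forgery Env.forgery
  simp only [SimCtx.env_C]
  have h2 : PT fun p : α × ℕ × Data × Data =>
      (q p.1).exec H S X PoS A m C T (r p.1 + 1) := by fun_prop
  have h3 : ∀ (q : SimCtx) i t msg sig, (q.env H S X PoS A m C T).verify
      ((q.env H S X PoS A m C T).pk i) t msg sig = S.verify q.n (q.pk S PoS A T i) t msg sig :=
    fun _ _ _ _ _ => rfl
  simp only [h3]
  unfold SimCtx.exec at h2
  refine PT.optionGetD (PT.optionMap (PT.find? (by fun_prop) ?_) (by fun_prop)) (by fun_prop)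
  fun_prop

@[fun_prop]
theorem PT.simForgerMove (hq : PT q) (hr : PT r) :
    PT fun x => (q x).forgerMove H S X PoS A m C T (r x) := by
  unfold SimCtx.forgerMove
  fun_prop

@[fun_prop]
theorem PT.collisionOutput {n : α → ℕ} {l : α → List Bool} {h : α → List Data} (hn : PT n) (hl : PT l)
    (hh : PT h) : PT fun x => collisionOutput H S X PoS A m C T (n x) (l x) (h x) := by
  unfold Superlight.collisionOutput
  fun_prop

@[fun_prop]
theorem PT.forgerOutput {n : α → ℕ} {l : α → List Bool} {h : α → List Data} (hn : PT n) (hl : PT l)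
    (hh : PT h) : PT fun x => forgerOutput H S X PoS A m C T (n x) (l x) (h x) := by
  unfold Superlight.forgerOutput
  fun_prop

end Reductions

/-! ### Executions in the simulated world -/

namespace Env

/-- The environments differ at most in the secret keys and signatures of their parties. -/
structure Agree (E' E : Env) : Prop where
  m_eq : E'.m = E.m
  C_eq : E'.C = E.C
  K_eq : E'.K = E.K
  hashKey_eq : E'.hashKey = E.hashKey
  pk_eq : ∀ i < E.K, E'.pk i = E.pk i
  verify_eq : E'.verify = E.verify
  δ_eq : E'.δ = E.δ
  commit_eq : E'.commit = E.commit
  committeeOf_eq : E'.committeeOf = E.committeeOf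
  genesis_eq : E'.genesis = E.genesis
  step_eq : E'.step = E.step

namespace Agree
variable {E' E : Env} (a : E'.Agree E) (strat : List Data → Data)
include a

theorem setupMsg : E'.setupMsg = E.setupMsg := by
  rw [Env.setupMsg, Env.setupMsg, a.hashKey_eq, a.K_eq]
  congr 2
  exact List.map_congr_left fun i hi => a.pk_eq i (List.mem_range.mp hi)

theorem genesisMove : E'.genesisMove strat = E.genesisMove strat := by
  rw [Env.genesisMove, Env.genesisMove, a.setupMsg]

theorem st₀ : E'.st₀ strat = E.st₀ strat := by
  rw [Env.st₀, Env.st₀, a.genesisMove, a.genesis_eq]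

theorem view (rs : List Round) : E'.view strat rs = E.view strat rs := by
  rw [Env.view, Env.view, a.setupMsg, a.st₀]

theorem committee (rs : List Round) (j : ℕ) : E'.committee strat rs j = E.committee strat rs j := by
  cases j with
  | zero => rw [Env.committee, Env.committee, a.committeeOf_eq, a.st₀]
  | succ j => rw [Env.committee, Env.committee, a.C_eq]

theorem stateCommitment (st : Data) (L : List Data) :
    E'.stateCommitment st L = E.stateCommitment st L := by
  rw [Env.stateCommitment, Env.stateCommitment, a.commit_eq, a.δ_eq]

theorem isMember {i : ℕ} (hi : i < E.K) (S : Data) : E'.IsMember i S = E.IsMember i S := by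
  rw [IsMember, IsMember, a.m_eq, a.pk_eq i hi]

theorem nextRound_out (rs : List Round) :
    (E'.nextRound strat rs).out = (E.nextRound strat rs).out := by
  simp only [Env.nextRound, a.genesisMove, a.view, a.step_eq]

/-- Environments that agree have the same next round, if the signatures and keys that are revealed
in it are the same. -/
theorem nextRound {rs : List Round}
    (hs : rs.length % E.C = 0 → ∀ i < E.K,
      E.IsMember i (E.committee strat rs (rs.length / E.C)) = true →
      E'.signState i (rs.length / E.C) (stateMsg (E.stateCommitment (E.st₀ strat)
        ((E.nextRound strat rs).out.ledger i))) =
      E.signState i (rs.length / E.C) (stateMsg (E.stateCommitment (E.st₀ strat)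
        ((E.nextRound strat rs).out.ledger i))))
    (hh : (rs.length + 1) % E.C = 0 → ∀ i < E.K,
      E.IsMember i (E.committee strat rs (rs.length / E.C)) = true →
      E'.signHandover i (rs.length / E.C) (handoverMsg (rs.length / E.C + 1)
        (E.nextRound strat rs).out.nextCommittee) =
      E.signHandover i (rs.length / E.C) (handoverMsg (rs.length / E.C + 1)
        (E.nextRound strat rs).out.nextCommittee))
    (hk : ∀ i < E.K, (E.nextRound strat rs).out.Grants i = true →
      E'.sk i (rs.length / E.C) = E.sk i (rs.length / E.C)) :
    E'.nextRound strat rs = E.nextRound strat rs := by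
  unfold Env.nextRound at hs hh hk ⊢
  simp only [a.genesisMove, a.view, a.step_eq, a.st₀, a.committee, a.C_eq, a.K_eq,
    a.stateCommitment] at hs hh hk ⊢
  rw [Round.mk.injEq]
  refine ⟨rfl, rfl, ?_, ?_, ?_⟩
  · split_ifs with h0
    · congr 1
      refine List.map_congr_left fun i hi => ?_
      have hi := List.mem_range.mp hi
      rw [a.isMember hi]
      split_ifs with h1
      · exact hs h0 i hi (by simp only [Bool.and_eq_true] at h1; exact h1.2)
      · rfl
    · rfl
  · split_ifs with h0
    · congr 1
      refine List.map_congr_left fun i hi => ?_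
      have hi := List.mem_range.mp hi
      rw [a.isMember hi]
      split_ifs with h1
      · exact hh h0 i hi (by simp only [Bool.and_eq_true] at h1; exact h1.2)
      · rfl
    · rfl
  · congr 1
    refine List.map_congr_left fun i hi => ?_
    have hi := List.mem_range.mp hi
    split_ifs with h1
    · exact hk i hi (by simp only [Bool.and_eq_true] at h1; exact h1.1)
    · rfl

theorem stateQuery {i j : ℕ} (hi : i < E.K)
    (h : E'.exec strat (j * E.C) = E.exec strat (j * E.C)) :
    E'.stateQuery strat i j = E.stateQuery strat i j := by
  rw [Env.stateQuery, Env.stateQuery, a.C_eq, h, a.committee, a.isMember hi, a.nextRound_out,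
    a.st₀, a.stateCommitment]

theorem handoverQuery {i j : ℕ} (hi : i < E.K)
    (h : E'.exec strat ((j + 1) * E.C - 1) = E.exec strat ((j + 1) * E.C - 1)) :
    E'.handoverQuery strat i j = E.handoverQuery strat i j := by
  rw [Env.handoverQuery, Env.handoverQuery, a.C_eq, h, a.committee, a.isMember hi, a.nextRound_out]

theorem forgery {i r : ℕ} (hi : i < E.K) (h : E'.exec strat (r + 1) = E.exec strat (r + 1))
    (sigs : List (ℕ × Data × Data)) (t : ℕ) :
    E'.forgery strat sigs r i t = E.forgery strat sigs r i t := by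
  simp only [Env.forgery, a.C_eq, h, a.committee, a.st₀, a.stateCommitment, a.verify_eq,
    a.pk_eq i hi]

end Agree

theorem exec_congr {E' E : Env} {strat : List Data → Data} {N : ℕ}
    (h : ∀ k < N, E'.nextRound strat (E.exec strat k) = E.nextRound strat (E.exec strat k)) :
    ∀ k ≤ N, E'.exec strat k = E.exec strat k := by
  intro k hk
  induction k with
  | zero => rfl
  | succ k ih => rw [exec, exec, ih (by omega), h k (by omega)]

end Env

section SimWorld
variable (H : HashFamily) (S : SignatureScheme) (X : StateMachine) (PoS : PoSProtocol) (A : Adversary)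
  (m C : ℕ) (T : Polynomial ℕ) {n : ℕ}

/-- The world that a reduction with the coins `l` simulates, if the hash key is generated with the
coins `ωh`, the keys of party `i` are generated with the coins `ωg`, and the operations with the keys
of this party in the periods up to `t` use the coins `ρ`. -/
noncomputable def simWorld (ωh : Coins (H.coins.eval n)) (l : List Bool) (i t : ℕ)
    (ωg : Coins (S.coins.eval n)) (ρ : ℕ → Coins (S.coins.eval n)) : World H S PoS T n :=
  (ωh, toCoins _ (l.drop (posOffset PoS A T n)),
    fun k => if k.1 = i then ωg else toCoins _ (genBits S PoS A T n l k),
    fun k j a => if k.1 = i ∧ j.1 ≤ t then ρ (3 * j + a) else toCoins _ (opBits S PoS A T n l k j a))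

variable {H S PoS A T} {ωh : Coins (H.coins.eval n)} {l : List Bool} {i t : ℕ}
  {ωg : Coins (S.coins.eval n)} {ρ : ℕ → Coins (S.coins.eval n)} {recv : List Data}

local notation "𝓦" => simWorld H S PoS A T ωh l i t ωg ρ
local notation "𝓔" => (World.env X (simWorld H S PoS A T ωh l i t ωg ρ) m C)
local notation "𝓺" => SimCtx.mk n (H.gen n ωh) l i t recv

theorem genCoins_simWorld {j : ℕ} (hj : j < PoS.parties.eval n) :
    World.genCoins 𝓦 j = if j = i then ωg else toCoins _ (genBits S PoS A T n l j) := by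
  rw [World.genCoins, dif_pos hj]
  rfl

theorem opCoins_simWorld {j e : ℕ} (hj : j < PoS.parties.eval n) (he : e < T.eval n) (a : Fin 3) :
    World.opCoins 𝓦 j e a =
      if j = i ∧ e ≤ t then ρ (3 * e + a) else toCoins _ (opBits S PoS A T n l j e a) := by
  rw [World.opCoins, dif_pos ⟨hj, he⟩]
  rfl

/-- The simulation is only incorrect, if at all, in secret keys and signatures. -/
theorem agree_simWorld (hpk : i < PoS.parties.eval n → recv.getD 0 .nil = (S.gen n ωg).1) :
    (SimCtx.env H S X PoS A m C T 𝓺).Agree 𝓔 := by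
  have h : ∀ j < PoS.parties.eval n, SimCtx.pk S PoS A T 𝓺 j = (S.gen n (World.genCoins 𝓦 j)).1 := by
    intro j hj
    rw [genCoins_simWorld hj, SimCtx.pk]
    dsimp only
    split_ifs with h
    · exact hpk (h ▸ hj)
    · rfl
  have h' : SimCtx.pks S PoS A T 𝓺 =
      (List.range (PoS.parties.eval n)).map fun j => (S.gen n (World.genCoins 𝓦 j)).1 :=
    List.map_congr_left fun j hj => h j (List.mem_range.mp hj)
  refine ⟨rfl, rfl, rfl, rfl, h, rfl, rfl, rfl, rfl, ?_, ?_⟩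
  · dsimp only [SimCtx.env, World.env]
    rw [h']
    rfl
  · dsimp only [SimCtx.env, World.env]
    rw [h']
    rfl

theorem key_size_world {T : Polynomial ℕ} (ω : World H S PoS T n) (j : ℕ) {e : ℕ}
    (he : e < S.periods n) : (ω.key j e).size ≤ S.keyLen.eval n := S.key_size _ _ _ _ he

/-- The keys of parties that are not targeted are simulated correctly. Clipping, which keeps the
iterated updates polynomially bounded, does not affect keys within the supported periods. -/
theorem key_simWorld_of_ne {j : ℕ} (hj : j < PoS.parties.eval n) (hji : j ≠ i) {e : ℕ}
    (he : e < S.periods n) (heT : e ≤ T.eval n) : SimCtx.key S PoS A T 𝓺 j e = World.key 𝓦 j e := by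
  unfold SimCtx.key
  simp only [if_neg hji, Nat.sub_zero, Nat.zero_add]
  induction e with
  | zero =>
    rw [World.key, SignatureAlgorithms.keyAt, genCoins_simWorld hj, if_neg hji]
    rfl
  | succ e ih =>
    rw [List.range_succ, List.foldl_append, ih (by omega) (by omega)]
    have : S.updateL n (World.key 𝓦 j e) (opBits S PoS A T n l j e 2) = World.key 𝓦 j (e + 1) := by
      conv_rhs => rw [World.key, SignatureAlgorithms.keyAt, opCoins_simWorld hj (by omega),
        if_neg (by tauto)]
      rfl
    simp only [List.foldl_cons, List.foldl_nil]
    rw [this, clip_of_le (key_size_world _ _ he)]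

/-- The keys of the targeted party are simulated correctly from the break-in on. -/
theorem key_simWorld_self (hi : i < PoS.parties.eval n)
    (hrec : recv.getD (3 * t + 4) .nil = World.key 𝓦 i (t + 1)) {e : ℕ} (hte : t + 1 ≤ e)
    (he : e < S.periods n) (heT : e ≤ T.eval n) : SimCtx.key S PoS A T 𝓺 i e = World.key 𝓦 i e := by
  unfold SimCtx.key
  simp only [if_true]
  induction e, hte using Nat.le_induction with
  | base => simpa using hrec
  | succ e hte ih =>
    rw [Nat.sub_add_comm hte, List.range_succ, List.foldl_append, ih (by omega) (by omega)]
    have : S.updateL n (World.key 𝓦 i e) (opBits S PoS A T n l i e 2) = World.key 𝓦 i (e + 1) := by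
      conv_rhs => rw [World.key, SignatureAlgorithms.keyAt, opCoins_simWorld hi (by omega),
        if_neg (by omega)]
      rfl
    simp only [List.foldl_cons, List.foldl_nil]
    rw [Nat.add_sub_cancel' hte, this, clip_of_le (key_size_world _ _ he)]

/-- The list `recv` of what the reduction has received in the attack on the signature scheme suffices
for the simulation of `N` rounds. -/
structure Supports (E : Env) (strat : List Data → Data) (i t : ℕ) (recv : List Data) (N : ℕ) :
    Prop where
  state : ∀ e ≤ t, e * E.C < N →
    E.IsMember i (E.committee strat (E.exec strat (e * E.C)) e) = true →
    recv.getD (1 + 3 * e) .nil = E.signState i e (stateMsg (E.stateCommitment (E.st₀ strat)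
      ((E.nextRound strat (E.exec strat (e * E.C))).out.ledger i)))
  handover : ∀ e ≤ t, (e + 1) * E.C ≤ N →
    E.IsMember i (E.committee strat (E.exec strat ((e + 1) * E.C - 1)) e) = true →
    recv.getD (2 + 3 * e) .nil = E.signHandover i e (handoverMsg (e + 1)
      (E.nextRound strat (E.exec strat ((e + 1) * E.C - 1))).out.nextCommittee)
  key : (t + 1) * E.C < N → recv.getD (3 * t + 4) .nil = E.sk i (t + 1)
  honest : ∀ ρ < N, ρ / E.C ≤ t → (E.nextRound strat (E.exec strat ρ)).out.Grants i = false

/-- With support from the challenger, executions are simulated perfectly: revealed are only the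
signatures of the targeted party, which are known, and, since this party is honest in the periods up
to `t`, keys of later periods. -/
theorem exec_simWorld (hC : 0 < C) (hT : T.eval n ≤ C * S.periods n)
    (hpk : i < PoS.parties.eval n → recv.getD 0 .nil = (S.gen n ωg).1) {N : ℕ} (hN : N ≤ T.eval n)
    (hrec : i < PoS.parties.eval n → Supports 𝓔 (SimCtx.strat A 𝓺) i t recv N) :
    SimCtx.exec H S X PoS A m C T 𝓺 N = (𝓔).exec (SimCtx.strat A 𝓺) N := by
  have a := agree_simWorld (X := X) (A := A) (T := T) (m := m) (C := C) (ωh := ωh)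
      (l := l) (t := t) (ρ := ρ) hpk
  refine Env.exec_congr (fun k hk => a.nextRound _ ?_ ?_ ?_) N le_rfl
  all_goals
    rw [Env.length_exec]
    have hCE : (𝓔).C = C := rfl
    have hKE : (𝓔).K = PoS.parties.eval n := rfl
    have h1 : k / C < S.periods n := Nat.div_lt_of_lt_mul (by omega)
    have h2 : k / C < T.eval n := (Nat.div_le_self _ _).trans_lt (by omega)
    have hmod := Nat.div_add_mod' k C
  · intro h0 j hj hmem
    change SimCtx.signState S PoS A T 𝓺 j (k / C) _ =
      S.sign n (World.key 𝓦 j (k / C)) _ (World.opCoins 𝓦 j (k / C) 0)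
    unfold SimCtx.signState
    dsimp only
    by_cases hji : j = i
    · subst hji
      by_cases hkt : k / C ≤ t
      · have h0' : k % C = 0 := h0
        have hk' : k / C * C = k := by omega
        have := (hrec hj).state (k / C) hkt (by rw [hCE, hk']; exact hk)
        rw [hCE, hk'] at this
        rw [if_pos ⟨rfl, hkt⟩]
        exact this hmem
      · have hlt : (t + 1) * C ≤ k / C * C := Nat.mul_le_mul_right _ (by omega)
        rw [if_neg (by omega), key_simWorld_self hj ((hrec hj).key (by rw [hCE]; omega)) (by omega) h1
          h2.le, opCoins_simWorld hj h2, if_neg (by omega)]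
        rfl
    · rw [if_neg (by tauto), key_simWorld_of_ne (ωg := ωg) (ρ := ρ) hj hji h1 h2.le,
        opCoins_simWorld hj h2,
        if_neg (by tauto)]
      rfl
  · intro h0 j hj hmem
    change SimCtx.signHandover S PoS A T 𝓺 j (k / C) _ =
      S.sign n (World.key 𝓦 j (k / C)) _ (World.opCoins 𝓦 j (k / C) 1)
    unfold SimCtx.signHandover
    dsimp only
    by_cases hji : j = i
    · subst hji
      by_cases hkt : k / C ≤ t
      · have h0' : (k + 1) % C = 0 := h0
        have hk' : (k / C + 1) * C - 1 = k := by
          have h3 := Nat.mod_lt k hC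
          have h4 : k % C + 1 = C := by
            by_contra h5
            have h6 : (k + 1) % C = k % C + 1 := by
              rw [← hmod, Nat.mul_comm, Nat.add_assoc, Nat.mul_add_mod, Nat.mul_add_mod,
                  Nat.mod_mod, Nat.mod_eq_of_lt (by omega)]
            omega
          rw [Nat.succ_mul]
          omega
        have := (hrec hj).handover (k / C) hkt (by
          rw [hCE]
          have := Nat.mul_pos (Nat.succ_pos (k / C)) hC
          omega)
        rw [hCE, hk'] at this
        rw [if_pos ⟨rfl, hkt⟩]
        exact this hmem
      · have hlt : (t + 1) * C ≤ k / C * C := Nat.mul_le_mul_right _ (by omega)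
        rw [if_neg (by omega), key_simWorld_self hj ((hrec hj).key (by rw [hCE]; omega)) (by omega) h1
          h2.le, opCoins_simWorld hj h2, if_neg (by omega)]
        rfl
    · rw [if_neg (by tauto), key_simWorld_of_ne (ωg := ωg) (ρ := ρ) hj hji h1 h2.le,
        opCoins_simWorld hj h2,
        if_neg (by tauto)]
      rfl
  · intro j hj hg
    change SimCtx.key S PoS A T 𝓺 j (k / C) = World.key 𝓦 j (k / C)
    by_cases hji : j = i
    · subst hji
      by_cases hkt : k / C ≤ t
      · rw [(hrec hj).honest k hk hkt] at hg
        cases hg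
      · have hlt : (t + 1) * C ≤ k / C * C := Nat.mul_le_mul_right _ (by omega)
        exact key_simWorld_self hj ((hrec hj).key (by rw [hCE]; omega)) (by omega) h1 h2.le
    · exact key_simWorld_of_ne hj hji h1 h2.le

end SimWorld

/-! ### What the reductions compute -/

namespace World
variable {H : HashFamily} {S : SignatureScheme} (X : StateMachine) {PoS : PoSProtocol} (A : Adversary)
  (m C : ℕ) {T : Polynomial ℕ} {n : ℕ} (ω : World H S PoS T n) (l : List Bool) (r : ℕ)

/-- The data of the tournament of round `r`, against the adversary `A` with the coins `l`. -/
noncomputable def gctx : GCtx :=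
  ⟨n, H.gen n ω.1, l, r, (ω.env X m C).st₀ (A.nextL n l), (ω.env X m C).exec (A.nextL n l) (r + 1)⟩

/-- The answers of the adversary in the tournament of round `r`. -/
noncomputable def answers : List Data :=
  (ω.gctx X A m C l r).answers A ((ω.gctx X A m C l r).tournament H S X PoS A m C
    ((ω.env X m C).view (A.nextL n l) ((ω.env X m C).exec (A.nextL n l) (r + 1)))).2

/-- Two colliding inputs in the tournament of round `r`, if there are such. -/
noncomputable def collision : Data :=
  (ω.gctx X A m C l r).findCollision H ((ω.gctx X A m C l r).hashInputs H X C (ω.answers X A m C l r))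

/-- The signatures that the adversary shows in the tournament of round `r`. -/
noncomputable def sigCandidates : List (ℕ × Data × Data) :=
  (ω.gctx X A m C l r).sigCandidates m C (ω.answers X A m C l r)

/-- The tournament of round `r` exhibits a collision of the hash function. -/
def Collides : Prop :=
  (ω.collision X A m C l r).fst ≠ (ω.collision X A m C l r).snd ∧
    H.hash n (H.gen n ω.1) (ω.collision X A m C l r).fst =
      H.hash n (H.gen n ω.1) (ω.collision X A m C l r).snd

/-- The tournament of round `r` exhibits a forged signature of party `i` for period `t`. -/
def ForgesAt (i t : ℕ) : Prop :=
  ∃ msg sig, (t, msg, sig) ∈ ω.sigCandidates X A m C l r ∧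
    (ω.env X m C).Forged (A.nextL n l) r ((ω.env X m C).exec (A.nextL n l) (r + 1)) i t msg sig

/-- The data of the tournament describe the actual environment. -/
theorem fits : (ω.gctx X A m C l r).Fits H S X PoS A m C (ω.env X m C) :=
  ⟨rfl, rfl, rfl, rfl, rfl, rfl, rfl, rfl, rfl⟩

theorem tournament_eq : (ω.env X m C).tournament (A.nextL n l) r =
    (ω.gctx X A m C l r).tournament H S X PoS A m C
      ((ω.env X m C).view (A.nextL n l) ((ω.env X m C).exec (A.nextL n l) (r + 1))) :=
  (ω.fits X A m C l r).tournament _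

variable {X A m C ω l r}

/-- A failing tournament violates safety or the honest majorities, or it exhibits a collision or a
forgery. -/
theorem collides_or_forgesAt (hC : 0 < C) (hT : T.eval n ≤ C * S.periods n) (hr : r < T.eval n)
    (hsafe : (ω.env X m C).Safe
      ((ω.env X m C).exec ((ω.env X m C).withTournament (A.nextL n l) r) (T.eval n)))
    (hmaj : (ω.env X m C).HonestMajority ((ω.env X m C).withTournament (A.nextL n l) r)
      ((ω.env X m C).exec ((ω.env X m C).withTournament (A.nextL n l) r) (T.eval n)))
    (hfail : (ω.env X m C).TournamentFails (A.nextL n l) (T.eval n) r) :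
    ω.Collides X A m C l r ∨
      ∃ i < PoS.parties.eval n, ∃ t < T.eval n, ω.ForgesAt X A m C l r i t := by
  have hper : r / C < S.periods n := Nat.div_lt_of_lt_mul (by omega)
  have has : ∀ a, (∃ p, p <+: ((ω.env X m C).tournament (A.nextL n l) r).2 ∧ a = A.nextL n l p) →
      a ∈ ω.answers X A m C l r := by
    rintro a ⟨p, hp, rfl⟩
    rw [tournament_eq] at hp
    exact GCtx.mem_answers (c := ω.gctx X A m C l r) hp
  have f := ω.fits X A m C l r
  rcases Env.tournamentFails (E := ω.env X m C) hC hr hsafe hmaj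
    (fun i _ j hj msg => S.correct _ _ _ _ _ _ (lt_of_le_of_lt hj hper))
    (fun i _ j hj msg => S.correct _ _ _ _ _ _ (lt_of_le_of_lt hj hper)) rfl hfail with h | h
  · obtain ⟨a, b, ha, hb, hne, hab⟩ := h
    exact Or.inl (GCtx.findCollision_spec (f.mem_hashInputs has ha) (f.mem_hashInputs has hb) hne hab)
  · obtain ⟨i, t, msg, sig, hsig, hf⟩ := h
    refine Or.inr ⟨i, hf.1.1, t, ?_, msg, sig, f.mem_sigCandidates has hsig, hf⟩
    exact hf.2.1.trans_lt ((Nat.div_le_self _ _).trans_lt hr)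

end World

theorem Outcome.ofData_toData (o : Outcome) : Outcome.ofData o.toData = o := by
  simp [Outcome.ofData, Outcome.toData, nth_ofList]

section
variable {H : HashFamily} {S : SignatureScheme} {X : StateMachine} {PoS : PoSProtocol} {A : Adversary}
  {m C : ℕ} {T : Polynomial ℕ} {n : ℕ}

/-- The rounds can be reconstructed from the view, since the missing messages are the adversary's
own. -/
theorem ofView_eq (ω : World H S PoS T n) (l : List Bool) (r : ℕ) :
    GCtx.ofView A n l r
      ((ω.env X m C).view (A.nextL n l) ((ω.env X m C).exec (A.nextL n l) (r + 1))) =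
    ω.gctx X A m C l r := by
  have hrs : (List.range (((ω.env X m C).view (A.nextL n l)
      ((ω.env X m C).exec (A.nextL n l) (r + 1))).length - 2)).map (fun k =>
    (⟨A.nextL n l (((ω.env X m C).view (A.nextL n l)
        ((ω.env X m C).exec (A.nextL n l) (r + 1))).take (k + 2)),
      Outcome.ofData ((((ω.env X m C).view (A.nextL n l)
        ((ω.env X m C).exec (A.nextL n l) (r + 1))).getD (k + 2) .nil).nth 0),
      (((ω.env X m C).view (A.nextL n l)
        ((ω.env X m C).exec (A.nextL n l) (r + 1))).getD (k + 2) .nil).nth 1,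
      (((ω.env X m C).view (A.nextL n l)
        ((ω.env X m C).exec (A.nextL n l) (r + 1))).getD (k + 2) .nil).nth 2,
      (((ω.env X m C).view (A.nextL n l)
        ((ω.env X m C).exec (A.nextL n l) (r + 1))).getD (k + 2) .nil).nth 3⟩ : Round)) =
      (ω.env X m C).exec (A.nextL n l) (r + 1) := by
    apply List.ext_getElem?
    intro k
    by_cases hk : k < r + 1
    · rw [Env.getElem?_exec _ _ hk, List.getElem?_map, List.getElem?_range (by
        simpa [Env.view, Env.length_exec] using hk)]
      have hget : ((ω.env X m C).view (A.nextL n l)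
          ((ω.env X m C).exec (A.nextL n l) (r + 1))).getD (k + 2) .nil =
          ((ω.env X m C).nextRound (A.nextL n l) ((ω.env X m C).exec (A.nextL n l) k)).msg := by
        simp only [Env.view, List.getD_eq_getElem?_getD, List.getElem?_cons_succ, List.getElem?_map,
          Env.getElem?_exec _ _ hk, Option.map_some, Option.getD_some]
      have htake : ((ω.env X m C).view (A.nextL n l)
          ((ω.env X m C).exec (A.nextL n l) (r + 1))).take (k + 2) =
          (ω.env X m C).view (A.nextL n l) ((ω.env X m C).exec (A.nextL n l) k) := by
        simp only [Env.view, List.take_succ_cons, ← List.map_take]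
        rw [Env.take_exec _ _ (by omega)]
      simp only [Option.map_some, Option.some_inj]
      rw [hget, htake]
      simp only [Round.msg, nth_ofList, List.getD_cons_zero, List.getD_cons_succ,
        Outcome.ofData_toData]
      rfl
    · rw [List.getElem?_eq_none (by simpa [Env.view, Env.length_exec] using hk),
        List.getElem?_eq_none (by simpa [Env.length_exec] using hk)]
  unfold GCtx.ofView World.gctx
  rw [hrs]
  rfl

/-- Only the view up to round `r` matters for the tournament. -/
theorem tournamentMove_eq (ω : World H S PoS T n) {l : List Bool} {r : ℕ}
    (hg : guessRound PoS A T n l = r) {h : List Data}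
    (hh : r + 3 ≤ h.length → h.take (r + 3) =
      (ω.env X m C).view (A.nextL n l) ((ω.env X m C).exec (A.nextL n l) (r + 1))) :
    tournamentMove H S X PoS A m C T n l h = (ω.env X m C).withTournament (A.nextL n l) r h := by
  unfold tournamentMove Env.withTournament
  rw [hg]
  split_ifs with h1
  · rfl
  · rw [hh (by omega), ofView_eq ω, World.tournament_eq]

theorem st₀_tournamentMove (ω : World H S PoS T n) {l : List Bool} {r : ℕ}
    (hg : guessRound PoS A T n l = r) :
    (ω.env X m C).st₀ (tournamentMove H S X PoS A m C T n l) =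
      (ω.env X m C).st₀ ((ω.env X m C).withTournament (A.nextL n l) r) := by
  rw [Env.st₀, Env.st₀, Env.genesisMove, tournamentMove_eq ω hg fun h => by simp at h]
  rfl

/-- If the round is guessed correctly, then the adversary that simulates the tournament behaves in the
protocol like the one that takes part in it. -/
theorem exec_tournamentMove (ω : World H S PoS T n) {l : List Bool} {r : ℕ}
    (hg : guessRound PoS A T n l = r) (k : ℕ) :
    (ω.env X m C).exec (tournamentMove H S X PoS A m C T n l) k =
      (ω.env X m C).exec ((ω.env X m C).withTournament (A.nextL n l) r) k := by
  have hgm : (ω.env X m C).genesisMove (tournamentMove H S X PoS A m C T n l) =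
      (ω.env X m C).genesisMove ((ω.env X m C).withTournament (A.nextL n l) r) :=
    tournamentMove_eq ω hg fun h => by simp at h
  have hst := st₀_tournamentMove (X := X) (m := m) (C := C) ω hg
  induction k with
  | zero => rfl
  | succ k ih =>
    rw [Env.exec, Env.exec, ih, Env.nextRound_eq, Env.nextRound_eq, hgm, hst]
    congr 3
    rw [Env.view, Env.view, hst]
    refine tournamentMove_eq ω hg fun h => ?_
    simp only [List.length_cons, List.length_map, Env.length_exec] at h
    simp only [List.take_succ_cons, ← List.map_take]
    rw [Env.take_exec _ _ (by omega), Env.exec_withTournament _ _ _ le_rfl, Env.st₀_withTournament]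
    rfl

variable {ωh : Coins (H.coins.eval n)} {l : List Bool} {i t r : ℕ}
  {ωg : Coins (S.coins.eval n)} {ρ : ℕ → Coins (S.coins.eval n)} {recv : List Data}

/-- A simulated execution that is correct up to round `r` yields the correct tournament. -/
theorem gctx_simWorld
    (hpk : i < PoS.parties.eval n → recv.getD 0 .nil = (S.gen n ωg).1)
    (hexec : SimCtx.exec H S X PoS A m C T ⟨n, H.gen n ωh, l, i, t, recv⟩ (r + 1) =
      ((simWorld H S PoS A T ωh l i t ωg ρ).env X m C).exec (A.nextL n l) (r + 1)) :
    SimCtx.gctx H S X PoS A m C T ⟨n, H.gen n ωh, l, i, t, recv⟩ r =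
      (simWorld H S PoS A T ωh l i t ωg ρ).gctx X A m C l r ∧
    SimCtx.answers H S X PoS A m C T ⟨n, H.gen n ωh, l, i, t, recv⟩ r =
      (simWorld H S PoS A T ωh l i t ωg ρ).answers X A m C l r := by
  have a := agree_simWorld (X := X) (A := A) (T := T) (m := m) (C := C) (ωh := ωh) (l := l) (t := t)
    (ρ := ρ) hpk
  have h1 : SimCtx.gctx H S X PoS A m C T ⟨n, H.gen n ωh, l, i, t, recv⟩ r =
      (simWorld H S PoS A T ωh l i t ωg ρ).gctx X A m C l r := by
    rw [SimCtx.gctx, World.gctx, hexec, a.st₀]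
    rfl
  refine ⟨h1, ?_⟩
  rw [SimCtx.answers, World.answers, h1, SimCtx.view, hexec, a.view]
  rfl

/-- The collision finder, which knows all signing keys, simulates the world perfectly. -/
theorem exec_simWorld_untargeted (hC : 0 < C) (hT : T.eval n ≤ C * S.periods n)
    (hi : PoS.parties.eval n ≤ i) {N : ℕ} (hN : N ≤ T.eval n) :
    SimCtx.exec H S X PoS A m C T ⟨n, H.gen n ωh, l, i, t, recv⟩ N =
      ((simWorld H S PoS A T ωh l i t ωg ρ).env X m C).exec (A.nextL n l) N :=
  exec_simWorld X m C hC hT (fun h => absurd h (by omega)) hN fun h => absurd h (by omega)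

/-- The collision finder targets the nonexistent party with number `PoS.parties.eval n`. -/
theorem collisionOutput_eq (hC : 0 < C) (hT : T.eval n ≤ C * S.periods n) (hr : r < T.eval n)
    (hg : guessRound PoS A T n l = r) :
    collisionOutput H S X PoS A m C T n l [H.gen n ωh] =
      (simWorld H S PoS A T ωh l (PoS.parties.eval n) 0 ωg ρ).collision X A m C l r := by
  unfold collisionOutput SimCtx.collision World.collision
  rw [hg]
  have := gctx_simWorld (X := X) (PoS := PoS) (A := A) (m := m) (ωh := ωh) (l := l)
      (t := 0) (ωg := ωg) (ρ := ρ) (recv := [])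
    (fun h => absurd h (lt_irrefl _))
    (exec_simWorld_untargeted (X := X) (A := A) (m := m) (ωh := ωh) (l := l) hC hT le_rfl hr)
  simp only [List.getD_cons_zero]
  rw [this.1, this.2]

end

/-! ### Sequences of coins -/

section Flat
variable {H : HashFamily} {S : SignatureScheme} {PoS : PoSProtocol} {A : Adversary}
  {T : Polynomial ℕ} {n : ℕ}

/-- The coin with number `x`, which is `false` beyond the end. -/
def coinAt {k : ℕ} (ω : Coins k) (x : ℕ) : Bool := if h : x < k then ω ⟨x, h⟩ else false

/-- The sequence of coins from which a reduction simulates a given world, adversary and guess. -/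
noncomputable def flatBit (ω : World H S PoS T n) (ωA : Coins (A.coins.eval n))
    (g : Coins (guesses PoS T n)) (x : ℕ) : Bool :=
  if x < A.coins.eval n then coinAt ωA x
  else if x < posOffset PoS A T n then coinAt g (x - A.coins.eval n)
  else if x < genOffset PoS A T n then coinAt ω.2.1 (x - posOffset PoS A T n)
  else if x < opOffset S PoS A T n then
    coinAt (ω.genCoins ((x - genOffset PoS A T n) / S.coins.eval n))
      ((x - genOffset PoS A T n) % S.coins.eval n)
  else if x < hashOffset S PoS A T n then
    coinAt (ω.opCoins ((x - opOffset S PoS A T n) / S.coins.eval n / 3 / T.eval n)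
      ((x - opOffset S PoS A T n) / S.coins.eval n / 3 % T.eval n)
      (Fin.ofNat 3 ((x - opOffset S PoS A T n) / S.coins.eval n)))
      ((x - opOffset S PoS A T n) % S.coins.eval n)
  else coinAt ω.1 (x - hashOffset S PoS A T n)

theorem toCoins_drop_map {k o L : ℕ} (f : ℕ → Bool) (h : o + k ≤ L) :
    toCoins k (((List.range L).map f).drop o) = fun j : Fin k => f (o + j) := by
  funext j
  have := j.2
  simp [toCoins, List.getD_eq_getElem?_getD, List.getElem?_drop,
    List.getElem?_range (show o + (j : ℕ) < L by omega)]

variable (ω : World H S PoS T n) (ωA : Coins (A.coins.eval n)) (g : Coins (guesses PoS T n)) {L : ℕ}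

theorem flat_adversary (hL : A.coins.eval n ≤ L) :
    toCoins (A.coins.eval n) ((List.range L).map (flatBit ω ωA g)) = ωA := by
  have := toCoins_drop_map (k := A.coins.eval n) (o := 0) (flatBit ω ωA g) (by omega : _ ≤ L)
  rw [List.drop_zero] at this
  rw [this]
  funext j
  simp [flatBit, coinAt]

theorem flat_guess (hL : posOffset PoS A T n ≤ L) :
    toCoins (guesses PoS T n) (((List.range L).map (flatBit ω ωA g)).drop (A.coins.eval n)) = g := by
  rw [toCoins_drop_map _ (by rw [posOffset] at hL; exact hL)]
  funext j
  have := j.2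
  rw [flatBit, if_neg (by omega), if_pos (by rw [posOffset]; omega), coinAt, dif_pos (by omega)]
  simp

theorem flat_pos (hL : genOffset PoS A T n ≤ L) :
    toCoins _ (((List.range L).map (flatBit ω ωA g)).drop (posOffset PoS A T n)) = ω.2.1 := by
  rw [toCoins_drop_map _ (by rw [genOffset] at hL; exact hL)]
  funext j
  have := j.2
  have h1 : A.coins.eval n ≤ posOffset PoS A T n := Nat.le_add_right _ _
  rw [flatBit, if_neg (by omega), if_neg (by omega), if_pos (by rw [genOffset]; omega), coinAt,
    dif_pos (by omega)]
  simp

/-- Blocks of `c` coins each do not overlap. -/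
theorem block_le {K c i b : ℕ} (hi : i < K) (hb : b < c) : i * c + b < K * c :=
  calc i * c + b < i * c + c := by omega
    _ = (i + 1) * c := by ring
    _ ≤ K * c := Nat.mul_le_mul_right _ hi

theorem flat_gen (hL : opOffset S PoS A T n ≤ L) {i : ℕ} (hi : i < PoS.parties.eval n) :
    toCoins _ (genBits S PoS A T n ((List.range L).map (flatBit ω ωA g)) i) = ω.genCoins i := by
  have hblock : i * S.coins.eval n + S.coins.eval n ≤ PoS.parties.eval n * S.coins.eval n := by
    rw [← Nat.succ_mul]
    exact Nat.mul_le_mul_right _ hi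
  have h1 : A.coins.eval n ≤ posOffset PoS A T n := Nat.le_add_right _ _
  have h2 : posOffset PoS A T n ≤ genOffset PoS A T n := Nat.le_add_right _ _
  have h3 : opOffset S PoS A T n =
    genOffset PoS A T n + PoS.parties.eval n * S.coins.eval n := rfl
  rw [genBits, toCoins_drop_map _ (by omega)]
  funext j
  have hj := j.2
  have h4 : genOffset PoS A T n + i * S.coins.eval n + j - genOffset PoS A T n =
      j + S.coins.eval n * i := by
    rw [Nat.mul_comm]
    omega
  rw [flatBit, if_neg (by omega), if_neg (by omega), if_neg (by omega), if_pos (by omega), h4,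
    Nat.add_mul_div_left _ _ (by omega), Nat.add_mul_mod_self_left, Nat.div_eq_of_lt hj,
    Nat.mod_eq_of_lt hj, Nat.zero_add, coinAt, dif_pos hj]

theorem flat_op (hL : hashOffset S PoS A T n ≤ L) {i e : ℕ} (hi : i < PoS.parties.eval n)
    (he : e < T.eval n) (a : Fin 3) :
    toCoins _ (opBits S PoS A T n ((List.range L).map (flatBit ω ωA g)) i e a) = ω.opCoins i e a := by
  have ha := a.2
  have hb1 := block_le hi he
  have hb2 := block_le hb1 ha
  have hblock : ((i * T.eval n + e) * 3 + a) * S.coins.eval n + S.coins.eval n ≤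
      PoS.parties.eval n * T.eval n * 3 * S.coins.eval n := by
    rw [← Nat.succ_mul]
    exact Nat.mul_le_mul_right _ hb2
  have h1 : A.coins.eval n ≤ posOffset PoS A T n := Nat.le_add_right _ _
  have h2 : posOffset PoS A T n ≤ genOffset PoS A T n := Nat.le_add_right _ _
  have h2' : genOffset PoS A T n ≤ opOffset S PoS A T n := Nat.le_add_right _ _
  have h3 : hashOffset S PoS A T n =
    opOffset S PoS A T n + PoS.parties.eval n * T.eval n * 3 * S.coins.eval n := rfl
  rw [opBits, toCoins_drop_map _ (by omega)]
  funext j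
  have hj := j.2
  have h4 : opOffset S PoS A T n + ((i * T.eval n + e) * 3 + a) * S.coins.eval n + j -
      opOffset S PoS A T n = j + S.coins.eval n * ((i * T.eval n + e) * 3 + a) := by
    rw [Nat.mul_comm (S.coins.eval n)]
    omega
  have h5 : ((i * T.eval n + e) * 3 + (a : ℕ)) / 3 = e + T.eval n * i := by
    rw [Nat.mul_comm (T.eval n)]
    omega
  have h6 : Fin.ofNat 3 ((i * T.eval n + e) * 3 + (a : ℕ)) = a := by
    apply Fin.ext
    simp only [Fin.ofNat]
    omega
  rw [flatBit, if_neg (by omega), if_neg (by omega), if_neg (by omega), if_neg (by omega),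
    if_pos (by omega), h4, Nat.add_mul_div_left _ _ (by omega), Nat.add_mul_mod_self_left,
    Nat.div_eq_of_lt hj, Nat.mod_eq_of_lt hj, Nat.zero_add, h5, h6,
    Nat.add_mul_div_left _ _ (by omega), Nat.add_mul_mod_self_left, Nat.div_eq_of_lt he,
    Nat.mod_eq_of_lt he, Nat.zero_add, coinAt, dif_pos hj]

theorem flat_hash (hL : hashOffset S PoS A T n + H.coins.eval n ≤ L) :
    toCoins _ (((List.range L).map (flatBit ω ωA g)).drop (hashOffset S PoS A T n)) = ω.1 := by
  rw [toCoins_drop_map _ hL]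
  funext j
  have := j.2
  have h1 : A.coins.eval n ≤ posOffset PoS A T n := Nat.le_add_right _ _
  have h2 : posOffset PoS A T n ≤ genOffset PoS A T n := Nat.le_add_right _ _
  have h3 : genOffset PoS A T n ≤ opOffset S PoS A T n := Nat.le_add_right _ _
  have h4 : opOffset S PoS A T n ≤ hashOffset S PoS A T n := Nat.le_add_right _ _
  rw [flatBit, if_neg (by omega), if_neg (by omega), if_neg (by omega), if_neg (by omega),
    if_neg (by omega), coinAt, dif_pos (by omega)]
  simp

/-- Every world is simulated, for a suitable choice of the coins. -/
theorem simWorld_flat (hL : hashOffset S PoS A T n ≤ L) (i t : ℕ) {ρ : ℕ → Coins (S.coins.eval n)}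
    (hρ : i < PoS.parties.eval n → ∀ e ≤ t, e < T.eval n → ∀ a : Fin 3,
      ρ (3 * e + a) = ω.opCoins i e a) :
    simWorld H S PoS A T ω.1 ((List.range L).map (flatBit ω ωA g)) i t (ω.genCoins i) ρ = ω := by
  have h3 : genOffset PoS A T n ≤ opOffset S PoS A T n := Nat.le_add_right _ _
  have h4 : opOffset S PoS A T n ≤ hashOffset S PoS A T n := Nat.le_add_right _ _
  unfold simWorld
  refine Prod.ext rfl (Prod.ext (flat_pos ω ωA g (by omega)) (Prod.ext ?_ ?_))
  · funext k
    have hk : ω.genCoins k = ω.2.2.1 k := by rw [World.genCoins, dif_pos k.2]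
    rw [← hk]
    dsimp only
    split_ifs with h
    · rw [h]
    · exact flat_gen ω ωA g (by omega) k.2
  · funext k e a
    have hk : ω.opCoins k e a = ω.2.2.2 k e a := by rw [World.opCoins, dif_pos ⟨k.2, e.2⟩]
    rw [← hk]
    dsimp only
    split_ifs with h
    · rw [hρ (h.1 ▸ k.2) e h.2 e.2, h.1]
    · exact flat_op ω ωA g hL k.2 e.2 a

end Flat

/-! ### The attack on the signature scheme -/

namespace SignatureScheme
variable {S : SignatureScheme} {n : ℕ} {F : List Data → Data} {st : AttackState}
  {ρ : Coins (S.coins.eval n)}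

/-- A move that is neither a query nor an update nor a break-in has the empty reply. -/
theorem attackStep_nil (hb : st.broken = none) (hF : F st.received = .nil) :
    S.attackStep n F st ρ = { st with received := st.received ++ [.nil] } := by
  unfold attackStep
  rw [hb, hF]

theorem attackStep_sign (hb : st.broken = none) {msg : Data}
    (hF : F st.received = .cons (num 0) msg) :
    S.attackStep n F st ρ =
      { st with
        received := st.received ++ [S.sign n st.key msg ρ]
        queries := st.queries ++ [(st.period, msg)] } := by
  unfold attackStep
  rw [hb, hF]
  rfl

theorem attackStep_update (hb : st.broken = none) {msg : Data}
    (hF : F st.received = .cons (num 1) msg) (hp : st.period + 1 < S.periods n) :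
    S.attackStep n F st ρ =
      { st with
        period := st.period + 1
        key := S.update n st.key ρ
        received := st.received ++ [.nil] } := by
  unfold attackStep
  rw [hb, hF]
  exact if_pos hp

theorem attackStep_break (hb : st.broken = none) {msg : Data}
    (hF : F st.received = .cons (num 2) msg) :
    S.attackStep n F st ρ =
      { st with
        received := st.received ++ [st.key]
        broken := some st.period } := by
  unfold attackStep
  rw [hb, hF]
  rfl

theorem attackStep_broken {b : ℕ} (hb : st.broken = some b) : S.attackStep n F st ρ = st := by
  unfold attackStep
  rw [hb]

/-- The state of the attack after `k` moves. -/
def attackAt (S : SignatureScheme) (n : ℕ) (F : List Data → Data) (ω : Coins (S.coins.eval n))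
    (ρ : ℕ → Coins (S.coins.eval n)) (k : ℕ) : AttackState :=
  (List.range k).foldl (fun st k => S.attackStep n F st (ρ k))
    { period := 0, key := (S.gen n ω).2, received := [(S.gen n ω).1], queries := [],
      broken := none }

theorem attackAt_succ (ω : Coins (S.coins.eval n)) (ρ : ℕ → Coins (S.coins.eval n)) (k : ℕ) :
    S.attackAt n F ω ρ (k + 1) = S.attackStep n F (S.attackAt n F ω ρ k) (ρ k) := by
  rw [attackAt, List.range_succ, List.foldl_append]
  rfl

theorem attack_eq_attackAt (ω : Coins (S.coins.eval n)) {q : ℕ} (ρ : ℕ → Coins (S.coins.eval n)) :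
    S.attack n F ω (fun k : Fin q => ρ k) = S.attackAt n F ω ρ q := by
  have : (List.ofFn fun k : Fin q => ρ k) = (List.range q).map ρ := by
    apply List.ext_getElem <;> simp
  rw [attack, attackAt, this, List.foldl_map]

end SignatureScheme

section Entries
variable (E : Env) (strat : List Data → Data) (r i t : ℕ)

/-- What the forger receives in reply to its move number `k`. -/
def forgerEntry (k : ℕ) : Data :=
  if k < 3 * t + 3 then
    if k % 3 = 0 then
      if E.IsMember i (E.committee strat (E.exec strat (k / 3 * E.C)) (k / 3)) = true then
        E.signState i (k / 3) (stateMsg (E.stateCommitment (E.st₀ strat)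
          ((E.nextRound strat (E.exec strat (k / 3 * E.C))).out.ledger i)))
      else .nil
    else if k % 3 = 1 then
      if (k / 3 + 1) * E.C ≤ r + 1 then
        if E.IsMember i (E.committee strat (E.exec strat ((k / 3 + 1) * E.C - 1)) (k / 3)) = true then
          E.signHandover i (k / 3) (handoverMsg (k / 3 + 1)
            (E.nextRound strat (E.exec strat ((k / 3 + 1) * E.C - 1))).out.nextCommittee)
        else .nil
      else .nil
    else .nil
  else if k = 3 * t + 3 ∧ t < r / E.C then E.sk i (t + 1) else .nil

/-- What the forger has received after `k` moves. -/
def forgerView (k : ℕ) : List Data := E.pk i :: (List.range k).map (forgerEntry E strat r i t)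

theorem length_forgerView (k : ℕ) : (forgerView E strat r i t k).length = k + 1 := by
  simp [forgerView]

theorem forgerView_succ (k : ℕ) : forgerView E strat r i t (k + 1) =
    forgerView E strat r i t k ++ [forgerEntry E strat r i t k] := by
  simp [forgerView, List.range_succ]

theorem getD_forgerView {k x : ℕ} (h : x < k) :
    (forgerView E strat r i t k).getD (x + 1) .nil = forgerEntry E strat r i t x := by
  simp [forgerView, h]

variable {E strat r i t}

/-- The forger has received enough after `k` moves, if its replies include those that concern the
first `N` rounds. -/
theorem supports_forgerView (hC : 0 < E.C) (hu : E.HonestUntil (E.exec strat (r + 1)) r t i)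
    {N k : ℕ} (hN : N ≤ r + 1) (h0 : ∀ e ≤ t, e * E.C < N → 3 * e < k)
    (h1 : ∀ e ≤ t, (e + 1) * E.C ≤ N → 3 * e + 1 < k)
    (h2 : (t + 1) * E.C < N → 3 * t + 3 < k) :
    Supports E strat i t (forgerView E strat r i t k) N := by
  refine ⟨fun e he heN hmem => ?_, fun e he heN hmem => ?_, fun htN => ?_, fun ρ hρ hρt => ?_⟩
  · have h3 : 3 * e / 3 = e := by omega
    have h4 : 3 * e % 3 = 0 := by omega
    rw [Nat.add_comm, getD_forgerView _ _ _ _ _ (h0 e he heN), forgerEntry, if_pos (by omega), h3, h4,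
      if_pos rfl, if_pos hmem]
  · have h3 : (3 * e + 1) / 3 = e := by omega
    have h4 : (3 * e + 1) % 3 = 1 := by omega
    rw [show 2 + 3 * e = (3 * e + 1) + 1 by omega, getD_forgerView _ _ _ _ _ (h1 e he heN),
      forgerEntry, if_pos (by omega), h3, h4, if_neg (by omega), if_pos rfl, if_pos (by omega),
      if_pos hmem]
  · have h3 : t + 1 ≤ r / E.C := (Nat.le_div_iff_mul_le hC).mpr (by omega)
    rw [show 3 * t + 4 = (3 * t + 3) + 1 by omega, getD_forgerView _ _ _ _ _ (h2 htN), forgerEntry,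
      if_neg (by omega), if_pos ⟨rfl, by omega⟩]
  · have h3 := (hu.2 ρ (by omega) hρt).2
    rw [E.take_exec strat (by omega), Env.exec] at h3
    simp only [Env.corrupted, List.any_append, List.any_cons, List.any_nil, Bool.or_false,
      Bool.or_eq_false_iff] at h3
    exact h3.2

end Entries

section Attack
variable {H : HashFamily} {S : SignatureScheme} {X : StateMachine} {PoS : PoSProtocol} {A : Adversary}
  {m C : ℕ} {T : Polynomial ℕ} {n : ℕ} {ωh : Coins (H.coins.eval n)} {l : List Bool} {i t r : ℕ}
  {ωg : Coins (S.coins.eval n)} {ρ : ℕ → Coins (S.coins.eval n)}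

local notation "𝓦" => simWorld H S PoS A T ωh l i t ωg ρ
local notation "𝓔" => (World.env X (simWorld H S PoS A T ωh l i t ωg ρ) m C)
local notation "𝓢" => A.nextL n l

/-- The moves of the forger, computed in the world that it simulates. Each move only needs the part
of the execution that is supported by the replies to previous moves. -/
theorem forgerMove_eq (hC : 0 < C) (hT : T.eval n ≤ C * S.periods n) (hr : r < T.eval n)
    (hi : i < PoS.parties.eval n) (hu : (𝓔).HonestUntil ((𝓔).exec 𝓢 (r + 1)) r t i)
    (ht : t ≤ r / C) {k : ℕ} :
    (k < 3 * t + 3 → SimCtx.forgerMove H S X PoS A m C T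
        ⟨n, H.gen n ωh, l, i, t, forgerView 𝓔 𝓢 r i t k⟩ r =
      if k % 3 = 0 then (𝓔).stateQuery 𝓢 i (k / 3)
      else if k % 3 = 1 then if (k / 3 + 1) * C ≤ r + 1 then (𝓔).handoverQuery 𝓢 i (k / 3) else .nil
      else if k / 3 < r / C then .cons (num 1) .nil else .nil) ∧
    (t < r / C → SimCtx.forgerMove H S X PoS A m C T
        ⟨n, H.gen n ωh, l, i, t, forgerView 𝓔 𝓢 r i t (3 * t + 3)⟩ r = .cons (num 2) .nil) ∧
    (t < r / C → SimCtx.forgerMove H S X PoS A m C T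
        ⟨n, H.gen n ωh, l, i, t, forgerView 𝓔 𝓢 r i t (3 * t + 4)⟩ r =
      (𝓔).forgery 𝓢 ((𝓦).sigCandidates X A m C l r) r i t) ∧
    (t = r / C → 3 * t + 3 ≤ k → k ≤ 3 * T.eval n + 4 → SimCtx.forgerMove H S X PoS A m C T
        ⟨n, H.gen n ωh, l, i, t, forgerView 𝓔 𝓢 r i t k⟩ r =
      if k = 3 * T.eval n + 4 then (𝓔).forgery 𝓢 ((𝓦).sigCandidates X A m C l r) r i t
      else .nil) := by
  have hCE : (𝓔).C = C := rfl
  have hle : r / C * C ≤ r := Nat.div_mul_le_self _ _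
  have hpk : ∀ k, i < PoS.parties.eval n →
      (forgerView 𝓔 𝓢 r i t k).getD 0 .nil = (S.gen n ωg).1 := by
    intro k _
    change (S.gen n (World.genCoins 𝓦 i)).1 = _
    rw [genCoins_simWorld hi, if_pos rfl]
  have a := fun k => agree_simWorld (X := X) (A := A) (T := T) (m := m) (C := C) (ωh := ωh) (l := l)
    (t := t) (ρ := ρ) (hpk k)
  have hmulmono : ∀ {a b : ℕ}, a * C < b * C → a < b := fun h => Nat.lt_of_mul_lt_mul_right h
  have hexec : ∀ {N k : ℕ}, N ≤ r + 1 → (∀ e ≤ t, e * C < N → 3 * e < k) →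
      (∀ e ≤ t, (e + 1) * C ≤ N → 3 * e + 1 < k) → ((t + 1) * C < N → 3 * t + 3 < k) →
      SimCtx.exec H S X PoS A m C T ⟨n, H.gen n ωh, l, i, t, forgerView 𝓔 𝓢 r i t k⟩ N =
        (𝓔).exec 𝓢 N := by
    intro N k hN h0 h1 h2
    exact exec_simWorld X m C hC hT (hpk k) (by omega) fun _ =>
      supports_forgerView hC hu hN h0 h1 h2
  have hforge : ∀ {k : ℕ}, (∀ e ≤ t, e * C < r + 1 → 3 * e < k) →
      (∀ e ≤ t, (e + 1) * C ≤ r + 1 → 3 * e + 1 < k) → ((t + 1) * C < r + 1 → 3 * t + 3 < k) →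
      SimCtx.forgery H S X PoS A m C T
        ⟨n, H.gen n ωh, l, i, t, forgerView 𝓔 𝓢 r i t k⟩ r i t =
      (𝓔).forgery 𝓢 ((𝓦).sigCandidates X A m C l r) r i t := by
    intro k h0 h1 h2
    have he := hexec le_rfl h0 h1 h2
    have hg := gctx_simWorld (X := X) (hpk k) he
    rw [SimCtx.forgery, hg.1, hg.2]
    exact (a k).forgery _ hi he _ _
  refine ⟨fun hk => ?_, fun hlt => ?_, fun hlt => ?_, fun heq h1 h2 => ?_⟩
  · unfold SimCtx.forgerMove
    simp only [length_forgerView, Nat.add_sub_cancel, if_pos hk]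
    have hkt : k / 3 ≤ t := by omega
    have hktC : k / 3 * C ≤ r / C * C := Nat.mul_le_mul_right _ (hkt.trans ht)
    split_ifs with h0 h1 h2
    · refine (a k).stateQuery _ hi (hexec (by rw [hCE]; omega) (fun e _ h => ?_) (fun e _ h => ?_)
        fun h => ?_)
      · have := hmulmono h
        omega
      · have := Nat.le_of_mul_le_mul_right h hC
        omega
      · have := hmulmono h
        omega
    · have hpos : 0 < (k / 3 + 1) * C := Nat.mul_pos (by omega) hC
      refine (a k).handoverQuery _ hi (hexec (by rw [hCE]; omega) (fun e _ h => ?_) (fun e _ h => ?_)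
        fun h => ?_)
      · rw [hCE] at h
        have := hmulmono (show e * C < (k / 3 + 1) * C by omega)
        omega
      · rw [hCE] at h
        have := hmulmono (show (e + 1) * C < (k / 3 + 1) * C by omega)
        omega
      · rw [hCE] at h
        have := hmulmono (show (t + 1) * C < (k / 3 + 1) * C by omega)
        omega
    all_goals rfl
  · unfold SimCtx.forgerMove
    simp only [length_forgerView, Nat.add_sub_cancel]
    rw [if_neg (by omega), if_pos hlt]
    exact if_pos trivial
  · unfold SimCtx.forgerMove
    simp only [length_forgerView, Nat.add_sub_cancel]
    rw [if_neg (by omega), if_pos hlt, if_neg (by omega)]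
    exact hforge (fun e he _ => by omega) (fun e he _ => by omega) fun _ => by omega
  · unfold SimCtx.forgerMove
    simp only [length_forgerView, Nat.add_sub_cancel]
    rw [if_neg (by omega), if_neg (by omega)]
    split_ifs with hk
    · refine hforge (fun e he _ => by omega) (fun e he _ => by omega) fun h => ?_
      have h3 : t + 1 ≤ r / C := (Nat.le_div_iff_mul_le hC).mpr (by omega)
      omega
    · rfl

/-- The messages that party `i` signs in period `p`. -/
def SignedBy (E : Env) (strat : List Data → Data) (r i : ℕ) (x : ℕ × Data) : Prop :=
  x.2 = stateMsg (E.stateCommitment (E.st₀ strat)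
    (Env.ledger (E.exec strat (r + 1)) (x.1 * E.C) i)) ∨
  x.2 = handoverMsg (x.1 + 1) (E.committee strat (E.exec strat (r + 1)) (x.1 + 1))

variable {F : List Data → Data} {L : ℕ}

/-- As long as the adversary is not given the key, the challenger signs with the keys, and with the
coins, of the targeted party in the simulated world. -/
theorem attackAt_eq (hC : 0 < C) (hT : T.eval n ≤ C * S.periods n) (hr : r < T.eval n)
    (hi : i < PoS.parties.eval n) (hu : (𝓔).HonestUntil ((𝓔).exec 𝓢 (r + 1)) r t i)
    (ht : t ≤ r / C)
    (hF : ∀ recv, (SimCtx.forgerMove H S X PoS A m C T ⟨n, H.gen n ωh, l, i, t, recv⟩ r).size ≤ L →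
      F recv = SimCtx.forgerMove H S X PoS A m C T ⟨n, H.gen n ωh, l, i, t, recv⟩ r)
    (hL : 7 ≤ L) (hs : ∀ j ≤ t, ((𝓔).stateQuery 𝓢 i j).size ≤ L)
    (hh : ∀ j ≤ t,
        (j + 1) * C ≤ r + 1 → ((𝓔).handoverQuery 𝓢 i j).size ≤ L) {k : ℕ} (hk : k ≤ 3 * t + 3) :
    let st := S.attackAt n F ωg ρ k
    st.received = forgerView 𝓔 𝓢 r i t k ∧ st.broken = none ∧ st.period = min (k / 3) (r / C) ∧
      st.key = World.key 𝓦 i (min (k / 3) (r / C)) ∧ ∀ x ∈ st.queries, SignedBy 𝓔 𝓢 r i x := by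
  have hCE : (𝓔).C = C := rfl
  have hle : r / C * C ≤ r := Nat.div_mul_le_self _ _
  have hper : r / C < S.periods n := Nat.div_lt_of_lt_mul (by omega)
  have heT : r / C < T.eval n := (Nat.div_le_self _ _).trans_lt hr
  induction k with
  | zero =>
    refine ⟨?_, rfl, by simp [SignatureScheme.attackAt], ?_, by simp [SignatureScheme.attackAt]⟩
    · change [(S.gen n ωg).1] = [(S.gen n (World.genCoins 𝓦 i)).1]
      rw [genCoins_simWorld hi, if_pos rfl]
    · rw [Nat.zero_div, Nat.zero_min, World.key, SignatureAlgorithms.keyAt, genCoins_simWorld hi,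
        if_pos rfl]
      rfl
  | succ k ih =>
    obtain ⟨hrec, hbr, hp, hkey, hq⟩ := ih (by omega)
    intro st
    have hst : st = S.attackStep n F (S.attackAt n F ωg ρ k) (ρ k) :=
      SignatureScheme.attackAt_succ _ _ _
    clear_value st
    have hm := (forgerMove_eq (m := m) (X := X) (k := k) hC hT hr hi hu ht).1 (by omega)
    have hmove := hF (forgerView 𝓔 𝓢 r i t k)
    rw [hm, ← hrec] at hmove
    rw [forgerView_succ, ← hrec]
    have hkt : k / 3 ≤ t := by omega
    have hktC : k / 3 * C ≤ r / C * C := Nat.mul_le_mul_right _ (hkt.trans ht)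
    rw [min_eq_left (by omega)] at hp hkey
    have hopc : ∀ a : Fin 3, k % 3 = a → World.opCoins 𝓦 i (k / 3) a = ρ k := by
      intro a ha
      rw [opCoins_simWorld hi (by omega), if_pos ⟨rfl, hkt⟩]
      congr 1
      omega
    rw [forgerEntry, if_pos (by omega)]
    by_cases h0 : k % 3 = 0
    · have hdiv : (k + 1) / 3 = k / 3 := by omega
      simp only [if_pos h0] at hmove
      rw [if_pos h0, hdiv, min_eq_left (by omega)]
      have hmove := hmove (hs _ hkt)
      rw [Env.stateQuery] at hmove
      split_ifs at hmove with hmem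
      · rw [if_pos hmem]
        rw [SignatureScheme.attackStep_sign hbr hmove] at hst
        subst hst
        refine ⟨?_, hbr, hp, hkey, fun x hx => ?_⟩
        · rw [hkey, ← hopc 0 h0]
          rfl
        · rcases List.mem_append.mp hx with hx | hx
          · exact hq x hx
          · obtain rfl := List.mem_singleton.mp hx
            refine Or.inl ?_
            dsimp only
            rw [hp, Env.ledger, Env.outcome, Env.getElem?_exec _ _ (by rw [hCE]; omega)]
            rfl
      · rw [if_neg hmem]
        rw [SignatureScheme.attackStep_nil hbr hmove] at hst
        subst hst
        exact ⟨rfl, hbr, hp, hkey, hq⟩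
    · simp only [if_neg h0] at hmove
      rw [if_neg h0]
      by_cases h1 : k % 3 = 1
      · have hdiv : (k + 1) / 3 = k / 3 := by omega
        simp only [if_pos h1] at hmove
        rw [if_pos h1, hdiv, min_eq_left (by omega)]
        by_cases hrC : (k / 3 + 1) * C ≤ r + 1
        · simp only [if_pos hrC] at hmove
          have hmove := hmove (hh _ hkt hrC)
          rw [Env.handoverQuery] at hmove
          rw [if_pos (show (k / 3 + 1) * (𝓔).C ≤ r + 1 from hrC)]
          split_ifs at hmove with hmem
          · rw [if_pos hmem]
            rw [SignatureScheme.attackStep_sign hbr hmove] at hst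
            subst hst
            refine ⟨?_, hbr, hp, hkey, fun x hx => ?_⟩
            · rw [hkey, ← hopc 1 h1]
              rfl
            · rcases List.mem_append.mp hx with hx | hx
              · exact hq x hx
              · obtain rfl := List.mem_singleton.mp hx
                refine Or.inr ?_
                have hpos : 0 < (k / 3 + 1) * C := Nat.mul_pos (by omega) hC
                dsimp only
                rw [hp, Env.committee, Env.outcome, Env.getElem?_exec _ _ (by rw [hCE]; omega)]
                rfl
          · rw [if_neg hmem]
            rw [SignatureScheme.attackStep_nil hbr hmove] at hst
            subst hst
            exact ⟨rfl, hbr, hp, hkey, hq⟩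
        · simp only [if_neg hrC] at hmove
          rw [if_neg (show ¬ (k / 3 + 1) * (𝓔).C ≤ r + 1 from hrC)]
          have hmove := hmove (by simp only [Data.size]; omega)
          rw [SignatureScheme.attackStep_nil hbr hmove] at hst
          subst hst
          exact ⟨rfl, hbr, hp, hkey, hq⟩
      · have hdiv : (k + 1) / 3 = k / 3 + 1 := by omega
        simp only [if_neg h1] at hmove
        rw [if_neg h1, hdiv]
        by_cases hke : k / 3 < r / C
        · simp only [if_pos hke] at hmove
          have hmove := hmove (by simp [Data.size, num, ofList]; omega)
          rw [SignatureScheme.attackStep_update hbr hmove (by omega)] at hst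
          subst hst
          rw [min_eq_left (by omega)]
          refine ⟨rfl, hbr, by rw [hp], ?_, hq⟩
          rw [World.key, SignatureAlgorithms.keyAt, hopc 2 (by simp; omega), hkey]
          rfl
        · simp only [if_neg hke] at hmove
          have hmove := hmove (by simp only [Data.size]; omega)
          rw [SignatureScheme.attackStep_nil hbr hmove] at hst
          subst hst
          rw [min_eq_right (by omega), show r / C = k / 3 by omega]
          exact ⟨rfl, hbr, hp, hkey, hq⟩

/-- If there is a forged signature, then the search finds one. -/
theorem forgery_spec {E : Env} {strat : List Data → Data} {sigs : List (ℕ × Data × Data)}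
    {msg sig : Data} (hmem : (t, msg, sig) ∈ sigs)
    (hf : E.Forged strat r (E.exec strat (r + 1)) i t msg sig) :
    ((E.forgery strat sigs r i t).nth 0).toNat = t ∧
      E.verify (E.pk i) t ((E.forgery strat sigs r i t).nth 1)
        ((E.forgery strat sigs r i t).nth 2) = true ∧
      ¬ SignedBy E strat r i (t, (E.forgery strat sigs r i t).nth 1) := by
  obtain ⟨-, -, hv, h1, h2⟩ := hf
  unfold Env.forgery
  obtain ⟨x, hx⟩ := Option.isSome_iff_exists.mp (List.find?_isSome.mpr ⟨(t, msg, sig), hmem, by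
    simp only [decide_true, hv, Bool.true_and, Bool.and_eq_true, Bool.not_eq_true',
        decide_eq_false_iff_not]
    exact ⟨h1, h2⟩⟩ : (sigs.find? fun x => decide (x.1 = t) && E.verify (E.pk i) t x.2.1 x.2.2 &&
      !decide (x.2.1 = stateMsg (E.stateCommitment (E.st₀ strat)
        (Env.ledger (E.exec strat (r + 1)) (t * E.C) i))) &&
      !decide (x.2.1 = handoverMsg (t + 1) (E.committee strat (E.exec strat (r + 1)) (t + 1)))).isSome)
  have h3 := List.find?_some hx
  rw [hx]
  simp only [Bool.and_eq_true, Bool.not_eq_true', decide_eq_false_iff_not, decide_eq_true_eq] at h3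
  simp only [Option.map_some, Option.getD_some, nth_ofList, List.getD_cons_zero,
    List.getD_cons_succ]
  refine ⟨by simp [Data.toNat, num, toList_ofList], h3.1.1.2, fun h => ?_⟩
  rcases h with h | h
  · exact h3.1.2 h
  · exact h3.2 h

/-- If the tournament exhibits a forged signature of the targeted party and period, then the forger
wins the attack game. -/
theorem forges_of_forgesAt (hC : 0 < C) (hT : T.eval n ≤ C * S.periods n) (hr : r < T.eval n)
    (hf : (𝓦).ForgesAt X A m C l r i t)
    (hF : ∀ recv, (SimCtx.forgerMove H S X PoS A m C T ⟨n, H.gen n ωh, l, i, t, recv⟩ r).size ≤ L →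
      F recv = SimCtx.forgerMove H S X PoS A m C T ⟨n, H.gen n ωh, l, i, t, recv⟩ r)
    (hL : 7 ≤ L) (hs : ∀ j ≤ t, ((𝓔).stateQuery 𝓢 i j).size ≤ L)
    (hh : ∀ j ≤ t, (j + 1) * C ≤ r + 1 → ((𝓔).handoverQuery 𝓢 i j).size ≤ L)
    (hfs : ((𝓔).forgery 𝓢 ((𝓦).sigCandidates X A m C l r) r i t).size ≤ L) :
    S.Forges n F ωg fun k : Fin (3 * T.eval n + 4) => ρ k := by
  obtain ⟨msg, sig, hmem, hforged⟩ := hf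
  have hu := hforged.1
  have hi : i < PoS.parties.eval n := hu.1
  have ht : t ≤ r / C := hforged.2.1
  have hper : r / C < S.periods n := Nat.div_lt_of_lt_mul (by omega)
  have heT : r / C < T.eval n := (Nat.div_le_self _ _).trans_lt hr
  obtain ⟨hrec, hbr, hp, hkey, hq⟩ := attackAt_eq hC hT hr hi hu ht hF hL hs hh le_rfl
  have hspec := forgery_spec hmem hforged
  have hpk : (𝓔).pk i = (S.gen n ωg).1 := by
    change (S.gen n (World.genCoins 𝓦 i)).1 = _
    rw [genCoins_simWorld hi, if_pos rfl]
  rw [hpk] at hspec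
  have hm := fun k => forgerMove_eq (X := X) (m := m) (k := k) hC hT hr hi hu ht
  -- It is enough that the forgery is output, and that the break-in comes after period `t`.
  have hfin : ∀ st : AttackState, S.attackAt n F ωg ρ (3 * T.eval n + 4) = st →
      F st.received = (𝓔).forgery 𝓢 ((𝓦).sigCandidates X A m C l r) r i t →
      (∀ b, st.broken = some b → t < b) → (∀ x ∈ st.queries, SignedBy 𝓔 𝓢 r i x) →
      S.Forges n F ωg fun k : Fin (3 * T.eval n + 4) => ρ k := by
    intro st hst hout hb hqs
    unfold SignatureScheme.Forges
    rw [SignatureScheme.attack_eq_attackAt, hst]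
    dsimp only
    rw [hout, hspec.1]
    exact ⟨hspec.2.1, by omega, hb, fun h => hspec.2.2 (hqs _ h)⟩
  -- If the execution up to round `r` extends beyond period `t`, the forger needs the key of the
  -- next period; after the break-in no further moves are made. Otherwise it waits until the end.
  rcases ht.lt_or_eq with hlt | heq
  · have hmove := hF (forgerView 𝓔 𝓢 r i t (3 * t + 3))
    rw [(hm 0).2.1 hlt, ← hrec] at hmove
    have hmove := hmove (by simp [Data.size, num, ofList]; omega)
    have hst := SignatureScheme.attackAt_succ (S := S) (n := n) (F := F) ωg ρ (3 * t + 3)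
    rw [SignatureScheme.attackStep_break hbr hmove] at hst
    have hstay : ∀ k, 3 * t + 4 ≤ k → S.attackAt n F ωg ρ k = S.attackAt n F ωg ρ (3 * t + 3 + 1) := by
      intro k hk
      induction k, hk using Nat.le_induction with
      | base => rfl
      | succ k _ ih =>
        rw [SignatureScheme.attackAt_succ, ih]
        rw [hst]
        exact SignatureScheme.attackStep_broken rfl
    refine hfin _ (hstay _ (by omega)) ?_ ?_ ?_
    · have hrec' : (S.attackAt n F ωg ρ (3 * t + 3 + 1)).received = forgerView 𝓔 𝓢 r i t (3 * t + 4) := by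
        rw [hst, forgerView_succ, forgerEntry, if_neg (by omega), if_pos ⟨rfl, hlt⟩, ← hrec, hkey,
          show (3 * t + 3) / 3 = t + 1 by omega, min_eq_left (by omega)]
        rfl
      rw [hrec', hF _ (by rw [(hm 0).2.2.1 hlt]; exact hfs), (hm 0).2.2.1 hlt]
    · intro b hb
      rw [hst] at hb
      have : (S.attackAt n F ωg ρ (3 * t + 3)).period = b := by simpa using hb
      omega
    · rw [hst]
      exact hq
  · have hstay : ∀ k, 3 * t + 3 ≤ k → k ≤ 3 * T.eval n + 4 →
        (S.attackAt n F ωg ρ k).received = forgerView 𝓔 𝓢 r i t k ∧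
        (S.attackAt n F ωg ρ k).broken = none ∧
        (S.attackAt n F ωg ρ k).queries = (S.attackAt n F ωg ρ (3 * t + 3)).queries := by
      intro k hk
      induction k, hk using Nat.le_induction with
      | base => exact fun _ => ⟨hrec, hbr, rfl⟩
      | succ k hk ih =>
        intro hkT
        obtain ⟨h1, h2, h3⟩ := ih (by omega)
        have hmk := (hm k).2.2.2 heq hk (by omega)
        rw [if_neg (by omega)] at hmk
        have hmove := hF (forgerView 𝓔 𝓢 r i t k)
        rw [hmk, ← h1] at hmove
        have hmove := hmove (by simp only [Data.size]; omega)
        rw [SignatureScheme.attackAt_succ, SignatureScheme.attackStep_nil h2 hmove]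
        refine ⟨?_, h2, h3⟩
        rw [forgerView_succ, forgerEntry, if_neg (by omega), if_neg, ← h1]
        rintro ⟨-, h⟩
        exact absurd h (by change ¬ t < r / C; omega)
    obtain ⟨h1, h2, h3⟩ := hstay (3 * T.eval n + 4) (by omega) le_rfl
    have hmk := (hm (3 * T.eval n + 4)).2.2.2 heq (by omega) le_rfl
    rw [if_pos rfl] at hmk
    -- There is no break-in, and the forgery is output after the last move.
    refine hfin _ rfl ?_ ?_ ?_
    · rw [h1, hF _ (by rw [hmk]; exact hfs), hmk]
    · rw [h2]
      simp
    · rw [h3]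
      exact hq

end Attack

/-! ### Probabilities -/

section Pr
variable {Ω Ω' : Type}

theorem pr_nonneg (E : Ω → Prop) : 0 ≤ pr E := by
  unfold pr
  positivity

theorem pr_mono [Finite Ω] {E E' : Ω → Prop} (h : ∀ ω, E ω → E' ω) : pr E ≤ pr E' := by
  unfold pr
  gcongr
  exact Nat.card_le_card_of_injective (Subtype.map id h) (Subtype.map_injective _ Function.injective_id)

theorem pr_or_le [Finite Ω] (E E' : Ω → Prop) : pr (fun ω => E ω ∨ E' ω) ≤ pr E + pr E' := by
  unfold pr
  rw [← add_div]
  gcongr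
  exact_mod_cast Set.ncard_union_le {ω | E ω} {ω | E' ω}

theorem pr_exists_le [Finite Ω] (N : ℕ) (E : ℕ → Ω → Prop) :
    pr (fun ω => ∃ i < N, E i ω) ≤ ∑ i ∈ Finset.range N, pr (E i) := by
  induction N with
  | zero => simp [pr]
  | succ N ih =>
    rw [Finset.sum_range_succ]
    refine (pr_mono fun ω h => ?_).trans ((pr_or_le _ _).trans (add_le_add_left ih _))
    obtain ⟨i, hi, h⟩ := h
    rcases Nat.lt_succ_iff_lt_or_eq.mp hi with hi | rfl
    · exact Or.inl ⟨i, hi, h⟩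
    · exact Or.inr h

theorem pr_prod (E : Ω → Prop) (E' : Ω' → Prop) :
    pr (fun ω : Ω × Ω' => E ω.1 ∧ E' ω.2) = pr E * pr E' := by
  unfold pr
  have : Nat.card {ω : Ω × Ω' // E ω.1 ∧ E' ω.2} = Nat.card {ω // E ω} * Nat.card {ω // E' ω} := by
    rw [← Nat.card_prod]
    exact Nat.card_congr (Equiv.subtypeProdEquivProd (p := E) (q := E'))
  rw [this, Nat.card_prod, Nat.cast_mul, Nat.cast_mul, mul_div_mul_comm]

/-- A surjective homomorphism of finite groups maps the uniform distribution to the uniform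
distribution, since all its fibres have the size of the kernel. -/
theorem pr_comp_hom [AddGroup Ω] [AddGroup Ω'] [Finite Ω] (φ : Ω →+ Ω')
    (hφ : Function.Surjective φ) (E : Ω' → Prop) : pr (fun ω => E (φ ω)) = pr E := by
  obtain ⟨s, hs⟩ := hφ.hasRightInverse
  have key : ∀ E : Ω' → Prop,
      Nat.card {ω // E (φ ω)} = Nat.card {ω // E ω} * Nat.card φ.ker := by
    intro E
    rw [← Nat.card_prod]
    refine Nat.card_congr ⟨fun ω => (⟨φ ω, ω.2⟩, ⟨ω.1 - s (φ ω), ?_⟩),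
      fun x => ⟨x.2.1 + s x.1.1, ?_⟩, fun ω => ?_, fun x => ?_⟩
    · rw [AddMonoidHom.mem_ker, map_sub, hs, sub_self]
    · rw [map_add, hs, AddMonoidHom.mem_ker.mp x.2.2, zero_add]
      exact x.1.2
    · ext
      simp
    · have h1 : φ (x.2.1 + s x.1.1) = x.1.1 := by
        rw [map_add, hs, AddMonoidHom.mem_ker.mp x.2.2, zero_add]
      ext
      · exact h1
      · simp [h1]
  have h1 := key E
  have h2 := key fun _ => True
  have h3 : ∀ Ω : Type, Nat.card {_ω : Ω // True} = Nat.card Ω :=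
    fun Ω => Nat.card_congr (Equiv.subtypeUnivEquiv fun _ => trivial)
  rw [h3, h3] at h2
  unfold pr
  have h4 : (Nat.card φ.ker : ℝ) ≠ 0 := by
    have := (inferInstance : Finite φ.ker)
    exact_mod_cast Nat.card_pos.ne'
  rw [h1, h2, Nat.cast_mul, Nat.cast_mul, mul_div_mul_right _ _ h4]

end Pr

theorem bitsMod_cons (M : ℕ) (b : Bool) (l : List Bool) :
    bitsMod M (b :: l) = (2 * bitsMod M l + if b then 1 else 0) % M := by
  simp [bitsMod]

theorem bitsMod_testBit (M : ℕ) {k x : ℕ} (hx : x < 2 ^ k) :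
    bitsMod M (List.ofFn fun i : Fin k => x.testBit i) = x % M := by
  induction k generalizing x with
  | zero =>
    obtain rfl : x = 0 := by simpa using hx
    simp [bitsMod]
  | succ k ih =>
    rw [List.ofFn_succ, bitsMod_cons]
    have : (fun i : Fin k => x.testBit (i.succ : Fin (k + 1))) = fun i : Fin k => (x / 2).testBit i := by
      funext i
      rw [Fin.val_succ, Nat.testBit_succ]
    rw [this, ih (by rw [pow_succ] at hx; omega)]
    have h2 : (if x.testBit ((0 : Fin (k + 1)) : ℕ) = true then 1 else 0) = x % 2 := by
      rcases Nat.mod_two_eq_zero_or_one x with h | h <;> simp [h]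
    rw [h2, Nat.add_mod, Nat.mul_mod, Nat.mod_mod, ← Nat.mul_mod, ← Nat.add_mod, Nat.div_add_mod]

/-- Every value of a guess modulo `M` has about the probability `1 / M`. -/
theorem le_pr_bitsMod {M g : ℕ} (hg : g < M) :
    1 ≤ 2 * M * pr fun ω : Coins M => bitsMod M (List.ofFn ω) = g := by
  have hM : 0 < M := by omega
  have hMM : M < 2 ^ M := Nat.lt_two_pow_self
  have hcard : 2 ^ M / M ≤ Nat.card {ω : Coins M // bitsMod M (List.ofFn ω) = g} := by
    have hlt : ∀ k : Fin (2 ^ M / M), k * M + g < 2 ^ M := fun k =>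
      calc k * M + g < k * M + M := by omega
        _ = (k + 1) * M := by ring
        _ ≤ 2 ^ M / M * M := Nat.mul_le_mul_right _ k.2
        _ ≤ 2 ^ M := Nat.div_mul_le_self _ _
    let f : Fin (2 ^ M / M) → {ω : Coins M // bitsMod M (List.ofFn ω) = g} := fun k =>
      ⟨fun i => (k * M + g).testBit i, by
        rw [bitsMod_testBit M (hlt k), Nat.mul_comm, Nat.mul_add_mod, Nat.mod_eq_of_lt hg]⟩
    have hf : Function.Injective f := by
      intro k k' h
      have h1 : (k : ℕ) * M + g = k' * M + g := by
        apply Nat.eq_of_testBit_eq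
        intro i
        by_cases hi : i < M
        · exact congrFun (congrArg Subtype.val h) ⟨i, hi⟩
        · rw [Nat.testBit_lt_two_pow ((hlt k).trans_le (Nat.pow_le_pow_right (by omega) (by omega))),
            Nat.testBit_lt_two_pow ((hlt k').trans_le (Nat.pow_le_pow_right (by omega) (by omega)))]
      apply Fin.ext
      exact Nat.eq_of_mul_eq_mul_right hM (by omega)
    simpa using Nat.card_le_card_of_injective f hf
  have h1 : 2 ^ M ≤ 2 * M * (2 ^ M / M) := by
    have h2 := Nat.div_add_mod (2 ^ M) M
    have h3 := Nat.mod_lt (2 ^ M) hM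
    have h4 : M * 1 ≤ M * (2 ^ M / M) := Nat.mul_le_mul_left _ ((Nat.one_le_div_iff hM).mpr hMM.le)
    rw [Nat.mul_assoc]
    omega
  have h5 : 2 ^ M ≤ 2 * M * Nat.card {ω : Coins M // bitsMod M (List.ofFn ω) = g} :=
    h1.trans (Nat.mul_le_mul_left _ hcard)
  have h6 : Nat.card (Coins M) = 2 ^ M := by simp
  unfold pr
  rw [h6, ← mul_div_assoc, le_div_iff₀ (by positivity), one_mul]
  exact_mod_cast h5

/-- A reduction that succeeds whenever an event occurs and its independent guess is right loses at most
the factor `2 * M`, where `M` is the number of possible guesses. -/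
theorem pr_le_of_guess {Ω Ω' : Type} [AddGroup Ω] [AddGroup Ω'] [Finite Ω] [Finite Ω'] {M g : ℕ}
    (hg : g < M) (φ : Ω →+ Ω' × Coins M) (hφ : Function.Surjective φ) {E : Ω' → Prop} {E' : Ω → Prop}
    (h : ∀ ω, E (φ ω).1 → bitsMod M (List.ofFn (φ ω).2) = g → E' ω) :
    pr E ≤ 2 * M * pr E' := by
  have h1 := pr_prod E fun ω : Coins M => bitsMod M (List.ofFn ω) = g
  rw [← pr_comp_hom φ hφ] at h1
  have h2 : pr E * pr (fun ω : Coins M => bitsMod M (List.ofFn ω) = g) ≤ pr E' := by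
    rw [← h1]
    exact pr_mono fun ω hω => h ω hω.1 hω.2
  calc pr E ≤ pr E * (2 * M * pr fun ω : Coins M => bitsMod M (List.ofFn ω) = g) :=
        le_mul_of_one_le_right (pr_nonneg E) (le_pr_bitsMod hg)
    _ = 2 * M * (pr E * pr fun ω : Coins M => bitsMod M (List.ofFn ω) = g) := by ring
    _ ≤ 2 * M * pr E' := by gcongr

/-! ### Negligible functions -/

theorem Negligible.of_le {f g : ℕ → ℝ} (hf : Negligible f) (h0 : ∀ n, 0 ≤ g n)
    (h : ∀ n, g n ≤ f n) : Negligible g :=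
  Asymptotics.SuperpolynomialDecay.trans_abs_le hf fun n => by
    rw [abs_of_nonneg (h0 n), abs_of_nonneg ((h0 n).trans (h n))]
    exact h n

theorem Negligible.poly_mul {f : ℕ → ℝ} (hf : Negligible f) (P : Polynomial ℕ) :
    Negligible fun n => ((P.eval n : ℕ) : ℝ) * f n := by
  have := Asymptotics.SuperpolynomialDecay.polynomial_mul hf (P.map (Nat.castRingHom ℝ))
  refine this.congr fun n => ?_
  rw [Polynomial.eval_natCast_map]
  rfl

/-! ### The coins of the reductions -/

section Coins
variable {H : HashFamily} {S : SignatureScheme} {PoS : PoSProtocol} {A : Adversary}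
  {T : Polynomial ℕ} {n : ℕ}

theorem toCoins_drop_add {L : ℕ} (a b : Coins L) (k o : ℕ) :
    toCoins k ((List.ofFn (a + b)).drop o) =
      toCoins k ((List.ofFn a).drop o) + toCoins k ((List.ofFn b).drop o) := by
  funext j
  rw [Pi.add_apply]
  by_cases h : o + j < L
  · simp [toCoins, List.getD_eq_getElem?_getD, h]
  · simp [toCoins, List.getD_eq_getElem?_getD, h]
    rfl

theorem toCoins_add {L : ℕ} (a b : Coins L) (k : ℕ) :
    toCoins k (List.ofFn (a + b)) = toCoins k (List.ofFn a) + toCoins k (List.ofFn b) := by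
  simpa using toCoins_drop_add a b k 0

/-- The coins of the simulated world depend additively on all coins used in the simulation. -/
theorem simWorld_add {L : ℕ} (ωh ωh' : Coins (H.coins.eval n)) (a b : Coins L) (i t : ℕ)
    (ωg ωg' : Coins (S.coins.eval n)) (ρ ρ' : ℕ → Coins (S.coins.eval n)) :
    simWorld H S PoS A T (ωh + ωh') (List.ofFn (a + b)) i t (ωg + ωg') (ρ + ρ') =
      simWorld H S PoS A T ωh (List.ofFn a) i t ωg ρ +
        simWorld H S PoS A T ωh' (List.ofFn b) i t ωg' ρ' := by
  refine Prod.ext rfl (Prod.ext (toCoins_drop_add a b _ _) (Prod.ext ?_ ?_))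
  · funext k
    simp only [simWorld, genBits, toCoins_drop_add, Prod.snd_add, Prod.fst_add, Pi.add_apply]
    split_ifs <;> rfl
  · funext k e c
    simp only [simWorld, opBits, toCoins_drop_add, Prod.snd_add, Pi.add_apply]
    split_ifs <;> rfl

theorem ofFn_eq_map_range {α : Type} {L : ℕ} (f : ℕ → α) :
    (List.ofFn fun k : Fin L => f k) = (List.range L).map f := by
  apply List.ext_getElem <;> simp

theorem guess_eq {l : List Bool} (hl : posOffset PoS A T n ≤ l.length) :
    guess PoS A T n l = bitsMod (guesses PoS T n)
      (List.ofFn (toCoins (guesses PoS T n) (l.drop (A.coins.eval n)))) := by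
  rw [guess]
  congr 1
  rw [posOffset] at hl
  apply List.ext_getElem
  · simp
    omega
  · intro j h1 h2
    simp at h2
    simp [toCoins, List.getD_eq_getElem?_getD, List.getElem?_drop,
      List.getElem?_eq_getElem (show A.coins.eval n + j < l.length by omega)]

/-- The guess with the given components. -/
noncomputable def guessOf (PoS : PoSProtocol) (T : Polynomial ℕ) (n r i t : ℕ) : ℕ :=
  r + (T.eval n + 1) * (i + (PoS.parties.eval n + 1) * t)

theorem guessOf_lt {r i t : ℕ} (hr : r < T.eval n) (hi : i ≤ PoS.parties.eval n) (ht : t < T.eval n) :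
    guessOf PoS T n r i t < guesses PoS T n := by
  have h1 : i + (PoS.parties.eval n + 1) * t < (PoS.parties.eval n + 1) * (T.eval n + 1) := by
    calc i + (PoS.parties.eval n + 1) * t < (PoS.parties.eval n + 1) * (t + 1) := by
          rw [Nat.mul_succ]
          omega
      _ ≤ _ := Nat.mul_le_mul_left _ (by omega)
  unfold guessOf guesses
  calc r + (T.eval n + 1) * (i + (PoS.parties.eval n + 1) * t)
      < (T.eval n + 1) * (i + (PoS.parties.eval n + 1) * t + 1) := by
        rw [Nat.mul_succ]
        omega
    _ ≤ (T.eval n + 1) * ((PoS.parties.eval n + 1) * (T.eval n + 1)) := Nat.mul_le_mul_left _ h1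
    _ = _ := by ring

theorem guess_components {r i t : ℕ} (hr : r < T.eval n) (hi : i ≤ PoS.parties.eval n)
    {l : List Bool} (hg : guess PoS A T n l = guessOf PoS T n r i t) :
    guessRound PoS A T n l = r ∧ guessParty PoS A T n l = i ∧ guessPeriod PoS A T n l = t := by
  have h1 : guess PoS A T n l / (T.eval n + 1) = i + (PoS.parties.eval n + 1) * t := by
    rw [hg, guessOf, Nat.add_mul_div_left _ _ (by omega), Nat.div_eq_of_lt (by omega), Nat.zero_add]
  refine ⟨?_, ?_, ?_⟩
  · rw [guessRound, hg, guessOf, Nat.add_mul_mod_self_left, Nat.mod_eq_of_lt (by omega)]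
  · rw [guessParty, h1, Nat.add_mul_mod_self_left, Nat.mod_eq_of_lt (by omega)]
  · rw [guessPeriod, h1, Nat.add_mul_div_left _ _ (by omega), Nat.div_eq_of_lt (by omega),
      Nat.zero_add]

variable (H S PoS A T n)

/-- The coins of the adversary and of the guess, in the coins of a reduction. -/
noncomputable def advCoins (L : ℕ) : Coins L →+ Coins (A.coins.eval n) × Coins (guesses PoS T n) :=
  AddMonoidHom.mk' (fun a => (toCoins _ (List.ofFn a), toCoins _ ((List.ofFn a).drop (A.coins.eval n))))
    fun a b => Prod.ext (toCoins_add a b _) (toCoins_drop_add a b _ _)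

/-- The experiment of the adversary against the protocol. -/
noncomputable def protocolHom (L : ℕ) : World H S PoS T n × Coins L →+
    (World H S PoS T n × Coins (A.coins.eval n)) × Coins (guesses PoS T n) :=
  AddMonoidHom.mk' (fun ω => ((ω.1, (advCoins PoS A T n L ω.2).1), (advCoins PoS A T n L ω.2).2))
    fun a b => by
      rw [Prod.fst_add, Prod.snd_add, map_add]
      rfl

/-- The experiment simulated by the collision finder. -/
noncomputable def collisionHom (L : ℕ) : Coins (H.coins.eval n) × Coins L →+
    (World H S PoS T n × Coins (A.coins.eval n)) × Coins (guesses PoS T n) :=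
  AddMonoidHom.mk' (fun ω => ((simWorld H S PoS A T ω.1 (List.ofFn ω.2) (PoS.parties.eval n) 0 0 0,
      (advCoins PoS A T n L ω.2).1), (advCoins PoS A T n L ω.2).2))
    fun a b => by
      have := simWorld_add (H := H) (S := S) (PoS := PoS) (A := A) (T := T) a.1 b.1 a.2 b.2
        (PoS.parties.eval n) 0 0 0 0 0
      rw [add_zero, add_zero] at this
      rw [Prod.fst_add, Prod.snd_add, map_add, this]
      rfl

/-- The coins of the challenger, as an infinite sequence. -/
def moveCoins {q c : ℕ} (ρ : Fin q → Coins c) (k : ℕ) : Coins c :=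
  if h : k < q then ρ ⟨k, h⟩ else 0

/-- The experiment simulated by the forger. -/
noncomputable def forgerHom (L q i t : ℕ) :
    Coins L × Coins (S.coins.eval n) × (Fin q → Coins (S.coins.eval n)) →+
    (World H S PoS T n × Coins (A.coins.eval n)) × Coins (guesses PoS T n) :=
  AddMonoidHom.mk' (fun ω => ((simWorld H S PoS A T
      (toCoins _ ((List.ofFn ω.1).drop (hashOffset S PoS A T n))) (List.ofFn ω.1) i t ω.2.1
      (moveCoins ω.2.2), (advCoins PoS A T n L ω.1).1), (advCoins PoS A T n L ω.1).2))
    fun a b => by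
      have h : moveCoins (a + b).2.2 = moveCoins a.2.2 + moveCoins b.2.2 := by
        funext k
        rw [Pi.add_apply, moveCoins, moveCoins, moveCoins]
        split_ifs
        · rfl
        · rw [add_zero]
      rw [h, Prod.snd_add, Prod.fst_add, Prod.fst_add, map_add, toCoins_drop_add, simWorld_add]
      rfl

variable {H S PoS A T n} {L : ℕ}

/-- Any coins of the adversary and of the guess occur. -/
theorem protocolHom_surjective (hL : posOffset PoS A T n ≤ L) :
    Function.Surjective (protocolHom H S PoS A T n L) := by
  rintro ⟨⟨ω, ωA⟩, g⟩
  have h1 : A.coins.eval n ≤ posOffset PoS A T n := Nat.le_add_right _ _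
  refine ⟨(ω, fun k => flatBit ω ωA g k), ?_⟩
  simp only [protocolHom, advCoins, AddMonoidHom.mk'_apply]
  rw [ofFn_eq_map_range, flat_adversary _ _ _ (by omega), flat_guess _ _ _ hL]

theorem hashOffset_ge : posOffset PoS A T n ≤ hashOffset S PoS A T n := by
  unfold hashOffset opOffset genOffset
  omega

/-- The collision finder simulates every world. -/
theorem collisionHom_surjective (hL : hashOffset S PoS A T n ≤ L) :
    Function.Surjective (collisionHom H S PoS A T n L) := by
  rintro ⟨⟨ω, ωA⟩, g⟩
  have h1 : A.coins.eval n ≤ posOffset PoS A T n := Nat.le_add_right _ _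
  have h2 := hashOffset_ge (S := S) (PoS := PoS) (A := A) (T := T) (n := n)
  refine ⟨(ω.1, fun k => flatBit ω ωA g k), ?_⟩
  simp only [collisionHom, advCoins, AddMonoidHom.mk'_apply]
  rw [ofFn_eq_map_range, flat_adversary _ _ _ (by omega), flat_guess _ _ _ (by omega)]
  have h3 : ω.genCoins (PoS.parties.eval n) = 0 := by
    rw [World.genCoins, dif_neg (lt_irrefl _)]
    rfl
  have := simWorld_flat ω ωA g hL (PoS.parties.eval n) 0 (ρ := 0) fun h => absurd h (lt_irrefl _)
  rw [h3] at this
  rw [this]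

/-- The forger simulates every world, whatever the targeted party and period are. -/
theorem forgerHom_surjective (hL : hashOffset S PoS A T n + H.coins.eval n ≤ L) {q : ℕ}
    (hq : 3 * T.eval n ≤ q) (i t : ℕ) : Function.Surjective (forgerHom H S PoS A T n L q i t) := by
  rintro ⟨⟨ω, ωA⟩, g⟩
  have h1 : A.coins.eval n ≤ posOffset PoS A T n := Nat.le_add_right _ _
  have h2 := hashOffset_ge (S := S) (PoS := PoS) (A := A) (T := T) (n := n)
  refine ⟨(fun k => flatBit ω ωA g k, ω.genCoins i,
    fun k => ω.opCoins i (k / 3) (Fin.ofNat 3 k)), ?_⟩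
  simp only [forgerHom, advCoins, AddMonoidHom.mk'_apply]
  rw [ofFn_eq_map_range, flat_adversary _ _ _ (by omega), flat_guess _ _ _ (by omega),
    flat_hash _ _ _ hL, simWorld_flat ω ωA g (by omega) i t]
  intro _ e _ he a
  have ha := a.2
  have h4 : Fin.ofNat 3 (3 * e + (a : ℕ)) = a := by
    apply Fin.ext
    simp only [Fin.ofNat]
    omega
  rw [moveCoins, dif_pos (by omega)]
  dsimp only
  rw [h4, show (3 * e + (a : ℕ)) / 3 = e by omega]

end Coins

/-! ### Bounds for the messages of the reductions -/

theorem PT.exists_size_bound {f : ℕ × List Bool × List Bool × ℕ × ℕ × ℕ → Data} (hf : PT f)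
    (L N : Polynomial ℕ) : ∃ Q : Polynomial ℕ, ∀ n l l' a b c, l.length ≤ L.eval n →
      l'.length ≤ L.eval n → a ≤ N.eval n → b ≤ N.eval n → c ≤ N.eval n →
      (f (n, l, l', a, b, c)).size ≤ Q.eval n := by
  obtain ⟨P, hP⟩ := hf.pb
  refine ⟨P.comp (2 * Polynomial.X + 8 * L + 6 * N + 20), fun n l l' a b c hl hl' ha hb hc => ?_⟩
  refine (hP (n, l, l', a, b, c)).trans ?_
  rw [Polynomial.eval_comp]
  refine poly_mono _ ?_
  have hbits : ∀ l : List Bool, l.length ≤ L.eval n → (enc l).size ≤ 4 * L.eval n + 1 := by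
    intro l hl
    refine (enc_size_le_of_forall (b := 3) fun b _ => ?_).trans ?_
    · cases b <;> decide
    · omega
  have h1 := hbits l hl
  have h2 := hbits l' hl'
  simp only [enc_pair, Data.size, enc_nat_size, Polynomial.eval_add, Polynomial.eval_mul,
    Polynomial.eval_X, Polynomial.eval_ofNat]
  omega

section
variable {H : HashFamily} {S : SignatureScheme} {X : StateMachine} {PoS : PoSProtocol} {A : Adversary}
  {m C : ℕ} {T : Polynomial ℕ} {n : ℕ}

namespace World
variable {ω : World H S PoS T n} {l l' : List Bool} {r : ℕ}

/-- The outcome of the tournament depends on the coins `l` only through the adversary's strategy. -/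
theorem answers_congr (h : A.nextL n l = A.nextL n l') :
    ω.answers X A m C l r = ω.answers X A m C l' r := by
  have e : ∀ l, ω.answers X A m C l r = (List.range (((ω.env X m C).tournament (A.nextL n l) r).2.length
      + 1)).map fun k => A.nextL n l (((ω.env X m C).tournament (A.nextL n l) r).2.take k) := by
    intro l
    rw [answers, tournament_eq]
    rfl
  rw [e, e, h]

theorem sigCandidates_congr (h : A.nextL n l = A.nextL n l') :
    ω.sigCandidates X A m C l r = ω.sigCandidates X A m C l' r := by
  rw [sigCandidates, sigCandidates, answers_congr h]
  rfl

theorem collides_congr (h : A.nextL n l = A.nextL n l') :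
    ω.Collides X A m C l r = ω.Collides X A m C l' r := by
  have : ω.collision X A m C l r = ω.collision X A m C l' r := by
    rw [collision, collision, answers_congr h, gctx, gctx, h]
    rfl
  rw [Collides, Collides, this]

theorem forgesAt_congr (h : A.nextL n l = A.nextL n l') (i t : ℕ) :
    ω.ForgesAt X A m C l r i t = ω.ForgesAt X A m C l' r i t := by
  rw [ForgesAt, ForgesAt, sigCandidates_congr h, h]

end World

theorem nextL_ofFn (A : Adversary) (ωA : Coins (A.coins.eval n)) :
    A.nextL n (List.ofFn ωA) = A.next n ωA := by
  funext h
  rw [Adversary.nextL, toCoins_ofFn]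

/-- An adversary ignores coins beyond those that it uses. -/
theorem nextL_ofFn_toCoins (A : Adversary) (l : List Bool) :
    A.nextL n (List.ofFn (toCoins (A.coins.eval n) l)) = A.nextL n l :=
  nextL_ofFn A _

variable (H S PoS A T) in
/-- A polynomial that evaluates to the number of coins used by the forger. -/
noncomputable def coinsPoly : Polynomial ℕ :=
  A.coins + (T + 1) * (PoS.parties + 1) * (T + 1) + PoS.coins + PoS.parties * S.coins +
    PoS.parties * T * 3 * S.coins + H.coins

theorem eval_coinsPoly :
    (coinsPoly H S PoS A T).eval n = hashOffset S PoS A T n + H.coins.eval n := by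
  simp [coinsPoly, hashOffset, opOffset, genOffset, posOffset, guesses]

variable (H S X PoS A m C T)

/-- The queries of the forger and its forgery are of polynomial size, since they can be computed in
polynomial time from the coins of the whole experiment. -/
theorem exists_forger_bound : ∃ Q : Polynomial ℕ, ∀ n, 0 < C → T.eval n ≤ C * S.periods n →
    ∀ (ω : World H S PoS T n) (l : List Bool) (r : ℕ), r < T.eval n → ∀ i < PoS.parties.eval n,
      (∀ j ≤ r / C, ((ω.env X m C).stateQuery (A.nextL n l) i j).size ≤ Q.eval n) ∧
      (∀ j, (j + 1) * C ≤ r + 1 →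
        ((ω.env X m C).handoverQuery (A.nextL n l) i j).size ≤ Q.eval n) ∧
      ∀ t ≤ r / C, ((ω.env X m C).forgery (A.nextL n l) (ω.sigCandidates X A m C l r) r i t).size ≤
        Q.eval n := by
  have hsim : PT fun p : ℕ × List Bool × List Bool × ℕ × ℕ × ℕ => SimCtx.mk p.1
      (H.genL p.1 (p.2.1.drop (hashOffset S PoS A T p.1))) p.2.1 (PoS.parties.eval p.1) 0 [] := by
    fun_prop
  obtain ⟨Q₁, h₁⟩ := (PT.simStateQuery H S X PoS A m C T (i := fun p => p.2.2.2.1)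
    (j := fun p => p.2.2.2.2.1) hsim (by fun_prop) (by fun_prop)).exists_size_bound
    (coinsPoly H S PoS A T) (T + PoS.parties)
  obtain ⟨Q₂, h₂⟩ := (PT.simHandoverQuery H S X PoS A m C T (i := fun p => p.2.2.2.1)
    (j := fun p => p.2.2.2.2.1) hsim (by fun_prop) (by fun_prop)).exists_size_bound
    (coinsPoly H S PoS A T) (T + PoS.parties)
  obtain ⟨Q₃, h₃⟩ := (PT.simForgery H S X PoS A m C T (r := fun p => p.2.2.2.2.2)
    (i := fun p => p.2.2.2.1) (t := fun p => p.2.2.2.2.1) hsim (by fun_prop) (by fun_prop)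
    (by fun_prop)).exists_size_bound (coinsPoly H S PoS A T) (T + PoS.parties)
  refine ⟨Q₁ + Q₂ + Q₃, fun n hC hT ω l r hr i hi => ?_⟩
  -- All coins of the experiment as a single sequence `l₀`, from which nobody is targeted.
  set l₀ := (List.range ((coinsPoly H S PoS A T).eval n)).map (flatBit ω (toCoins _ l) 0) with hl₀
  have hlen : l₀.length ≤ (coinsPoly H S PoS A T).eval n := by simp [hl₀]
  have hcoins := eval_coinsPoly (H := H) (S := S) (PoS := PoS) (A := A) (T := T) (n := n)
  have h4 : A.coins.eval n ≤ posOffset PoS A T n := Nat.le_add_right _ _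
  have h5 := hashOffset_ge (S := S) (PoS := PoS) (A := A) (T := T) (n := n)
  have hnext : A.nextL n l₀ = A.nextL n l := by
    funext h
    rw [Adversary.nextL, Adversary.nextL, hl₀, flat_adversary _ _ _ (by omega)]
  have hW : simWorld H S PoS A T ω.1 l₀ (PoS.parties.eval n) 0 (ω.genCoins (PoS.parties.eval n)) 0 =
      ω :=
    simWorld_flat ω _ 0 (by omega) _ _ fun h => absurd h (lt_irrefl _)
  have hs : H.genL n (l₀.drop (hashOffset S PoS A T n)) = H.gen n ω.1 := by
    rw [HashFamily.genL, hl₀, flat_hash _ _ _ (by omega)]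
  have a := agree_simWorld (X := X) (A := A) (T := T) (m := m) (C := C) (ωh := ω.1) (l := l₀)
    (i := PoS.parties.eval n) (t := 0) (recv := []) (ωg := ω.genCoins (PoS.parties.eval n)) (ρ := 0)
    fun h => absurd h (lt_irrefl _)
  have hexec := fun N (hN : N ≤ T.eval n) => exec_simWorld_untargeted (X := X) (PoS := PoS) (A := A)
    (m := m) (ωh := ω.1) (l := l₀)
        (t := 0) (recv := []) (ωg := ω.genCoins (PoS.parties.eval n)) (ρ := 0)
    hC hT le_rfl hN
  have hg := gctx_simWorld (X := X) (fun h => absurd h (lt_irrefl _)) (hexec (r + 1) hr)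
  rw [hW] at a hg
  simp only [hW] at hexec
  have hle : r / C * C ≤ r := Nat.div_mul_le_self _ _
  have hjT : ∀ j ≤ r / C, j ≤ (T + PoS.parties).eval n ∧ j * C ≤ r := by
    intro j hj
    have := Nat.mul_le_mul_right C hj
    have := Nat.div_le_self r C
    rw [Polynomial.eval_add]
    omega
  have hiT : i ≤ (T + PoS.parties).eval n := by
    rw [Polynomial.eval_add]
    omega
  have hrT : r ≤ (T + PoS.parties).eval n := by
    rw [Polynomial.eval_add]
    omega
  simp only at h₁ h₂ h₃
  rw [← hnext, ← World.sigCandidates_congr hnext, Polynomial.eval_add, Polynomial.eval_add]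
  refine ⟨fun j hj => ?_, fun j hj => ?_, fun t ht => ?_⟩
  · have h := h₁ n l₀ l₀ i j 0 hlen hlen hiT (hjT j hj).1 (Nat.zero_le _)
    have hq : SimCtx.stateQuery H S X PoS A m C T
        ⟨n, H.gen n ω.1, l₀, PoS.parties.eval n, 0, []⟩ i j =
        (ω.env X m C).stateQuery (A.nextL n l₀) i j :=
      a.stateQuery _ hi (hexec _ (by have := (hjT j hj).2; change j * C ≤ _; omega))
    rw [hs, hq] at h
    omega
  · have h6 : j ≤ r / C := by
      refine (Nat.le_div_iff_mul_le hC).mpr ?_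
      rw [Nat.succ_mul] at hj
      omega
    have h := h₂ n l₀ l₀ i j 0 hlen hlen hiT (hjT j h6).1 (Nat.zero_le _)
    have hq : SimCtx.handoverQuery H S X PoS A m C T
        ⟨n, H.gen n ω.1, l₀, PoS.parties.eval n, 0, []⟩ i j =
        (ω.env X m C).handoverQuery (A.nextL n l₀) i j :=
      a.handoverQuery _ hi (hexec _ (by change (j + 1) * C - 1 ≤ _; omega))
    rw [hs, hq] at h
    omega
  · have h := h₃ n l₀ l₀ i t r hlen hlen hiT (hjT t ht).1 hrT
    have hq : SimCtx.forgery H S X PoS A m C T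
        ⟨n, H.gen n ω.1, l₀, PoS.parties.eval n, 0, []⟩ r i t =
        (ω.env X m C).forgery (A.nextL n l₀) (ω.sigCandidates X A m C l₀ r) r i t := by
      rw [SimCtx.forgery, hg.1, hg.2]
      exact a.forgery _ hi (hexec _ hr) _ _
    rw [hs, hq] at h
    omega

/-- The output of the collision finder is of polynomial size. -/
theorem exists_collision_bound : ∃ Q : Polynomial ℕ, ∀ n (l : List Bool) (ωh : Coins (H.coins.eval n)),
    l.length ≤ (coinsPoly H S PoS A T).eval n →
      (collisionOutput H S X PoS A m C T n l [H.gen n ωh]).size ≤ Q.eval n := by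
  have hPT : PT fun p : ℕ × List Bool × List Bool × ℕ × ℕ × ℕ =>
      collisionOutput H S X PoS A m C T p.1 p.2.1 [H.genL p.1 p.2.2.1] := by fun_prop
  obtain ⟨Q, hQ⟩ := hPT.exists_size_bound (coinsPoly H S PoS A T) 0
  refine ⟨Q, fun n l ωh hl => ?_⟩
  have := hQ n l (List.ofFn ωh) 0 0 0 hl (by
    rw [List.length_ofFn, eval_coinsPoly]
    omega) (Nat.zero_le _) (Nat.zero_le _) (Nat.zero_le _)
  dsimp only at this
  rwa [HashFamily.genL, toCoins_ofFn] at this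

end

/-! ### The four reductions -/

section Bounds
variable (H : HashFamily) (S : SignatureScheme) (X : StateMachine) (PoS : PoSProtocol) (A : Adversary)
  (m C : ℕ) (T : Polynomial ℕ)

/-- The adversary against the protocol that simulates the tournament. -/
noncomputable def protocolAdversary : Adversary :=
  Adversary.ofPT (coinsPoly H S PoS A T) A.len (tournamentMove H S X PoS A m C T) (by fun_prop)

variable {H S X PoS A m C T} {n r : ℕ}

theorem protocolAdversary_next (ω : Coins ((coinsPoly H S PoS A T).eval n)) :
    (protocolAdversary H S X PoS A m C T).next n ω =
      tournamentMove H S X PoS A m C T n (List.ofFn ω) := by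
  funext h
  refine clip_of_le ?_
  unfold tournamentMove
  split_ifs <;> exact A.next_size _ _ _

/-- A tournament does not make an execution unsafe more often than the adversary against the
protocol, up to the loss for guessing the round. -/
theorem pr_not_safe_le (hr : r < T.eval n) :
    (pr fun ω : World H S PoS T n × Coins (A.coins.eval n) =>
      ¬ (ω.1.env X m C).Safe ((ω.1.env X m C).exec
        ((ω.1.env X m C).withTournament (A.next n ω.2) r) (T.eval n))) ≤
    2 * guesses PoS T n *
      pr fun ω : World H S PoS T n × Coins ((coinsPoly H S PoS A T).eval n) =>
        ¬ (ω.1.env X m C).Safe ((ω.1.env X m C).exec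
          ((protocolAdversary H S X PoS A m C T).next n ω.2) (T.eval n)) := by
  have h5 := hashOffset_ge (S := S) (PoS := PoS) (A := A) (T := T) (n := n)
  have hcoins := eval_coinsPoly (H := H) (S := S) (PoS := PoS) (A := A) (T := T) (n := n)
  refine pr_le_of_guess (guessOf_lt (i := 0) (t := 0) hr (Nat.zero_le _) (by omega))
    (protocolHom H S PoS A T n _) (protocolHom_surjective (by omega)) fun ω hE hg => ?_
  have hg' := (guess_components hr (Nat.zero_le _) ((guess_eq (by
    rw [List.length_ofFn]
    omega)).trans hg)).1
  rw [protocolAdversary_next, exec_tournamentMove _ hg']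
  exact hE

/-- The same for honest majorities. -/
theorem pr_not_honestMajority_le (hr : r < T.eval n) :
    (pr fun ω : World H S PoS T n × Coins (A.coins.eval n) =>
      ¬ (ω.1.env X m C).HonestMajority ((ω.1.env X m C).withTournament (A.next n ω.2) r)
        ((ω.1.env X m C).exec ((ω.1.env X m C).withTournament (A.next n ω.2) r) (T.eval n))) ≤
    2 * guesses PoS T n *
      pr fun ω : World H S PoS T n × Coins ((coinsPoly H S PoS A T).eval n) =>
        ¬ (ω.1.env X m C).HonestMajority ((protocolAdversary H S X PoS A m C T).next n ω.2)
          ((ω.1.env X m C).exec ((protocolAdversary H S X PoS A m C T).next n ω.2) (T.eval n)) := by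
  have h5 := hashOffset_ge (S := S) (PoS := PoS) (A := A) (T := T) (n := n)
  have hcoins := eval_coinsPoly (H := H) (S := S) (PoS := PoS) (A := A) (T := T) (n := n)
  refine pr_le_of_guess (guessOf_lt (i := 0) (t := 0) hr (Nat.zero_le _) (by omega))
    (protocolHom H S PoS A T n _) (protocolHom_surjective (by omega)) fun ω hE hg => ?_
  have hg' := (guess_components hr (Nat.zero_le _) ((guess_eq (by
    rw [List.length_ofFn]
    omega)).trans hg)).1
  rw [protocolAdversary_next, exec_tournamentMove _ hg']
  intro hmaj
  refine hE fun j hj => ?_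
  have := hmaj j hj
  have hcom : ∀ rs, (ω.1.env X m C).committee
      (tournamentMove H S X PoS A m C T n (List.ofFn ω.2)) rs j =
      (ω.1.env X m C).committee
        ((ω.1.env X m C).withTournament (A.nextL n (List.ofFn ω.2)) r) rs j := by
    intro rs
    cases j with
    | zero => rw [Env.committee, Env.committee, st₀_tournamentMove _ hg']
    | succ j => rfl
  rw [hcom] at this
  exact this

variable (H S X PoS A m C T) in
/-- The collision finder, with messages of size at most `Q`. -/
noncomputable def collisionFinder (Q : Polynomial ℕ) : Adversary :=
  Adversary.ofPT (coinsPoly H S PoS A T) Q (collisionOutput H S X PoS A m C T) (by fun_prop)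

/-- Collisions in the tournament are found by the collision finder, up to the loss for guessing the
round. -/
theorem pr_collides_le (hC : 0 < C) (hT : T.eval n ≤ C * S.periods n) (hr : r < T.eval n)
    {Q : Polynomial ℕ} (hQ : ∀ (l : List Bool) (ωh : Coins (H.coins.eval n)),
      l.length ≤ (coinsPoly H S PoS A T).eval n →
        (collisionOutput H S X PoS A m C T n l [H.gen n ωh]).size ≤ Q.eval n) :
    (pr fun ω : World H S PoS T n × Coins (A.coins.eval n) =>
      ω.1.Collides X A m C (List.ofFn ω.2) r) ≤
    2 * guesses PoS T n *
      pr fun ω : Coins (H.coins.eval n) × Coins ((coinsPoly H S PoS A T).eval n) =>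
        let s := H.gen n ω.1
        let out := (collisionFinder H S X PoS A m C T Q).next n ω.2 [s]
        out.fst ≠ out.snd ∧ H.hash n s out.fst = H.hash n s out.snd := by
  have h5 := hashOffset_ge (S := S) (PoS := PoS) (A := A) (T := T) (n := n)
  have hcoins := eval_coinsPoly (H := H) (S := S) (PoS := PoS) (A := A) (T := T) (n := n)
  refine pr_le_of_guess (guessOf_lt (i := 0) (t := 0) hr (Nat.zero_le _) (by omega))
    (collisionHom H S PoS A T n _) (collisionHom_surjective (by omega)) fun ω hE hg => ?_
  have hg' := (guess_components hr (Nat.zero_le _) ((guess_eq (by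
    rw [List.length_ofFn]
    omega)).trans hg)).1
  have hout : (collisionFinder H S X PoS A m C T Q).next n ω.2 [H.gen n ω.1] =
      (simWorld H S PoS A T ω.1 (List.ofFn ω.2) (PoS.parties.eval n) 0 0 0).collision X A m C
        (List.ofFn ω.2) r := by
    have hsize := hQ (List.ofFn ω.2) ω.1 (by rw [List.length_ofFn])
    have hclip := clip_of_le hsize
    rw [collisionOutput_eq (ωg := 0) (ρ := 0) hC hT hr hg'] at hclip
    rw [← hclip, ← collisionOutput_eq (ωg := 0) (ρ := 0) hC hT hr hg']
    rfl
  have hE' := (World.collides_congr (nextL_ofFn_toCoins A (List.ofFn ω.2))).mp hE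
  dsimp only
  rw [hout]
  exact hE'

variable (H S X PoS A m C T) in
/-- The forger, with messages of size at most `Q`. -/
noncomputable def forger (Q : Polynomial ℕ) : Adversary :=
  Adversary.ofPT (coinsPoly H S PoS A T) Q (forgerOutput H S X PoS A m C T) (by fun_prop)

/-- Forgeries in the tournament are found by the forger, up to the loss for guessing round, party
and period. The number of moves, `3 * T + 4`, leaves room for three moves in each period and the
break-in, and `7` is the size of the largest of the fixed moves. -/
theorem pr_forgesAt_le (hC : 0 < C) (hT : T.eval n ≤ C * S.periods n) (hr : r < T.eval n)
    {i t : ℕ} (hi : i < PoS.parties.eval n) (ht : t < T.eval n) {Q : Polynomial ℕ} (h7 : 7 ≤ Q.eval n)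
    (hQ : ∀ (ω : World H S PoS T n) (l : List Bool),
      (∀ j ≤ r / C, ((ω.env X m C).stateQuery (A.nextL n l) i j).size ≤ Q.eval n) ∧
      (∀ j, (j + 1) * C ≤ r + 1 →
        ((ω.env X m C).handoverQuery (A.nextL n l) i j).size ≤ Q.eval n) ∧
      ∀ t ≤ r / C, ((ω.env X m C).forgery (A.nextL n l) (ω.sigCandidates X A m C l r) r i t).size ≤
        Q.eval n) :
    (pr fun ω : World H S PoS T n × Coins (A.coins.eval n) =>
      ω.1.ForgesAt X A m C (List.ofFn ω.2) r i t) ≤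
    2 * guesses PoS T n *
      pr fun ω : Coins ((coinsPoly H S PoS A T).eval n) × Coins (S.coins.eval n) ×
          (Fin ((3 * T + 4 : Polynomial ℕ).eval n) → Coins (S.coins.eval n)) =>
        S.Forges n ((forger H S X PoS A m C T Q).next n ω.1) ω.2.1 ω.2.2 := by
  have h5 := hashOffset_ge (S := S) (PoS := PoS) (A := A) (T := T) (n := n)
  have hcoins := eval_coinsPoly (H := H) (S := S) (PoS := PoS) (A := A) (T := T) (n := n)
  have hq : (3 * T + 4 : Polynomial ℕ).eval n = 3 * T.eval n + 4 := by simp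
  rw [hq]
  refine pr_le_of_guess (guessOf_lt hr hi.le ht) (forgerHom H S PoS A T n _ _ i t)
    (forgerHom_surjective (by omega) (by omega) i t) fun ω hE hg => ?_
  have hg' := guess_components hr hi.le ((guess_eq (by
    rw [List.length_ofFn]
    omega)).trans hg)
  have hE' := (World.forgesAt_congr (nextL_ofFn_toCoins A (List.ofFn ω.1)) i t).mp hE
  have htr : t ≤ r / C := hE'.choose_spec.choose_spec.2.2.1
  obtain ⟨h1, h2, h3⟩ := hQ (forgerHom H S PoS A T n _ _ i t ω).1.1 (List.ofFn ω.1)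
  have hρ : (fun k : Fin (3 * T.eval n + 4) => moveCoins ω.2.2 k) = ω.2.2 := by
    funext k
    rw [moveCoins, dif_pos k.2]
  have := forges_of_forgesAt (L := Q.eval n) (F := (forger H S X PoS A m C T Q).next n ω.1) hC hT hr
    hE' (fun recv hsize => ?_) h7 (fun j hj => h1 j (hj.trans htr)) (fun j _ hj => h2 j hj) (h3 t htr)
  · rw [hρ] at this
    exact this
  · have hout : forgerOutput H S X PoS A m C T n (List.ofFn ω.1) recv =
        SimCtx.forgerMove H S X PoS A m C T ⟨n, H.gen n
          (toCoins _ ((List.ofFn ω.1).drop (hashOffset S PoS A T n))), List.ofFn ω.1, i, t, recv⟩ r := by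
      rw [forgerOutput, hg'.1, hg'.2.1, hg'.2.2]
      rfl
    rw [← hout] at hsize ⊢
    exact clip_of_le hsize

end Bounds

end Superlight

theorem mainTheorem1
    (H : Superlight.HashFamily) (S : Superlight.SignatureScheme) (X : Superlight.StateMachine)
    (PoS : Superlight.PoSProtocol) (m C : ℕ) (hC : 0 < C) (T : Polynomial ℕ)
    (hT : ∀ n, T.eval n ≤ C * S.periods n)
    (hHash : H.CollisionResistant) (hSig : S.ExistentiallyUnforgeable)
    (hMaj : Superlight.HonestCommittees H S X PoS m C T)
    (hSafe : Superlight.SafeProtocol H S X PoS m C T)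
    (A : Superlight.Adversary) (r : ℕ → ℕ) (hr : ∀ n, r n < T.eval n) :
    Superlight.Negligible fun n =>
      Superlight.pr fun ω : Superlight.World H S PoS T n × Superlight.Coins (A.coins.eval n) =>
        (ω.1.env X m C).TournamentFails (A.next n ω.2) (T.eval n) (r n) := by
  open Superlight in
  obtain ⟨Q, hQ⟩ := exists_collision_bound H S X PoS A m C T
  obtain ⟨Q', hQ'⟩ := exists_forger_bound H S X PoS A m C T
  obtain ⟨M, hM⟩ : ∃ M : Polynomial ℕ, ∀ n, ((M.eval n : ℕ) : ℝ) = 2 * guesses PoS T n :=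
    ⟨2 * ((T + 1) * (PoS.parties + 1) * (T + 1)), fun n => by simp [guesses]⟩
  -- The forger is used once for each of the polynomially many parties and periods. The summand `7`
  -- leaves room for the moves of the forger that are not queries.
  have hneg := ((((hSafe (protocolAdversary H S X PoS A m C T)).poly_mul M).add
    ((hMaj (protocolAdversary H S X PoS A m C T)).poly_mul M)).add
    ((hHash (collisionFinder H S X PoS A m C T Q)).poly_mul M)).add
    ((hSig (forger H S X PoS A m C T (Q' + 7)) (3 * T + 4)).poly_mul (PoS.parties * T * M))
  refine Negligible.of_le hneg (fun n => pr_nonneg _) fun n => ?_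
  have hevent : ∀ ω : World H S PoS T n × Coins (A.coins.eval n),
      (ω.1.env X m C).TournamentFails (A.next n ω.2) (T.eval n) (r n) →
      ((¬ (ω.1.env X m C).Safe ((ω.1.env X m C).exec
        ((ω.1.env X m C).withTournament (A.next n ω.2) (r n)) (T.eval n)) ∨
      ¬ (ω.1.env X m C).HonestMajority ((ω.1.env X m C).withTournament (A.next n ω.2) (r n))
        ((ω.1.env X m C).exec ((ω.1.env X m C).withTournament (A.next n ω.2) (r n)) (T.eval n))) ∨
      ω.1.Collides X A m C (List.ofFn ω.2) (r n)) ∨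
      ∃ i < PoS.parties.eval n, ∃ t < T.eval n,
        ω.1.ForgesAt X A m C (List.ofFn ω.2) (r n) i t := by
    intro ω hfail
    rw [← nextL_ofFn] at hfail ⊢
    by_contra hcon
    push Not at hcon
    obtain ⟨⟨⟨h1, h2⟩, h3⟩, h4⟩ := hcon
    rcases World.collides_or_forgesAt hC (hT n) (hr n) h1 h2 hfail with h | ⟨i, hi, t, ht, h⟩
    · exact h3 h
    · exact h4 i hi t ht h
  have hforge : (pr fun ω : World H S PoS T n × Coins (A.coins.eval n) =>
      ∃ i < PoS.parties.eval n, ∃ t < T.eval n,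
        ω.1.ForgesAt X A m C (List.ofFn ω.2) (r n) i t) ≤
      (((PoS.parties * T * M).eval n : ℕ) : ℝ) *
        pr fun ω : Coins ((coinsPoly H S PoS A T).eval n) × Coins (S.coins.eval n) ×
          (Fin ((3 * T + 4 : Polynomial ℕ).eval n) → Coins (S.coins.eval n)) =>
        S.Forges n ((forger H S X PoS A m C T (Q' + 7)).next n ω.1) ω.2.1 ω.2.2 := by
    have hbound : ∀ i < PoS.parties.eval n, ∀ (ω : World H S PoS T n) (l : List Bool),
        (∀ j ≤ r n / C, ((ω.env X m C).stateQuery (A.nextL n l) i j).size ≤ (Q' + 7).eval n) ∧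
        (∀ j, (j + 1) * C ≤ r n + 1 →
          ((ω.env X m C).handoverQuery (A.nextL n l) i j).size ≤ (Q' + 7).eval n) ∧
        ∀ t ≤ r n / C, ((ω.env X m C).forgery (A.nextL n l)
          (ω.sigCandidates X A m C l (r n)) (r n) i t).size ≤ (Q' + 7).eval n := by
      intro i hi ω l
      obtain ⟨h1, h2, h3⟩ := hQ' n hC (hT n) ω l (r n) (hr n) i hi
      have hle : Q'.eval n ≤ (Q' + 7).eval n := by simp
      exact ⟨fun j hj => (h1 j hj).trans hle, fun j hj => (h2 j hj).trans hle,
        fun t ht => (h3 t ht).trans hle⟩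
    refine (pr_exists_le _ _).trans ?_
    refine (Finset.sum_le_sum fun i hi => (pr_exists_le _ _).trans (Finset.sum_le_sum fun t ht =>
      pr_forgesAt_le hC (hT n) (hr n) (Finset.mem_range.mp hi) (Finset.mem_range.mp ht)
        (Q := Q' + 7) (by simp) (hbound i (Finset.mem_range.mp hi)))).trans_eq ?_
    rw [← hM, Finset.sum_const, Finset.sum_const, Finset.card_range, Finset.card_range,
      Polynomial.eval_mul, Polynomial.eval_mul]
    push_cast
    simp only [nsmul_eq_mul]
    ring
  refine (pr_mono hevent).trans ((pr_or_le _ _).trans (add_le_add ((pr_or_le _ _).trans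
    (add_le_add ((pr_or_le _ _).trans (add_le_add ?_ ?_)) ?_)) hforge))
  · beta_reduce
    rw [hM]
    exact pr_not_safe_le (hr n)
  · beta_reduce
    rw [hM]
    exact pr_not_honestMajority_le (hr n)
  · beta_reduce
    rw [hM]
    exact pr_collides_le hC (hT n) (hr n) (hQ n)
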